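/- Let $n\ge 2$, $1<p<\infty$, $\lambda_p>0$, $\Lambda\in\mathbb R$. Write points of $\mathbb R^n$ as $x=(x_0,x')$, $x_0\in\mathbb R$, $x'\in\mathbb R^{n-1}$; let $\mathbb R^n_+=\{x_0>0\}$ and $\Omega^h=\{0<x_0<h\}$. Then there are $C<\infty$ and $L_0>0$, depending only on $n,p,\lambda_p,\Lambda$, such that the following holds for all $a>0$ and $h>0$. *Operator.* Let $A=(A_{ij})_{0\le i,j\le n-1}$ and $B=(B_i)$ be complex and $C^\infty$ in $\mathbb R^n_+$, with $A_{00}=1$, all $A_{0j}$ real, and $A$ $p$-elliptic: for a.e. $x\in\mathbb R^n_+$ and all $\xi,\eta\in\mathbb C^n$, $\mathrm{Re}\,\langle A(x)\xi,\mathcal J_p\xi\rangle\ge\lambda_p|\xi|^2$ and $|\langle A(x)\xi,\eta\rangle|\le\Lambda|\xi||\eta|$, where $\langle A\xi,\eta\rangle=\sum A_{ij}\xi_j\overline{\eta_i}$, $\mathcal J_p(\alpha+i\beta)=\alpha/p+i\beta/p'$ and $p'=p/(p-1)$. Let $$d\mu(x)=\sup_{B_{x_0/2}(x)}\big[|\nabla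 A|^2+|B|^2\big]\,x_0\,dx,\qquad d\mu'(x)=\sup_{B_{x_0/2}(x)}\Big[\sum_j|\partial_0A_{0j}|^2+\Big|\sum_j\partial_jA_{0j}\Big|^2+|B|^2\Big]\,x_0\,dx$$ on $\mathbb R^n_+$. For $Q=(0,q)$ and $\Delta=\{x'\in\mathbb R^{n-1}:|x'-q|<\rho\}$ put $T(\Delta)=\mathbb R^n_+\cap B_\rho(Q)$ and $2\Delta=\{|x'-q|<2\rho\}$. The Carleson norm $\|\nu\|_{\mathcal C}$ is the least constant with $\nu(T(\Delta))\le\|\nu\|_{\mathcal C}|\Delta|$ for all such $\Delta$. Assume that $\|\mu'\|_{\mathcal C}<\infty$. *Solution.* Let $f\in\dot B^{2,2}_{1/2}(\mathbb R^{n-1};\mathbb C)\cap L^p(\mathbb R^{n-1};\mathbb C)$ and let $u$ be an energy solution in $\Omega^h$ with datum $f$, extended by zero to $x_0\ge h$: $\nabla u\in L^2$, $\partial_i(A_{ij}\partial_ju)+B_i\partial_iu=0$ weakly in $\Omega^h$, and $u$ has trace $f$ on $x_0=0$ and trace $0$ on $x_0=h$. In $\Omega^h$, $u$ denotes the continuous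 representative, and $u(0,x')=f(x')$ a.e. The expression $|\nabla u|^2|u|^{p-2}$ is read as $0$ where $\nabla u=0$. *Maximal functions.* For $g:\mathbb R^{n-1}\to[0,\infty)$ let $\Omega_g=\{x_0>g(x')\}$, $\delta_g(x)=x_0-g(x')$, and $$\tilde N_{p,a,g}(u)(x')=\sup\{w(y):y\in\Omega_g,\ |y'-x'|<a|y_0-g(x')|\},\qquad w(y)=\Big(\frac1{|B_{y_0/2}(y)|}\int_{B_{y_0/2}(y)}|u|^p\Big)^{1/p}.$$ The truncated version $\tilde N^{r}_{p,a,g}$ uses only $y$ with $\delta_g(y)\le r$. For $g=0$ write $\tilde N_{p,a}$ and $\tilde N^r_{p,a}$. *Conclusions* (inequalities in $[0,\infty]$, with $0\cdot\infty=0$). (1) For every $r>0$, $$p\frac{\lambda_p}2\iint_{[0,r/2]\times\mathbb R^{n-1}}|\nabla u|^2|u|^{p-2}x_0\,dx'dx_0+\frac2r\iint_{[0,r]\times\mathbb R^{n-1}}|u|^p\,dx'dx_0\le\int_{\mathbb R^{n-1}}|f|^p\,dx'+\int_{\mathbb R^{n-1}}|u(r,x')|^p\,dx'+C\|\mu'\|_{\mathcal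 C}\int_{\mathbb R^{n-1}}\big[\tilde N^r_{p,a}(u)\big]^p\,dx'.$$ (2) Globally, $$p\frac{\lambda_p}2\iint_{\mathbb R^n_+}|\nabla u|^2|u|^{p-2}x_0\,dx'dx_0\le\int_{\mathbb R^{n-1}}|f|^p\,dx'+C\|\mu'\|_{\mathcal C}\int_{\mathbb R^{n-1}}\big[\tilde N_{p,a}(u)\big]^p\,dx'.$$ (3) If $g:\mathbb R^{n-1}\to[0,\infty)$ is Lipschitz with constant $L\le L_0$, $aL<1$, and $\Delta$ is a ball in $\mathbb R^{n-1}$ of diameter $d$ with $\sup_\Delta g\le d/2$, then $$\iint_{\Omega_g\cap T(\Delta)}|\nabla u|^2|u|^{p-2}\delta_g\,dx\le C\int_{2\Delta}\Big(|u(g(x'),x')|^p+(1+\|\mu\|_{\mathcal C})\big[\tilde N^{2d}_{p,a,g}(u)\big]^p\Big)dx'.$$ -/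

import Mathlib

open MeasureTheory Set Metric
open scoped ENNReal NNReal ContDiff

noncomputable section

namespace StripPDE

/-- The boundary space, the Euclidean space of dimension `d` (so the ambient dimension is `d + 1`). -/
abbrev Bdry (d : ℕ) := EuclideanSpace ℝ (Fin d)

/-- The ambient Euclidean space of dimension `d + 1`; the coordinate `x 0` is the transversal one. -/
abbrev Space (d : ℕ) := EuclideanSpace ℝ (Fin (d + 1))

/-- The point with transversal coordinate `t` and tangential coordinates `y`. -/
def pt {d : ℕ} (t : ℝ) (y : Bdry d) : Space d :=
  WithLp.toLp 2 (Fin.cons t (fun i => y i) : Fin (d + 1) → ℝ)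

/-- The tangential part of a point. -/
def tang {d : ℕ} (x : Space d) : Bdry d := WithLp.toLp 2 (fun i => x i.succ)

/-- The open upper half-space. -/
def halfSpace (d : ℕ) : Set (Space d) := {x | 0 < x 0}

/-- The open infinite strip of height `h`. -/
def strip (d : ℕ) (h : ℝ) : Set (Space d) := {x | 0 < x 0 ∧ x 0 < h}

/-- The partial derivative in the direction of the `k`-th coordinate. -/
def pd {d : ℕ} (k : Fin (d + 1)) (F : Space d → ℂ) (x : Space d) : ℂ :=
  fderiv ℝ F x (EuclideanSpace.single k 1)

/-! ### Ellipticity -/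

/-- The pairing `⟨M ξ, η⟩`, linear in `ξ` and conjugate linear in `η`. -/
def pairing {n : ℕ} (M : Matrix (Fin n) (Fin n) ℂ) (ξ η : EuclideanSpace ℂ (Fin n)) : ℂ :=
  ∑ i, ∑ j, M i j * ξ j * (starRingEnd ℂ) (η i)

/-- The real linear map sending `α + i β` to `α / p + i β / p'`, where `p' = p / (p - 1)`. -/
def Jmap {n : ℕ} (p : ℝ) (ξ : EuclideanSpace ℂ (Fin n)) : EuclideanSpace ℂ (Fin n) :=
  WithLp.toLp 2 (fun i => (⟨(ξ i).re / p, (ξ i).im / (p / (p - 1))⟩ : ℂ))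

/-- `p`-ellipticity in the half-space, with lower constant `lam` and upper bound `Lam`. -/
def IsPElliptic {d : ℕ} (p lam Lam : ℝ)
    (A : Space d → Matrix (Fin (d + 1)) (Fin (d + 1)) ℂ) : Prop :=
  ∀ᵐ x ∂(volume.restrict (halfSpace d)),
    (∀ ξ : EuclideanSpace ℂ (Fin (d + 1)),
      lam * ‖ξ‖ ^ 2 ≤ (pairing (A x) ξ (Jmap p ξ)).re) ∧
    (∀ ξ η : EuclideanSpace ℂ (Fin (d + 1)), ‖pairing (A x) ξ η‖ ≤ Lam * ‖ξ‖ * ‖η‖)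

/-! ### Carleson measures in the half-space -/

/-- The Carleson norm: the least `C` such that the measure of every Carleson region `T(Δ)` (the part
in the half-space of a ball of radius `r` with centre on the boundary) is at most `C` times the
surface measure of `Δ`. -/
def carlesonNorm {d : ℕ} (μ : Measure (Space d)) : ℝ≥0∞ :=
  sInf {C : ℝ≥0∞ | ∀ (q : Bdry d) (r : ℝ), 0 < r →
    μ (halfSpace d ∩ ball (pt 0 q) r) ≤ C * volume (ball q r)}

/-- The measure on the half-space with density `(sup of F over B(x, x₀ / 2)) * x₀`. -/
def supMeasure {d : ℕ} (F : Space d → ℝ≥0∞) : Measure (Space d) :=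
  (volume.restrict (halfSpace d)).withDensity
    (fun x => (⨆ y ∈ ball x (x 0 / 2), F y) * ENNReal.ofReal (x 0))

/-- The measure `μ`, built from `|∇A|² + |B|²`. -/
def muFull {d : ℕ} (A : Space d → Matrix (Fin (d + 1)) (Fin (d + 1)) ℂ)
    (B : Space d → EuclideanSpace ℂ (Fin (d + 1))) : Measure (Space d) :=
  supMeasure (fun y =>
    (∑ i, ∑ j, ∑ k, ‖pd k (fun z => A z i j) y‖ₑ ^ 2) + ‖B y‖ₑ ^ 2)

/-- The measure `μ'`, built from `∑ⱼ |∂₀ A₀ⱼ|² + |∑ⱼ ∂ⱼ A₀ⱼ|² + |B|²`. -/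
def muRow {d : ℕ} (A : Space d → Matrix (Fin (d + 1)) (Fin (d + 1)) ℂ)
    (B : Space d → EuclideanSpace ℂ (Fin (d + 1))) : Measure (Space d) :=
  supMeasure (fun y =>
    (∑ j, ‖pd 0 (fun z => A z 0 j) y‖ₑ ^ 2) + ‖∑ j, pd j (fun z => A z 0 j) y‖ₑ ^ 2
      + ‖B y‖ₑ ^ 2)

/-! ### Averaged nontangential maximal functions -/

/-- The `L^p` average of `u` over `B(x, x₀ / 2)`; the radius always refers to the half-space. -/
def lpAverage {d : ℕ} (p : ℝ) (u : Space d → ℂ) (x : Space d) : ℝ≥0∞ :=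
  (⨍⁻ z in ball x (x 0 / 2), ‖u z‖ₑ ^ p ∂volume) ^ (1 / p)

/-- The domain above the graph of `g`. -/
def above {d : ℕ} (g : Bdry d → ℝ) : Set (Space d) := {x | g (tang x) < x 0}

/-- The cone of aperture `a` in the domain above the graph of `g`, with vertex `(g(y), y)`. -/
def cone {d : ℕ} (a : ℝ) (g : Bdry d → ℝ) (y : Bdry d) : Set (Space d) :=
  {x | x ∈ above g ∧ ‖y - tang x‖ < a * |g y - x 0|}

/-- The maximal function over the cones of the domain above the graph of `g`. For `g = 0` this is
the one of the half-space. -/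
def ntMax {d : ℕ} (p a : ℝ) (g : Bdry d → ℝ) (u : Space d → ℂ) (y : Bdry d) : ℝ≥0∞ :=
  ⨆ x ∈ cone a g y, lpAverage p u x

/-- The truncated maximal function: only points of the cone with `x₀ - g(x') ≤ r` are used. -/
def ntMaxTrunc {d : ℕ} (p a : ℝ) (g : Bdry d → ℝ) (r : ℝ) (u : Space d → ℂ) (y : Bdry d) : ℝ≥0∞ :=
  ⨆ x ∈ cone a g y ∩ {x | x 0 - g (tang x) ≤ r}, lpAverage p u x

/-! ### Energy solutions in a strip -/

/-- Membership in the homogeneous Besov space of order `1/2` with exponents `2, 2` on the boundary: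
finiteness of the Gagliardo seminorm. -/
def HomBesovHalf {d : ℕ} (f : Bdry d → ℂ) : Prop :=
  AEStronglyMeasurable f volume ∧
    ∫⁻ x, ∫⁻ y, ‖f x - f y‖ₑ ^ 2 / ‖x - y‖ₑ ^ (d + 1) < ⊤

/-- `u` is locally integrable up to the boundary of the half-space, has the weak gradient `G` there,
and has the trace `f` on the boundary. All three are expressed by the Green formula against test
functions that need not vanish on the boundary. -/
def HasWeakGradTrace {d : ℕ} (u : Space d → ℂ) (G : Space d → EuclideanSpace ℂ (Fin (d + 1)))
    (f : Bdry d → ℂ) : Prop :=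
  LocallyIntegrableOn u {x | 0 ≤ x 0} volume ∧
  LocallyIntegrableOn G {x | 0 ≤ x 0} volume ∧
  LocallyIntegrable f volume ∧
  ∀ φ : Space d → ℂ, ContDiff ℝ ∞ φ → HasCompactSupport φ → ∀ i : Fin (d + 1),
    ∫ x in halfSpace d, u x * pd i φ x =
      -(∫ x in halfSpace d, G x i * φ x) - (if i = 0 then ∫ y, f y * φ (pt 0 y) else 0)

/-- `u`, with gradient `G`, is the energy solution in the strip of height `h` of
`∂ᵢ (Aᵢⱼ ∂ⱼ u) + Bᵢ ∂ᵢ u = 0` with datum `f` on `x₀ = 0` and zero datum on `x₀ = h`, extended by zero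
above the strip. The vanishing trace on `x₀ = h` is expressed by requiring that the extension by zero
has a square integrable weak gradient in the whole half-space. The pointwise values of `u` are those
of its continuous representative in the strip, and those of the trace on `x₀ = 0`. -/
structure IsEnergySolution {d : ℕ} (h : ℝ)
    (A : Space d → Matrix (Fin (d + 1)) (Fin (d + 1)) ℂ)
    (B : Space d → EuclideanSpace ℂ (Fin (d + 1))) (f : Bdry d → ℂ)
    (u : Space d → ℂ) (G : Space d → EuclideanSpace ℂ (Fin (d + 1))) : Prop where
  continuousOn : ContinuousOn u (strip d h)
  eq_zero : ∀ x : Space d, h ≤ x 0 → u x = 0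
  eq_datum : ∀ᵐ y : Bdry d, u (pt 0 y) = f y
  weakGradTrace : HasWeakGradTrace u G f
  gradient_L2 : MemLp G 2 (volume.restrict (halfSpace d))
  weak_equation : ∀ φ : Space d → ℂ, ContDiff ℝ ∞ φ → HasCompactSupport φ →
    tsupport φ ⊆ strip d h →
    ∫ x, ∑ i, ∑ j, A x i j * G x j * pd i φ x = ∫ x, ∑ i, B x i * G x i * φ x

/-- The integrand `|∇u|² |u|^(p-2)` of the `p`-adapted square function. In `[0, ∞]` one has
`0 * ∞ = 0`, so it is zero wherever the gradient vanishes, also for `p < 2`. -/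
def energyDensity {d : ℕ} (p : ℝ) (u : Space d → ℂ) (G : Space d → EuclideanSpace ℂ (Fin (d + 1)))
    (x : Space d) : ℝ≥0∞ :=
  ‖G x‖ₑ ^ 2 * ‖u x‖ₑ ^ (p - 2)

end StripPDE

end

/-! The equation is tested with |u|^(p-2) ū ζ, where the cutoff ζ is comparable to the distance to
the boundary. Ellipticity adapted to p turns the main term into a multiple of the integral of |∇u|²
|u|^(p-2) ζ. The dangerous term is the flux Re(A₀ⱼ ∂ⱼu |u|^(p-2) ū) ∂₀ζ, which carries a full
gradient of u and no factor x₀. Since A₀ⱼ is real, it equals A₀ⱼ ∂ⱼ(|u|^p) ∂₀ζ / p. The symmetry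
∂₀∂ⱼ|u|^p = ∂ⱼ∂₀|u|^p, tested with A₀ⱼ ζ and summed over j, exchanges it for ∂₀(|u|^p) ∂₀ζ / p,
because A₀₀ = 1. The price is a set of errors containing only ∂₀A₀ⱼ, the divergence of the first
row, and tangential derivatives of ζ. This is why μ' involves just these derivatives. The exchange
is `Profile.pointwise_lower_bound`; integrated, it is `IsEnergySolution.energy_inequality`.

The coefficient errors and B are absorbed by Young's inequality at the cost of an integral of |u|^p
against a Carleson density. That integral is bounded in `carleson_averaging` by a nontangential
maximal function: values of |u|^p are first averaged over Whitney balls, then a Vitali covering is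
used. The averages are centred directly above the boundary point, so they belong to cones of every
positive aperture, and the constant does not depend on a.

On slabs ζ is the parabola x₀ (1 - x₀/r). Its derivative takes the values 1 and -1 at the ends and
has slope -2/r, which gives the two boundary integrals and the bulk term after integration along
vertical lines (`IsEnergySolution.integral_capDeriv`). The global estimate is the limit r → ∞, where
u vanishes on the top face. Above a graph, ζ = tent²/x₀ equals x₀ between the graph and a conical
roof. Being quadratic, it has a gradient of size at most a multiple of tent/x₀ = √(ζ/x₀), so its
flux terms are absorbed and leave |u|^p / x₀ on two thin layers, which is again Carleson
(`IsEnergySolution.layer_inequality`).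

Neither |u|^(p-2) ū nor u itself is an admissible test function. The weight is therefore replaced by
bounded profiles, for which all bounds hold with the same constants, and the limit is taken by
Fatou's lemma. The solution is replaced by mollifications shifted so as to vanish near the top of
the strip (`IsEnergySolution.nonlinear_test`). -/

noncomputable section

namespace StripPDE

open Filter Topology

/-! ### The product structure of the ambient space -/

section Geometry

variable {d : ℕ}

@[simp] lemma pt_zero (t : ℝ) (y : Bdry d) : (pt t y : Space d) 0 = t := by simp [pt]

@[simp] lemma pt_succ (t : ℝ) (y : Bdry d) (i : Fin d) : (pt t y : Space d) i.succ = y i := by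
  simp [pt]

@[simp] lemma tang_pt (t : ℝ) (y : Bdry d) : tang (pt t y) = y := by
  ext i; simp [tang]

@[simp] lemma pt_tang (x : Space d) : pt (x 0) (tang x) = x := by
  ext i; refine Fin.cases ?_ (fun j => ?_) i <;> simp [tang]

lemma continuous_pt : Continuous (fun q : ℝ × Bdry d => (pt q.1 q.2 : Space d)) := by
  unfold pt
  refine (PiLp.continuous_toLp 2 _).comp (continuous_pi fun i => ?_)
  refine Fin.cases ?_ (fun j => ?_) i
  · simpa using continuous_fst
  · simpa using (by fun_prop : Continuous fun q : ℝ × Bdry d => q.2 j)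

lemma continuous_tang : Continuous (tang : Space d → Bdry d) := by
  unfold tang
  exact (PiLp.continuous_toLp 2 _).comp (by fun_prop)

lemma continuous_coord (i : Fin (d + 1)) : Continuous (fun x : Space d => x i) := by fun_prop

/-- The measurable identification of the ambient space with the product of the transversal line and
the boundary. -/
def ptEquiv (d : ℕ) : ℝ × Bdry d ≃ᵐ Space d where
  toFun q := pt q.1 q.2
  invFun x := (x 0, tang x)
  left_inv q := by simp
  right_inv x := by simp
  measurable_toFun := continuous_pt.measurable
  measurable_invFun := ((continuous_coord 0).prodMk continuous_tang).measurable

@[simp] lemma ptEquiv_apply (q : ℝ × Bdry d) : ptEquiv d q = pt q.1 q.2 := rfl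

/-- Euclidean volume is the product measure in coordinates, from which the zeroth coordinate splits
off. Every use of Fubini on vertical lines rests on this. -/
lemma measurePreserving_ptEquiv : MeasurePreserving (ptEquiv d) := by
  have h1 : MeasurePreserving (Prod.map (id : ℝ → ℝ) (WithLp.ofLp : Bdry d → Fin d → ℝ)) :=
    (MeasurePreserving.id volume).prod (PiLp.volume_preserving_ofLp (Fin d))
  have h2 := (volume_preserving_piFinSuccAbove (fun _ : Fin (d + 1) => ℝ) 0).symm
  have h3 := PiLp.volume_preserving_toLp (Fin (d + 1))
  have := h3.comp (h2.comp h1)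
  convert this using 1
  funext q
  ext i
  refine Fin.cases ?_ (fun j => ?_) i <;> simp [MeasurableEquiv.piFinSuccAbove]

lemma lintegral_space {F : Space d → ℝ≥0∞} (hF : AEMeasurable F) :
    ∫⁻ x, F x = ∫⁻ y : Bdry d, ∫⁻ t : ℝ, F (pt t y) := by
  have hmp := measurePreserving_ptEquiv (d := d)
  rw [← hmp.lintegral_comp_emb (ptEquiv d).measurableEmbedding]
  exact lintegral_prod_symm _ (hF.comp_quasiMeasurePreserving hmp.quasiMeasurePreserving)

lemma integrable_comp_pt {E : Type*} [NormedAddCommGroup E] {F : Space d → E} (hF : Integrable F) :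
    Integrable (fun q : ℝ × Bdry d => F (pt q.1 q.2)) :=
  (measurePreserving_ptEquiv.integrable_comp_emb (ptEquiv d).measurableEmbedding).2 hF

lemma integral_space {E : Type*} [NormedAddCommGroup E] [NormedSpace ℝ E] {F : Space d → E}
    (hF : Integrable F) : ∫ x, F x = ∫ y : Bdry d, ∫ t : ℝ, F (pt t y) := by
  rw [← (measurePreserving_ptEquiv (d := d)).integral_comp (ptEquiv d).measurableEmbedding]
  exact integral_prod_symm _ (integrable_comp_pt hF)

lemma ae_ae_of_ae {P : Space d → Prop} (h : ∀ᵐ x, P x) :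
    ∀ᵐ y : Bdry d, ∀ᵐ t : ℝ, P (pt t y) := by
  have h1 : ∀ᵐ q : ℝ × Bdry d, P (pt q.1 q.2) :=
    measurePreserving_ptEquiv.quasiMeasurePreserving.ae h
  have h2 : ∀ᵐ q : Bdry d × ℝ, P (pt q.2 q.1) :=
    (Measure.measurePreserving_swap (μ := (volume : Measure (Bdry d)))
      (ν := (volume : Measure ℝ))).quasiMeasurePreserving.ae h1
  exact Measure.ae_ae_of_ae_prod h2

lemma integrable_slice {E : Type*} [NormedAddCommGroup E] {F : Space d → E} (hF : Integrable F) :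
    ∀ᵐ y : Bdry d, Integrable (fun t : ℝ => F (pt t y)) :=
  (integrable_prod_iff' (integrable_comp_pt hF).aestronglyMeasurable |>.1 (integrable_comp_pt hF)).1

lemma measurableSet_halfSpace : MeasurableSet (halfSpace d) :=
  (isOpen_lt continuous_const (continuous_coord 0)).measurableSet

lemma isOpen_halfSpace : IsOpen (halfSpace d) := isOpen_lt continuous_const (continuous_coord 0)

lemma isOpen_strip (h : ℝ) : IsOpen (strip d h) :=
  (isOpen_lt continuous_const (continuous_coord 0)).inter
    (isOpen_lt (continuous_coord 0) continuous_const)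

lemma norm_sq_pt (t : ℝ) (y : Bdry d) : ‖(pt t y : Space d)‖ ^ 2 = t ^ 2 + ‖y‖ ^ 2 := by
  simp [EuclideanSpace.norm_sq_eq, Fin.sum_univ_succ]

lemma pt_sub (s t : ℝ) (y z : Bdry d) : (pt s y - pt t z : Space d) = pt (s - t) (y - z) := by
  ext i; refine Fin.cases ?_ (fun j => ?_) i <;> simp

lemma pt_add (s t : ℝ) (y z : Bdry d) : (pt s y + pt t z : Space d) = pt (s + t) (y + z) := by
  ext i; refine Fin.cases ?_ (fun j => ?_) i <;> simp

lemma norm_pt_le (t : ℝ) (y : Bdry d) : ‖(pt t y : Space d)‖ ≤ |t| + ‖y‖ := by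
  apply le_of_sq_le_sq _ (by positivity)
  rw [norm_sq_pt]
  nlinarith [sq_abs t, abs_nonneg t, norm_nonneg y]

lemma abs_coord_le (x : Space d) (i : Fin (d + 1)) : |x i| ≤ ‖x‖ := by
  simpa using PiLp.norm_apply_le x i

lemma norm_tang_le (x : Space d) : ‖tang x‖ ≤ ‖x‖ := by
  apply le_of_sq_le_sq _ (by positivity)
  conv_rhs => rw [← pt_tang x, norm_sq_pt]
  nlinarith [sq_nonneg (x 0)]

lemma tang_sub (x z : Space d) : tang (x - z) = tang x - tang z := by
  ext i; simp [tang]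

lemma dist_le_coord_add_tang (x z : Space d) : dist x z ≤ |x 0 - z 0| + dist (tang x) (tang z) := by
  rw [dist_eq_norm, dist_eq_norm, ← tang_sub]
  conv_lhs => rw [← pt_tang (x - z)]
  simpa using norm_pt_le ((x - z) 0) (tang (x - z))

lemma dist_tang_le (x z : Space d) : dist (tang x) (tang z) ≤ dist x z := by
  rw [dist_eq_norm, dist_eq_norm, ← tang_sub]; exact norm_tang_le _

lemma abs_coord_sub_le (x z : Space d) (i : Fin (d + 1)) : |x i - z i| ≤ dist x z := by
  rw [dist_eq_norm]; simpa using abs_coord_le (x - z) i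

lemma pt_zero_zero_basis (t : ℝ) : (pt t 0 : Space d) = t • EuclideanSpace.single 0 1 := by
  ext i; refine Fin.cases ?_ (fun j => ?_) i <;> simp

end Geometry

/-! ### Bounded weights approximating `|z|^(p-2)` -/

section Weights

/-- A bounded profile `w` on `[0, ∞)`, dominated by `s^((p-2)/2)`, whose logarithmic derivative
`s w' / w` lies between `0` and `(p-2)/2`. -/
structure Profile (p : ℝ) where
  w : ℝ → ℝ
  w' : ℝ → ℝ
  K : ℝ
  continuousOn_w : ContinuousOn w (Ici 0)
  w_nonneg : ∀ s, 0 ≤ s → 0 ≤ w s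
  w_le : ∀ s, 0 ≤ s → w s ≤ K
  hasDerivAt_w : ∀ s, 0 < s → HasDerivAt w (w' s) s
  continuousOn_w' : ContinuousOn w' (Ioi 0)
  log_deriv : ∀ s, 0 < s → ∃ θ ∈ Icc (0 : ℝ) 1, s * w' s = (p - 2) / 2 * θ * w s
  tendsto_zero : Tendsto (fun s => s * w' s) (𝓝[>] 0) (𝓝 0)
  w_le_rpow : ∀ s, 0 < s → w s ≤ s ^ ((p - 2) / 2)

namespace Profile

variable {p : ℝ} (P : Profile p)

/-- The weight `w(|z|²)`. -/
def om (z : ℂ) : ℝ := P.w (‖z‖ ^ 2)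

/-- The weighted conjugate `w(|z|²) z̄`. -/
def Th (z : ℂ) : ℂ := P.om z • (starRingEnd ℂ) z

/-- The derivative of `Th`. -/
def DTh (z : ℂ) : ℂ →L[ℝ] ℂ :=
  P.om z • (Complex.conjCLE : ℂ →L[ℝ] ℂ) +
    (2 * P.w' (‖z‖ ^ 2)) • (innerSL ℝ z).smulRight ((starRingEnd ℂ) z)

/-- The potential whose gradient is `p Th`. -/
def V (z : ℂ) : ℝ := p / 2 * ∫ s in (0 : ℝ)..‖z‖ ^ 2, P.w (max s 0)

lemma K_nonneg : 0 ≤ P.K := (P.w_nonneg 0 le_rfl).trans (P.w_le 0 le_rfl)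

lemma om_nonneg (z : ℂ) : 0 ≤ P.om z := P.w_nonneg _ (by positivity)

lemma om_le (z : ℂ) : P.om z ≤ P.K := P.w_le _ (by positivity)

lemma continuous_om : Continuous P.om :=
  P.continuousOn_w.comp_continuous (by fun_prop) (fun z => by simp)

lemma Th_zero : P.Th 0 = 0 := by simp [Th]

lemma norm_Th (z : ℂ) : ‖P.Th z‖ = P.om z * ‖z‖ := by
  simp [Th, abs_of_nonneg (P.om_nonneg z)]

lemma DTh_apply (z ξ : ℂ) : P.DTh z ξ = P.om z * (starRingEnd ℂ) ξ +
    2 * P.w' (‖z‖ ^ 2) * ((starRingEnd ℂ) z * ξ).re * (starRingEnd ℂ) z := by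
  simp [DTh, Complex.inner]
  ring

/-- The profile need not be differentiable at 0. There `Th` is a continuous weight times
conjugation, which vanishes to first order, so continuity of the weight is enough. -/
lemma hasFDerivAt_Th (z : ℂ) : HasFDerivAt P.Th (P.DTh z) z := by
  by_cases hz : z = 0
  · subst hz
    have h0 : P.DTh 0 = P.om 0 • (Complex.conjCLE : ℂ →L[ℝ] ℂ) := by
      ext <;> simp [DTh]
    rw [h0, hasFDerivAt_iff_isLittleO_nhds_zero]
    have h1 : (fun h : ℂ => P.Th (0 + h) - P.Th 0 - (P.om 0 • (Complex.conjCLE : ℂ →L[ℝ] ℂ)) h)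
        = fun h => (P.om h - P.om 0) • (starRingEnd ℂ) h := by
      funext h; simp [Th, sub_mul]
    rw [h1]
    have h2 : (fun h : ℂ => P.om h - P.om 0) =o[𝓝 0] (fun _ => (1 : ℝ)) := by
      rw [Asymptotics.isLittleO_one_iff]
      have := (P.continuous_om.tendsto 0).sub_const (P.om 0)
      simpa using this
    have h3 : (fun h : ℂ => (starRingEnd ℂ) h) =O[𝓝 0] (fun h : ℂ => h) :=
      Asymptotics.isBigO_of_le _ (fun h => by simp)
    simpa using h2.smul_isBigO h3
  · have hpos : 0 < ‖z‖ ^ 2 := by positivity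
    have h1 : HasFDerivAt P.om (P.w' (‖z‖ ^ 2) • (2 • innerSL ℝ z)) z :=
      (P.hasDerivAt_w _ hpos).comp_hasFDerivAt z (hasStrictFDerivAt_norm_sq z).hasFDerivAt
    have h2 : HasFDerivAt (fun z : ℂ => (starRingEnd ℂ) z) (Complex.conjCLE : ℂ →L[ℝ] ℂ) z :=
      (Complex.conjCLE : ℂ →L[ℝ] ℂ).hasFDerivAt
    refine (h1.smul h2).congr_fderiv ?_
    ext <;> simp [DTh] <;> ring

/-- With e = z/|z|, the condition on the logarithmic derivative gives the derivative of |z|^(p-2) z̄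
with p - 2 damped by a factor θ in [0,1]. The profile enters later pointwise bounds only through θ
and the weight, which makes them uniform over profiles. -/
lemma exists_polar (z : ℂ) : ∃ e : ℂ, ‖e‖ = 1 ∧ ∃ θ ∈ Icc (0 : ℝ) 1, ∀ ξ, P.DTh z ξ =
    P.om z * ((starRingEnd ℂ) ξ + ((p - 2) * θ * ((starRingEnd ℂ) e * ξ).re : ℝ)
      * (starRingEnd ℂ) e) := by
  by_cases hz : z = 0
  · refine ⟨1, by simp, 0, by simp, fun ξ => ?_⟩
    subst hz; simp [DTh_apply]
  · have hn : (‖z‖ : ℝ) ≠ 0 := by simpa using hz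
    have hn' : (‖z‖ : ℂ) ≠ 0 := by exact_mod_cast hn
    obtain ⟨θ, hθ, h⟩ := P.log_deriv (‖z‖ ^ 2) (by positivity)
    refine ⟨z / ‖z‖, by simp [hz], θ, hθ, fun ξ => ?_⟩
    rw [DTh_apply, mul_add]
    congr 1
    have h1 : ((starRingEnd ℂ) (z / ‖z‖) * ξ).re = ((starRingEnd ℂ) z * ξ).re / ‖z‖ := by
      rw [map_div₀, Complex.conj_ofReal, div_mul_eq_mul_div, Complex.div_ofReal_re]
    rw [h1, map_div₀, Complex.conj_ofReal]
    have h2 : 2 * P.w' (‖z‖ ^ 2) = (p - 2) * θ * P.om z / ‖z‖ ^ 2 := by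
      unfold om; field_simp; linarith
    have h3 : (2 : ℂ) * P.w' (‖z‖ ^ 2) = (p - 2) * θ * P.om z / ‖z‖ ^ 2 := by exact_mod_cast h2
    rw [h3]
    push_cast
    field_simp

lemma norm_DTh_apply_le (z ξ : ℂ) : ‖P.DTh z ξ‖ ≤ (1 + |p - 2|) * P.om z * ‖ξ‖ := by
  obtain ⟨e, he, θ, hθ, h⟩ := P.exists_polar z
  rw [h, norm_mul, Complex.norm_real, Real.norm_of_nonneg (P.om_nonneg z)]
  have h1 : ‖(((p - 2) * θ * ((starRingEnd ℂ) e * ξ).re : ℝ) : ℂ) * (starRingEnd ℂ) e‖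
      ≤ |p - 2| * ‖ξ‖ := by
    rw [norm_mul, Complex.norm_real, RCLike.norm_conj, he, mul_one, Real.norm_eq_abs, abs_mul,
      abs_mul, abs_of_nonneg hθ.1]
    have : |((starRingEnd ℂ) e * ξ).re| ≤ ‖ξ‖ := by
      refine (Complex.abs_re_le_norm _).trans ?_
      simp [he]
    calc |p - 2| * θ * |((starRingEnd ℂ) e * ξ).re| ≤ |p - 2| * 1 * ‖ξ‖ := by
          gcongr; exact hθ.2
      _ = _ := by ring
  have h2 := norm_add_le ((starRingEnd ℂ) ξ)
    ((((p - 2) * θ * ((starRingEnd ℂ) e * ξ).re : ℝ) : ℂ) * (starRingEnd ℂ) e)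
  rw [RCLike.norm_conj] at h2
  calc _ ≤ P.om z * (‖ξ‖ + |p - 2| * ‖ξ‖) := by
        gcongr
        · exact P.om_nonneg z
        · linarith
    _ = _ := by ring

lemma norm_DTh_le (z : ℂ) : ‖P.DTh z‖ ≤ (1 + |p - 2|) * P.K := by
  refine ContinuousLinearMap.opNorm_le_bound _
    (mul_nonneg (by positivity) P.K_nonneg) fun ξ => (P.norm_DTh_apply_le z ξ).trans ?_
  gcongr
  exact P.om_le z

/-- The only doubtful point is 0, where the second summand has norm at most 2 |s w'(s)| with s =
|z|², and this tends to 0 by `tendsto_zero`. -/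
lemma continuous_DTh : Continuous P.DTh := by
  have h1 : Continuous fun z => P.om z • (Complex.conjCLE : ℂ →L[ℝ] ℂ) :=
    P.continuous_om.smul continuous_const
  refine h1.add (continuous_iff_continuousAt.2 fun z => ?_)
  by_cases hz : z = 0
  · subst hz
    have hlim : Tendsto (fun z : ℂ => 2 * |‖z‖ ^ 2 * P.w' (‖z‖ ^ 2)|) (𝓝[≠] 0) (𝓝 0) := by
      have ha : Tendsto (fun z : ℂ => ‖z‖ ^ 2) (𝓝[≠] 0) (𝓝[>] 0) := by
        refine tendsto_nhdsWithin_iff.2 ⟨?_, ?_⟩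
        · have : Tendsto (fun z : ℂ => ‖z‖ ^ 2) (𝓝 0) (𝓝 (‖(0 : ℂ)‖ ^ 2)) :=
            (by fun_prop : Continuous fun z : ℂ => ‖z‖ ^ 2).tendsto 0
          simpa using this.mono_left nhdsWithin_le_nhds
        · filter_upwards [self_mem_nhdsWithin] with z hz
          have : 0 < ‖z‖ := by simpa using hz
          exact pow_pos this 2
      simpa using ((P.tendsto_zero.comp ha).abs).const_mul 2
    let R : ℂ → ℂ →L[ℝ] ℂ := fun z =>
      (2 * P.w' (‖z‖ ^ 2)) • (innerSL ℝ z).smulRight ((starRingEnd ℂ) z)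
    have h0 : R 0 = 0 := by ext <;> simp [R]
    suffices ContinuousAt R 0 from this
    rw [continuousAt_iff_punctured_nhds, h0]
    refine squeeze_zero_norm (fun z => ?_) hlim
    refine ContinuousLinearMap.opNorm_le_bound _ (by positivity) fun ξ => ?_
    have h3 : |inner ℝ z ξ| ≤ ‖z‖ * ‖ξ‖ := abs_real_inner_le_norm z ξ
    simp only [R, _root_.smul_apply, ContinuousLinearMap.smulRight_apply,
      innerSL_apply_apply, norm_smul, RCLike.norm_conj, Real.norm_eq_abs, abs_mul, abs_two,
      abs_pow, abs_norm]
    calc 2 * |P.w' (‖z‖ ^ 2)| * (|inner ℝ z ξ| * ‖z‖)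
        ≤ 2 * |P.w' (‖z‖ ^ 2)| * ((‖z‖ * ‖ξ‖) * ‖z‖) := by gcongr
      _ = _ := by ring
  · have hpos : 0 < ‖z‖ ^ 2 := by positivity
    have h2 : ContinuousAt (fun z : ℂ => P.w' (‖z‖ ^ 2)) z :=
      ContinuousAt.comp (f := fun z : ℂ => ‖z‖ ^ 2)
        (P.continuousOn_w'.continuousAt (Ioi_mem_nhds hpos)) (by fun_prop)
    have h3 : Continuous fun z : ℂ => (innerSL ℝ z).smulRight ((starRingEnd ℂ) z) := by
      fun_prop
    exact (continuousAt_const.mul h2).smul h3.continuousAt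

lemma contDiff_Th : ContDiff ℝ 1 P.Th := by
  rw [contDiff_one_iff_fderiv]
  refine ⟨fun z => (P.hasFDerivAt_Th z).differentiableAt, ?_⟩
  have : fderiv ℝ P.Th = P.DTh := funext fun z => (P.hasFDerivAt_Th z).fderiv
  rw [this]; exact P.continuous_DTh

lemma continuous_Th : Continuous P.Th := P.contDiff_Th.continuous

/-- Since Re(ξ `Th`) is the derivative of `V` in the direction ξ divided by p, this is the symmetry
of the Hessian of `V`. -/
lemma curl (z ξ η : ℂ) : (ξ * P.DTh z η).re = (η * P.DTh z ξ).re := by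
  simp only [DTh_apply, Complex.mul_re, Complex.add_re, Complex.add_im, Complex.mul_im,
    Complex.conj_re, Complex.conj_im, Complex.ofReal_re, Complex.ofReal_im, Complex.re_ofNat,
    Complex.im_ofNat]
  ring

lemma continuous_wmax : Continuous fun s : ℝ => P.w (max s 0) :=
  P.continuousOn_w.comp_continuous (by fun_prop) (fun s => by simp)

lemma hasFDerivAt_V (z : ℂ) :
    HasFDerivAt P.V ((p * P.om z) • (innerSL ℝ z : ℂ →L[ℝ] ℝ)) z := by
  have h1 : HasDerivAt (fun t => ∫ s in (0 : ℝ)..t, P.w (max s 0)) (P.w (max (‖z‖ ^ 2) 0))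
      (‖z‖ ^ 2) :=
    intervalIntegral.integral_hasDerivAt_right (P.continuous_wmax.intervalIntegrable _ _)
      (P.continuous_wmax.stronglyMeasurableAtFilter _ _) P.continuous_wmax.continuousAt
  rw [max_eq_left (by positivity)] at h1
  have h2 := (h1.comp_hasFDerivAt z (hasStrictFDerivAt_norm_sq z).hasFDerivAt).const_mul (p / 2)
  refine h2.congr_fderiv ?_
  ext <;> simp [om] <;> ring

lemma fderiv_V_apply (z ξ : ℂ) : ((p * P.om z) • (innerSL ℝ z : ℂ →L[ℝ] ℝ)) ξ
    = p * (ξ * P.Th z).re := by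
  simp [Th, Complex.inner]
  ring

lemma continuous_V : Continuous P.V :=
  continuous_iff_continuousAt.2 fun z => (P.hasFDerivAt_V z).continuousAt

lemma contDiff_V : ContDiff ℝ 1 P.V := by
  rw [contDiff_one_iff_fderiv]
  refine ⟨fun z => (P.hasFDerivAt_V z).differentiableAt, ?_⟩
  have : fderiv ℝ P.V = fun z => (p * P.om z) • (innerSL ℝ z : ℂ →L[ℝ] ℝ) :=
    funext fun z => (P.hasFDerivAt_V z).fderiv
  rw [this]
  exact (continuous_const.mul P.continuous_om).smul (innerSL ℝ).continuous

lemma V_nonneg (hp : 0 ≤ p) (z : ℂ) : 0 ≤ P.V z :=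
  mul_nonneg (by positivity) (intervalIntegral.integral_nonneg (by positivity)
    fun s _ => P.w_nonneg _ (le_max_right _ _))

lemma V_le_sq (hp : 0 ≤ p) (z : ℂ) : P.V z ≤ p / 2 * P.K * ‖z‖ ^ 2 := by
  unfold V
  rw [mul_assoc]
  gcongr
  have := intervalIntegral.integral_mono_on (a := 0) (b := ‖z‖ ^ 2) (by positivity)
    (P.continuous_wmax.intervalIntegrable _ _) (intervalIntegrable_const (μ := volume) (c := P.K))
    (fun s _ => P.w_le _ (le_max_right _ _))
  simpa [mul_comm] using this

lemma V_le_rpow (hp : 0 < p) (z : ℂ) : P.V z ≤ ‖z‖ ^ p := by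
  unfold V
  have h1 : ∫ s in (0 : ℝ)..‖z‖ ^ 2, P.w (max s 0) ≤ ∫ s in (0 : ℝ)..‖z‖ ^ 2, s ^ ((p - 2) / 2) := by
    refine intervalIntegral.integral_mono_on_of_le_Ioo (by positivity)
      (P.continuous_wmax.intervalIntegrable _ _)
      (intervalIntegral.intervalIntegrable_rpow' (by linarith)) (fun s hs => ?_)
    rw [max_eq_left hs.1.le]
    exact P.w_le_rpow s hs.1
  rw [integral_rpow (Or.inl (by linarith))] at h1
  have h2 : (p - 2) / 2 + 1 = p / 2 := by ring
  rw [h2, Real.zero_rpow (by positivity), sub_zero] at h1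
  have h3 : (‖z‖ ^ 2) ^ (p / 2) = ‖z‖ ^ p := by
    rw [← Real.rpow_natCast, ← Real.rpow_mul (norm_nonneg z)]; congr 1; push_cast; ring
  rw [h3] at h1
  calc p / 2 * _ ≤ p / 2 * (‖z‖ ^ p / (p / 2)) := by gcongr
    _ = _ := by field_simp

lemma om_mul_sq_le (hp : 0 < p) (z : ℂ) : P.om z * ‖z‖ ^ 2 ≤ ‖z‖ ^ p := by
  by_cases hz : z = 0
  · subst hz; simp [Real.zero_rpow hp.ne']
  have hn : 0 < ‖z‖ := by simpa using hz
  have h1 := P.w_le_rpow (‖z‖ ^ 2) (by positivity)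
  have h3 : (‖z‖ ^ 2) ^ ((p - 2) / 2) * ‖z‖ ^ 2 = ‖z‖ ^ p := by
    rw [← Real.rpow_natCast, ← Real.rpow_mul (norm_nonneg z), ← Real.rpow_add hn]
    congr 1; push_cast; ring
  rw [← h3]
  unfold om
  gcongr

/-- Ellipticity transfers from the `p`-adapted pairing to the gradient of the weighted test
function. -/
lemma ellipticity {n : ℕ} (hp : 1 < p) {lam : ℝ} (hlam : 0 ≤ lam) {M : Matrix (Fin n) (Fin n) ℂ}
    (hM : ∀ ξ : EuclideanSpace ℂ (Fin n), lam * ‖ξ‖ ^ 2 ≤ (pairing M ξ (Jmap p ξ)).re)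
    (z : ℂ) (ξ : EuclideanSpace ℂ (Fin n)) :
    lam * min 2 p * (P.om z * ‖ξ‖ ^ 2) ≤ (∑ i, ∑ j, M i j * ξ j * P.DTh z (ξ i)).re := by
  obtain ⟨e, he, θ, hθ, h⟩ := P.exists_polar z
  obtain ⟨η, hη⟩ : ∃ η : EuclideanSpace ℂ (Fin n), η = (starRingEnd ℂ) e • ξ := ⟨_, rfl⟩
  have hnorm : ‖η‖ = ‖ξ‖ := by rw [hη, norm_smul, RCLike.norm_conj, he, one_mul]
  have hnorm' : ‖Complex.I • η‖ = ‖ξ‖ := by rw [norm_smul, Complex.norm_I, one_mul, hnorm]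
  have hee : (starRingEnd ℂ) e * e = 1 := by
    rw [mul_comm, Complex.mul_conj, Complex.normSq_eq_norm_sq, he]; simp
  have hp0 : p ≠ 0 := by linarith
  -- Rotated by ē, the derivative is a combination of the p-adapted pairings at η and iη with
  -- nonnegative coefficients 1 - θ and 1 + (p-1)θ. The value θ = 1 is the pure power, where only iη
  -- survives, with coefficient p; θ = 0 is a constant weight.
  have key : ∀ i j, M i j * ξ j * P.DTh z (ξ i) = P.om z *
      (((1 - θ : ℝ) : ℂ) * (M i j * η j * (starRingEnd ℂ) (Jmap p η i)) +
        ((1 + (p - 1) * θ : ℝ) : ℂ) * (M i j * (Complex.I • η) j *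
          (starRingEnd ℂ) (Jmap p (Complex.I • η) i))) := by
    intro i j
    rw [h]
    have h1 : ξ j = e * η j := by
      simp only [hη, PiLp.smul_apply, smul_eq_mul]
      linear_combination (-(ξ j)) * hee
    have h2 : (starRingEnd ℂ) (ξ i) = (starRingEnd ℂ) e * (starRingEnd ℂ) (η i) := by
      rw [← map_mul]; congr 1
      simp only [hη, PiLp.smul_apply, smul_eq_mul]
      linear_combination (-(ξ i)) * hee
    have h3 : (starRingEnd ℂ) e * ξ i = η i := by simp [hη]
    have h4 : (starRingEnd ℂ) (η i) + ((p - 2) * θ * (η i).re : ℝ)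
        = ((1 - θ : ℝ) : ℂ) * (starRingEnd ℂ) (Jmap p η i) +
          ((1 + (p - 1) * θ : ℝ) : ℂ) * (Complex.I * (starRingEnd ℂ) (Jmap p (Complex.I • η) i)) := by
      have hp1 : p - 1 ≠ 0 := by linarith
      apply Complex.ext
      · simp [Jmap]
        field_simp
        ring
      · simp [Jmap]
        field_simp
        ring
    have h5 : (Complex.I • η) j = Complex.I * η j := rfl
    rw [h3, h2, h1, h5]
    linear_combination (P.om z : ℂ) * M i j * η j * ((starRingEnd ℂ) (η i)
      + ((p - 2) * θ * (η i).re : ℝ)) * hee + (P.om z : ℂ) * M i j * η j * h4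
  have hsum : ∑ i, ∑ j, M i j * ξ j * P.DTh z (ξ i) = P.om z *
      (((1 - θ : ℝ) : ℂ) * pairing M η (Jmap p η) +
        ((1 + (p - 1) * θ : ℝ) : ℂ) * pairing M (Complex.I • η) (Jmap p (Complex.I • η))) := by
    simp only [pairing, Finset.mul_sum, ← Finset.sum_add_distrib]
    exact Finset.sum_congr rfl fun i _ => Finset.sum_congr rfl fun j _ => by rw [key]
  rw [hsum, Complex.re_ofReal_mul, Complex.add_re, Complex.re_ofReal_mul, Complex.re_ofReal_mul]
  have e1 := hM η
  have e2 := hM (Complex.I • η)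
  rw [hnorm] at e1
  rw [hnorm'] at e2
  -- The two coefficients add up to 2 + (p-2)θ, which lies between 2 and p.
  have hmin : min 2 p ≤ 2 + (p - 2) * θ := by
    rcases le_total 2 p with h2 | h2
    · rw [min_eq_left h2]; nlinarith [hθ.1]
    · rw [min_eq_right h2]; nlinarith [hθ.2]
  have h5 : (2 + (p - 2) * θ) * (lam * ‖ξ‖ ^ 2) ≤ (1 - θ) * (pairing M η (Jmap p η)).re +
      (1 + (p - 1) * θ) * (pairing M (Complex.I • η) (Jmap p (Complex.I • η))).re := by
    have ha : 0 ≤ 1 - θ := by linarith [hθ.2]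
    have hb : 0 ≤ 1 + (p - 1) * θ := by nlinarith [hθ.1]
    nlinarith [mul_le_mul_of_nonneg_left e1 ha, mul_le_mul_of_nonneg_left e2 hb]
  have h6 : min 2 p * (lam * ‖ξ‖ ^ 2) ≤ (2 + (p - 2) * θ) * (lam * ‖ξ‖ ^ 2) := by gcongr
  calc _ = P.om z * (min 2 p * (lam * ‖ξ‖ ^ 2)) := by ring
    _ ≤ _ := mul_le_mul_of_nonneg_left (h6.trans h5) (P.om_nonneg z)

/-- Dominated convergence with majorant s^((p-2)/2), which is integrable at 0 because p > 0. -/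
lemma tendsto_V (hp : 0 < p) {P : ℕ → Profile p}
    (h : ∀ s, 0 < s → Tendsto (fun n => (P n).w s) atTop (𝓝 (s ^ ((p - 2) / 2)))) (z : ℂ) :
    Tendsto (fun n => (P n).V z) atTop (𝓝 (‖z‖ ^ p)) := by
  have h1 : Tendsto (fun n => ∫ s in (0 : ℝ)..‖z‖ ^ 2, (P n).w (max s 0)) atTop
      (𝓝 (∫ s in (0 : ℝ)..‖z‖ ^ 2, s ^ ((p - 2) / 2))) := by
    refine intervalIntegral.tendsto_integral_filter_of_dominated_convergence
      (fun s => s ^ ((p - 2) / 2)) (Eventually.of_forall fun n =>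
        (P n).continuous_wmax.aestronglyMeasurable) (Eventually.of_forall fun n => ?_)
      (intervalIntegral.intervalIntegrable_rpow' (by linarith)) ?_
    · refine Eventually.of_forall fun s hs => ?_
      rw [uIoc_of_le (by positivity)] at hs
      rw [max_eq_left hs.1.le, Real.norm_of_nonneg ((P n).w_nonneg _ hs.1.le)]
      exact (P n).w_le_rpow s hs.1
    · refine Eventually.of_forall fun s hs => ?_
      rw [uIoc_of_le (by positivity)] at hs
      rw [max_eq_left hs.1.le]
      exact h s hs.1
  rw [integral_rpow (Or.inl (by linarith))] at h1
  have h2 : (p - 2) / 2 + 1 = p / 2 := by ring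
  have h3 : (‖z‖ ^ 2) ^ (p / 2) = ‖z‖ ^ p := by
    rw [← Real.rpow_natCast, ← Real.rpow_mul (norm_nonneg z)]; congr 1; push_cast; ring
  rw [h2, Real.zero_rpow (by positivity), sub_zero, h3] at h1
  have h4 := h1.const_mul (p / 2)
  rwa [mul_div_cancel₀ _ (by positivity)] at h4

lemma tendsto_om {P : ℕ → Profile p}
    (h : ∀ s, 0 < s → Tendsto (fun n => (P n).w s) atTop (𝓝 (s ^ ((p - 2) / 2))))
    {z : ℂ} (hz : z ≠ 0) :
    Tendsto (fun n => ENNReal.ofReal ((P n).om z)) atTop (𝓝 (‖z‖ₑ ^ (p - 2))) := by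
  have hn : 0 < ‖z‖ := by simpa using hz
  have h1 := ENNReal.tendsto_ofReal (h (‖z‖ ^ 2) (by positivity))
  have h3 : (‖z‖ ^ 2) ^ ((p - 2) / 2) = ‖z‖ ^ (p - 2) := by
    rw [← Real.rpow_natCast, ← Real.rpow_mul (norm_nonneg z)]; congr 1; push_cast; ring
  rw [h3, ← ENNReal.ofReal_rpow_of_pos hn, ofReal_norm] at h1
  exact h1

/-- The profile `(s / (1 + s / N))^((p-2)/2)`, for `2 ≤ p`. -/
def large (hp : 2 ≤ p) (N : ℝ) (hN : 0 < N) : Profile p where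
  w s := (s / (1 + s / N)) ^ ((p - 2) / 2)
  w' s := (1 / (1 + s / N) ^ 2) * ((p - 2) / 2) * (s / (1 + s / N)) ^ ((p - 2) / 2 - 1)
  K := N ^ ((p - 2) / 2)
  continuousOn_w := by
    refine ContinuousOn.rpow_const (ContinuousOn.div (by fun_prop) (by fun_prop) fun s hs => ?_)
      fun s hs => Or.inr (by linarith)
    have : 0 ≤ s / N := div_nonneg hs hN.le
    positivity
  w_nonneg s hs := by positivity
  w_le s hs := by
    refine Real.rpow_le_rpow (by positivity) ?_ (by linarith)
    rw [div_le_iff₀ (by positivity)]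
    have : N * (1 + s / N) = N + s := by field_simp
    linarith
  hasDerivAt_w s hs := by
    have h1 : HasDerivAt (fun s : ℝ => s / (1 + s / N)) (1 / (1 + s / N) ^ 2) s := by
      have := (hasDerivAt_id s).div (((hasDerivAt_id s).div_const N).const_add 1)
        (by positivity : (1 + id s / N) ≠ 0)
      refine this.congr_deriv ?_
      simp only [id]
      field_simp
      ring
    exact h1.rpow_const (Or.inl (by positivity))
  continuousOn_w' := by
    refine ContinuousOn.mul (ContinuousOn.mul (ContinuousOn.div (by fun_prop) (by fun_prop)
      fun s hs => ?_) (by fun_prop)) (ContinuousOn.rpow_const (ContinuousOn.div (by fun_prop)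
      (by fun_prop) fun s hs => ?_) fun s hs => Or.inl ?_) <;>
    · have hs' : 0 < s := hs
      positivity
  log_deriv s hs := by
    refine ⟨1 / (1 + s / N), ⟨by positivity, ?_⟩, ?_⟩
    · rw [div_le_one (by positivity)]; linarith [div_pos hs hN]
    · rw [Real.rpow_sub_one (by positivity)]
      field_simp
  tendsto_zero := by
    have hc : Tendsto (fun s : ℝ => (p - 2) / 2 * (s / (1 + s / N)) ^ ((p - 2) / 2)) (𝓝[>] 0)
        (𝓝 0) := by
      have h1 : ContinuousAt (fun s : ℝ => (p - 2) / 2 * (s / (1 + s / N)) ^ ((p - 2) / 2)) 0 := by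
        refine continuousAt_const.mul (ContinuousAt.rpow_const (ContinuousAt.div (by fun_prop)
          (by fun_prop) (by simp)) (Or.inr (by linarith)))
      have h2 := h1.tendsto.mono_left (nhdsWithin_le_nhds (s := Ioi 0))
      have h3 : (p - 2) / 2 * ((0 : ℝ) / (1 + 0 / N)) ^ ((p - 2) / 2) = 0 := by
        rcases eq_or_ne ((p - 2) / 2) 0 with h | h
        · simp [h]
        · simp [Real.zero_rpow h]
      rwa [h3] at h2
    refine squeeze_zero' ?_ ?_ hc
    · filter_upwards [self_mem_nhdsWithin] with s hs
      have hs' : 0 < s := hs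
      have : 0 ≤ p - 2 := by linarith
      positivity
    · filter_upwards [self_mem_nhdsWithin] with s hs
      have hs' : 0 < s := hs
      have hp2 : 0 ≤ p - 2 := by linarith
      rw [Real.rpow_sub_one (by positivity)]
      have h1 : s * (1 / (1 + s / N) ^ 2 * ((p - 2) / 2) *
          ((s / (1 + s / N)) ^ ((p - 2) / 2) / (s / (1 + s / N))))
          = ((p - 2) / 2 * (s / (1 + s / N)) ^ ((p - 2) / 2)) * (1 / (1 + s / N)) := by
        field_simp
      rw [h1]
      refine mul_le_of_le_one_right (by positivity) ?_
      rw [div_le_one (by positivity)]; linarith [div_pos hs' hN]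
  w_le_rpow s hs := by
    refine Real.rpow_le_rpow (by positivity) ?_ (by linarith)
    exact div_le_self hs.le (by linarith [div_pos hs hN])

/-- The profile `(s + 1 / N)^((p-2)/2)`, for `p ≤ 2`. -/
def small (hp : p ≤ 2) (N : ℝ) (hN : 0 < N) : Profile p where
  w s := (s + 1 / N) ^ ((p - 2) / 2)
  w' s := 1 * ((p - 2) / 2) * (s + 1 / N) ^ ((p - 2) / 2 - 1)
  K := (1 / N) ^ ((p - 2) / 2)
  continuousOn_w := by
    refine ContinuousOn.rpow_const (by fun_prop) fun s hs => Or.inl ?_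
    have : (0 : ℝ) ≤ s := hs
    positivity
  w_nonneg s hs := by positivity
  w_le s hs := Real.rpow_le_rpow_of_nonpos (by positivity) (by linarith) (by linarith)
  hasDerivAt_w s hs := ((hasDerivAt_id s).add_const (1 / N)).rpow_const (Or.inl (by positivity))
  continuousOn_w' := by
    refine ContinuousOn.mul (by fun_prop) (ContinuousOn.rpow_const (by fun_prop)
      fun s hs => Or.inl ?_)
    have hs' : 0 < s := hs
    positivity
  log_deriv s hs := by
    refine ⟨s / (s + 1 / N), ⟨by positivity, ?_⟩, ?_⟩
    · rw [div_le_one (by positivity)]; linarith [div_pos one_pos hN]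
    · rw [Real.rpow_sub_one (by positivity)]
      field_simp
  tendsto_zero := by
    have h1 : ContinuousAt (fun s : ℝ => s * (1 * ((p - 2) / 2) * (s + 1 / N) ^ ((p - 2) / 2 - 1)))
        0 := by
      refine continuousAt_id.mul (continuousAt_const.mul (ContinuousAt.rpow_const (by fun_prop)
        (Or.inl (by simpa using hN.ne'))))
    simpa using h1.tendsto.mono_left (nhdsWithin_le_nhds (s := Ioi 0))
  w_le_rpow s hs := Real.rpow_le_rpow_of_nonpos hs (by linarith [div_pos one_pos hN])
    (by linarith)

/-- The weight `|z|^(p-2)` is a limit of bounded profiles. -/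
lemma exists_approx (hp : 1 < p) : ∃ P : ℕ → Profile p,
    (∀ z, Tendsto (fun n => ENNReal.ofReal ((P n).om z)) atTop (𝓝 (‖z‖ₑ ^ (p - 2)))) ∧
    ∀ z, Tendsto (fun n => (P n).V z) atTop (𝓝 (‖z‖ ^ p)) := by
  have hN : Tendsto (fun n : ℕ => ((n : ℝ) + 1)) atTop atTop :=
    tendsto_atTop_add_const_right _ _ tendsto_natCast_atTop_atTop
  rcases le_or_gt 2 p with h2 | h2
  · have hw : ∀ s, 0 < s → Tendsto (fun n : ℕ => (large h2 ((n : ℝ) + 1) (by positivity)).w s)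
        atTop (𝓝 (s ^ ((p - 2) / 2))) := by
      intro s hs
      have h1 : Tendsto (fun n : ℕ => s / (1 + s / ((n : ℝ) + 1))) atTop (𝓝 (s / (1 + 0))) :=
        tendsto_const_nhds.div (tendsto_const_nhds.add (hN.const_div_atTop s)) (by norm_num)
      rw [add_zero, div_one] at h1
      exact h1.rpow_const (Or.inl hs.ne')
    refine ⟨fun n => large h2 ((n : ℝ) + 1) (by positivity), fun z => ?_,
      tendsto_V (by linarith) hw⟩
    by_cases hz : z = 0
    · subst hz
      have h3 : ∀ n : ℕ, ENNReal.ofReal ((large h2 ((n : ℝ) + 1) (by positivity)).om 0)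
          = ‖(0 : ℂ)‖ₑ ^ (p - 2) := by
        intro n
        rcases eq_or_lt_of_le h2 with h | h
        · simp [om, large, ← h]
        · have : (p - 2) / 2 ≠ 0 := by linarith
          simp [om, large, Real.zero_rpow this, ENNReal.zero_rpow_of_pos (sub_pos.2 h)]
      simp only [h3]
      exact tendsto_const_nhds
    · exact tendsto_om hw hz
  · have hw : ∀ s, 0 < s → Tendsto (fun n : ℕ => (small h2.le ((n : ℝ) + 1) (by positivity)).w s)
        atTop (𝓝 (s ^ ((p - 2) / 2))) := by
      intro s hs
      have h1 : Tendsto (fun n : ℕ => s + 1 / ((n : ℝ) + 1)) atTop (𝓝 (s + 0)) :=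
        tendsto_const_nhds.add (hN.const_div_atTop 1)
      rw [add_zero] at h1
      exact h1.rpow_const (Or.inl hs.ne')
    refine ⟨fun n => small h2.le ((n : ℝ) + 1) (by positivity), fun z => ?_,
      tendsto_V (by linarith) hw⟩
    by_cases hz : z = 0
    · subst hz
      -- For p < 2 the limit weight at the origin is ∞, and the values of the profiles at 0 do tend
      -- to ∞, so convergence holds at every point and not only off the zero set of u.
      have h4 : ‖(0 : ℂ)‖ₑ ^ (p - 2) = ⊤ := by
        rw [enorm_zero, ENNReal.zero_rpow_of_neg (by linarith)]
      rw [h4]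
      refine ENNReal.tendsto_ofReal_atTop.comp ?_
      have h5 : ∀ n : ℕ, (small h2.le ((n : ℝ) + 1) (by positivity)).om 0
          = ((n : ℝ) + 1) ^ ((2 - p) / 2) := by
        intro n
        simp only [om, small, norm_zero, ne_eq, OfNat.ofNat_ne_zero, not_false_eq_true, zero_pow,
          zero_add]
        rw [one_div, Real.inv_rpow (by positivity), ← Real.rpow_neg (by positivity)]
        congr 1; ring
      simp only [h5]
      exact (tendsto_rpow_atTop (by linarith)).comp hN
    · exact tendsto_om hw hz

end Profile

end Weights

/-! ### Lipschitz test functions -/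

section LipschitzTest

variable {d : ℕ}

lemma norm_single_one (i : Fin (d + 1)) : ‖(EuclideanSpace.single i (1 : ℝ) : Space d)‖ = 1 := by
  simp

lemma norm_pd_le_of_lipschitz {φ : Space d → ℂ} {K : ℝ≥0} (hφ : LipschitzWith K φ)
    (i : Fin (d + 1)) (x : Space d) : ‖pd i φ x‖ ≤ K := by
  refine (ContinuousLinearMap.le_opNorm _ _).trans ?_
  rw [norm_single_one, mul_one]
  exact norm_fderiv_le_of_lipschitz ℝ hφ

lemma measurable_pd (i : Fin (d + 1)) (φ : Space d → ℂ) : Measurable (pd i φ) :=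
  measurable_fderiv_apply_const ℝ φ _

/-- The normalized bump function of outer radius `δ`, centred at the origin. -/
def bump (d : ℕ) (δ : ℝ) (hδ : 0 < δ) : ContDiffBump (0 : Space d) :=
  ⟨δ / 2, δ, by positivity, by linarith⟩

/-- Mollification at scale `δ`. -/
def moll (δ : ℝ) (hδ : 0 < δ) (F : Space d → ℂ) (x : Space d) : ℂ :=
  ∫ z, (bump d δ hδ).normed volume z • F (x - z)

lemma moll_eq_convolution (δ : ℝ) (hδ : 0 < δ) (F : Space d → ℂ) :
    moll δ hδ F = convolution ((bump d δ hδ).normed volume) F (ContinuousLinearMap.lsmul ℝ ℝ)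
      volume := rfl

lemma moll_contDiff (δ : ℝ) (hδ : 0 < δ) {F : Space d → ℂ} (hF : LocallyIntegrable F) :
    ContDiff ℝ ∞ (moll δ hδ F) := by
  rw [moll_eq_convolution]
  exact (bump d δ hδ).hasCompactSupport_normed.contDiff_convolution_left _
    (bump d δ hδ).contDiff_normed hF

lemma bump_normed_eq_zero {δ : ℝ} (hδ : 0 < δ) {z : Space d} (hz : δ ≤ ‖z‖) :
    (bump d δ hδ).normed volume z = 0 := by
  have : z ∉ Function.support ((bump d δ hδ).normed volume) := by
    rw [ContDiffBump.support_normed_eq]; simpa [bump] using hz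
  simpa using this

lemma moll_eq_zero {δ : ℝ} (hδ : 0 < δ) {F : Space d → ℂ} {x : Space d}
    (h : ∀ y, dist y x < δ → F y = 0) : moll δ hδ F x = 0 := by
  refine integral_eq_zero_of_ae (Eventually.of_forall fun z => ?_)
  rcases lt_or_ge ‖z‖ δ with hz | hz
  · simp [h (x - z) (by simpa [dist_eq_norm] using hz)]
  · simp [bump_normed_eq_zero hδ hz]

lemma norm_moll_le {δ : ℝ} (hδ : 0 < δ) {F : Space d → ℂ} {C : ℝ} (hF : ∀ x, ‖F x‖ ≤ C)
    (x : Space d) : ‖moll δ hδ F x‖ ≤ C := by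
  have hi : Integrable (fun z => (bump d δ hδ).normed volume z * C) :=
    ((bump d δ hδ).integrable_normed).mul_const C
  calc ‖moll δ hδ F x‖ ≤ ∫ z, (bump d δ hδ).normed volume z * C := by
        refine norm_integral_le_of_norm_le hi (Eventually.of_forall fun z => ?_)
        rw [norm_smul, Real.norm_of_nonneg ((bump d δ hδ).nonneg_normed z)]
        exact mul_le_mul_of_nonneg_left (hF _) ((bump d δ hδ).nonneg_normed z)
    _ = C := by rw [integral_mul_const, ContDiffBump.integral_normed, one_mul]

lemma tsupport_moll_subset {δ : ℝ} (hδ : 0 < δ) (F : Space d → ℂ) :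
    tsupport (moll δ hδ F) ⊆ cthickening δ (tsupport F) := by
  refine closure_minimal (fun x hx => ?_) isClosed_cthickening
  by_contra hx'
  refine hx (moll_eq_zero hδ fun y hy => ?_)
  by_contra hy'
  refine hx' ?_
  have := mem_cthickening_of_dist_le x y δ (tsupport F) (subset_closure hy')
    (by rw [dist_comm]; exact hy.le)
  exact this

/-- By Rademacher's theorem φ is differentiable almost everywhere, and its difference quotients are
bounded by K, so one may differentiate under the integral sign. -/
lemma pd_moll {δ : ℝ} (hδ : 0 < δ) {φ : Space d → ℂ} {K : ℝ≥0} (hφ : LipschitzWith K φ)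
    (i : Fin (d + 1)) (x : Space d) : pd i (moll δ hδ φ) x = moll δ hδ (pd i φ) x := by
  set ρ := (bump d δ hδ).normed volume with hρ
  set e : Space d := EuclideanSpace.single i 1 with he
  have hdiff : DifferentiableAt ℝ (moll δ hδ φ) x :=
    ((moll_contDiff δ hδ hφ.continuous.locallyIntegrable).differentiable (by simp)) x
  have h1 : HasDerivAt (fun t : ℝ => moll δ hδ φ (x + t • e)) (pd i (moll δ hδ φ) x) 0 := by
    exact hdiff.hasFDerivAt.hasLineDerivAt e
  have hρc : Continuous ρ := (bump d δ hδ).continuous_normed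
  have hae : ∀ᵐ z : Space d, DifferentiableAt ℝ φ (x - z) :=
    (quasiMeasurePreserving_sub_left_of_right_invariant volume x).ae hφ.ae_differentiableAt
  have h2 : HasDerivAt (fun t : ℝ => ∫ z, ρ z • φ (x + t • e - z))
      (∫ z, ρ z • pd i φ (x - z)) 0 := by
    refine (hasDerivAt_integral_of_dominated_loc_of_lip (bound := fun z => ρ z * K)
      (F := fun (t : ℝ) z => ρ z • φ (x + t • e - z)) (s := univ) univ_mem ?_ ?_ ?_ ?_ ?_ ?_).2
    · refine Eventually.of_forall fun t => Continuous.aestronglyMeasurable ?_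
      exact hρc.smul (hφ.continuous.comp (by fun_prop))
    · refine Continuous.integrable_of_hasCompactSupport
        (hρc.smul (hφ.continuous.comp (by fun_prop))) ?_
      exact (bump d δ hδ).hasCompactSupport_normed.smul_right
    · exact (hρc.measurable.smul ((measurable_pd i φ).comp (by fun_prop))).aestronglyMeasurable
    · refine Eventually.of_forall fun z => LipschitzOnWith.of_dist_le_mul fun s _ t _ => ?_
      have hnn : 0 ≤ ρ z := (bump d δ hδ).nonneg_normed z
      rw [dist_smul₀, Real.norm_of_nonneg hnn, Real.coe_nnabs, abs_of_nonneg (by positivity),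
        mul_assoc]
      refine mul_le_mul_of_nonneg_left ((hφ.dist_le_mul _ _).trans (le_of_eq ?_)) hnn
      rw [dist_eq_norm, dist_eq_norm]
      have : x + s • e - z - (x + t • e - z) = (s - t) • e := by module
      rw [this, norm_smul, he, norm_single_one, mul_one]
    · exact ((bump d δ hδ).integrable_normed).mul_const _
    · filter_upwards [hae] with z hz
      have h' : HasDerivAt (fun t : ℝ => φ (x - z + t • e)) (pd i φ (x - z)) 0 :=
        hz.hasFDerivAt.hasLineDerivAt e
      have h'' := h'.const_smul (ρ z)
      refine h''.congr_of_eventuallyEq (Eventually.of_forall fun t => ?_)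
      simp only [Pi.smul_apply]
      congr 2; abel
  exact h1.unique h2

lemma ae_tendsto_moll {F : Space d → ℂ} (hF : LocallyIntegrable F) {δ : ℕ → ℝ} (hδ : ∀ n, 0 < δ n)
    (h0 : Tendsto δ atTop (𝓝 0)) :
    ∀ᵐ x, Tendsto (fun n => moll (δ n) (hδ n) F x) atTop (𝓝 (F x)) :=
  ContDiffBump.ae_convolution_tendsto_right_of_locallyIntegrable (K := 2)
    (φ := fun n => bump d (δ n) (hδ n)) h0
    (Eventually.of_forall fun n => by simp only [bump]; linarith) hF

/-- A first order identity tested with smooth functions may be tested with Lipschitz functions. -/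
lemma lipschitz_test {U : Set (Space d)} (hU : IsOpen U) {H : Fin (d + 1) → Space d → ℂ}
    {b : Space d → ℂ} (hH : ∀ i, LocallyIntegrableOn (H i) U) (hb : LocallyIntegrableOn b U)
    (h : ∀ φ : Space d → ℂ, ContDiff ℝ ∞ φ → HasCompactSupport φ → tsupport φ ⊆ U →
      ∫ x, ∑ i, H i x * pd i φ x = ∫ x, b x * φ x)
    {φ : Space d → ℂ} {K : ℝ≥0} (hφ : LipschitzWith K φ) (hc : HasCompactSupport φ)
    (hs : tsupport φ ⊆ U) : ∫ x, ∑ i, H i x * pd i φ x = ∫ x, b x * φ x := by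
  -- All mollifications at scale at most δ₀ live on one compact subset of U, where the coefficients
  -- are integrable. Together with the bounds on φ and its gradient this gives the dominating
  -- functions.
  obtain ⟨δ₀, hδ₀, hsub⟩ := hc.isCompact.exists_cthickening_subset_open hU hs
  set S := cthickening δ₀ (tsupport φ) with hS
  have hScpt : IsCompact S := hc.isCompact.cthickening
  have hSm : MeasurableSet S := hScpt.measurableSet
  set δ : ℕ → ℝ := fun n => δ₀ / (n + 1) with hδdef
  have hδ : ∀ n, 0 < δ n := fun n => by positivity
  have hδle : ∀ n, δ n ≤ δ₀ := fun n =>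
    div_le_self hδ₀.le (by linarith [n.cast_nonneg (α := ℝ)])
  have hδ0 : Tendsto δ atTop (𝓝 0) :=
    (tendsto_atTop_add_const_right _ _ tendsto_natCast_atTop_atTop).const_div_atTop δ₀
  obtain ⟨M, hM⟩ := hc.exists_bound_of_continuous hφ.continuous
  set φn : ℕ → Space d → ℂ := fun n => moll (δ n) (hδ n) φ with hφn
  have hsupp : ∀ n, tsupport (φn n) ⊆ S := fun n =>
    (tsupport_moll_subset (hδ n) φ).trans (cthickening_mono (hδle n) _)
  have hcn : ∀ n, HasCompactSupport (φn n) := fun n =>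
    hScpt.of_isClosed_subset (isClosed_tsupport _) (hsupp n)
  have hloc : LocallyIntegrable φ := hφ.continuous.locallyIntegrable
  have heq : ∀ n, ∫ x, ∑ i, H i x * pd i (φn n) x = ∫ x, b x * φn n x := fun n =>
    h _ (moll_contDiff _ _ hloc) (hcn n) ((hsupp n).trans hsub)
  have hout : ∀ n x, x ∉ S → φn n x = 0 := fun n x hx =>
    image_eq_zero_of_notMem_tsupport fun hx' => hx (hsupp n hx')
  have hout' : ∀ n i x, x ∉ S → pd i (φn n) x = 0 := fun n i x hx => by
    have : x ∉ tsupport (fderiv ℝ (φn n)) := fun hx' => hx (hsupp n (tsupport_fderiv_subset ℝ hx'))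
    simp [pd, image_eq_zero_of_notMem_tsupport this]
  have hHS : ∀ i, IntegrableOn (H i) S := fun i => (hH i).integrableOn_compact_subset hsub hScpt
  have hbS : IntegrableOn b S := hb.integrableOn_compact_subset hsub hScpt
  have hpdloc : ∀ i, LocallyIntegrable (pd i φ) := fun i =>
    (locallyIntegrable_const (K : ℝ)).mono (measurable_pd i φ).aestronglyMeasurable
      (Eventually.of_forall fun x => by
        simpa using norm_pd_le_of_lipschitz hφ i x)
  have hindH : ∀ i n x, H i x * pd i (φn n) x = S.indicator (H i) x * pd i (φn n) x := by
    intro i n x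
    by_cases hx : x ∈ S
    · simp [hx]
    · simp [hx, hout' n i x hx]
  have hindb : ∀ n x, b x * φn n x = S.indicator b x * φn n x := by
    intro n x
    by_cases hx : x ∈ S
    · simp [hx]
    · simp [hx, hout n x hx]
  have hlim1 : Tendsto (fun n => ∫ x, b x * φn n x) atTop (𝓝 (∫ x, b x * φ x)) := by
    simp only [hindb]
    have hb' : ∀ x, b x * φ x = S.indicator b x * φ x := by
      intro x
      by_cases hx : x ∈ S
      · simp [hx]
      · have : φ x = 0 := image_eq_zero_of_notMem_tsupport fun hx' =>
          hx (self_subset_cthickening _ hx')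
        simp [this]
    simp only [hb']
    refine tendsto_integral_of_dominated_convergence (fun x => ‖S.indicator b x‖ * M)
      (fun n => ?_) ?_ (fun n => Eventually.of_forall fun x => ?_) ?_
    · exact (hbS.integrable_indicator hSm).aestronglyMeasurable.mul
        (moll_contDiff _ _ hloc).continuous.aestronglyMeasurable
    · exact (hbS.integrable_indicator hSm).norm.mul_const _
    · rw [norm_mul]
      gcongr
      exact norm_moll_le (hδ n) hM x
    · filter_upwards [ae_tendsto_moll hloc hδ hδ0] with x hx
      exact hx.const_mul _
  have hlim2 : Tendsto (fun n => ∫ x, ∑ i, H i x * pd i (φn n) x) atTop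
      (𝓝 (∫ x, ∑ i, H i x * pd i φ x)) := by
    simp only [hindH]
    have hH' : ∀ i x, H i x * pd i φ x = S.indicator (H i) x * pd i φ x := by
      intro i x
      by_cases hx : x ∈ S
      · simp [hx]
      · have : x ∉ tsupport (fderiv ℝ φ) := fun hx' =>
          hx (self_subset_cthickening _ (tsupport_fderiv_subset ℝ hx'))
        simp [pd, image_eq_zero_of_notMem_tsupport this]
    simp only [hH']
    refine tendsto_integral_of_dominated_convergence
      (fun x => ∑ i, ‖S.indicator (H i) x‖ * K) (fun n => ?_) ?_
      (fun n => Eventually.of_forall fun x => ?_) ?_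
    · exact Finset.aestronglyMeasurable_fun_sum _ fun i _ =>
        ((hHS i).integrable_indicator hSm).aestronglyMeasurable.mul
          (measurable_pd i _).aestronglyMeasurable
    · exact integrable_finsetSum _ fun i _ =>
        ((hHS i).integrable_indicator hSm).norm.mul_const _
    · refine norm_sum_le_of_le _ fun i _ => ?_
      rw [norm_mul]
      gcongr
      rw [hφn, pd_moll (hδ n) hφ]
      exact norm_moll_le (hδ n) (norm_pd_le_of_lipschitz hφ i) x
    · have hall : ∀ᵐ x, ∀ i, Tendsto (fun n => moll (δ n) (hδ n) (pd i φ) x) atTop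
          (𝓝 (pd i φ x)) := ae_all_iff.2 fun i => ae_tendsto_moll (hpdloc i) hδ hδ0
      filter_upwards [hall] with x hx
      refine tendsto_finsetSum _ fun i _ => ?_
      have := (hx i).const_mul (S.indicator (H i) x)
      refine this.congr fun n => ?_
      rw [hφn, pd_moll (hδ n) hφ]
  exact tendsto_nhds_unique hlim2 (by simpa only [heq] using hlim1)

/-- The product of a locally Lipschitz function and a compactly supported Lipschitz function. -/
lemma lipschitz_mul {U : Set (Space d)} {c ζ : Space d → ℂ} (hc : LocallyLipschitzOn U c)
    {K : ℝ≥0} (hζ : LipschitzWith K ζ) (hs : HasCompactSupport ζ) (hsub : tsupport ζ ⊆ U) :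
    ∃ K', LipschitzWith K' (fun x => c x * ζ x) := by
  obtain ⟨L, hL⟩ := (hc.mono hsub).exists_lipschitzOnWith_of_compact hs.isCompact
  obtain ⟨M, hM0, hM⟩ : ∃ M : ℝ, 0 ≤ M ∧ ∀ x ∈ tsupport ζ, ‖c x‖ ≤ M := by
    obtain ⟨M, hM⟩ := hs.isCompact.exists_bound_of_continuousOn hL.continuousOn
    exact ⟨max M 0, le_max_right _ _, fun x hx => (hM x hx).trans (le_max_left _ _)⟩
  obtain ⟨N, hN⟩ := hs.exists_bound_of_continuous hζ.continuous
  refine ⟨Real.toNNReal (M * K + N * L), LipschitzWith.of_dist_le_mul fun x y => ?_⟩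
  have hz : ∀ x, x ∉ tsupport ζ → ζ x = 0 := fun x hx => image_eq_zero_of_notMem_tsupport hx
  have hN0 : 0 ≤ N := (norm_nonneg _).trans (hN x)
  refine le_trans ?_ (mul_le_mul_of_nonneg_right (Real.le_coe_toNNReal _) dist_nonneg)
  -- If one point is off the support, the value of c there plays no role, since the product
  -- vanishes. Hence regularity of c is needed only on the support.
  have h1 : ∀ x ∈ tsupport ζ, ∀ y, y ∉ tsupport ζ →
      dist (c x * ζ x) (c y * ζ y) ≤ (M * K + N * L) * dist x y := by
    intro x hx y hy
    rw [hz y hy, mul_zero, dist_zero_right, norm_mul]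
    have h2 : ‖ζ x‖ ≤ K * dist x y := by
      simpa [hz y hy] using hζ.dist_le_mul x y
    calc ‖c x‖ * ‖ζ x‖ ≤ M * (K * dist x y) := by
          gcongr
          exact hM x hx
      _ ≤ _ := by
        have : 0 ≤ N * L * dist x y := by positivity
        linarith
  by_cases hx : x ∈ tsupport ζ <;> by_cases hy : y ∈ tsupport ζ
  · have h3 : c x * ζ x - c y * ζ y = c x * (ζ x - ζ y) + (c x - c y) * ζ y := by ring
    rw [dist_eq_norm, h3]
    refine (norm_add_le _ _).trans ?_
    rw [norm_mul, norm_mul, ← dist_eq_norm, ← dist_eq_norm]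
    calc ‖c x‖ * dist (ζ x) (ζ y) + dist (c x) (c y) * ‖ζ y‖
        ≤ M * (K * dist x y) + (L * dist x y) * N := by
          gcongr
          · exact hM x hx
          · exact hζ.dist_le_mul x y
          · exact hL.dist_le_mul x hx y hy
          · exact hN y
      _ = _ := by ring
  · exact h1 x hx y hy
  · rw [dist_comm, dist_comm x y]; exact h1 y hy x hx
  · rw [hz x hx, hz y hy, mul_zero, mul_zero, dist_self]
    positivity

end LipschitzTest

/-! ### Representation of the solution on vertical lines -/

section Slices

variable {d : ℕ}

/-- The transversal unit vector. -/
def e0 (d : ℕ) : Space d := EuclideanSpace.single 0 1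

lemma pt_add_smul (t s : ℝ) (y : Bdry d) : (pt t y : Space d) + s • e0 d = pt (t + s) y := by
  rw [e0, ← pt_zero_zero_basis, pt_add, add_zero]

lemma pt_sub_smul (t s : ℝ) (y : Bdry d) : (pt t y : Space d) - s • e0 d = pt (t - s) y := by
  rw [e0, ← pt_zero_zero_basis, pt_sub, sub_zero]

@[simp] lemma e0_zero : (e0 d) 0 = 1 := by simp [e0]

@[simp] lemma tang_add_smul (x : Space d) (s : ℝ) : tang (x + s • e0 d) = tang x := by
  ext i; simp [tang, e0]

lemma norm_le_of_strip {x : Space d} {s R : ℝ} (hx : 0 < x 0) (hs : 0 < s)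
    (h : ‖x + s • e0 d‖ ≤ R) : s ≤ R ∧ ‖x‖ ≤ 2 * R := by
  have h1 : |(x + s • e0 d) 0| ≤ R := (abs_coord_le _ _).trans h
  have h2 : ‖tang x‖ ≤ R := by
    have := (norm_tang_le (x + s • e0 d)).trans h
    rwa [tang_add_smul] at this
  have h3 : (x + s • e0 d) 0 = x 0 + s := by simp
  rw [h3, abs_of_pos (by linarith)] at h1
  refine ⟨by linarith, ?_⟩
  have h4 := norm_pt_le (x 0) (tang x)
  rw [pt_tang, abs_of_pos hx] at h4
  linarith

lemma measurePreserving_shear : MeasurePreserving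
    (fun q : ℝ × Space d => (q.1, q.2 - q.1 • e0 d)) (volume.prod volume) (volume.prod volume) := by
  refine MeasurePreserving.skew_product (MeasurePreserving.id volume)
    (g := fun s x => x - s • e0 d) (by fun_prop) (Eventually.of_forall fun s => ?_)
  exact (measurePreserving_sub_right volume (s • e0 d)).map_eq

/-- For x in the half-space, x + s e₀ can lie in the ball of radius R only if s ≤ R and |x| ≤ 2R. So
integrability of G on bounded sets up to the boundary suffices. -/
lemma shear_integrable {G : Space d → ℂ} (hG : LocallyIntegrableOn G {x | 0 ≤ x 0})
    {b : Space d → ℂ} (hb : Measurable b) {M R : ℝ} (hM : ∀ x, ‖b x‖ ≤ M)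
    (hR : ∀ x, R < ‖x‖ → b x = 0) :
    Integrable (fun q : ℝ × Space d => (Ioi (0 : ℝ)).indicator
      (fun s => (halfSpace d).indicator G q.2 * b (q.2 + s • e0 d)) q.1) (volume.prod volume) := by
  have hcl : IsClosed {x : Space d | 0 ≤ x 0} := isClosed_le continuous_const (continuous_coord 0)
  have hK : IsCompact ({x : Space d | 0 ≤ x 0} ∩ closedBall 0 (2 * R)) :=
    (isCompact_closedBall _ _).inter_left hcl
  have hGi : IntegrableOn G (halfSpace d ∩ closedBall 0 (2 * R)) :=
    (hG.integrableOn_compact_subset inter_subset_left hK).mono_set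
      (inter_subset_inter_left _ fun x (hx : 0 < x 0) => hx.le)
  have hm : MeasurableSet (halfSpace d ∩ closedBall (0 : Space d) (2 * R)) :=
    measurableSet_halfSpace.inter measurableSet_closedBall
  have h1 : Integrable (fun q : ℝ × Space d => (Ioc (0 : ℝ) R).indicator (fun _ => M) q.1 *
      ‖(halfSpace d ∩ closedBall (0 : Space d) (2 * R)).indicator G q.2‖)
      (volume.prod volume) := by
    refine Integrable.mul_prod (f := (Ioc (0 : ℝ) R).indicator (fun _ => M)) ?_
      (hGi.integrable_indicator hm).norm
    exact (integrable_indicator_iff measurableSet_Ioc).2 (integrableOn_const (by simp))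
  have hGm : AEStronglyMeasurable ((halfSpace d).indicator G) := by
    have h2 : AEStronglyMeasurable G (volume.restrict {x : Space d | 0 ≤ x 0}) :=
      hG.aestronglyMeasurable
    exact (aestronglyMeasurable_indicator_iff measurableSet_halfSpace).2
      (h2.mono_set fun x (hx : 0 < x 0) => hx.le)
  have hrw : (fun q : ℝ × Space d => (Ioi (0 : ℝ)).indicator
      (fun s => (halfSpace d).indicator G q.2 * b (q.2 + s • e0 d)) q.1)
      = fun q => (halfSpace d).indicator G q.2 *
        (Ioi (0 : ℝ)).indicator (fun s => b (q.2 + s • e0 d)) q.1 := by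
    funext q; by_cases h : q.1 ∈ Ioi (0 : ℝ) <;> simp [indicator, h]
  refine h1.mono' ?_ (Eventually.of_forall fun q => ?_)
  · rw [hrw]
    refine AEStronglyMeasurable.mul hGm.comp_snd ?_
    refine Measurable.aestronglyMeasurable ?_
    have : (fun q : ℝ × Space d => (Ioi (0 : ℝ)).indicator (fun s => b (q.2 + s • e0 d)) q.1)
        = (Prod.fst ⁻¹' Ioi (0 : ℝ)).indicator fun q => b (q.2 + q.1 • e0 d) := by
      funext q; simp [indicator]
    rw [this]
    exact (hb.comp (by fun_prop)).indicator (measurable_fst measurableSet_Ioi)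
  · rcases q with ⟨s, x⟩
    by_cases hs : 0 < s
    swap
    · simp only [indicator, mem_Ioi, hs, if_false, norm_zero]
      have hs' : ¬ s ∈ Ioc (0 : ℝ) R := fun h => hs h.1
      simp [hs']
    by_cases hx : x ∈ halfSpace d
    swap
    · simp [hs, indicator, hx]
    rcases lt_or_ge R ‖x + s • e0 d‖ with hlt | hle
    · simp only [indicator, mem_Ioi, hs, if_true, hR _ hlt, mul_zero, norm_zero]
      have : 0 ≤ M := (norm_nonneg _).trans (hM 0)
      split_ifs <;> positivity
    · obtain ⟨h3, h4⟩ := norm_le_of_strip hx hs hle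
      have h5 : x ∈ halfSpace d ∩ closedBall (0 : Space d) (2 * R) := ⟨hx, by simpa using h4⟩
      have h6 : s ∈ Ioc (0 : ℝ) R := ⟨hs, h3⟩
      rw [indicator_of_mem (show s ∈ Ioi (0 : ℝ) from hs), indicator_of_mem hx,
        indicator_of_mem h5, indicator_of_mem h6, norm_mul, mul_comm]
      gcongr
      exact hM _

/-- The integral over the part of the vertical line above a point. -/
def tailIntegral (ψ : Space d → ℂ) (x : Space d) : ℂ := ∫ s in Ioi (0 : ℝ), ψ (x + s • e0 d)

/-- The tail integral is the convolution of ψ with the length measure on the downward vertical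
half-line, so it inherits the smoothness of ψ. -/
lemma tailIntegral_contDiff {ψ : Space d → ℂ} (hψ : ContDiff ℝ ∞ ψ) (hc : HasCompactSupport ψ) :
    ContDiff ℝ ∞ (tailIntegral ψ) := by
  set T : ℝ → Space d := fun s => -(s • e0 d) with hT
  have hTc : Continuous T := by fun_prop
  set μ : Measure (Space d) := Measure.map T (volume.restrict (Ioi 0)) with hμ
  have hnorm : ∀ s, ‖T s‖ = |s| := fun s => by simp [hT, e0, norm_smul]
  have hfin : IsLocallyFiniteMeasure μ := ⟨fun x => ⟨ball 0 (‖x‖ + 1),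
    isOpen_ball.mem_nhds (by simp), by
      rw [hμ, Measure.map_apply hTc.measurable measurableSet_ball]
      refine (Measure.restrict_apply_le _ _).trans_lt ?_
      refine (measure_mono (t := closedBall 0 (‖x‖ + 1)) fun s hs => ?_).trans_lt
        measure_closedBall_lt_top
      have : ‖T s‖ < ‖x‖ + 1 := by simpa using hs
      rw [hnorm] at this
      simpa using this.le⟩⟩
  have h1 : ContDiff ℝ ∞ (convolution (fun _ : Space d => (1 : ℝ)) ψ
      (ContinuousLinearMap.lsmul ℝ ℝ) μ) :=
    hc.contDiff_convolution_right _ (locallyIntegrable_const 1) hψ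
  have h2 : convolution (fun _ : Space d => (1 : ℝ)) ψ (ContinuousLinearMap.lsmul ℝ ℝ) μ
      = tailIntegral ψ := by
    funext x
    simp only [convolution, ContinuousLinearMap.lsmul_apply, one_smul, tailIntegral]
    rw [hμ, integral_map hTc.aemeasurable]
    · simp [hT]
    · exact (hψ.continuous.comp (by fun_prop)).aestronglyMeasurable
  rwa [h2] at h1

lemma integrable_line {ψ : Space d → ℂ} (hψ : Continuous ψ) (hc : HasCompactSupport ψ)
    (x : Space d) : Integrable (fun s : ℝ => ψ (x + s • e0 d)) := by
  refine Continuous.integrable_of_hasCompactSupport (hψ.comp (by fun_prop)) ?_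
  refine hc.comp_isClosedEmbedding ?_
  refine ((Homeomorph.addLeft x).isClosedEmbedding).comp (f := fun s : ℝ => s • e0 d) ?_
  exact isClosedEmbedding_smul_left (by intro h; simpa using congrArg (fun v : Space d => v 0) h)

lemma tailIntegral_add {ψ : Space d → ℂ} (hψ : Continuous ψ) (hc : HasCompactSupport ψ)
    (x : Space d) (t : ℝ) : tailIntegral ψ (x + t • e0 d)
      = tailIntegral ψ x - ∫ s in (0 : ℝ)..t, ψ (x + s • e0 d) := by
  have hi := integrable_line hψ hc x
  have h1 : tailIntegral ψ (x + t • e0 d) = ∫ s in Ioi t, ψ (x + s • e0 d) := by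
    have h2 : ∀ s : ℝ, x + t • e0 d + s • e0 d = x + (t + s) • e0 d := fun s => by module
    simp only [tailIntegral, h2]
    have := (measurePreserving_add_left volume t).setIntegral_preimage_emb
      (measurableEmbedding_addLeft t) (fun s => ψ (x + s • e0 d)) (Ioi t)
    simpa using this
  rw [h1, intervalIntegral.integral_Ioi_sub_Ioi' hi.integrableOn hi.integrableOn |>.symm]
  simp [tailIntegral]

lemma hasLineDerivAt_tailIntegral {ψ : Space d → ℂ} (hψ : Continuous ψ) (hc : HasCompactSupport ψ)
    (x : Space d) : HasLineDerivAt ℝ (tailIntegral ψ) (-ψ x) x (e0 d) := by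
  unfold HasLineDerivAt
  have h1 : HasDerivAt (fun t => ∫ s in (0 : ℝ)..t, ψ (x + s • e0 d)) (ψ (x + (0 : ℝ) • e0 d)) 0 := by
    have hc' : Continuous fun s : ℝ => ψ (x + s • e0 d) := hψ.comp (by fun_prop)
    exact intervalIntegral.integral_hasDerivAt_right (hc'.intervalIntegrable _ _)
      (hc'.stronglyMeasurableAtFilter _ _) hc'.continuousAt
  rw [zero_smul, add_zero] at h1
  have h2 := h1.const_sub (tailIntegral ψ x)
  exact h2.congr_of_eventuallyEq (Eventually.of_forall fun t => tailIntegral_add hψ hc x t)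

/-- The test function whose transversal derivative is `ψ` in the half-space. -/
def antiderivTest (ψ : Space d → ℂ) (x : Space d) : ℂ :=
  -- The tail integral does not decay downwards. The smooth step is 1 for x₀ ≥ -1/2 and 0 for x₀ ≤
  -- -1, which restores compact support without changing anything near the closed half-space.
  -((Real.smoothTransition (2 * x 0 + 2) : ℝ) : ℂ) * tailIntegral ψ x

lemma antiderivTest_eq {ψ : Space d → ℂ} {x : Space d} (hx : -1 / 2 ≤ x 0) :
    antiderivTest ψ x = -tailIntegral ψ x := by
  simp [antiderivTest, Real.smoothTransition.one_of_one_le (by linarith : 1 ≤ 2 * x 0 + 2)]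

lemma antiderivTest_contDiff {ψ : Space d → ℂ} (hψ : ContDiff ℝ ∞ ψ) (hc : HasCompactSupport ψ) :
    ContDiff ℝ ∞ (antiderivTest ψ) := by
  refine ContDiff.mul (ContDiff.neg ?_) (tailIntegral_contDiff hψ hc)
  refine Complex.ofRealCLM.contDiff.comp (Real.smoothTransition.contDiff.comp ?_)
  exact (contDiff_const.mul (EuclideanSpace.proj (𝕜 := ℝ) (0 : Fin (d + 1))).contDiff).add
    contDiff_const

lemma antiderivTest_hasCompactSupport {ψ : Space d → ℂ} (hc : HasCompactSupport ψ) :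
    HasCompactSupport (antiderivTest ψ) := by
  obtain ⟨R, hR⟩ := hc.isCompact.isBounded.subset_closedBall 0
  refine HasCompactSupport.of_support_subset_isCompact (isCompact_closedBall (0 : Space d)
    (2 * |R| + 1)) fun x hx => ?_
  by_contra hx'
  refine hx ?_
  simp only [antiderivTest]
  rcases le_or_gt (x 0) (-1) with h | h
  · simp [Real.smoothTransition.zero_of_nonpos (by linarith : 2 * x 0 + 2 ≤ 0)]
  · have : tailIntegral ψ x = 0 := by
      refine setIntegral_eq_zero_of_forall_eq_zero fun s hs => ?_
      by_contra hne
      have h1 : ‖x + s • e0 d‖ ≤ |R| := by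
        have := hR (subset_tsupport _ hne)
        exact (by simpa using this : ‖x + s • e0 d‖ ≤ R).trans (le_abs_self R)
      have hs' : 0 < s := hs
      have h2 : (x + s • e0 d) 0 = x 0 + s := by simp
      have h3 := (abs_coord_le (x + s • e0 d) 0).trans h1
      rw [h2] at h3
      have h4 := (norm_tang_le (x + s • e0 d)).trans h1
      rw [tang_add_smul] at h4
      have h5 := norm_pt_le (x 0) (tang x)
      rw [pt_tang] at h5
      have h6 : |x 0| ≤ |R| + 1 := by
        rw [abs_le] at h3 ⊢
        constructor <;> linarith [abs_nonneg R]
      exact hx' (by simpa using by linarith)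
    rw [this, mul_zero]

lemma pd_antiderivTest {ψ : Space d → ℂ} (hψ : ContDiff ℝ ∞ ψ) (hc : HasCompactSupport ψ)
    {x : Space d} (hx : x ∈ halfSpace d) : pd 0 (antiderivTest ψ) x = ψ x := by
  have h1 : antiderivTest ψ =ᶠ[𝓝 x] fun x => -tailIntegral ψ x := by
    filter_upwards [isOpen_halfSpace.mem_nhds hx] with z hz
    have : 0 < z 0 := hz
    exact antiderivTest_eq (by linarith)
  have hd : DifferentiableAt ℝ (tailIntegral ψ) x :=
    (tailIntegral_contDiff hψ hc).differentiable (by simp) x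
  rw [pd, h1.fderiv_eq, fderiv_fun_neg]
  have h2 := (hd.hasFDerivAt.hasLineDerivAt (e0 d)).lineDeriv.symm.trans
    (hasLineDerivAt_tailIntegral hψ.continuous hc x).lineDeriv
  change -(fderiv ℝ (tailIntegral ψ) x) (e0 d) = ψ x
  rw [h2, neg_neg]

/-- The vertical primitive, starting from the boundary, of a function on the half-space. -/
def primitive (G : Space d → ℂ) (x : Space d) : ℂ :=
  ∫ s in Ioi (0 : ℝ), (halfSpace d).indicator G (x - s • e0 d)

/-- Fubini before and after the measure-preserving shear (s, x) ↦ (s, x - s e₀): the vertical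
integration passes from the test function to G. -/
lemma integral_mul_tailIntegral {G : Space d → ℂ} (hG : LocallyIntegrableOn G {x | 0 ≤ x 0})
    {b : Space d → ℂ} (hb : Measurable b) {M R : ℝ} (hM : ∀ x, ‖b x‖ ≤ M)
    (hR : ∀ x, R < ‖x‖ → b x = 0) :
    Integrable (fun x => primitive G x * b x) ∧
      ∫ x in halfSpace d, G x * tailIntegral b x = ∫ x, primitive G x * b x := by
  have h1 := shear_integrable hG hb hM hR
  have h2 := (measurePreserving_shear (d := d)).integrable_comp h1.aestronglyMeasurable |>.2 h1
  set F : ℝ × Space d → ℂ := fun q => (Ioi (0 : ℝ)).indicator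
      (fun s => (halfSpace d).indicator G q.2 * b (q.2 + s • e0 d)) q.1 with hF
  have hcomp : ∀ s x, (F ∘ fun q : ℝ × Space d => (q.1, q.2 - q.1 • e0 d)) (s, x)
      = (Ioi (0 : ℝ)).indicator (fun s => (halfSpace d).indicator G (x - s • e0 d) * b x) s := by
    intro s x
    simp [hF, indicator]
  have hin : ∀ x, ∫ s, (F ∘ fun q : ℝ × Space d => (q.1, q.2 - q.1 • e0 d)) (s, x)
      = primitive G x * b x := by
    intro x
    simp only [hcomp]
    rw [integral_indicator measurableSet_Ioi, integral_mul_const, primitive]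
  have hin2 : ∀ x, ∫ s, F (s, x) = (halfSpace d).indicator (fun x => G x * tailIntegral b x) x := by
    intro x
    simp only [hF]
    rw [integral_indicator measurableSet_Ioi, integral_const_mul]
    by_cases hx : x ∈ halfSpace d <;> simp [hx, tailIntegral]
  constructor
  · have := h2.integral_prod_right
    simpa only [hin] using this
  · rw [← integral_indicator measurableSet_halfSpace]
    have e1 := integral_prod_symm _ h1
    have e2 := integral_prod_symm _ h2
    simp only [hin2] at e1
    simp only [hin] at e2
    have hmp := measurePreserving_shear (d := d)
    have e3 : ∫ q, (F ∘ fun q : ℝ × Space d => (q.1, q.2 - q.1 • e0 d)) q ∂(volume.prod volume)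
        = ∫ q, F q ∂(volume.prod volume) := by
      have hF' : AEStronglyMeasurable F
          (Measure.map (fun q : ℝ × Space d => (q.1, q.2 - q.1 • e0 d)) (volume.prod volume)) := by
        rw [hmp.map_eq]; exact h1.aestronglyMeasurable
      have := integral_map hmp.measurable.aemeasurable hF'
      rw [hmp.map_eq] at this
      exact this.symm
    rw [← e1, ← e2, e3]

end Slices

/-! ### The solution as trace plus vertical primitive of its transversal derivative. -/

section SliceFormula

variable {d : ℕ}

lemma locallyIntegrable_comp_tang {f : Bdry d → ℂ} (hf : LocallyIntegrable f) :
    LocallyIntegrable (fun x : Space d => f (tang x)) := by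
  refine (locallyIntegrable_iff).2 fun k hk => ?_
  obtain ⟨R, hR⟩ := hk.isBounded.subset_closedBall 0
  have h1 : Integrable (fun q : ℝ × Bdry d => (Icc (-R) R).indicator (fun _ => (1 : ℂ)) q.1 *
      (closedBall (0 : Bdry d) R).indicator f q.2) (volume.prod volume) := by
    refine Integrable.mul_prod (f := (Icc (-R) R).indicator fun _ => (1 : ℂ)) ?_ ?_
    · exact (integrable_indicator_iff measurableSet_Icc).2 (integrableOn_const (by simp))
    · exact (hf.integrableOn_isCompact (isCompact_closedBall _ _)).integrable_indicator
        measurableSet_closedBall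
  have h2 : Integrable (fun x : Space d => (Icc (-R) R).indicator (fun _ => (1 : ℂ)) (x 0) *
      (closedBall (0 : Bdry d) R).indicator f (tang x)) :=
    ((measurePreserving_ptEquiv (d := d)).symm.integrable_comp_emb
      (ptEquiv d).symm.measurableEmbedding).2 h1
  refine (h2.integrableOn (s := k)).congr_fun_ae ?_
  refine (ae_restrict_iff' hk.measurableSet).2 (Eventually.of_forall fun x hx => ?_)
  have hx' : ‖x‖ ≤ R := by simpa using hR hx
  have ha : x 0 ∈ Icc (-R) R := abs_le.1 ((abs_coord_le x 0).trans hx')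
  have hb : tang x ∈ closedBall (0 : Bdry d) R := by simpa using (norm_tang_le x).trans hx'
  simp only [indicator_of_mem ha, indicator_of_mem hb, one_mul]

/-- The duality `integral_mul_tailIntegral` with b the indicator of a ball gives integrability on
that ball. -/
lemma locallyIntegrable_primitive {G : Space d → ℂ} (hG : LocallyIntegrableOn G {x | 0 ≤ x 0}) :
    LocallyIntegrable (primitive G) := by
  refine (locallyIntegrable_iff).2 fun k hk => ?_
  obtain ⟨R, hR⟩ := hk.isBounded.subset_closedBall 0
  have h := (integral_mul_tailIntegral hG (b := (closedBall (0 : Space d) R).indicator fun _ => 1)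
    (measurable_const.indicator measurableSet_closedBall) (M := 1) (R := R)
    (fun x => by by_cases hx : x ∈ closedBall (0 : Space d) R <;> simp only [indicator, hx, if_true,
      if_false] <;> simp)
    (fun x hx => by simp [indicator, hx])).1
  refine (h.integrableOn (s := k)).congr_fun_ae ?_
  refine (ae_restrict_iff' hk.measurableSet).2 (Eventually.of_forall fun x hx => ?_)
  simp [hR hx]

lemma locallyIntegrableOn_coord {G : Space d → EuclideanSpace ℂ (Fin (d + 1))} {U : Set (Space d)}
    (hG : LocallyIntegrableOn G U) (i : Fin (d + 1)) : LocallyIntegrableOn (fun x => G x i) U := by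
  intro x hx
  obtain ⟨s, hs, h⟩ := hG x hx
  exact ⟨s, hs, (ContinuousLinearMap.integrable_comp (EuclideanSpace.proj (𝕜 := ℂ) i) h)⟩

/-- A function with a weak gradient and a trace is the primitive of its transversal derivative,
starting from the trace. -/
lemma ae_eq_trace_add_primitive {u : Space d → ℂ} {G : Space d → EuclideanSpace ℂ (Fin (d + 1))}
    {f : Bdry d → ℂ} (h : HasWeakGradTrace u G f) :
    ∀ᵐ x, x ∈ halfSpace d → u x - f (tang x) - primitive (fun x => G x 0) x = 0 := by
  obtain ⟨hu, hG, hf, hgreen⟩ := h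
  have hG0 := locallyIntegrableOn_coord hG 0
  have hsub : halfSpace d ⊆ {x : Space d | 0 ≤ x 0} := fun x (hx : 0 < x 0) => hx.le
  have hft := locallyIntegrable_comp_tang (d := d) hf
  have hpr := locallyIntegrable_primitive hG0
  refine isOpen_halfSpace.ae_eq_zero_of_integral_contDiff_smul_eq_zero
    (((hu.mono_set hsub).sub (hft.locallyIntegrableOn _)).sub (hpr.locallyIntegrableOn _))
    fun g hg hgc hgs => ?_
  set ψ : Space d → ℂ := fun x => (g x : ℂ) with hψ
  have hψs : ContDiff ℝ ∞ ψ := Complex.ofRealCLM.contDiff.comp hg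
  have hψc : HasCompactSupport ψ := hgc.comp_left (g := fun t : ℝ => (t : ℂ)) (by simp)
  have hψ0 : ∀ x, x ∉ tsupport g → ψ x = 0 := fun x hx => by
    simp [hψ, image_eq_zero_of_notMem_tsupport hx]
  obtain ⟨M, hM⟩ := hψc.exists_bound_of_continuous hψs.continuous
  obtain ⟨R, hR⟩ := hgc.isCompact.isBounded.subset_closedBall 0
  have hR' : ∀ x, R < ‖x‖ → ψ x = 0 := fun x hx => hψ0 x fun hx' => by
    have := hR hx'; simp at this; linarith
  -- This test function has transversal derivative ψ in the half-space, and its boundary value is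
  -- minus the integral of ψ over the vertical half-line. Green's formula thus says that u - f -
  -- primitive is orthogonal to ψ.
  have key := hgreen _ (antiderivTest_contDiff hψs hψc) (antiderivTest_hasCompactSupport hψc) 0
  obtain ⟨hI, hE⟩ := integral_mul_tailIntegral hG0 hψs.continuous.measurable hM hR'
  have hbd : ∀ x, ‖ψ x‖ ≤ M := hM
  have hmem : MemLp ψ ⊤ := memLp_top_of_bound hψs.continuous.aestronglyMeasurable M
    (Eventually.of_forall hM)
  have hcpt : IsCompact (tsupport g) := hgc.isCompact
  have hmul : ∀ w : Space d → ℂ, IntegrableOn w (tsupport g) → Integrable (fun x => w x * ψ x) := by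
    intro w hw
    have h1 : Integrable (fun x => (tsupport g).indicator w x * ψ x) :=
      (hw.integrable_indicator hcpt.measurableSet).mul_of_top_left hmem
    refine h1.congr (Eventually.of_forall fun x => ?_)
    by_cases hx : x ∈ tsupport g
    · simp [hx]
    · simp [hψ0 x hx]
  have hIu : Integrable (fun x => u x * ψ x) :=
    hmul u ((hu.mono_set hsub).integrableOn_compact_subset hgs hcpt)
  have hIf : Integrable (fun x => f (tang x) * ψ x) := hmul _ (hft.integrableOn_isCompact hcpt)
  have e1 : ∫ x in halfSpace d, u x * pd 0 (antiderivTest ψ) x = ∫ x, u x * ψ x := by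
    rw [← integral_indicator measurableSet_halfSpace]
    refine integral_congr_ae (Eventually.of_forall fun x => ?_)
    by_cases hx : x ∈ halfSpace d
    · simp only [indicator, hx, if_true]; rw [pd_antiderivTest hψs hψc hx]
    · have : ψ x = 0 := hψ0 x fun h => hx (hgs h)
      simp [hx, this]
  have e2 : ∫ x in halfSpace d, G x 0 * antiderivTest ψ x
      = -∫ x, primitive (fun x => G x 0) x * ψ x := by
    rw [← hE, ← integral_neg]
    refine setIntegral_congr_fun measurableSet_halfSpace fun x hx => ?_
    have hx' : 0 < x 0 := hx
    simp only
    rw [antiderivTest_eq (by linarith), mul_neg]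
  have e3 : ∫ y, f y * antiderivTest ψ (pt 0 y) = -∫ x, f (tang x) * ψ x := by
    rw [integral_space hIf, ← integral_neg]
    refine integral_congr_ae (Eventually.of_forall fun y => ?_)
    simp only [tang_pt]
    rw [antiderivTest_eq (by simp; norm_num), mul_neg, integral_const_mul]
    congr 2
    rw [tailIntegral, ← integral_indicator measurableSet_Ioi]
    refine integral_congr_ae (Eventually.of_forall fun t => ?_)
    simp only [pt_add_smul, zero_add]
    by_cases ht : 0 < t
    · simp [indicator, ht]
    · have : ψ (pt t y) = 0 := hψ0 _ fun h => ht (by simpa [halfSpace] using hgs h)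
      simp [indicator, ht, this]
  rw [e1, e2, if_pos rfl, e3] at key
  have e4 : ∫ x, g x • (u x - f (tang x) - primitive (fun x => G x 0) x)
      = ∫ x, (u x * ψ x - f (tang x) * ψ x - primitive (fun x => G x 0) x * ψ x) := by
    refine integral_congr_ae (Eventually.of_forall fun x => ?_)
    simp only [hψ, Complex.real_smul]; ring
  refine e4.trans ?_
  have hIuf : Integrable (fun x => u x * ψ x - f (tang x) * ψ x) := hIu.sub hIf
  rw [integral_sub hIuf hI, integral_sub hIu hIf, key]
  ring

lemma primitive_pt (G : Space d → ℂ) {t : ℝ} (ht : 0 ≤ t) (y : Bdry d) :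
    primitive G (pt t y) = ∫ s in (0 : ℝ)..t, G (pt s y) := by
  have h1 : primitive G (pt t y) = ∫ s : ℝ, (Ioo 0 t).indicator (fun s => G (pt s y)) (t - s) := by
    rw [primitive, ← integral_indicator measurableSet_Ioi]
    refine integral_congr_ae (Eventually.of_forall fun s => ?_)
    simp only [pt_sub_smul]
    by_cases hs : 0 < s <;> by_cases hts : s < t <;> simp [indicator, halfSpace, hs, hts]
  rw [h1, integral_sub_left_eq_self (fun s => (Ioo 0 t).indicator (fun s => G (pt s y)) s),
    integral_indicator measurableSet_Ioo, intervalIntegral.integral_of_le ht,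
    integral_Ioc_eq_integral_Ioo]

end SliceFormula

/-! ### Behaviour on vertical lines and square integrability of the solution. -/

section EnergySolution

variable {d : ℕ} {h : ℝ} {A : Space d → Matrix (Fin (d + 1)) (Fin (d + 1)) ℂ}
  {B : Space d → EuclideanSpace ℂ (Fin (d + 1))} {f : Bdry d → ℂ} {u : Space d → ℂ}
  {G : Space d → EuclideanSpace ℂ (Fin (d + 1))}

lemma memLp_coord {U : Set (Space d)} (hG : MemLp G 2 (volume.restrict U)) (i : Fin (d + 1)) :
    MemLp (fun x => G x i) 2 (volume.restrict U) :=
  (EuclideanSpace.proj (𝕜 := ℂ) i).comp_memLp' hG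

lemma ae_memLp_slice {F : Space d → ℂ} (hF : MemLp F 2 (volume.restrict (halfSpace d))) :
    ∀ᵐ y : Bdry d, MemLp (fun s => F (pt s y)) 2 (volume.restrict (Ioi 0)) := by
  have h1 : MemLp ((halfSpace d).indicator F) 2 volume :=
    (memLp_indicator_iff_restrict measurableSet_halfSpace).2 hF
  have h2 : ∀ᵐ y : Bdry d, ∀ᵐ t : ℝ, (halfSpace d).indicator F (pt t y)
      = h1.aestronglyMeasurable.mk _ (pt t y) := ae_ae_of_ae h1.aestronglyMeasurable.ae_eq_mk
  have h3 := integrable_slice ((memLp_two_iff_integrable_sq_norm h1.aestronglyMeasurable).1 h1)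
  filter_upwards [h2, h3] with y hy1 hy2
  have h4 : AEStronglyMeasurable (fun t : ℝ => (halfSpace d).indicator F (pt t y)) := by
    refine AEStronglyMeasurable.congr ?_ (EventuallyEq.symm hy1)
    exact (h1.aestronglyMeasurable.stronglyMeasurable_mk.comp_measurable
      (continuous_pt.comp (by fun_prop : Continuous fun t : ℝ => (t, y))).measurable
      ).aestronglyMeasurable
  have h5 : MemLp (fun t : ℝ => (halfSpace d).indicator F (pt t y)) 2 :=
    (memLp_two_iff_integrable_sq_norm h4).2 hy2
  have h6 : (fun t : ℝ => (halfSpace d).indicator F (pt t y))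
      = (Ioi (0 : ℝ)).indicator fun t => F (pt t y) := by
    funext t; by_cases ht : 0 < t <;> simp [indicator, halfSpace, ht]
  rw [h6] at h5
  exact (memLp_indicator_iff_restrict measurableSet_Ioi).1 h5

lemma intervalIntegrable_of_memLp {g : ℝ → ℂ} (hg : MemLp g 2 (volume.restrict (Ioi 0)))
    {a b : ℝ} (ha : 0 ≤ a) (hb : 0 ≤ b) : IntervalIntegrable g volume a b := by
  have key : ∀ a b : ℝ, 0 ≤ a → IntegrableOn g (Ioc a b) := fun a b ha => by
    have h1 : MemLp g 2 (volume.restrict (Ioc a b)) :=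
      hg.mono_measure (Measure.restrict_mono (fun x hx => lt_of_le_of_lt ha hx.1) le_rfl)
    exact h1.integrable (by norm_num)
  exact ⟨key a b ha, key b a hb⟩

/-- The solution is absolutely continuous on almost every vertical line, up to the boundary. -/
lemma IsEnergySolution.slice (hs : IsEnergySolution h A B f u G) (hh : 0 < h) :
    ∀ᵐ y : Bdry d, MemLp (fun s => G (pt s y) 0) 2 (volume.restrict (Ioi 0)) ∧
      ∀ t : ℝ, 0 ≤ t → u (pt t y) = f y + ∫ s in (0 : ℝ)..t, G (pt s y) 0 := by
  have h1 := ae_ae_of_ae (ae_eq_trace_add_primitive hs.weakGradTrace)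
  filter_upwards [h1, ae_memLp_slice (memLp_coord hs.gradient_L2 0), hs.eq_datum] with y hy hG hd
  refine ⟨hG, ?_⟩
  set P : ℝ → ℂ := fun t => f y + ∫ s in (0 : ℝ)..t, G (pt s y) 0 with hP
  have hPc : ContinuousOn P (Ici 0) := by
    refine continuousOn_const.add fun t ht => ?_
    have ht' : (0 : ℝ) ≤ t := ht
    have hI := intervalIntegrable_of_memLp hG le_rfl (by linarith : (0 : ℝ) ≤ t + 1)
    have := intervalIntegral.continuousOn_primitive_interval
      (((intervalIntegrable_iff_integrableOn_Icc_of_le (by linarith)).1 hI).mono_set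
        (uIcc_of_le (by linarith : (0 : ℝ) ≤ t + 1)).subset)
    refine (this t (by rw [uIcc_of_le (by linarith)]; exact ⟨ht', by linarith⟩)).mono_of_mem_nhdsWithin ?_
    rw [uIcc_of_le (by linarith : (0 : ℝ) ≤ t + 1)]
    filter_upwards [self_mem_nhdsWithin, mem_nhdsWithin_of_mem_nhds (Iio_mem_nhds (lt_add_one t))]
      with s hs1 hs2 using ⟨hs1, hs2.le⟩
  have hae : ∀ᵐ t : ℝ, 0 < t → u (pt t y) = P t := by
    filter_upwards [hy] with t ht h0
    have := ht (by simpa [halfSpace] using h0)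
    rw [primitive_pt _ h0.le, tang_pt] at this
    rw [hP]
    linear_combination this
  have hptc : Continuous fun t : ℝ => (pt t y : Space d) :=
    continuous_pt.comp (by fun_prop : Continuous fun t : ℝ => (t, y))
  intro t ht
  rcases eq_or_lt_of_le ht with rfl | ht0
  · rw [hd]; simp
  -- Almost everywhere equality becomes equality by continuity, separately on (0, h) and on [h, ∞).
  -- The second interval includes its endpoint, so the representation vanishes at height h: this is
  -- the zero trace on the top face.
  rcases lt_or_ge t h with hth | hth
  · have hu : ContinuousOn (fun t : ℝ => u (pt t y)) (Ioo 0 h) :=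
      hs.continuousOn.comp hptc.continuousOn fun t ht => by simpa [strip] using ht
    refine Measure.eqOn_open_of_ae_eq (μ := volume) ?_ isOpen_Ioo hu
      (hPc.mono fun s hs => hs.1.le) ⟨ht0, hth⟩
    refine (ae_restrict_iff' measurableSet_Ioo).2 ?_
    filter_upwards [hae] with s hs1 hs2 using hs1 hs2.1
  · have hu : ContinuousOn (fun t : ℝ => u (pt t y)) (Ici h) := by
      refine (continuousOn_const (c := (0 : ℂ))).congr fun s hs2 => ?_
      exact hs.eq_zero _ (by simpa using hs2)
    refine Measure.eqOn_of_ae_eq (μ := volume) (s := Ici h) ?_ hu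
      (hPc.mono fun s hs => hh.le.trans hs) (by simp) hth
    refine (ae_restrict_iff' measurableSet_Ici).2 ?_
    filter_upwards [hae] with s hs1 hs2 using hs1 (hh.trans_le hs2)

lemma enorm_integral_sq_le {g : ℝ → ℂ} {a b : ℝ} (hab : a ≤ b)
    (hg : AEStronglyMeasurable g (volume.restrict (Ioc a b))) :
    ‖∫ s in a..b, g s‖ₑ ^ 2 ≤ ENNReal.ofReal (b - a) * ∫⁻ s in Ioc a b, ‖g s‖ₑ ^ 2 := by
  rw [intervalIntegral.integral_of_le hab]
  have h1 := (enorm_integral_le_lintegral_enorm (μ := volume.restrict (Ioc a b)) g)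
  have h2 := eLpNorm_le_eLpNorm_mul_rpow_measure_univ (p := 1) (q := 2) (by norm_num) hg
  rw [eLpNorm_one_eq_lintegral_enorm] at h2
  have h3 := pow_le_pow_left' (h1.trans h2) 2
  refine h3.trans (le_of_eq ?_)
  rw [mul_pow, mul_comm]
  congr 1
  · rw [Measure.restrict_apply_univ, Real.volume_Ioc, ← ENNReal.rpow_natCast, ← ENNReal.rpow_mul]
    norm_num
  · rw [eLpNorm_eq_lintegral_rpow_enorm_toReal (by norm_num) (by norm_num), ← ENNReal.rpow_natCast,
      ← ENNReal.rpow_mul]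
    norm_num

/-- The energy of the transversal derivative on a vertical line. -/
def lineEnergy (G : Space d → EuclideanSpace ℂ (Fin (d + 1))) (y : Bdry d) : ℝ≥0∞ :=
  ∫⁻ s in Ioi (0 : ℝ), ‖G (pt s y) 0‖ₑ ^ 2

/-- Poincaré's inequality on a line: integrate down from height h, where u vanishes, and apply
Cauchy-Schwarz. -/
lemma IsEnergySolution.slice_bound (hs : IsEnergySolution h A B f u G) (hh : 0 < h) :
    ∀ᵐ y : Bdry d, ∀ t : ℝ, 0 ≤ t →
      ‖u (pt t y)‖ₑ ^ 2 ≤ ENNReal.ofReal h * lineEnergy G y := by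
  filter_upwards [hs.slice hh] with y ⟨hG, hy⟩ t ht
  rcases le_or_gt h t with hth | hth
  · rw [hs.eq_zero _ (by simpa using hth)]; simp
  have h1 : u (pt t y) = -∫ s in t..h, G (pt s y) 0 := by
    have e1 := hy h hh.le
    rw [hs.eq_zero _ (by simp)] at e1
    have e2 := intervalIntegral.integral_add_adjacent_intervals
      (intervalIntegrable_of_memLp hG le_rfl ht) (intervalIntegrable_of_memLp hG ht hh.le)
    rw [hy t ht]
    linear_combination (-1 : ℂ) * e1 + e2
  have hsub : Ioc t h ⊆ Ioi 0 := fun s hs => lt_of_le_of_lt ht hs.1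
  rw [h1, enorm_neg]
  refine (enorm_integral_sq_le hth.le
    (hG.aestronglyMeasurable.mono_measure (Measure.restrict_mono hsub le_rfl))).trans ?_
  refine mul_le_mul' (ENNReal.ofReal_le_ofReal (by linarith)) (lintegral_mono_set hsub)

lemma lintegral_halfSpace {F : Space d → ℝ≥0∞} (hF : AEMeasurable F (volume.restrict (halfSpace d))) :
    ∫⁻ x in halfSpace d, F x = ∫⁻ y : Bdry d, ∫⁻ t in Ioi (0 : ℝ), F (pt t y) := by
  rw [← lintegral_indicator measurableSet_halfSpace,
    lintegral_space ((aemeasurable_indicator_iff measurableSet_halfSpace).2 hF)]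
  refine lintegral_congr fun y => ?_
  rw [← lintegral_indicator measurableSet_Ioi]
  refine lintegral_congr fun t => ?_
  by_cases ht : 0 < t <;> simp [indicator, halfSpace, ht]

lemma IsEnergySolution.lintegral_lineEnergy (hs : IsEnergySolution h A B f u G) :
    ∫⁻ y, lineEnergy G y < ⊤ := by
  have h1 := memLp_coord hs.gradient_L2 0
  have h2 := lintegral_halfSpace ((h1.aestronglyMeasurable.enorm).pow_const 2)
  unfold lineEnergy
  rw [← h2]
  have h3 := lintegral_rpow_enorm_lt_top_of_eLpNorm_lt_top (by norm_num) (by norm_num) h1.2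
  simpa using h3

/-- The strip has finite height, so the bound on lines integrates. This qualitative fact makes all
products of the gradient with bounded multiples of u integrable over the whole half-space; the size
of the norm never enters the constants. -/
lemma IsEnergySolution.memLp_u (hs : IsEnergySolution h A B f u G) (hh : 0 < h) :
    MemLp u 2 (volume.restrict (halfSpace d)) := by
  have hm : AEStronglyMeasurable u (volume.restrict (halfSpace d)) :=
    hs.weakGradTrace.1.aestronglyMeasurable.mono_set fun x (hx : 0 < x 0) => hx.le
  refine ⟨hm, ?_⟩
  rw [eLpNorm_lt_top_iff_lintegral_rpow_enorm_lt_top (by norm_num) (by norm_num)]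
  simp only [ENNReal.toReal_ofNat, ENNReal.rpow_ofNat]
  rw [lintegral_halfSpace (hm.enorm.pow_const 2)]
  calc ∫⁻ y : Bdry d, ∫⁻ t in Ioi (0 : ℝ), ‖u (pt t y)‖ₑ ^ 2
      ≤ ∫⁻ y : Bdry d, ENNReal.ofReal h * (ENNReal.ofReal h * lineEnergy G y) := by
        refine lintegral_mono_ae ?_
        filter_upwards [hs.slice_bound hh] with y hy
        calc ∫⁻ t in Ioi (0 : ℝ), ‖u (pt t y)‖ₑ ^ 2
            ≤ ∫⁻ t in Ioi (0 : ℝ), (Ioc 0 h).indicator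
                (fun _ => ENNReal.ofReal h * lineEnergy G y) t := by
              refine setLIntegral_mono_ae' measurableSet_Ioi (Eventually.of_forall fun t ht => ?_)
              rcases le_or_gt t h with h1 | h1
              · rw [indicator_of_mem (show t ∈ Ioc 0 h from ⟨ht, h1⟩)]
                exact hy t (le_of_lt ht)
              · rw [hs.eq_zero _ (by simpa using h1.le)]; simp
          _ ≤ ∫⁻ t, (Ioc 0 h).indicator (fun _ => ENNReal.ofReal h * lineEnergy G y) t :=
              setLIntegral_le_lintegral _ _
          _ = _ := by
              rw [lintegral_indicator measurableSet_Ioc, setLIntegral_const, Real.volume_Ioc,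
                sub_zero, mul_comm]
    _ < ⊤ := by
        rw [lintegral_const_mul' _ _ (by simp), lintegral_const_mul' _ _ (by simp)]
        exact ENNReal.mul_lt_top (by simp) (ENNReal.mul_lt_top (by simp) hs.lintegral_lineEnergy)

lemma IsEnergySolution.memLp_level (hs : IsEnergySolution h A B f u G) (hh : 0 < h) {t : ℝ}
    (ht : 0 ≤ t) : MemLp (fun y => u (pt t y)) 2 volume := by
  have hm : AEStronglyMeasurable (fun y : Bdry d => u (pt t y)) volume := by
    rcases eq_or_lt_of_le ht with rfl | ht0
    · exact hs.weakGradTrace.2.2.1.aestronglyMeasurable.congr (EventuallyEq.symm hs.eq_datum)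
    rcases lt_or_ge t h with hth | hth
    · have : Continuous fun y : Bdry d => u (pt t y) :=
        hs.continuousOn.comp_continuous
          (continuous_pt.comp (by fun_prop : Continuous fun y : Bdry d => (t, y)))
          fun y => by simpa [strip] using ⟨ht0, hth⟩
      exact this.aestronglyMeasurable
    · have : (fun y : Bdry d => u (pt t y)) = fun _ => 0 :=
        funext fun y => hs.eq_zero _ (by simpa using hth)
      rw [this]; exact aestronglyMeasurable_const
  refine ⟨hm, ?_⟩
  rw [eLpNorm_lt_top_iff_lintegral_rpow_enorm_lt_top (by norm_num) (by norm_num)]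
  simp only [ENNReal.toReal_ofNat, ENNReal.rpow_ofNat]
  refine (lintegral_mono_ae ((hs.slice_bound hh).mono fun y hy => hy t ht)).trans_lt ?_
  rw [lintegral_const_mul' _ _ (by simp)]
  exact ENNReal.mul_lt_top (by simp) hs.lintegral_lineEnergy

end EnergySolution

/-! ### Approximation of the solution by smooth functions vanishing near the top -/

section Approximation

variable {d : ℕ}

/-- Continuity of translations in L², read off from the continuity of composition with
measure-preserving maps. -/
lemma tendsto_eLpNorm_translation {F : Space d → ℂ} (hF : MemLp F 2) :
    Tendsto (fun w : Space d => eLpNorm (fun x => F (x + w) - F x) 2) (𝓝 0) (𝓝 0) := by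
  have hmp : ∀ w : Space d, MeasurePreserving (fun x : Space d => x + w) volume volume :=
    fun w => measurePreserving_add_right volume w
  set g : Space d → C(Space d, Space d) := fun w => ⟨fun x => x + w, by fun_prop⟩ with hg
  have hgc : Continuous g :=
    (ContinuousMap.curry ⟨fun q : Space d × Space d => q.2 + q.1, by fun_prop⟩).continuous
  have hcont : Continuous fun w => Lp.compMeasurePreserving (g w) (hmp w) (hF.toLp F) :=
    Continuous.compMeasurePreservingLp (f := fun _ => hF.toLp F) (g := g) continuous_const hgc hmp
      (by norm_num)
  have h1 := hcont.tendsto 0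
  rw [tendsto_iff_edist_tendsto_0] at h1
  refine h1.congr fun w => ?_
  rw [Lp.edist_def]
  refine eLpNorm_congr_ae ?_
  have e1 : ∀ w, (Lp.compMeasurePreserving (g w) (hmp w) (hF.toLp F) : Space d → ℂ)
      =ᵐ[volume] fun x => F (x + w) := by
    intro w
    refine (Lp.coeFn_compMeasurePreserving _ (hmp w)).trans ?_
    exact (hmp w).quasiMeasurePreserving.ae_eq_comp hF.coeFn_toLp
  filter_upwards [e1 w, e1 0] with x hx1 hx2
  simp only [Pi.sub_apply]
  rw [hx1, hx2, add_zero]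

lemma moll_congr_ae {δ : ℝ} (hδ : 0 < δ) {F F' : Space d → ℂ} (h : F =ᵐ[volume] F')
    (x : Space d) : moll δ hδ F x = moll δ hδ F' x := by
  refine integral_congr_ae ?_
  filter_upwards [(quasiMeasurePreserving_sub_left_of_right_invariant volume x).ae_eq_comp h]
    with z hz
  rw [show F (x - z) = F' (x - z) from hz]

/-- Jensen's inequality for the probability measure whose density is the normalized bump. -/
lemma enorm_moll_sub_sq_le {δ : ℝ} (hδ : 0 < δ) {F : Space d → ℂ} (hF : StronglyMeasurable F)
    (hFi : LocallyIntegrable F) (x c : Space d) : ‖moll δ hδ F (x + c) - F x‖ₑ ^ 2 ≤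
      ∫⁻ z, ENNReal.ofReal ((bump d δ hδ).normed volume z) * ‖F (x + (c - z)) - F x‖ₑ ^ 2 := by
  set ρ := (bump d δ hδ).normed volume with hρ
  have hρc : Continuous ρ := (bump d δ hδ).continuous_normed
  have hnn : ∀ z, 0 ≤ ρ z := (bump d δ hδ).nonneg_normed
  set ν : Measure (Space d) := volume.withDensity fun z => ENNReal.ofReal (ρ z) with hν
  have hνp : IsProbabilityMeasure ν := ⟨by
    rw [hν, withDensity_apply _ MeasurableSet.univ, Measure.restrict_univ,
      ← ofReal_integral_eq_lintegral_ofReal (bump d δ hδ).integrable_normed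
        (Eventually.of_forall hnn), ContDiffBump.integral_normed, ENNReal.ofReal_one]⟩
  have hlin : ∀ k : Space d → ℝ≥0∞, Measurable k →
      ∫⁻ z, k z ∂ν = ∫⁻ z, ENNReal.ofReal (ρ z) * k z := fun k hk => by
    rw [hν, lintegral_withDensity_eq_lintegral_mul _ (by fun_prop) hk]; rfl
  have hgm : StronglyMeasurable fun z => F (x + (c - z)) - F x :=
    (hF.comp_measurable (by fun_prop)).sub stronglyMeasurable_const
  have hint : Integrable fun z => ρ z • F (x + c - z) := by
    have := (bump d δ hδ).hasCompactSupport_normed.convolutionExists_left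
      (ContinuousLinearMap.lsmul ℝ ℝ) (μ := volume) hρc hFi (x + c)
    exact this
  have h1 : moll δ hδ F (x + c) - F x = ∫ z, ρ z • (F (x + (c - z)) - F x) := by
    have h2 : F x = ∫ z, ρ z • F x := by
      rw [integral_smul_const, ContDiffBump.integral_normed, one_smul]
    conv_lhs => rw [h2]
    unfold moll
    rw [← integral_sub hint ((bump d δ hδ).integrable_normed.smul_const _)]
    refine integral_congr_ae (Eventually.of_forall fun z => ?_)
    simp only [smul_sub, add_sub_assoc, hρ]
  have h3 : ‖moll δ hδ F (x + c) - F x‖ₑ ≤ eLpNorm (fun z => F (x + (c - z)) - F x) 1 ν := by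
    rw [h1, eLpNorm_one_eq_lintegral_enorm, hlin _ hgm.enorm]
    refine (enorm_integral_le_lintegral_enorm _).trans (le_of_eq ?_)
    refine lintegral_congr fun z => ?_
    rw [enorm_smul, Real.enorm_of_nonneg (hnn z)]
  have h4 := h3.trans (eLpNorm_le_eLpNorm_of_exponent_le (by norm_num : (1 : ℝ≥0∞) ≤ 2)
    hgm.aestronglyMeasurable)
  refine (pow_le_pow_left' h4 2).trans (le_of_eq ?_)
  rw [← hlin _ (hgm.enorm.pow_const 2), eLpNorm_eq_lintegral_rpow_enorm_toReal (by norm_num)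
    (by norm_num), ← ENNReal.rpow_natCast, ← ENNReal.rpow_mul]
  norm_num

/-- The mollification after a vertical shift, which only uses values above the given point. -/
def shiftMoll (δ : ℝ) (hδ : 0 < δ) (F : Space d → ℂ) (x : Space d) : ℂ :=
  moll δ hδ ((halfSpace d).indicator F) (x + (2 * δ) • e0 d)

/-- The shifted mollification is an average of translates by 2δ e₀ - z with |z| < δ, all of length
less than 3δ. -/
lemma eLpNorm_moll_sub_le {F : Space d → ℂ} (hF : MemLp F 2) {ε : ℝ≥0∞} {r δ : ℝ} (hδ : 0 < δ)
    (hr : ∀ w : Space d, ‖w‖ < r → eLpNorm (fun x => F (x + w) - F x) 2 ≤ ε) (h3 : 3 * δ < r) :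
    eLpNorm (fun x => moll δ hδ F (x + (2 * δ) • e0 d) - F x) 2 ≤ ε := by
  -- The exchange of integrals needs joint measurability of F(x + w), hence a strongly measurable
  -- representative.
  wlog hFm : StronglyMeasurable F generalizing F
  · have hae := hF.aestronglyMeasurable.ae_eq_mk
    have hmk := (memLp_congr_ae hae).1 hF
    have := this hmk (fun w hw => ?_) hF.aestronglyMeasurable.stronglyMeasurable_mk
    · refine le_trans (le_of_eq (eLpNorm_congr_ae ?_)) this
      filter_upwards [hae] with x hx
      rw [moll_congr_ae hδ hae, hx]
    · refine le_trans (le_of_eq (eLpNorm_congr_ae ?_)) (hr w hw)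
      filter_upwards [hae, (measurePreserving_add_right volume w).quasiMeasurePreserving.ae_eq_comp
        hae] with x hx hx2
      have hx2' : F (x + w) = hF.aestronglyMeasurable.mk F (x + w) := hx2
      rw [hx, hx2']
  have hloc : LocallyIntegrable F := hF.locallyIntegrable (by norm_num)
  set ρ := (bump d δ hδ).normed volume with hρ
  have hρc : Continuous ρ := (bump d δ hδ).continuous_normed
  have hsq : ∀ k : Space d → ℂ, eLpNorm k 2 volume ^ 2 = ∫⁻ x, ‖k x‖ₑ ^ 2 := fun k => by
    rw [eLpNorm_eq_lintegral_rpow_enorm_toReal (by norm_num) (by norm_num),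
      ← ENNReal.rpow_natCast, ← ENNReal.rpow_mul]
    norm_num
  rw [← ENNReal.pow_le_pow_left_iff (n := 2) (by norm_num), hsq]
  have hρ1 : ∫⁻ z, ENNReal.ofReal (ρ z) = 1 := by
    rw [← ofReal_integral_eq_lintegral_ofReal (bump d δ hδ).integrable_normed
        (Eventually.of_forall (bump d δ hδ).nonneg_normed), ContDiffBump.integral_normed,
        ENNReal.ofReal_one]
  calc ∫⁻ x, ‖moll δ hδ F (x + (2 * δ) • e0 d) - F x‖ₑ ^ 2
      ≤ ∫⁻ x, ∫⁻ z, ENNReal.ofReal (ρ z) * ‖F (x + ((2 * δ) • e0 d - z)) - F x‖ₑ ^ 2 :=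
        lintegral_mono fun x => enorm_moll_sub_sq_le hδ hFm hloc x _
    _ = ∫⁻ z, ∫⁻ x, ENNReal.ofReal (ρ z) * ‖F (x + ((2 * δ) • e0 d - z)) - F x‖ₑ ^ 2 := by
        refine lintegral_lintegral_swap (Measurable.aemeasurable ?_)
        refine Measurable.mul (by fun_prop) (Measurable.pow_const (Measurable.enorm ?_) 2)
        exact (hFm.measurable.comp (by fun_prop)).sub (hFm.measurable.comp (by fun_prop))
    _ ≤ ∫⁻ z, ENNReal.ofReal (ρ z) * ε ^ 2 := by
        refine lintegral_mono fun z => ?_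
        rw [lintegral_const_mul' _ _ (by simp)]
        rcases lt_or_ge ‖z‖ δ with hz | hz
        · gcongr
          rw [← hsq]
          refine pow_le_pow_left' (hr _ ?_) 2
          refine (norm_sub_le _ _).trans_lt ?_
          rw [norm_smul, e0, norm_single_one, Real.norm_of_nonneg (by positivity)]
          linarith
        · simp [hρ, bump_normed_eq_zero hδ hz]
    _ = ε ^ 2 := by rw [lintegral_mul_const _ (by fun_prop), hρ1, one_mul]

lemma tendsto_shiftMoll {F : Space d → ℂ} (hF : MemLp F 2 (volume.restrict (halfSpace d)))
    {δ : ℕ → ℝ} (hδ : ∀ n, 0 < δ n) (h0 : Tendsto δ atTop (𝓝 0)) :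
    Tendsto (fun n => eLpNorm (fun x => shiftMoll (δ n) (hδ n) F x - (halfSpace d).indicator F x) 2)
      atTop (𝓝 0) := by
  have hF' : MemLp ((halfSpace d).indicator F) 2 volume :=
    (memLp_indicator_iff_restrict measurableSet_halfSpace).2 hF
  rw [ENNReal.tendsto_nhds_zero]
  intro ε hε
  have h1 := (ENNReal.tendsto_nhds_zero.1 (tendsto_eLpNorm_translation hF')) ε hε
  obtain ⟨r, hr, hr'⟩ := Metric.eventually_nhds_iff.1 h1
  have h2 : ∀ᶠ n in atTop, δ n < r / 3 := h0.eventually (Iio_mem_nhds (by positivity))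
  filter_upwards [h2] with n hn
  exact eLpNorm_moll_sub_le hF' (hδ n) (fun w hw => hr' (by simpa using hw)) (by linarith)

lemma locallyIntegrable_indicator {F : Space d → ℂ}
    (hF : MemLp F 2 (volume.restrict (halfSpace d))) :
    LocallyIntegrable ((halfSpace d).indicator F) :=
  ((memLp_indicator_iff_restrict measurableSet_halfSpace).2 hF).locallyIntegrable (by norm_num)

lemma shiftMoll_contDiff {F : Space d → ℂ} (hF : MemLp F 2 (volume.restrict (halfSpace d)))
    {δ : ℝ} (hδ : 0 < δ) : ContDiff ℝ ∞ (shiftMoll δ hδ F) :=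
  (moll_contDiff δ hδ (locallyIntegrable_indicator hF)).comp (contDiff_id.add contDiff_const)

/-- The shift 2δ exceeds the mollification radius δ by δ, so only values above height h are used.
Thanks to this margin the test functions built from the approximations have support inside the open
strip. -/
lemma shiftMoll_eq_zero {F : Space d → ℂ} {h : ℝ} (hF : ∀ x : Space d, h ≤ x 0 → F x = 0)
    {δ : ℝ} (hδ : 0 < δ) {x : Space d} (hx : h - δ ≤ x 0) : shiftMoll δ hδ F x = 0 := by
  refine moll_eq_zero hδ fun y hy => ?_
  have h1 := (abs_coord_sub_le y (x + (2 * δ) • e0 d) 0).trans_lt hy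
  have h2 : (x + (2 * δ) • e0 d) 0 = x 0 + 2 * δ := by simp
  rw [h2, abs_lt] at h1
  have : F y = 0 := hF y (by linarith)
  simp [indicator, this]

lemma pd_moll_eq {δ : ℝ} (hδ : 0 < δ) {F : Space d → ℂ} (hF : LocallyIntegrable F)
    (i : Fin (d + 1)) (x : Space d) : pd i (moll δ hδ F) x =
      ∫ z, fderiv ℝ ((bump d δ hδ).normed volume) (x - z) (EuclideanSpace.single i 1) • F z := by
  set ρ := (bump d δ hδ).normed volume with hρ
  have hρs : ContDiff ℝ ∞ ρ := (bump d δ hδ).contDiff_normed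
  have hρ1 : ContDiff ℝ 1 ρ := hρs.of_le (by exact_mod_cast le_top)
  have hρc : HasCompactSupport ρ := (bump d δ hδ).hasCompactSupport_normed
  rw [moll_eq_convolution, ← convolution_flip, pd,
    (hρc.hasFDerivAt_convolution_right _ hF hρ1 x).fderiv,
    convolution_precompR_apply _ hF (hρc.fderiv ℝ) (hρ1.continuous_fderiv one_ne_zero)]
  rfl

/-- The kernel is centred at height x₀ + 2δ with radius δ, so it vanishes on the boundary and
Green's formula has no boundary term. -/
lemma pd_shiftMoll {u : Space d → ℂ} {G : Space d → EuclideanSpace ℂ (Fin (d + 1))}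
    {f : Bdry d → ℂ} (h : HasWeakGradTrace u G f)
    (hu : MemLp u 2 (volume.restrict (halfSpace d))) {δ : ℝ}
    (hδ : 0 < δ) (i : Fin (d + 1)) {x : Space d} (hx : x ∈ halfSpace d) :
    pd i (shiftMoll δ hδ u) x = shiftMoll δ hδ (fun x => G x i) x := by
  set ρ := (bump d δ hδ).normed volume with hρ
  set X : Space d := x + (2 * δ) • e0 d with hX
  have hρs : ContDiff ℝ ∞ ρ := (bump d δ hδ).contDiff_normed
  have h1 : pd i (shiftMoll δ hδ u) x = pd i (moll δ hδ ((halfSpace d).indicator u)) X := by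
    unfold pd shiftMoll
    rw [fderiv_comp_add_right (f := moll δ hδ ((halfSpace d).indicator u))]
  set φ : Space d → ℂ := fun z => ((ρ (X - z) : ℝ) : ℂ) with hφ
  have hφs : ContDiff ℝ ∞ φ :=
    Complex.ofRealCLM.contDiff.comp (hρs.comp (contDiff_const.sub contDiff_id))
  have hφc : HasCompactSupport φ := by
    have h2 : HasCompactSupport (fun z => ρ (X - z)) :=
      (bump d δ hδ).hasCompactSupport_normed.comp_homeomorph (Homeomorph.subLeft X)
    exact h2.comp_left (g := fun t : ℝ => (t : ℂ)) (by simp)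
  have hpd : ∀ z, pd i φ z = -((fderiv ℝ ρ (X - z) (EuclideanSpace.single i 1) : ℝ) : ℂ) := by
    intro z
    have hd : HasFDerivAt ρ (fderiv ℝ ρ (X - z)) (X - z) :=
      (hρs.differentiable (by simp) _).hasFDerivAt
    have h3 : HasFDerivAt (fun z => X - z) (-ContinuousLinearMap.id ℝ (Space d)) z :=
      (hasFDerivAt_id z).const_sub X
    have h4 := Complex.ofRealCLM.hasFDerivAt.comp z (hd.comp z h3)
    have h5 : HasFDerivAt φ _ z := h4
    rw [pd, h5.fderiv]
    simp
  have key := h.2.2.2 φ hφs hφc i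
  have hbd : ∀ y : Bdry d, φ (pt 0 y) = 0 := by
    intro y
    have h6 : δ ≤ ‖X - pt 0 y‖ := by
      have h7 := abs_coord_le (X - pt 0 y) 0
      have h8 : (X - pt 0 y) 0 = x 0 + 2 * δ := by simp [hX]
      have hx' : 0 < x 0 := hx
      rw [h8, abs_of_pos (by linarith)] at h7
      linarith
    simp [hφ, hρ, bump_normed_eq_zero hδ h6]
  simp only [hbd, mul_zero, integral_zero, ite_self, sub_zero] at key
  rw [h1, pd_moll_eq hδ (locallyIntegrable_indicator hu)]
  have e1 : ∫ z, fderiv ℝ ρ (X - z) (EuclideanSpace.single i 1) • (halfSpace d).indicator u z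
      = -∫ z in halfSpace d, u z * pd i φ z := by
    rw [← integral_indicator measurableSet_halfSpace, ← integral_neg]
    refine integral_congr_ae (Eventually.of_forall fun z => ?_)
    by_cases hz : z ∈ halfSpace d
    · simp only [indicator, hz, if_true, hpd, Complex.real_smul]; ring
    · simp [indicator, hz]
  have e2 : shiftMoll δ hδ (fun x => G x i) x = ∫ z in halfSpace d, G z i * φ z := by
    unfold shiftMoll moll
    rw [← integral_sub_left_eq_self _ volume X, ← integral_indicator measurableSet_halfSpace]
    refine integral_congr_ae (Eventually.of_forall fun z => ?_)
    simp only [hX, sub_sub_cancel]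
    by_cases hz : z ∈ halfSpace d
    · simp [indicator, hz, hφ, hX, hρ, mul_comm]
    · simp [indicator, hz]
  rw [e1, key, neg_neg, e2]

end Approximation

/-! ### Testing with nonlinear functions of the solution. -/

section NonlinearTest

variable {d : ℕ} {p : ℝ}

namespace Profile

variable (P : Profile p)

lemma continuous_DTh_apply : Continuous fun q : ℂ × ℂ => P.DTh q.1 q.2 :=
  (P.continuous_DTh.comp continuous_fst).clm_apply continuous_snd

lemma aestronglyMeasurable_DTh {α : Type*} [MeasurableSpace α] {μ : Measure α} {a b : α → ℂ}
    (ha : AEStronglyMeasurable a μ) (hb : AEStronglyMeasurable b μ) :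
    AEStronglyMeasurable (fun x => P.DTh (a x) (b x)) μ :=
  Continuous.comp_aestronglyMeasurable (g := fun q : ℂ × ℂ => P.DTh q.1 q.2)
    (f := fun x => (a x, b x)) P.continuous_DTh_apply (ha.prodMk hb)

lemma lipschitz_Th : LipschitzWith (Real.toNNReal ((1 + |p - 2|) * P.K)) P.Th := by
  refine lipschitzWith_of_nnnorm_fderiv_le (𝕜 := ℝ)
    (fun z => (P.hasFDerivAt_Th z).differentiableAt) fun z => ?_
  rw [(P.hasFDerivAt_Th z).fderiv]
  exact NNReal.coe_le_coe.1 ((P.norm_DTh_le z).trans (Real.le_coe_toNNReal _))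

end Profile

lemma tendsto_integral_mul_zero {α : Type*} [MeasurableSpace α] {μ : Measure α}
    {m : α → ℂ} (hm : MemLp m 2 μ) {W w : ℕ → α → ℂ} {C : ℝ}
    (hW : ∀ n, AEStronglyMeasurable (W n) μ) (hle : ∀ n x, ‖W n x‖ ≤ C * ‖w n x‖)
    (hw : Tendsto (fun n => eLpNorm (w n) 2 μ) atTop (𝓝 0)) :
    Tendsto (fun n => ∫ x, m x * W n x ∂μ) atTop (𝓝 0) := by
  rw [tendsto_zero_iff_norm_tendsto_zero]
  have h1 : ∀ n, ‖∫ x, m x * W n x ∂μ‖ₑ ≤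
      eLpNorm m 2 μ * (ENNReal.ofReal C * eLpNorm (w n) 2 μ) := fun n => by
    refine (enorm_integral_le_lintegral_enorm _).trans ?_
    rw [← eLpNorm_one_eq_lintegral_enorm]
    refine (eLpNorm_smul_le_mul_eLpNorm (p := 2) (q := 2) (r := 1) (hW n)
      hm.aestronglyMeasurable).trans ?_
    gcongr
    exact eLpNorm_le_mul_eLpNorm_of_ae_le_mul (Eventually.of_forall (hle n)) 2
  have h2 : Tendsto (fun n => eLpNorm m 2 μ * (ENNReal.ofReal C * eLpNorm (w n) 2 μ)) atTop
      (𝓝 0) := by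
    have h3 := ENNReal.Tendsto.const_mul (a := ENNReal.ofReal C) hw (Or.inr (by simp))
    have h4 := ENNReal.Tendsto.const_mul (a := eLpNorm m 2 μ) h3 (Or.inr hm.eLpNorm_ne_top)
    simpa using h4
  have h5 := tendsto_of_tendsto_of_tendsto_of_le_of_le tendsto_const_nhds h2 (fun n => zero_le) h1
  have h6 := (ENNReal.tendsto_toReal (by simp)).comp h5
  exact h6.congr fun n => toReal_enorm _

lemma tendsto_integral_Th (P : Profile p) {m U : Space d → ℂ} (hm : MemLp m 2) (hU : MemLp U 2)
    {u : ℕ → Space d → ℂ} (hu : ∀ n, AEStronglyMeasurable (u n) volume)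
    (hlim : Tendsto (fun n => eLpNorm (fun x => u n x - U x) 2) atTop (𝓝 0))
    (hint : ∀ n, Integrable fun x => m x * P.Th (u n x)) :
    Tendsto (fun n => ∫ x, m x * P.Th (u n x)) atTop (𝓝 (∫ x, m x * P.Th (U x))) := by
  have hTU : MemLp (fun x => P.Th (U x)) 2 := by
    refine hU.of_le_mul (c := P.K) (P.continuous_Th.comp_aestronglyMeasurable
      hU.aestronglyMeasurable) (Eventually.of_forall fun x => ?_)
    rw [P.norm_Th]
    gcongr
    exact P.om_le _
  have h0 := tendsto_integral_mul_zero hm (W := fun n x => P.Th (u n x) - P.Th (U x))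
    (w := fun n x => u n x - U x) (C := Real.toNNReal ((1 + |p - 2|) * P.K))
    (fun n => (P.continuous_Th.comp_aestronglyMeasurable (hu n)).sub hTU.aestronglyMeasurable)
    (fun n x => P.lipschitz_Th.norm_sub_le _ _) hlim
  have h1 : Integrable fun x => m x * P.Th (U x) := hm.integrable_mul hTU
  rw [← tendsto_sub_nhds_zero_iff]
  refine h0.congr fun n => ?_
  rw [← integral_sub (hint n) h1]
  simp [mul_sub]

/-- Split DTh(uₙ)(vₙ) into DTh(uₙ)(vₙ - V), which is small in L² because `DTh` is bounded, and
DTh(uₙ)(V), which is handled by dominated convergence. `DTh` is merely continuous, so the second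
part needs uₙ → U almost everywhere. -/
lemma tendsto_integral_DTh (P : Profile p) {k U V : Space d → ℂ} (hk : MemLp k 2)
    (hV : MemLp V 2) {u v : ℕ → Space d → ℂ} (hu : ∀ n, AEStronglyMeasurable (u n) volume)
    (hv : ∀ n, AEStronglyMeasurable (v n) volume)
    (hae : ∀ᵐ x, Tendsto (fun n => u n x) atTop (𝓝 (U x)))
    (hlim : Tendsto (fun n => eLpNorm (fun x => v n x - V x) 2) atTop (𝓝 0))
    (hint : ∀ n, Integrable fun x => k x * P.DTh (u n x) (v n x)) :
    Tendsto (fun n => ∫ x, k x * P.DTh (u n x) (v n x)) atTop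
      (𝓝 (∫ x, k x * P.DTh (U x) (V x))) := by
  have hbd : ∀ z ξ, ‖P.DTh z ξ‖ ≤ (1 + |p - 2|) * P.K * ‖ξ‖ := fun z ξ =>
    (P.DTh z).le_of_opNorm_le (P.norm_DTh_le z) ξ
  have h0 := tendsto_integral_mul_zero hk (W := fun n x => P.DTh (u n x) (v n x - V x))
    (w := fun n x => v n x - V x) (C := (1 + |p - 2|) * P.K)
    (fun n => P.aestronglyMeasurable_DTh (hu n) ((hv n).sub hV.aestronglyMeasurable)) (fun n x => hbd _ _) hlim
  have hbint : Integrable fun x => k x * V x := hk.integrable_mul hV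
  have hdom : ∀ z x, ‖k x * P.DTh z (V x)‖ ≤ (1 + |p - 2|) * P.K * ‖k x * V x‖ := fun z x => by
    rw [norm_mul, norm_mul, mul_left_comm]
    gcongr
    exact hbd _ _
  have h1 : Tendsto (fun n => ∫ x, k x * P.DTh (u n x) (V x)) atTop
      (𝓝 (∫ x, k x * P.DTh (U x) (V x))) := by
    refine tendsto_integral_of_dominated_convergence
      (fun x => (1 + |p - 2|) * P.K * ‖k x * V x‖)
      (fun n => hk.aestronglyMeasurable.mul (P.aestronglyMeasurable_DTh (hu n) hV.aestronglyMeasurable))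
      (hbint.norm.const_mul _) (fun n => Eventually.of_forall fun x => hdom _ x) ?_
    filter_upwards [hae] with x hx
    exact ((P.continuous_DTh_apply.tendsto (U x, V x)).comp
      (hx.prodMk_nhds tendsto_const_nhds)).const_mul _
  have h2 := h0.add h1
  rw [zero_add] at h2
  refine h2.congr fun n => ?_
  have h3 : Integrable fun x => k x * P.DTh (u n x) (V x) :=
    (hbint.norm.const_mul ((1 + |p - 2|) * P.K)).mono'
      (hk.aestronglyMeasurable.mul (P.aestronglyMeasurable_DTh (hu n) hV.aestronglyMeasurable))
      (Eventually.of_forall fun x => hdom _ x)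
  have h4 : Integrable fun x => k x * P.DTh (u n x) (v n x - V x) := by
    refine ((hint n).sub h3).congr (Eventually.of_forall fun x => ?_)
    simp [mul_sub]
  rw [← integral_add h4 h3]
  simp [mul_sub]

lemma pd_eq_zero_of_notMem {ζ : Space d → ℂ} {x : Space d} (hx : x ∉ tsupport ζ)
    (i : Fin (d + 1)) : pd i ζ x = 0 := by
  have h1 : fderiv ℝ ζ x = 0 := by
    by_contra h
    exact hx (tsupport_fderiv_subset ℝ (subset_tsupport _ h))
  rw [pd, h1]; rfl

/-- `H` times a bounded function supported in a compact subset of the half-space, where `H` is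
locally square integrable. -/
lemma memLp_mul_of_support {H ζ : Space d → ℂ} {S : Set (Space d)} (hS : MeasurableSet S)
    (hH : MemLp H 2 (volume.restrict S)) (hζ : AEStronglyMeasurable ζ volume) {M : ℝ}
    (hM : ∀ x, ‖ζ x‖ ≤ M) (h0 : ∀ x, x ∉ S → ζ x = 0) : MemLp (fun x => H x * ζ x) 2 := by
  have h1 : MemLp (S.indicator H) 2 := (memLp_indicator_iff_restrict hS).2 hH
  have h2 : (fun x => H x * ζ x) = fun x => S.indicator H x * ζ x := by
    funext x
    by_cases hx : x ∈ S <;> simp [hx, h0]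
  rw [h2]
  refine h1.of_le_mul (c := M) (h1.aestronglyMeasurable.mul hζ) (Eventually.of_forall fun x => ?_)
  rw [norm_mul, mul_comm]
  gcongr
  exact hM x

-- The product Th(u) ζ need be neither Lipschitz nor supported below the top of the strip, so Th(uₙ)
-- ζ is used with shifted mollifications uₙ, and then n → ∞. The field H and the right side b are
-- left general so that the result serves both the equation and the curl identities.
set_option maxHeartbeats 1600000 in
lemma IsEnergySolution.nonlinear_test {h : ℝ} (hh : 0 < h)
    {A : Space d → Matrix (Fin (d + 1)) (Fin (d + 1)) ℂ}
    {B : Space d → EuclideanSpace ℂ (Fin (d + 1))} {f : Bdry d → ℂ} {u : Space d → ℂ}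
    {G : Space d → EuclideanSpace ℂ (Fin (d + 1))} (hs : IsEnergySolution h A B f u G)
    (P : Profile p) {H : Fin (d + 1) → Space d → ℂ} {b : Space d → ℂ}
    (hH : ∀ i, ∀ S : Set (Space d), IsCompact S → S ⊆ halfSpace d →
      MemLp (H i) 2 (volume.restrict S))
    (hb : ∀ S : Set (Space d), IsCompact S → S ⊆ halfSpace d → MemLp b 2 (volume.restrict S))
    (htest : ∀ φ : Space d → ℂ, (∃ K, LipschitzWith K φ) → HasCompactSupport φ →
      tsupport φ ⊆ strip d h → ∫ x, ∑ i, H i x * pd i φ x = ∫ x, b x * φ x)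
    {ζ : Space d → ℂ} {K : ℝ≥0} (hζ : LipschitzWith K ζ) (hc : HasCompactSupport ζ)
    (hsub : tsupport ζ ⊆ halfSpace d) :
    ∫ x, ∑ i, H i x * (P.DTh (u x) (G x i) * ζ x + P.Th (u x) * pd i ζ x) =
      ∫ x, b x * (P.Th (u x) * ζ x) := by
  set S := tsupport ζ with hS
  have hSm : MeasurableSet S := (isClosed_tsupport ζ).measurableSet
  have hu2 := hs.memLp_u hh
  have hG2 : ∀ i, MemLp (fun x => G x i) 2 (volume.restrict (halfSpace d)) :=
    memLp_coord hs.gradient_L2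
  set U := (halfSpace d).indicator u with hUdef
  set W : Fin (d + 1) → Space d → ℂ := fun i => (halfSpace d).indicator (fun x => G x i) with hW
  have hU : MemLp U 2 := (memLp_indicator_iff_restrict measurableSet_halfSpace).2 hu2
  have hWL : ∀ i, MemLp (W i) 2 := fun i =>
    (memLp_indicator_iff_restrict measurableSet_halfSpace).2 (hG2 i)
  obtain ⟨M, hM⟩ := hc.exists_bound_of_continuous hζ.continuous
  have hζ0 : ∀ x, x ∉ S → ζ x = 0 := fun x hx => image_eq_zero_of_notMem_tsupport hx
  have hk : ∀ i, MemLp (fun x => H i x * ζ x) 2 := fun i =>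
    memLp_mul_of_support hSm (hH i S hc.isCompact hsub) hζ.continuous.aestronglyMeasurable hM hζ0
  have hl : ∀ i, MemLp (fun x => H i x * pd i ζ x) 2 := fun i =>
    memLp_mul_of_support hSm (hH i S hc.isCompact hsub) (measurable_pd i ζ).aestronglyMeasurable
      (norm_pd_le_of_lipschitz hζ i) (fun x hx => pd_eq_zero_of_notMem hx i)
  have hm : MemLp (fun x => b x * ζ x) 2 :=
    memLp_mul_of_support hSm (hb S hc.isCompact hsub) hζ.continuous.aestronglyMeasurable hM hζ0
  -- the approximating sequence
  obtain ⟨δ, hδ, hδ0, hae⟩ : ∃ δ : ℕ → ℝ, ∃ hδ : ∀ n, 0 < δ n, Tendsto δ atTop (𝓝 0) ∧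
      ∀ᵐ x, Tendsto (fun n => shiftMoll (δ n) (hδ n) u x) atTop (𝓝 (U x)) := by
    have hpos : ∀ n : ℕ, (0 : ℝ) < 1 / ((n : ℝ) + 1) := fun n => by positivity
    have h1 := tendsto_shiftMoll hu2 hpos tendsto_one_div_add_atTop_nhds_zero_nat
    -- Convergence in L² yields an almost everywhere convergent subsequence, as required by
    -- `tendsto_integral_DTh`.
    obtain ⟨ns, hns, h2⟩ := (tendstoInMeasure_of_tendsto_eLpNorm (by norm_num : (2 : ℝ≥0∞) ≠ 0)
      (fun n => (shiftMoll_contDiff hu2 (hpos n)).continuous.aestronglyMeasurable)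
      hU.aestronglyMeasurable h1).exists_seq_tendsto_ae
    exact ⟨fun n => 1 / ((ns n : ℝ) + 1), fun n => hpos _,
      tendsto_one_div_add_atTop_nhds_zero_nat.comp hns.tendsto_atTop, h2⟩
  set us : ℕ → Space d → ℂ := fun n => shiftMoll (δ n) (hδ n) u with hus
  set vs : Fin (d + 1) → ℕ → Space d → ℂ := fun i n =>
    shiftMoll (δ n) (hδ n) (fun x => G x i) with hvs
  have husC : ∀ n, ContDiff ℝ ∞ (us n) := fun n => shiftMoll_contDiff hu2 (hδ n)
  have hvsC : ∀ i n, ContDiff ℝ ∞ (vs i n) := fun i n => shiftMoll_contDiff (hG2 i) (hδ n)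
  have hulim : Tendsto (fun n => eLpNorm (fun x => us n x - U x) 2) atTop (𝓝 0) :=
    tendsto_shiftMoll hu2 hδ hδ0
  have hvlim : ∀ i, Tendsto (fun n => eLpNorm (fun x => vs i n x - W i x) 2) atTop (𝓝 0) :=
    fun i => tendsto_shiftMoll (hG2 i) hδ hδ0
  -- on compact sets the approximations are bounded
  have hint : ∀ {k F : Space d → ℂ}, MemLp k 2 → (∀ x, x ∉ S → k x = 0) → Continuous F →
      Integrable fun x => k x * F x := by
    intro k F hk hk0 hF
    obtain ⟨N, hN⟩ := hc.isCompact.exists_bound_of_continuousOn (f := F) hF.continuousOn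
    have h1 : IntegrableOn k S := by
      have : Fact (volume S < ⊤) := ⟨hc.isCompact.measure_lt_top⟩
      exact (hk.restrict S).integrable (by norm_num)
    have h2 : IntegrableOn (fun x => k x * F x) S :=
      Integrable.mul_bdd (c := N) h1 hF.aestronglyMeasurable
        (ae_restrict_of_forall_mem hSm hN)
    refine (integrableOn_iff_integrable_of_support_subset fun x hx => ?_).1 h2
    by_contra hxS
    exact hx (by simp [hk0 x hxS])
  have hkI : ∀ i n, Integrable fun x => (H i x * ζ x) * P.DTh (us n x) (vs i n x) := fun i n =>
    hint (hk i) (fun x hx => by simp [hζ0 x hx])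
      ((P.continuous_DTh.comp (husC n).continuous).clm_apply (hvsC i n).continuous)
  have hlI : ∀ i n, Integrable fun x => (H i x * pd i ζ x) * P.Th (us n x) := fun i n =>
    hint (hl i) (fun x hx => by simp [pd_eq_zero_of_notMem hx])
      (P.continuous_Th.comp (husC n).continuous)
  have hmI : ∀ n, Integrable fun x => (b x * ζ x) * P.Th (us n x) := fun n =>
    hint hm (fun x hx => by simp [hζ0 x hx]) (P.continuous_Th.comp (husC n).continuous)
  -- the identity for the approximations
  have hid : ∀ n, (∑ i, ((∫ x, (H i x * ζ x) * P.DTh (us n x) (vs i n x)) +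
      ∫ x, (H i x * pd i ζ x) * P.Th (us n x))) = ∫ x, (b x * ζ x) * P.Th (us n x) := by
    intro n
    have hC1 : ContDiff ℝ 1 (fun x => P.Th (us n x)) :=
      P.contDiff_Th.comp ((husC n).of_le (by exact_mod_cast le_top))
    have hL := lipschitz_mul (U := univ) hC1.locallyLipschitz.locallyLipschitzOn hζ hc
      (subset_univ _)
    -- The factor ζ keeps the support away from the bottom, and the vanishing of uₙ keeps it away
    -- from the top.
    have hsupp : tsupport (fun x => P.Th (us n x) * ζ x) ⊆ strip d h := by
      have h1 : tsupport (fun x => P.Th (us n x) * ζ x) ⊆ S :=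
        closure_mono fun x hx => right_ne_zero_of_mul hx
      have h2 : tsupport (fun x => P.Th (us n x) * ζ x) ⊆ {x | x 0 ≤ h - δ n} := by
        refine closure_minimal (fun x hx => ?_)
          (isClosed_le (continuous_coord 0) continuous_const)
        by_contra hx'
        have h3 : us n x = 0 := shiftMoll_eq_zero hs.eq_zero (hδ n) (not_le.1 hx').le
        exact hx (by simp [h3, P.Th_zero])
      intro x hx
      have h3 : x 0 ≤ h - δ n := h2 hx
      have h4 := hδ n
      exact ⟨hsub (h1 hx), by linarith⟩
    have h1 := htest _ hL (hc.mul_left (f := fun x => P.Th (us n x))) hsupp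
    have h2 : ∫ x, b x * (P.Th (us n x) * ζ x) = ∫ x, (b x * ζ x) * P.Th (us n x) :=
      integral_congr_ae (Eventually.of_forall fun x => by ring)
    rw [← h2, ← h1]
    simp_rw [← integral_add (hkI _ n) (hlI _ n)]
    have hI : ∀ i, Integrable fun x => H i x * ζ x * P.DTh (us n x) (vs i n x) +
        H i x * pd i ζ x * P.Th (us n x) := fun i => (hkI i n).add (hlI i n)
    rw [← integral_finsetSum _ fun i _ => hI i]
    refine integral_congr_ae ?_
    filter_upwards [hζ.ae_differentiableAt (μ := volume)] with x hx
    refine Finset.sum_congr rfl fun i _ => ?_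
    by_cases hxS : x ∈ S
    · have h3 : HasFDerivAt (us n) (fderiv ℝ (us n) x) x :=
        ((husC n).differentiable (by simp) x).hasFDerivAt
      have h4 := ((P.hasFDerivAt_Th (us n x)).comp x h3).mul hx.hasFDerivAt
      have h5 : pd i (fun x => P.Th (us n x) * ζ x) x =
          P.Th (us n x) * pd i ζ x + ζ x * P.DTh (us n x) (pd i (us n) x) := by
        rw [pd, (show HasFDerivAt (fun x => P.Th (us n x) * ζ x) _ x from h4).fderiv]
        simp [pd]
      rw [h5, pd_shiftMoll hs.weakGradTrace hu2 (hδ n) i (hsub hxS)]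
      simp only [hvs, hus]; ring
    · have h5 : x ∉ tsupport (fun x => P.Th (us n x) * ζ x) := fun hx' =>
        hxS (closure_mono (fun y hy => right_ne_zero_of_mul hy) hx')
      simp [hζ0 x hxS, pd_eq_zero_of_notMem hxS, pd_eq_zero_of_notMem h5]
  have hlimL := tendsto_finsetSum Finset.univ fun i (_ : i ∈ Finset.univ) =>
    (tendsto_integral_DTh P (hk i) (hWL i) (fun n => (husC n).continuous.aestronglyMeasurable)
      (fun n => (hvsC i n).continuous.aestronglyMeasurable) hae (hvlim i) (hkI i)).add
    (tendsto_integral_Th P (hl i) hU (fun n => (husC n).continuous.aestronglyMeasurable) hulim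
      (hlI i))
  have hlimR := tendsto_integral_Th P hm hU
    (fun n => (husC n).continuous.aestronglyMeasurable) hulim hmI
  have key := tendsto_nhds_unique (hlimL.congr hid) hlimR
  have hUu : ∀ x ∈ S, U x = u x := fun x hx => indicator_of_mem (hsub hx) _
  have hWG : ∀ i, ∀ x ∈ S, W i x = G x i := fun i x hx => indicator_of_mem (hsub hx) _
  have hTU : MemLp (fun x => P.Th (U x)) 2 := by
    refine hU.of_le_mul (c := P.K) (P.continuous_Th.comp_aestronglyMeasurable
      hU.aestronglyMeasurable) (Eventually.of_forall fun x => ?_)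
    rw [P.norm_Th]
    gcongr
    exact P.om_le _
  have hDU : ∀ i, MemLp (fun x => P.DTh (U x) (W i x)) 2 := fun i =>
    (hWL i).of_le_mul (c := (1 + |p - 2|) * P.K)
      (P.aestronglyMeasurable_DTh hU.aestronglyMeasurable (hWL i).aestronglyMeasurable)
      (Eventually.of_forall fun x => (P.DTh (U x)).le_of_opNorm_le (P.norm_DTh_le _) _)
  have e1 : ∫ x, b x * (P.Th (u x) * ζ x) = ∫ x, (b x * ζ x) * P.Th (U x) := by
    refine integral_congr_ae (Eventually.of_forall fun x => ?_)
    by_cases hxS : x ∈ S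
    · simp only [hUu x hxS]; ring
    · simp [hζ0 x hxS]
  have hA : ∀ i, Integrable fun x => (H i x * ζ x) * P.DTh (U x) (W i x) := fun i =>
    (hk i).integrable_mul (hDU i)
  have hB : ∀ i, Integrable fun x => (H i x * pd i ζ x) * P.Th (U x) := fun i =>
    (hl i).integrable_mul hTU
  rw [e1, ← key]
  simp_rw [← integral_add (hA _) (hB _)]
  have hI : ∀ i, Integrable fun x => H i x * ζ x * P.DTh (U x) (W i x) +
      H i x * pd i ζ x * P.Th (U x) := fun i => (hA i).add (hB i)
  rw [← integral_finsetSum _ fun i _ => hI i]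
  refine integral_congr_ae (Eventually.of_forall fun x => Finset.sum_congr rfl fun i _ => ?_)
  by_cases hxS : x ∈ S
  · simp only [hUu x hxS, hWG i x hxS]; ring
  · simp [hζ0 x hxS, pd_eq_zero_of_notMem hxS]

end NonlinearTest

/-! ### The pointwise inequality behind the energy estimates. -/

section CoreInequality

variable {d : ℕ} {p : ℝ}

/-- The partial derivative of a real-valued function. -/
def rd (k : Fin (d + 1)) (F : Space d → ℝ) (x : Space d) : ℝ :=
  fderiv ℝ F x (EuclideanSpace.single k 1)

lemma pd_ofReal (k : Fin (d + 1)) (F : Space d → ℝ) (x : Space d) :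
    pd k (fun x => (F x : ℂ)) x = (rd k F x : ℂ) := by
  by_cases hF : DifferentiableAt ℝ F x
  · have h1 : HasFDerivAt (fun x => (F x : ℂ)) _ x :=
      Complex.ofRealCLM.hasFDerivAt.comp x hF.hasFDerivAt
    rw [pd, rd, h1.fderiv]
    simp
  · have h2 : ¬ DifferentiableAt ℝ (fun x => (F x : ℂ)) x := fun h => hF
      (Complex.reCLM.differentiableAt.comp x h)
    rw [pd, rd, fderiv_zero_of_not_differentiableAt hF, fderiv_zero_of_not_differentiableAt h2]
    simp

lemma rd_re {F : Space d → ℂ} {x : Space d} (hF : DifferentiableAt ℝ F x) (k : Fin (d + 1)) :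
    rd k (fun x => (F x).re) x = (pd k F x).re := by
  have h1 : HasFDerivAt (fun x => (F x).re) _ x :=
    Complex.reCLM.hasFDerivAt.comp x hF.hasFDerivAt
  rw [pd, rd, h1.fderiv]
  simp

lemma rd_mul {F ζ : Space d → ℝ} {x : Space d} (hF : DifferentiableAt ℝ F x)
    (hζ : DifferentiableAt ℝ ζ x) (k : Fin (d + 1)) :
    rd k (fun x => F x * ζ x) x = F x * rd k ζ x + ζ x * rd k F x := by
  rw [rd, fderiv_fun_mul hF hζ]
  simp [rd]

lemma measurable_rd (k : Fin (d + 1)) (F : Space d → ℝ) : Measurable (rd k F) :=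
  measurable_fderiv_apply_const ℝ F _

lemma abs_rd_le {F : Space d → ℝ} {K : ℝ≥0} (hF : LipschitzWith K F) (k : Fin (d + 1))
    (x : Space d) : |rd k F x| ≤ K := by
  have h1 := (fderiv ℝ F x).le_of_opNorm_le (norm_fderiv_le_of_lipschitz ℝ hF)
    (EuclideanSpace.single k 1)
  rw [norm_single_one, mul_one] at h1
  exact h1

lemma rd_eq_zero_of_notMem {ζ : Space d → ℝ} {x : Space d} (hx : x ∉ tsupport ζ)
    (i : Fin (d + 1)) : rd i ζ x = 0 := by
  have h1 : fderiv ℝ ζ x = 0 := by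
    by_contra h
    exact hx (tsupport_fderiv_subset ℝ (subset_tsupport _ h))
  rw [rd, h1]; rfl

/-- The tangential gradient, with a vanishing transversal component. -/
def tgrad (F : Space d → ℝ) (x : Space d) : EuclideanSpace ℂ (Fin (d + 1)) :=
  WithLp.toLp 2 (fun i => if i = 0 then 0 else (rd i F x : ℂ))

/-- The coefficient density whose Carleson norm enters the energy estimate. -/
def rowDensity (A : Space d → Matrix (Fin (d + 1)) (Fin (d + 1)) ℂ)
    (B : Space d → EuclideanSpace ℂ (Fin (d + 1))) (x : Space d) : ℝ :=
  (∑ j, ‖pd 0 (fun z => A z 0 j) x‖ ^ 2) + ‖∑ j, pd j (fun z => A z 0 j) x‖ ^ 2 + ‖B x‖ ^ 2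

lemma young_om {w X a z s θ : ℝ} (hw : 0 ≤ w) (hs : 0 ≤ s) (hθ : 0 < θ) :
    s * (X * (a * (w * z))) ≤ θ * (w * a ^ 2 * s) + X ^ 2 * (w * z ^ 2) * s / (4 * θ) := by
  have h1 : 0 ≤ (2 * θ * a - X * z) ^ 2 * (w * s) / (4 * θ) := by positivity
  have h2 : (2 * θ * a - X * z) ^ 2 * (w * s) / (4 * θ) =
      θ * (w * a ^ 2 * s) + X ^ 2 * (w * z ^ 2) * s / (4 * θ) - s * (X * (a * (w * z))) := by
    field_simp
    ring
  linarith

namespace Profile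

variable (P : Profile p)

/-- Here ξ, g, s stand for ∇u, ∇ζ, ζ, while α and β stand for ∂₀ and ∂ⱼ of the real parts of A₀ⱼ. On
the right side, the integrand of the tested equation is reduced by those of the curl identities with
A₀ⱼ ζ. As the first row is real, the subtraction cancels the flux of that row against ∂₀ζ, and A₀₀ =
1 leaves the term ξ₀ T g₀. The errors from α, the sum of β, and b are absorbed by three Young
inequalities, hence 3θ. The tangential part of ∇ζ appears twice, each time bounded with `Lam`. -/
lemma pointwise_lower_bound (hp : 1 < p) {lam Lam θ : ℝ} (hlam : 0 ≤ lam) (hθ : 0 < θ)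
    {M : Matrix (Fin (d + 1)) (Fin (d + 1)) ℂ}
    (hM : ∀ ξ : EuclideanSpace ℂ (Fin (d + 1)), lam * ‖ξ‖ ^ 2 ≤ (pairing M ξ (Jmap p ξ)).re)
    (hM' : ∀ ξ η : EuclideanSpace ℂ (Fin (d + 1)), ‖pairing M ξ η‖ ≤ Lam * ‖ξ‖ * ‖η‖)
    (h00 : M 0 0 = 1) (him : ∀ j, (M 0 j).im = 0) (z : ℂ)
    (ξ b : EuclideanSpace ℂ (Fin (d + 1))) {s : ℝ} (hs : 0 ≤ s) (g : Fin (d + 1) → ℝ)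
    (g' : EuclideanSpace ℂ (Fin (d + 1))) (hg' : ∀ i, g' i = if i = 0 then 0 else (g i : ℂ))
    (α : Fin (d + 1) → ℝ) (β : Fin (d + 1) → ℝ) (a0 : Fin (d + 1) → ℂ) (b0 : ℂ)
    (hα : ∀ j, |α j| ≤ ‖a0 j‖) (hβ : |∑ j, β j| ≤ ‖b0‖) :
    (lam * min 2 p - 3 * θ) * (P.om z * ‖ξ‖ ^ 2 * s) + (ξ 0 * P.Th z).re * g 0
      - ((∑ j, ‖a0 j‖ ^ 2) + ‖b0‖ ^ 2 + ‖b‖ ^ 2) * (P.om z * ‖z‖ ^ 2) * s / (4 * θ)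
      - 2 * Lam * (‖g'‖ * (‖ξ‖ * ‖P.Th z‖)) ≤
    ((∑ i, (∑ j, M i j * ξ j) * (P.DTh z (ξ i) * s + P.Th z * g i)) -
        (∑ i, b i * ξ i) * (P.Th z * s)).re -
      ∑ j, ((ξ j * P.Th z).re * ((M 0 j).re * g 0 + s * α j) -
        (ξ 0 * P.Th z).re * ((M 0 j).re * g j + s * β j)) := by
  set T := P.Th z with hT
  have hTn : ‖T‖ = P.om z * ‖z‖ := P.norm_Th z
  have hell := P.ellipticity hp hlam hM z ξ
  set Q := ∑ i, ∑ j, M i j * ξ j * P.DTh z (ξ i) with hQ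
  have hrow : ∀ j, (M 0 j * ξ j * T).re = (M 0 j).re * (ξ j * T).re := fun j => by
    rw [mul_assoc, Complex.mul_re, him j]; ring
  -- the algebraic identity
  have e1 : (∑ i, (∑ j, M i j * ξ j) * (P.DTh z (ξ i) * s + T * g i)) =
      Q * s + (∑ j, M 0 j * ξ j * T) * g 0 + pairing M ξ g' * T := by
    have : ∀ i, (∑ j, M i j * ξ j) * (P.DTh z (ξ i) * s + T * g i) =
        (∑ j, M i j * ξ j * P.DTh z (ξ i)) * s + (∑ j, M i j * ξ j * T) * g i := fun i => by
      simp only [Finset.sum_mul, ← Finset.sum_add_distrib]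
      exact Finset.sum_congr rfl fun j _ => by ring
    simp_rw [this, Finset.sum_add_distrib, hQ, Finset.sum_mul]
    rw [add_assoc]
    congr 1
    rw [Fin.sum_univ_succ]
    congr 1
    rw [pairing, Fin.sum_univ_succ]
    simp only [hg']
    simp [Finset.sum_mul]
    exact Finset.sum_congr rfl fun i _ => Finset.sum_congr rfl fun j _ => by ring
  -- The sum of A₀ⱼ gⱼ splits into g₀, because A₀₀ = 1, and a pairing of the tangential vector g'
  -- with the transversal unit vector, to which the upper bound on the matrix applies.
  have e2 : ∑ j, ((ξ j * T).re * ((M 0 j).re * g 0 + s * α j) -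
        (ξ 0 * T).re * ((M 0 j).re * g j + s * β j)) =
      (∑ j, M 0 j * ξ j * T).re * g 0 + s * (∑ j, (ξ j * T).re * α j)
        - (ξ 0 * T).re * g 0
        - (ξ 0 * T).re * (pairing M g' (EuclideanSpace.single 0 1)).re
        - s * ((ξ 0 * T).re * ∑ j, β j) := by
    have h1 : (pairing M g' (EuclideanSpace.single 0 1)).re =
        (∑ j, (M 0 j).re * g j) - g 0 := by
      have : pairing M g' (EuclideanSpace.single 0 1) = ∑ j, M 0 j * g' j := by
        rw [pairing, Fin.sum_univ_succ]
        simp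
      rw [this, Complex.re_sum, Fin.sum_univ_succ, Fin.sum_univ_succ]
      simp [hg', h00]
    rw [h1, Complex.re_sum]
    simp_rw [hrow, Finset.sum_sub_distrib, Finset.mul_sum, Finset.sum_mul, mul_sub, mul_add,
      Finset.sum_add_distrib, Finset.mul_sum]
    have h2 : ∀ j, (ξ j * T).re * ((M 0 j).re * g 0) = (M 0 j).re * (ξ j * T).re * g 0 :=
      fun j => by ring
    have h3 : ∀ j, (ξ j * T).re * (s * α j) = s * ((ξ j * T).re * α j) := fun j => by ring
    have h4 : ∀ j, (ξ 0 * T).re * (s * β j) = s * ((ξ 0 * T).re * β j) := fun j => by ring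
    simp_rw [h2, h3, h4]
    ring
  rw [e1, e2]
  have e3 : (Q * s + (∑ j, M 0 j * ξ j * T) * g 0 + pairing M ξ g' * T -
      (∑ i, b i * ξ i) * (T * s)).re = Q.re * s + (∑ j, M 0 j * ξ j * T).re * g 0 +
      (pairing M ξ g' * T).re - s * ((∑ i, b i * ξ i) * T).re := by
    simp only [Complex.sub_re, Complex.add_re, Complex.re_mul_ofReal]
    congr 1
    rw [← mul_assoc, Complex.re_mul_ofReal]; ring
  rw [e3]
  -- estimates
  have f0 : lam * min 2 p * (P.om z * ‖ξ‖ ^ 2 * s) ≤ Q.re * s := by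
    calc _ = lam * min 2 p * (P.om z * ‖ξ‖ ^ 2) * s := by ring
      _ ≤ Q.re * s := by gcongr
  have hξ0 : |(ξ 0 * T).re| ≤ ‖ξ‖ * ‖T‖ := by
    refine (Complex.abs_re_le_norm _).trans ?_
    rw [norm_mul]
    gcongr
    exact PiLp.norm_apply_le ξ 0
  have f1 : -(pairing M ξ g' * T).re ≤ Lam * (‖g'‖ * (‖ξ‖ * ‖T‖)) := by
    refine (neg_le_abs _).trans ((Complex.abs_re_le_norm _).trans ?_)
    rw [norm_mul]
    calc _ ≤ Lam * ‖ξ‖ * ‖g'‖ * ‖T‖ := by gcongr; exact hM' _ _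
      _ = _ := by ring
  have f2 : -((ξ 0 * T).re * (pairing M g' (EuclideanSpace.single 0 1)).re) ≤
      Lam * (‖g'‖ * (‖ξ‖ * ‖T‖)) := by
    refine (neg_le_abs _).trans ?_
    rw [abs_mul]
    have h2 := hM' g' (EuclideanSpace.single 0 1)
    rw [PiLp.norm_single, norm_one, mul_one] at h2
    calc _ ≤ (‖ξ‖ * ‖T‖) * (Lam * ‖g'‖) := by
          gcongr
          exact (Complex.abs_re_le_norm _).trans h2
      _ = _ := by ring
  have hcs : ∀ (c : Fin (d + 1) → ℝ), (∀ i, 0 ≤ c i) →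
      ∑ i, c i * ‖ξ i‖ ≤ √(∑ i, c i ^ 2) * ‖ξ‖ := fun c hc => by
    rw [EuclideanSpace.norm_eq]
    exact Real.sum_mul_le_sqrt_mul_sqrt _ _ _
  have f3 : ((∑ i, b i * ξ i) * T).re ≤ ‖b‖ * (‖ξ‖ * ‖T‖) := by
    refine (le_abs_self _).trans ((Complex.abs_re_le_norm _).trans ?_)
    rw [norm_mul, ← mul_assoc]
    gcongr
    refine (norm_sum_le _ _).trans ?_
    simp_rw [norm_mul]
    rw [EuclideanSpace.norm_eq b]
    exact hcs _ fun i => norm_nonneg _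
  have f4 : ∑ j, (ξ j * T).re * α j ≤ √(∑ j, ‖a0 j‖ ^ 2) * (‖ξ‖ * ‖T‖) := by
    calc ∑ j, (ξ j * T).re * α j ≤ ∑ j, ‖a0 j‖ * ‖ξ j‖ * ‖T‖ := by
          refine Finset.sum_le_sum fun j _ => (le_abs_self _).trans ?_
          rw [abs_mul]
          calc _ ≤ (‖ξ j‖ * ‖T‖) * ‖a0 j‖ := by
                rw [← norm_mul]
                gcongr
                · exact Complex.abs_re_le_norm _
                · exact hα j
            _ = _ := by ring
      _ = (∑ j, ‖a0 j‖ * ‖ξ j‖) * ‖T‖ := by rw [Finset.sum_mul]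
      _ ≤ (√(∑ j, ‖a0 j‖ ^ 2) * ‖ξ‖) * ‖T‖ := by
          gcongr
          exact hcs _ fun i => norm_nonneg _
      _ = _ := by ring
  have f5 : -((ξ 0 * T).re * ∑ j, β j) ≤ ‖b0‖ * (‖ξ‖ * ‖T‖) := by
    refine (neg_le_abs _).trans ?_
    rw [abs_mul, mul_comm]
    gcongr
  have y1 := young_om (X := ‖b‖) (a := ‖ξ‖) (z := ‖z‖) (P.om_nonneg z) hs hθ
  have y2 := young_om (X := √(∑ j, ‖a0 j‖ ^ 2)) (a := ‖ξ‖) (z := ‖z‖) (P.om_nonneg z) hs hθ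
  have y3 := young_om (X := ‖b0‖) (a := ‖ξ‖) (z := ‖z‖) (P.om_nonneg z) hs hθ
  rw [Real.sq_sqrt (Finset.sum_nonneg fun _ _ => by positivity)] at y2
  rw [← hTn] at y1 y2 y3
  have g3 := mul_le_mul_of_nonneg_left f3 hs
  have g4 := mul_le_mul_of_nonneg_left f4 hs
  have g5 := mul_le_mul_of_nonneg_left f5 hs
  have e4 : ((∑ j, ‖a0 j‖ ^ 2) + ‖b0‖ ^ 2 + ‖b‖ ^ 2) * (P.om z * ‖z‖ ^ 2) * s / (4 * θ) =
      (∑ j, ‖a0 j‖ ^ 2) * (P.om z * ‖z‖ ^ 2) * s / (4 * θ) +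
      ‖b0‖ ^ 2 * (P.om z * ‖z‖ ^ 2) * s / (4 * θ) +
      ‖b‖ ^ 2 * (P.om z * ‖z‖ ^ 2) * s / (4 * θ) := by ring
  rw [e4]
  linarith

end Profile

end CoreInequality

/-! ### The tested equation and the tested curl identities. -/

section TestedEquation

variable {d : ℕ} {p : ℝ}

lemma contDiff_pd {φ : Space d → ℂ} (hφ : ContDiff ℝ ∞ φ) (k : Fin (d + 1)) :
    ContDiff ℝ ∞ (pd k φ) :=
  (hφ.fderiv_right (m := ∞) (by simp)).clm_apply contDiff_const

lemma hasCompactSupport_pd {φ : Space d → ℂ} (hφ : HasCompactSupport φ) (k : Fin (d + 1)) :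
    HasCompactSupport (pd k φ) :=
  HasCompactSupport.intro hφ fun _ hx => pd_eq_zero_of_notMem hx k

lemma pd_pd_comm {φ : Space d → ℂ} (hφ : ContDiff ℝ ∞ φ) (j k : Fin (d + 1)) (x : Space d) :
    pd j (pd k φ) x = pd k (pd j φ) x := by
  have hd : DifferentiableAt ℝ (fderiv ℝ φ) x :=
    (hφ.fderiv_right (m := ∞) (by simp)).differentiable (by simp) x
  have h1 : ∀ a b : Fin (d + 1), pd a (pd b φ) x =
      fderiv ℝ (fderiv ℝ φ) x (EuclideanSpace.single a 1) (EuclideanSpace.single b 1) := by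
    intro a b
    have h2 := hd.hasFDerivAt.clm_apply (hasFDerivAt_const (EuclideanSpace.single b (1 : ℝ)) x)
    have h3 : HasFDerivAt (pd b φ) _ x := h2
    rw [pd, h3.fderiv]
    simp
  rw [h1, h1]
  have h2 : ContDiff ℝ 2 φ := by exact_mod_cast contDiff_infty.1 hφ 2
  exact (h2.contDiffAt.isSymmSndFDerivAt (by simp)) _ _

/-- Both sides are minus the integral of u against the mixed second derivative of φ, by Green's
formula for ∂₀φ and for ∂ⱼφ. -/
lemma HasWeakGradTrace.curl {u : Space d → ℂ} {G : Space d → EuclideanSpace ℂ (Fin (d + 1))}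
    {f : Bdry d → ℂ} (h : HasWeakGradTrace u G f) {φ : Space d → ℂ} (hφ : ContDiff ℝ ∞ φ)
    (hc : HasCompactSupport φ) (hs : tsupport φ ⊆ halfSpace d) (j : Fin (d + 1)) :
    ∫ x in halfSpace d, G x j * pd 0 φ x = ∫ x in halfSpace d, G x 0 * pd j φ x := by
  have hb : ∀ k y, pd k φ (pt 0 y) = 0 := fun k y => by
    refine pd_eq_zero_of_notMem (fun hx => ?_) k
    have h1 : 0 < (pt 0 y : Space d) 0 := hs hx
    simp at h1
  have h1 := h.2.2.2 _ (contDiff_pd hφ 0) (hasCompactSupport_pd hc 0) j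
  have h2 := h.2.2.2 _ (contDiff_pd hφ j) (hasCompactSupport_pd hc j) 0
  simp only [hb, mul_zero, integral_zero, ite_self, sub_zero, pd_pd_comm hφ j 0] at h1 h2
  rw [h1] at h2
  exact neg_inj.1 h2

variable {h : ℝ} {A : Space d → Matrix (Fin (d + 1)) (Fin (d + 1)) ℂ}
    {B : Space d → EuclideanSpace ℂ (Fin (d + 1))} {f : Bdry d → ℂ} {u : Space d → ℂ}
    {G : Space d → EuclideanSpace ℂ (Fin (d + 1))}

lemma IsEnergySolution.memLp_Th (hs : IsEnergySolution h A B f u G) (hh : 0 < h) (P : Profile p) :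
    MemLp (fun x => P.Th (u x)) 2 (volume.restrict (halfSpace d)) := by
  have hu := hs.memLp_u hh
  refine hu.of_le_mul (c := P.K) (P.continuous_Th.comp_aestronglyMeasurable
    hu.aestronglyMeasurable) (Eventually.of_forall fun x => ?_)
  rw [P.norm_Th]
  gcongr
  exact P.om_le _

lemma IsEnergySolution.memLp_DTh (hs : IsEnergySolution h A B f u G) (hh : 0 < h) (P : Profile p)
    (i : Fin (d + 1)) :
    MemLp (fun x => P.DTh (u x) (G x i)) 2 (volume.restrict (halfSpace d)) :=
  (memLp_coord hs.gradient_L2 i).of_le_mul (c := (1 + |p - 2|) * P.K)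
    (P.aestronglyMeasurable_DTh (hs.memLp_u hh).aestronglyMeasurable
      (memLp_coord hs.gradient_L2 i).aestronglyMeasurable)
    (Eventually.of_forall fun x => (P.DTh (u x)).le_of_opNorm_le (P.norm_DTh_le _) _)

lemma memLp_bdd_mul {α : Type*} [MeasurableSpace α] {μ : Measure α} {c X : α → ℂ} {M : ℝ}
    (hX : MemLp X 2 μ) (hc : AEStronglyMeasurable c μ) (hM : ∀ᵐ x ∂μ, ‖c x‖ ≤ M) :
    MemLp (fun x => c x * X x) 2 μ := by
  refine hX.of_le_mul (c := M) (hc.mul hX.aestronglyMeasurable) ?_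
  filter_upwards [hM] with x hx
  rw [norm_mul]
  gcongr

lemma memLp_mul_of_continuousOn {c X : Space d → ℂ} {S : Set (Space d)} (hS : IsCompact S)
    (hc : ContinuousOn c S) (hX : MemLp X 2 (volume.restrict S)) :
    MemLp (fun x => c x * X x) 2 (volume.restrict S) := by
  obtain ⟨M, hM⟩ := hS.exists_bound_of_continuousOn hc
  exact memLp_bdd_mul hX (hc.aestronglyMeasurable hS.measurableSet)
    (ae_restrict_of_forall_mem hS.measurableSet hM)

lemma locallyIntegrableOn_of_memLp {X : Space d → ℂ} {U : Set (Space d)} (hU : IsOpen U)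
    (hX : ∀ S, IsCompact S → S ⊆ U → MemLp X 2 (volume.restrict S)) :
    LocallyIntegrableOn X U := by
  rw [locallyIntegrableOn_iff hU.isLocallyClosed]
  intro S hSU hS
  have : Fact (volume S < ⊤) := ⟨hS.measure_lt_top⟩
  exact (hX S hS hSU).integrable (by norm_num)

/-- The nonlinear test identity in real form, on a compact set containing the support of the cutoff,
together with the integrability of the integrand. -/
lemma IsEnergySolution.nonlinear_test_re (hs : IsEnergySolution h A B f u G) (hh : 0 < h)
    (P : Profile p) {H : Fin (d + 1) → Space d → ℂ} {b : Space d → ℂ}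
    (hH : ∀ i, ∀ S : Set (Space d), IsCompact S → S ⊆ halfSpace d →
      MemLp (H i) 2 (volume.restrict S))
    (hb : ∀ S : Set (Space d), IsCompact S → S ⊆ halfSpace d → MemLp b 2 (volume.restrict S))
    (htest : ∀ φ : Space d → ℂ, ContDiff ℝ ∞ φ → HasCompactSupport φ →
      tsupport φ ⊆ strip d h → ∫ x, ∑ i, H i x * pd i φ x = ∫ x, b x * φ x)
    {ζ : Space d → ℝ} {K : ℝ≥0} (hζ : LipschitzWith K ζ) {S : Set (Space d)} (hS : IsCompact S)
    (hζS : tsupport ζ ⊆ S) (hSs : S ⊆ halfSpace d) :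
    IntegrableOn (fun x => ((∑ i, H i x * (P.DTh (u x) (G x i) * ζ x + P.Th (u x) * rd i ζ x))
      - b x * (P.Th (u x) * ζ x)).re) S ∧
    ∫ x in S, ((∑ i, H i x * (P.DTh (u x) (G x i) * ζ x + P.Th (u x) * rd i ζ x))
      - b x * (P.Th (u x) * ζ x)).re = 0 := by
  set c : Space d → ℂ := fun x => (ζ x : ℂ) with hc
  have hcL : LipschitzWith K c := by
    have := Complex.isometry_ofReal.lipschitz.comp hζ
    rwa [one_mul] at this
  have hcs : HasCompactSupport ζ := hS.of_isClosed_subset (isClosed_tsupport ζ) hζS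
  have hcc : HasCompactSupport c := hcs.comp_left (g := fun t : ℝ => (t : ℂ)) (by simp)
  have hct : tsupport c ⊆ S := (closure_mono fun x hx => by
    simpa [hc] using hx : tsupport c ⊆ tsupport ζ).trans hζS
  have hpd : ∀ i x, (rd i ζ x : ℂ) = pd i c x := fun i x => (pd_ofReal i ζ x).symm
  have hstrip : strip d h ⊆ halfSpace d := fun x hx => hx.1
  have hmono : volume.restrict S ≤ volume.restrict (halfSpace d) := Measure.restrict_mono hSs le_rfl
  have hT := (hs.memLp_Th hh P).mono_measure hmono
  have hD := fun i => (hs.memLp_DTh hh P i).mono_measure hmono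
  have key := hs.nonlinear_test hh P hH hb (fun φ hφ hφc hφs => by
    obtain ⟨K', hK'⟩ := hφ
    exact lipschitz_test (isOpen_strip h)
      (fun i => locallyIntegrableOn_of_memLp (isOpen_strip h) fun S hS hSU =>
        hH i S hS (hSU.trans hstrip))
      (locallyIntegrableOn_of_memLp (isOpen_strip h) fun S hS hSU => hb S hS (hSU.trans hstrip))
      htest hK' hφc hφs) hcL hcc (hct.trans hSs)
  obtain ⟨M, hM⟩ := hcc.exists_bound_of_continuous hcL.continuous
  have hI1 : IntegrableOn (fun x => ∑ i, H i x * (P.DTh (u x) (G x i) * c x +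
      P.Th (u x) * pd i c x)) S := by
    refine integrable_finsetSum _ fun i _ => (hH i S hS hSs).integrable_mul (q := 2) ?_
    refine MemLp.add ?_ ?_
    · have := memLp_bdd_mul (hD i) hcL.continuous.aestronglyMeasurable (Eventually.of_forall hM)
      simpa only [mul_comm] using this
    · have := memLp_bdd_mul hT (measurable_pd i c).aestronglyMeasurable
        (Eventually.of_forall (norm_pd_le_of_lipschitz hcL i))
      simpa only [mul_comm] using this
  have hI2 : IntegrableOn (fun x => b x * (P.Th (u x) * c x)) S := by
    refine (hb S hS hSs).integrable_mul (q := 2) ?_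
    have := memLp_bdd_mul hT hcL.continuous.aestronglyMeasurable (Eventually.of_forall hM)
    simpa only [mul_comm] using this
  have hc0 : ∀ x, x ∉ S → c x = 0 := fun x hx =>
    image_eq_zero_of_notMem_tsupport fun h => hx (hct h)
  have hpd0 : ∀ i x, x ∉ S → pd i c x = 0 := fun i x hx =>
    pd_eq_zero_of_notMem (fun h => hx (hct h)) i
  have k1 : ∫ x in S, ∑ i, H i x * (P.DTh (u x) (G x i) * c x + P.Th (u x) * pd i c x) =
      ∫ x, ∑ i, H i x * (P.DTh (u x) (G x i) * c x + P.Th (u x) * pd i c x) :=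
    setIntegral_eq_integral_of_forall_compl_eq_zero fun x hx => by
      simp [hc0 x hx, hpd0 _ x hx]
  have k2 : ∫ x in S, b x * (P.Th (u x) * c x) = ∫ x, b x * (P.Th (u x) * c x) :=
    setIntegral_eq_integral_of_forall_compl_eq_zero fun x hx => by simp [hc0 x hx]
  have hI := hI1.sub hI2
  simp only [hpd]
  refine ⟨hI.re, ?_⟩
  have h3 := integral_re hI
  refine h3.trans ?_
  simp only [Pi.sub_apply]
  rw [integral_sub hI1 hI2, k1, k2, key, sub_self]
  simp

lemma IsEnergySolution.equation_test (hs : IsEnergySolution h A B f u G) (hh : 0 < h)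
    (hA : ∀ i j, ContDiffOn ℝ ∞ (fun x => A x i j) (halfSpace d))
    (hB : ContDiffOn ℝ ∞ B (halfSpace d)) (P : Profile p)
    {ζ : Space d → ℝ} {K : ℝ≥0} (hζ : LipschitzWith K ζ) {S : Set (Space d)} (hS : IsCompact S)
    (hζS : tsupport ζ ⊆ S) (hSs : S ⊆ halfSpace d) :
    IntegrableOn (fun x => ((∑ i, (∑ j, A x i j * G x j) *
        (P.DTh (u x) (G x i) * ζ x + P.Th (u x) * rd i ζ x))
      - (∑ i, B x i * G x i) * (P.Th (u x) * ζ x)).re) S ∧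
    ∫ x in S, ((∑ i, (∑ j, A x i j * G x j) *
        (P.DTh (u x) (G x i) * ζ x + P.Th (u x) * rd i ζ x))
      - (∑ i, B x i * G x i) * (P.Th (u x) * ζ x)).re = 0 := by
  have hG : ∀ j, ∀ S : Set (Space d), S ⊆ halfSpace d →
      MemLp (fun x => G x j) 2 (volume.restrict S) := fun j S hS =>
    (memLp_coord hs.gradient_L2 j).mono_measure (Measure.restrict_mono hS le_rfl)
  refine hs.nonlinear_test_re hh P (H := fun i x => ∑ j, A x i j * G x j)
    (b := fun x => ∑ i, B x i * G x i) (fun i S hS hSs => ?_) (fun S hS hSs => ?_) ?_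
    hζ hS hζS hSs
  · exact memLp_finsetSum _ fun j _ =>
      memLp_mul_of_continuousOn hS ((hA i j).continuousOn.mono hSs) (hG j S hSs)
  · refine memLp_finsetSum _ fun j _ => memLp_mul_of_continuousOn hS ?_ (hG j S hSs)
    have h1 : Continuous fun v : EuclideanSpace ℂ (Fin (d + 1)) => v j := by fun_prop
    exact h1.comp_continuousOn (hB.continuousOn.mono hSs)
  · intro φ hφ hφc hφs
    have := hs.weak_equation φ hφ hφc hφs
    simpa only [Finset.sum_mul] using this

/-- Weak form of ∂₀∂ⱼ V(u) = ∂ⱼ∂₀ V(u). The field with Gⱼ in slot 0 and -G₀ in slot j is divergence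
free. When it is tested with Th(u) ζ, the terms with `DTh` cancel in real part by `Profile.curl`,
and only derivatives of ζ remain. -/
lemma IsEnergySolution.curl_test (hs : IsEnergySolution h A B f u G) (hh : 0 < h)
    (P : Profile p) (j : Fin (d + 1))
    {ζ : Space d → ℝ} {K : ℝ≥0} (hζ : LipschitzWith K ζ) {S : Set (Space d)} (hS : IsCompact S)
    (hζS : tsupport ζ ⊆ S) (hSs : S ⊆ halfSpace d) :
    IntegrableOn (fun x => (G x j * P.Th (u x)).re * rd 0 ζ x -
      (G x 0 * P.Th (u x)).re * rd j ζ x) S ∧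
    ∫ x in S, ((G x j * P.Th (u x)).re * rd 0 ζ x - (G x 0 * P.Th (u x)).re * rd j ζ x) = 0 := by
  have hG : ∀ j, ∀ S : Set (Space d), S ⊆ halfSpace d →
      MemLp (fun x => G x j) 2 (volume.restrict S) := fun j S hS =>
    (memLp_coord hs.gradient_L2 j).mono_measure (Measure.restrict_mono hS le_rfl)
  have hsum : ∀ (x : Space d) (F : Fin (d + 1) → ℂ),
      ∑ i, ((if i = 0 then G x j else 0) - if i = j then G x 0 else 0) * F i =
        G x j * F 0 - G x 0 * F j := fun x F => by
    simp [sub_mul, Finset.sum_sub_distrib, ite_mul]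
  have key := hs.nonlinear_test_re hh P
    (H := fun i x => (if i = 0 then G x j else 0) - if i = j then G x 0 else 0)
    (b := fun _ => 0) (fun i S hS hSs => ?_) (fun S hS hSs => MemLp.zero') ?_ hζ hS hζS hSs
  · have hpt : ∀ x, ((∑ i, ((if i = 0 then G x j else 0) - if i = j then G x 0 else 0) *
        (P.DTh (u x) (G x i) * ζ x + P.Th (u x) * rd i ζ x)) - 0 * (P.Th (u x) * ζ x)).re =
        (G x j * P.Th (u x)).re * rd 0 ζ x - (G x 0 * P.Th (u x)).re * rd j ζ x := fun x => by
      rw [hsum, zero_mul, sub_zero]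
      have h1 := P.curl (u x) (G x j) (G x 0)
      have h2 : G x j * (P.DTh (u x) (G x 0) * ζ x + P.Th (u x) * rd 0 ζ x) -
          G x 0 * (P.DTh (u x) (G x j) * ζ x + P.Th (u x) * rd j ζ x) =
          (G x j * P.DTh (u x) (G x 0)) * (ζ x : ℂ) - (G x 0 * P.DTh (u x) (G x j)) * (ζ x : ℂ) +
          ((G x j * P.Th (u x)) * (rd 0 ζ x : ℂ) - (G x 0 * P.Th (u x)) * (rd j ζ x : ℂ)) := by
        ring
      rw [h2, Complex.add_re, Complex.sub_re, Complex.sub_re]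
      simp only [Complex.re_mul_ofReal]
      rw [h1]; ring
    simp only [hpt] at key
    exact key
  · refine MemLp.sub ?_ ?_
    · split_ifs
      exacts [hG j S hSs, MemLp.zero']
    · split_ifs
      exacts [hG 0 S hSs, MemLp.zero']
  · intro φ hφ hφc hφs
    have hsub : tsupport φ ⊆ halfSpace d := fun x hx => (hφs hx).1
    have h1 := hs.weakGradTrace.curl hφ hφc hsub j
    simp only [hsum, zero_mul, integral_zero]
    have hz : ∀ k (F : Space d → ℂ), ∀ x, x ∉ halfSpace d → F x * pd k φ x = 0 := fun k F x hx => by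
      rw [pd_eq_zero_of_notMem (fun h => hx (hsub h)), mul_zero]
    rw [setIntegral_eq_integral_of_forall_compl_eq_zero (hz 0 _),
      setIntegral_eq_integral_of_forall_compl_eq_zero (hz j _)] at h1
    have hI : ∀ k l, Integrable fun x => G x k * pd l φ x := fun k l => by
      have h2 : IntegrableOn (fun x => G x k * pd l φ x) (halfSpace d) :=
        (memLp_coord hs.gradient_L2 k).integrable_mul (q := 2)
          (((contDiff_pd hφ l).continuous.memLp_of_hasCompactSupport
            (hasCompactSupport_pd hφc l)).restrict _)
      refine (integrableOn_iff_integrable_of_support_subset fun x hx => ?_).1 h2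
      by_contra hx'
      exact hx (hz l (fun x => G x k) x hx')
    rw [integral_sub (hI j 0) (hI 0 j), h1, sub_self]

end TestedEquation

/-! ### The integrated energy inequality for general cutoffs. -/

section EnergyInequality

variable {d : ℕ} {p : ℝ}

lemma convex_halfSpace : Convex ℝ (halfSpace d) :=
  convex_halfSpace_gt (f := fun x : Space d => x 0)
    ⟨fun _ _ => by simp, fun _ _ => by simp⟩ 0

lemma norm_le_sum_norm {n : ℕ} (v : EuclideanSpace ℂ (Fin n)) : ‖v‖ ≤ ∑ i, ‖v i‖ := by
  rw [EuclideanSpace.norm_eq]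
  exact Real.sqrt_le_iff.2 ⟨Finset.sum_nonneg fun i _ => norm_nonneg _,
    Finset.sum_sq_le_sq_sum_of_nonneg fun i _ => norm_nonneg _⟩

lemma norm_tgrad_le (F : Space d → ℝ) (x : Space d) :
    ‖tgrad F x‖ ≤ ∑ i : Fin d, |rd i.succ F x| := by
  refine (norm_le_sum_norm _).trans (le_of_eq ?_)
  rw [Fin.sum_univ_succ]
  simp [tgrad]

lemma norm_tgrad_le_of_lipschitz {F : Space d → ℝ} {K : ℝ≥0} (hF : LipschitzWith K F)
    (x : Space d) : ‖tgrad F x‖ ≤ d * K := by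
  refine (norm_tgrad_le F x).trans ((Finset.sum_le_sum fun i _ => abs_rd_le hF i.succ x).trans ?_)
  simp

lemma measurable_tgrad (F : Space d → ℝ) : Measurable (tgrad F) := by
  unfold tgrad
  refine (WithLp.measurable_toLp 2 _).comp (measurable_pi_lambda _ fun i => ?_)
  by_cases hi : i = 0
  · simp [hi]
  · simp only [hi, if_false]
    exact Complex.measurable_ofReal.comp (measurable_rd i F)

lemma tgrad_eq_zero_of_notMem {ζ : Space d → ℝ} {x : Space d} (hx : x ∉ tsupport ζ) :
    tgrad ζ x = 0 := by
  ext i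
  simp [tgrad, rd_eq_zero_of_notMem hx]

variable {h : ℝ} {A : Space d → Matrix (Fin (d + 1)) (Fin (d + 1)) ℂ}
    {B : Space d → EuclideanSpace ℂ (Fin (d + 1))} {f : Bdry d → ℂ} {u : Space d → ℂ}
    {G : Space d → EuclideanSpace ℂ (Fin (d + 1))}

lemma continuousOn_pd_coeff (hA : ∀ i j, ContDiffOn ℝ ∞ (fun x => A x i j) (halfSpace d))
    (i j k : Fin (d + 1)) : ContinuousOn (pd k (fun x => A x i j)) (halfSpace d) :=
  ((hA i j).continuousOn_fderiv_of_isOpen isOpen_halfSpace (by simp)).clm_apply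
    continuousOn_const

lemma continuousOn_rowDensity (hA : ∀ i j, ContDiffOn ℝ ∞ (fun x => A x i j) (halfSpace d))
    (hB : ContDiffOn ℝ ∞ B (halfSpace d)) : ContinuousOn (rowDensity A B) (halfSpace d) := by
  unfold rowDensity
  refine ((continuousOn_finsetSum _ fun j _ => (continuousOn_pd_coeff hA 0 j 0).norm.pow 2).add
    ((continuousOn_finsetSum _ fun j _ => continuousOn_pd_coeff hA 0 j j).norm.pow 2)).add
    (hB.continuousOn.norm.pow 2)

lemma rowDensity_nonneg (x : Space d) : 0 ≤ rowDensity A B x := by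
  unfold rowDensity; positivity

lemma IsEnergySolution.integrable_energy (hs : IsEnergySolution h A B f u G) (hh : 0 < h)
    (P : Profile p) {c : Space d → ℝ} (hc : Measurable c) {M : ℝ} (hM : ∀ x, |c x| ≤ M) :
    IntegrableOn (fun x => P.om (u x) * ‖G x‖ ^ 2 * c x) (halfSpace d) := by
  have h1 : IntegrableOn (fun x => ‖G x‖ ^ 2) (halfSpace d) := hs.gradient_L2.norm.integrable_sq
  have h2 := (h1.bdd_mul (c := P.K) (P.continuous_om.comp_aestronglyMeasurable
    (hs.memLp_u hh).aestronglyMeasurable) (Eventually.of_forall fun x => by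
      rw [Real.norm_of_nonneg (P.om_nonneg _)]; exact P.om_le _))
  exact h2.mul_bdd (c := M) hc.aestronglyMeasurable (Eventually.of_forall hM)

lemma IsEnergySolution.integrable_transversal (hs : IsEnergySolution h A B f u G) (hh : 0 < h)
    (P : Profile p) (j : Fin (d + 1)) {c : Space d → ℝ} (hc : Measurable c) {M : ℝ}
    (hM : ∀ x, |c x| ≤ M) :
    IntegrableOn (fun x => (G x j * P.Th (u x)).re * c x) (halfSpace d) := by
  have h1 : IntegrableOn (fun x => G x j * P.Th (u x)) (halfSpace d) :=
    (memLp_coord hs.gradient_L2 j).integrable_mul (q := 2) (hs.memLp_Th hh P)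
  exact Integrable.mul_bdd (c := M) h1.re hc.aestronglyMeasurable (Eventually.of_forall hM)

lemma IsEnergySolution.integrable_flux (hs : IsEnergySolution h A B f u G) (hh : 0 < h)
    (P : Profile p) {c : Space d → ℝ} (hc : Measurable c) {M : ℝ} (hM : ∀ x, |c x| ≤ M) :
    IntegrableOn (fun x => c x * (‖G x‖ * ‖P.Th (u x)‖)) (halfSpace d) := by
  have h1 : IntegrableOn (fun x => ‖G x‖ * ‖P.Th (u x)‖) (halfSpace d) :=
    hs.gradient_L2.norm.integrable_mul (q := 2) (hs.memLp_Th hh P).norm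
  exact h1.bdd_mul (c := M) hc.aestronglyMeasurable (Eventually.of_forall hM)

/-- Integrate `Profile.pointwise_lower_bound`: its right side integrates to zero, being the tested
equation minus the curl identities. The bound R is imposed on the integral in [0, ∞], so it also
provides integrability of the coefficient term. -/
lemma IsEnergySolution.energy_inequality_of_tsupport {lam Lam θ : ℝ}
    (hs : IsEnergySolution h A B f u G) (hh : 0 < h)
    (hA : ∀ i j, ContDiffOn ℝ ∞ (fun x => A x i j) (halfSpace d))
    (hB : ContDiffOn ℝ ∞ B (halfSpace d)) (hell : IsPElliptic p lam Lam A)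
    (hrow : ∀ x ∈ halfSpace d, A x 0 0 = 1 ∧ ∀ j, (A x 0 j).im = 0)
    (hp : 1 < p) (hlam : 0 ≤ lam) (hθ : 0 < θ) (P : Profile p)
    {ζ : Space d → ℝ} {K : ℝ≥0} (hζ : LipschitzWith K ζ) (hζ0 : ∀ x, 0 ≤ ζ x)
    (hc : HasCompactSupport ζ) (hsub : tsupport ζ ⊆ halfSpace d) {R : ℝ} (hR0 : 0 ≤ R)
    (hR : ∫⁻ x in halfSpace d,
      ENNReal.ofReal (rowDensity A B x * (P.om (u x) * ‖u x‖ ^ 2) * ζ x) ≤ ENNReal.ofReal R) :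
    (lam * min 2 p - 3 * θ) * (∫ x in halfSpace d, P.om (u x) * ‖G x‖ ^ 2 * ζ x) +
      (∫ x in halfSpace d, (G x 0 * P.Th (u x)).re * rd 0 ζ x) ≤
    R / (4 * θ) + 2 * Lam * ∫ x in halfSpace d, ‖tgrad ζ x‖ * (‖G x‖ * ‖P.Th (u x)‖) := by
  set S := tsupport ζ with hS
  have hSc : IsCompact S := hc
  have hmono : volume.restrict S ≤ volume.restrict (halfSpace d) :=
    Measure.restrict_mono hsub le_rfl
  have hSm : MeasurableSet S := hSc.measurableSet
  obtain ⟨M, hM⟩ := hc.exists_bound_of_continuous hζ.continuous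
  have hI1 := hs.integrable_energy hh P hζ.continuous.measurable hM
  have hI2 := hs.integrable_transversal hh P 0 (measurable_rd 0 ζ) (abs_rd_le hζ 0)
  have hI3 := hs.integrable_flux hh P (measurable_tgrad ζ).norm
    (fun x => by rw [abs_of_nonneg (norm_nonneg _)]; exact norm_tgrad_le_of_lipschitz hζ x)
  have hz : ∀ x, x ∉ S → ζ x = 0 := fun x hx => image_eq_zero_of_notMem_tsupport hx
  have hI4 : IntegrableOn (fun x => rowDensity A B x * (P.om (u x) * ‖u x‖ ^ 2) * ζ x)
      (halfSpace d) := by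
    refine ⟨?_, ?_⟩
    · refine (((continuousOn_rowDensity hA hB).aestronglyMeasurable measurableSet_halfSpace).mul
        ?_).mul hζ.continuous.aestronglyMeasurable
      exact (P.continuous_om.comp_aestronglyMeasurable (hs.memLp_u hh).aestronglyMeasurable).mul
        ((hs.memLp_u hh).aestronglyMeasurable.norm.pow 2)
    · rw [hasFiniteIntegral_iff_norm]
      refine lt_of_le_of_lt (lintegral_mono fun x => ?_) (hR.trans_lt ENNReal.ofReal_lt_top)
      rw [Real.norm_of_nonneg (mul_nonneg (mul_nonneg (rowDensity_nonneg x)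
        (mul_nonneg (P.om_nonneg _) (by positivity))) (hζ0 x))]
  have hR' : ∫ x in halfSpace d, rowDensity A B x * (P.om (u x) * ‖u x‖ ^ 2) * ζ x ≤ R := by
    rw [integral_eq_lintegral_of_nonneg_ae (Eventually.of_forall fun x =>
      mul_nonneg (mul_nonneg (rowDensity_nonneg x)
        (mul_nonneg (P.om_nonneg _) (by positivity))) (hζ0 x)) hI4.aestronglyMeasurable]
    exact ENNReal.toReal_le_of_le_ofReal hR0 hR
  obtain ⟨hE, hE0⟩ := hs.equation_test hh hA hB P hζ hSc subset_rfl hsub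
  -- the curl identities with the first row of the coefficients
  have hcurl : ∀ j, IntegrableOn (fun x =>
        (G x j * P.Th (u x)).re * rd 0 (fun x => (A x 0 j).re * ζ x) x -
        (G x 0 * P.Th (u x)).re * rd j (fun x => (A x 0 j).re * ζ x) x) S ∧
      ∫ x in S, ((G x j * P.Th (u x)).re * rd 0 (fun x => (A x 0 j).re * ζ x) x -
        (G x 0 * P.Th (u x)).re * rd j (fun x => (A x 0 j).re * ζ x) x) = 0 := by
    intro j
    -- The coefficients are smooth only in the open half-space, possibly with unbounded derivatives
    -- at the boundary. The compact support of ζ inside makes the product Lipschitz.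
    obtain ⟨K', hK'⟩ : ∃ K', LipschitzWith K' (fun x => (A x 0 j).re * ζ x) := by
      have hcL : LipschitzWith K (fun x => (ζ x : ℂ)) := by
        have := Complex.isometry_ofReal.lipschitz.comp hζ
        rwa [one_mul] at this
      have hct : tsupport (fun x => (ζ x : ℂ)) ⊆ S := closure_mono fun x hx => by simpa using hx
      obtain ⟨K', hK'⟩ := lipschitz_mul (U := halfSpace d)
        (ContDiffOn.locallyLipschitzOn convex_halfSpace ((hA 0 j).of_le (by simp))) hcL
        (hc.comp_left (g := fun t : ℝ => (t : ℂ)) (by simp)) (hct.trans hsub)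
      refine ⟨K', LipschitzWith.of_dist_le_mul fun x y => le_trans ?_ (hK'.dist_le_mul x y)⟩
      rw [dist_eq_norm, dist_eq_norm]
      refine le_trans (le_of_eq ?_) (Complex.abs_re_le_norm _)
      simp
    refine hs.curl_test hh P j hK' hSc (closure_mono fun x hx => right_ne_zero_of_mul hx) hsub
  have hE2 : IntegrableOn (fun x => ∑ j,
      ((G x j * P.Th (u x)).re * rd 0 (fun x => (A x 0 j).re * ζ x) x -
        (G x 0 * P.Th (u x)).re * rd j (fun x => (A x 0 j).re * ζ x) x)) S :=
    integrable_finsetSum _ fun j _ => (hcurl j).1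
  have hE20 : ∫ x in S, ∑ j,
      ((G x j * P.Th (u x)).re * rd 0 (fun x => (A x 0 j).re * ζ x) x -
        (G x 0 * P.Th (u x)).re * rd j (fun x => (A x 0 j).re * ζ x) x) = 0 := by
    rw [integral_finsetSum _ fun j _ => (hcurl j).1]
    exact Finset.sum_eq_zero fun j _ => (hcurl j).2
  have hJ1 := (hI1.mono_set hsub).const_mul (lam * min 2 p - 3 * θ)
  have hJ2 := hI2.mono_set hsub
  have hJ3 := (hI3.mono_set hsub).const_mul (2 * Lam)
  have hJ4 := (hI4.mono_set hsub).div_const (4 * θ)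
  have hle : ∫ x in S, ((lam * min 2 p - 3 * θ) * (P.om (u x) * ‖G x‖ ^ 2 * ζ x) +
        (G x 0 * P.Th (u x)).re * rd 0 ζ x -
        rowDensity A B x * (P.om (u x) * ‖u x‖ ^ 2) * ζ x / (4 * θ) -
        2 * Lam * (‖tgrad ζ x‖ * (‖G x‖ * ‖P.Th (u x)‖))) ≤ 0 := by
    have h0 : ∫ x in S, (((∑ i, (∑ j, A x i j * G x j) *
        (P.DTh (u x) (G x i) * ζ x + P.Th (u x) * rd i ζ x))
      - (∑ i, B x i * G x i) * (P.Th (u x) * ζ x)).re - ∑ j,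
      ((G x j * P.Th (u x)).re * rd 0 (fun x => (A x 0 j).re * ζ x) x -
        (G x 0 * P.Th (u x)).re * rd j (fun x => (A x 0 j).re * ζ x) x)) = 0 := by
      rw [integral_sub hE hE2, hE0, hE20, sub_self]
    rw [← h0]
    refine integral_mono_ae (((hJ1.add hJ2).sub hJ4).sub hJ3) (hE.sub hE2) ?_
    filter_upwards [ae_mono hmono hell, ae_restrict_mem hSm,
      ae_restrict_of_ae (hζ.ae_differentiableAt (μ := volume))] with x hx hxS hxd
    have hxs := hsub hxS
    have hAd : ∀ j, DifferentiableAt ℝ (fun x => A x 0 j) x := fun j =>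
      ((hA 0 j).contDiffAt (isOpen_halfSpace.mem_nhds hxs)).differentiableAt (by simp)
    have hAre : ∀ j, DifferentiableAt ℝ (fun x => (A x 0 j).re) x := fun j =>
      (Complex.reCLM.differentiableAt).comp x (hAd j)
    simp only [rd_mul (hAre _) hxd]
    exact P.pointwise_lower_bound hp hlam hθ hx.1 hx.2 (hrow x hxs).1 (hrow x hxs).2 (u x) (G x)
      (B x) (hζ0 x) (fun i => rd i ζ x) (tgrad ζ x) (fun i => by simp [tgrad])
      (fun j => rd 0 (fun x => (A x 0 j).re) x) (fun j => rd j (fun x => (A x 0 j).re) x)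
      (fun j => pd 0 (fun x => A x 0 j) x) (∑ j, pd j (fun x => A x 0 j) x)
      (fun j => by rw [rd_re (hAd j)]; exact Complex.abs_re_le_norm _)
      (by
        simp only [rd_re (hAd _)]
        rw [← Complex.re_sum]
        exact Complex.abs_re_le_norm _)
  have hsplit : ∫ x in S, ((lam * min 2 p - 3 * θ) * (P.om (u x) * ‖G x‖ ^ 2 * ζ x) +
        (G x 0 * P.Th (u x)).re * rd 0 ζ x -
        rowDensity A B x * (P.om (u x) * ‖u x‖ ^ 2) * ζ x / (4 * θ) -
        2 * Lam * (‖tgrad ζ x‖ * (‖G x‖ * ‖P.Th (u x)‖))) =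
      (lam * min 2 p - 3 * θ) * (∫ x in S, P.om (u x) * ‖G x‖ ^ 2 * ζ x) +
      (∫ x in S, (G x 0 * P.Th (u x)).re * rd 0 ζ x) -
      (∫ x in S, rowDensity A B x * (P.om (u x) * ‖u x‖ ^ 2) * ζ x) / (4 * θ) -
      2 * Lam * ∫ x in S, ‖tgrad ζ x‖ * (‖G x‖ * ‖P.Th (u x)‖) := by
    have hJ12 := hJ1.add hJ2
    have hJ124 := hJ12.sub hJ4
    rw [integral_sub (by exact hJ124) hJ3, integral_sub (by exact hJ12) hJ4,
      integral_add hJ1 hJ2, integral_const_mul, integral_const_mul, integral_div]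
  have hto : ∀ F : Space d → ℝ, (∀ x, x ∉ S → F x = 0) →
      ∫ x in S, F x = ∫ x in halfSpace d, F x := fun F hF => by
    rw [setIntegral_eq_integral_of_forall_compl_eq_zero hF,
      setIntegral_eq_integral_of_forall_compl_eq_zero fun x hx => hF x fun h => hx (hsub h)]
  rw [hsplit, hto _ fun x hx => by simp [hz x hx], hto _ fun x hx => by
    simp [rd_eq_zero_of_notMem hx], hto _ fun x hx => by simp [hz x hx], hto _ fun x hx => by
    simp [tgrad_eq_zero_of_notMem hx]] at hle
  have hR'' := div_le_div_of_nonneg_right hR' (by positivity : 0 ≤ 4 * θ)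
  linarith

lemma rd_eq_zero_of_min {F : Space d → ℝ} (hF : ∀ x, 0 ≤ F x) {x : Space d} (hx : F x = 0)
    (k : Fin (d + 1)) : rd k F x = 0 := by
  have h1 : IsLocalMin F x := Eventually.of_forall fun y => hx.trans_le (hF y)
  rw [rd, h1.fderiv_eq_zero]
  simp

lemma rd_posPart_sub {ζ : Space d → ℝ} (hζ : Continuous ζ) (ε : ℝ) (k : Fin (d + 1))
    (x : Space d) : rd k (fun x => max (ζ x - ε) 0) x = if ε < ζ x then rd k ζ x else 0 := by
  split_ifs with hx
  · have h1 : (fun x => max (ζ x - ε) 0) =ᶠ[𝓝 x] fun x => ζ x - ε := by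
      filter_upwards [hζ.continuousAt.eventually (lt_mem_nhds hx)] with y hy
      exact max_eq_left (by linarith)
    rw [rd, h1.fderiv_eq, fderiv_sub_const, rd]
  · exact rd_eq_zero_of_min (fun x => le_max_right _ _)
      (max_eq_right (by linarith [not_lt.1 hx])) k

lemma tgrad_posPart_sub {ζ : Space d → ℝ} (hζ : Continuous ζ) (ε : ℝ) (x : Space d) :
    tgrad (fun x => max (ζ x - ε) 0) x = if ε < ζ x then tgrad ζ x else 0 := by
  ext i
  by_cases hi : i = 0
  · split_ifs <;> simp [tgrad, hi]
  · simp only [tgrad, hi, if_false, rd_posPart_sub hζ]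
    split_ifs <;> simp [hi]

/-- The energy inequality for cutoffs vanishing on the boundary of the half-space. -/
lemma IsEnergySolution.energy_inequality {lam Lam θ : ℝ}
    (hs : IsEnergySolution h A B f u G) (hh : 0 < h)
    (hA : ∀ i j, ContDiffOn ℝ ∞ (fun x => A x i j) (halfSpace d))
    (hB : ContDiffOn ℝ ∞ B (halfSpace d)) (hell : IsPElliptic p lam Lam A)
    (hrow : ∀ x ∈ halfSpace d, A x 0 0 = 1 ∧ ∀ j, (A x 0 j).im = 0)
    (hp : 1 < p) (hlam : 0 ≤ lam) (hθ : 0 < θ) (P : Profile p)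
    {ζ : Space d → ℝ} {K : ℝ≥0} (hζ : LipschitzWith K ζ) (hζ0 : ∀ x, 0 ≤ ζ x)
    (hc : HasCompactSupport ζ) (hbd : ∀ x : Space d, x 0 ≤ 0 → ζ x = 0) {R : ℝ} (hR0 : 0 ≤ R)
    (hR : ∫⁻ x in halfSpace d,
      ENNReal.ofReal (rowDensity A B x * (P.om (u x) * ‖u x‖ ^ 2) * ζ x) ≤ ENNReal.ofReal R) :
    (lam * min 2 p - 3 * θ) * (∫ x in halfSpace d, P.om (u x) * ‖G x‖ ^ 2 * ζ x) +
      (∫ x in halfSpace d, (G x 0 * P.Th (u x)).re * rd 0 ζ x) ≤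
    R / (4 * θ) + 2 * Lam * ∫ x in halfSpace d, ‖tgrad ζ x‖ * (‖G x‖ * ‖P.Th (u x)‖) := by
  set ε : ℕ → ℝ := fun n => 1 / ((n : ℝ) + 1) with hε
  have hεpos : ∀ n, 0 < ε n := fun n => by positivity
  have hε0 : Tendsto ε atTop (𝓝 0) := tendsto_one_div_add_atTop_nhds_zero_nat
  -- Subtracting ε and taking the positive part moves the support into {ζ ≥ ε}, which stays inside
  -- the half-space, and keeps the Lipschitz constant. The gradient is that of ζ where ζ > ε and
  -- zero elsewhere; where ζ = 0 the gradient of ζ vanishes too, since it is a minimum. So all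
  -- integrals converge by domination.
  set Z : ℕ → Space d → ℝ := fun n x => max (ζ x - ε n) 0 with hZ
  have hZL : ∀ n, LipschitzWith K (Z n) := fun n => by
    have h1 : LipschitzWith K (fun x => ζ x - ε n) := fun x y => by
      rw [edist_sub_right]; exact hζ x y
    exact h1.max_const 0
  have hZ0 : ∀ n x, 0 ≤ Z n x := fun n x => le_max_right _ _
  have hZle : ∀ n x, Z n x ≤ ζ x := fun n x => max_le (by linarith [hεpos n]) (hζ0 x)
  have hZt : ∀ n, tsupport (Z n) ⊆ {x | ε n ≤ ζ x} := fun n =>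
    closure_minimal (fun x hx => by
      by_contra h1
      have h2 : ¬ ε n ≤ ζ x := h1
      exact hx (max_eq_right (by linarith)))
      (isClosed_le continuous_const hζ.continuous)
  have hZs : ∀ n, tsupport (Z n) ⊆ halfSpace d := fun n x hx => by
    by_contra h1
    have h2 := hbd x (not_lt.1 h1)
    have h3 : ε n ≤ ζ x := hZt n hx
    linarith [hεpos n]
  have hZc : ∀ n, HasCompactSupport (Z n) := fun n =>
    hc.mono fun x hx h1 => hx (by simp [hZ, h1, (hεpos n).le])
  have key := fun n => hs.energy_inequality_of_tsupport hh hA hB hell hrow hp hlam hθ P (hZL n)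
    (hZ0 n) (hZc n) (hZs n) hR0 ((lintegral_mono fun x => ENNReal.ofReal_le_ofReal
      (mul_le_mul_of_nonneg_left (hZle n x) (mul_nonneg (rowDensity_nonneg x)
        (mul_nonneg (P.om_nonneg _) (by positivity))))).trans hR)
  have hev : ∀ {x}, 0 < ζ x → ∀ᶠ n in atTop, ε n < ζ x := fun hx => hε0.eventually (gt_mem_nhds hx)
  obtain ⟨M, hM⟩ := hc.exists_bound_of_continuous hζ.continuous
  have hI1 := hs.integrable_energy hh P hζ.continuous.measurable hM
  have hI2 := hs.integrable_transversal hh P 0 (measurable_rd 0 ζ) (abs_rd_le hζ 0)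
  have hI3 := hs.integrable_flux hh P (measurable_tgrad ζ).norm
    (fun x => by rw [abs_of_nonneg (norm_nonneg _)]; exact norm_tgrad_le_of_lipschitz hζ x)
  have l1 : Tendsto (fun n => ∫ x in halfSpace d, P.om (u x) * ‖G x‖ ^ 2 * Z n x) atTop
      (𝓝 (∫ x in halfSpace d, P.om (u x) * ‖G x‖ ^ 2 * ζ x)) := by
    refine tendsto_integral_of_dominated_convergence _ (fun n =>
      (hs.integrable_energy hh P (hZL n).continuous.measurable (M := M) fun x => ?_).1) hI1
      (fun n => Eventually.of_forall fun x => ?_) (Eventually.of_forall fun x => ?_)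
    · rw [abs_of_nonneg (hZ0 n x)]
      exact (hZle n x).trans ((le_abs_self _).trans (hM x))
    · have := P.om_nonneg (u x)
      rw [Real.norm_of_nonneg (mul_nonneg (by positivity) (hZ0 n x))]
      exact mul_le_mul_of_nonneg_left (hZle n x) (by positivity)
    · refine Tendsto.const_mul _ ?_
      have := ((tendsto_const_nhds (x := ζ x)).sub hε0).max (tendsto_const_nhds (x := (0 : ℝ)))
      rwa [sub_zero, max_eq_left (hζ0 x)] at this
  have l2 : Tendsto (fun n => ∫ x in halfSpace d, (G x 0 * P.Th (u x)).re * rd 0 (Z n) x) atTop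
      (𝓝 (∫ x in halfSpace d, (G x 0 * P.Th (u x)).re * rd 0 ζ x)) := by
    refine tendsto_integral_of_dominated_convergence _ (fun n =>
      (hs.integrable_transversal hh P 0 (measurable_rd 0 _) (abs_rd_le (hZL n) 0)).1) hI2.norm
      (fun n => Eventually.of_forall fun x => ?_) (Eventually.of_forall fun x => ?_)
    · simp only [hZ, rd_posPart_sub hζ.continuous]
      split_ifs
      · exact le_rfl
      · simp only [mul_zero, norm_zero]; positivity
    · simp only [hZ, rd_posPart_sub hζ.continuous]
      rcases (hζ0 x).eq_or_lt with hx | hx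
      · rw [rd_eq_zero_of_min hζ0 hx.symm]
        simp
      · refine tendsto_const_nhds.congr' ?_
        filter_upwards [hev hx] with n hn
        rw [if_pos hn]
  have l3 : Tendsto (fun n => ∫ x in halfSpace d, ‖tgrad (Z n) x‖ * (‖G x‖ * ‖P.Th (u x)‖)) atTop
      (𝓝 (∫ x in halfSpace d, ‖tgrad ζ x‖ * (‖G x‖ * ‖P.Th (u x)‖))) := by
    refine tendsto_integral_of_dominated_convergence _ (fun n =>
      (hs.integrable_flux hh P (measurable_tgrad _).norm (fun x => by
        rw [abs_of_nonneg (norm_nonneg _)]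
        exact norm_tgrad_le_of_lipschitz (hZL n) x)).1) hI3.norm
      (fun n => Eventually.of_forall fun x => ?_) (Eventually.of_forall fun x => ?_)
    · simp only [hZ, tgrad_posPart_sub hζ.continuous]
      split_ifs
      · exact le_rfl
      · simp only [norm_zero, zero_mul]; positivity
    · simp only [hZ, tgrad_posPart_sub hζ.continuous]
      rcases (hζ0 x).eq_or_lt with hx | hx
      · have : tgrad ζ x = 0 := by
          ext i
          simp [tgrad, rd_eq_zero_of_min hζ0 hx.symm]
        simp [this]
      · refine tendsto_const_nhds.congr' ?_
        filter_upwards [hev hx] with n hn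
        rw [if_pos hn]
  exact le_of_tendsto_of_tendsto' ((l1.const_mul _).add l2)
    (tendsto_const_nhds.add (l3.const_mul _)) key

end EnergyInequality

/-! ### Carleson embedding with averages. -/

section CarlesonEmbedding

variable {d : ℕ}

lemma le_carlesonNorm (μ : Measure (Space d)) (q : Bdry d) {r : ℝ} (hr : 0 < r) :
    μ (halfSpace d ∩ ball (pt 0 q) r) ≤ carlesonNorm μ * volume (ball q r) := by
  have h0 : volume (ball q r) ≠ 0 := (measure_ball_pos volume q hr).ne'
  have h1 : volume (ball q r) ≠ ⊤ := measure_ball_lt_top.ne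
  rw [← ENNReal.div_le_iff h0 h1]
  exact le_sInf fun C hC => (ENNReal.div_le_iff h0 h1).2 (hC q r hr)

lemma volume_ball_mul (q : Bdry d) (s : ℝ) {c : ℝ} (hc : 0 < c) :
    volume (ball q (c * s)) = ENNReal.ofReal (c ^ d) * volume (ball q s) := by
  rw [Measure.addHaar_ball_mul_of_pos _ _ hc, ← Measure.addHaar_ball_center volume q s]
  simp

lemma dist_pt_le (t : ℝ) (q : Bdry d) (x : Space d) :
    dist x (pt t q) ≤ |x 0 - t| + dist (tang x) q := by
  simpa using dist_le_coord_add_tang x (pt t q)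

/-- The weak-type form of the Carleson embedding: the measure of a set is controlled by the volume of
any set containing the shadows of its points. -/
lemma carleson_weak (hd : 1 ≤ d) {ν : Measure (Space d)} {N : ℝ≥0∞}
    (hN : ∀ (q : Bdry d) (r : ℝ), 0 < r →
      ν (halfSpace d ∩ ball (pt 0 q) r) ≤ N * volume (ball q r))
    {A : Set (Space d)} (hA : A ⊆ halfSpace d) {O : Set (Bdry d)}
    (hO : ∀ z ∈ A, ball (tang z) (z 0 / 100) ⊆ O) :
    ν A ≤ ENNReal.ofReal (600 ^ d) * N * volume O := by
  -- This case is separate because the volume of O may be infinite while 0 · ∞ = 0. Here ν vanishes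
  -- on all Carleson boxes, and they exhaust the half-space.
  rcases eq_or_ne N 0 with rfl | hN0
  · have h1 : ν (⋃ n : ℕ, halfSpace d ∩ ball (pt 0 0) ((n : ℝ) + 1)) = 0 :=
      measure_iUnion_null fun n => by simpa using hN 0 ((n : ℝ) + 1) (by positivity)
    refine le_of_eq_of_le (measure_mono_null (fun z hz => ?_) h1) zero_le
    obtain ⟨n, hn⟩ := exists_nat_gt (dist z (pt 0 0))
    exact mem_iUnion.2 ⟨n, hA hz, by rw [mem_ball]; linarith⟩
  rcases eq_or_ne (volume O) ⊤ with hO' | hO'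
  · rw [hO', ENNReal.mul_top]
    · exact le_top
    · exact mul_ne_zero (by simp) hN0
  have hω : volume (ball (0 : Bdry d) 1) ≠ 0 := (measure_ball_pos volume _ one_pos).ne'
  have hω' : volume (ball (0 : Bdry d) 1) ≠ ⊤ := measure_ball_lt_top.ne
  -- Vitali's lemma requires bounded radii. A shadow of radius z₀/100 inside a set of finite volume
  -- bounds (z₀/100)^d, and d ≥ 1 then bounds z₀.
  obtain ⟨R, hR⟩ : ∃ R : ℝ, ∀ z ∈ A, z 0 ≤ R := by
    refine ⟨100 * max 1 (volume O / volume (ball (0 : Bdry d) 1)).toReal, fun z hz => ?_⟩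
    have hz0 : 0 < z 0 := hA hz
    have h1 := measure_mono (μ := volume) (hO z hz)
    rw [Measure.addHaar_ball_of_pos _ _ (by positivity), finrank_euclideanSpace_fin,
      ← ENNReal.le_div_iff_mul_le (Or.inl hω) (Or.inl hω')] at h1
    have h2 := (ENNReal.ofReal_le_iff_le_toReal (ENNReal.div_ne_top hO' hω)).1 h1
    by_contra hcon
    have h3 : max 1 (volume O / volume (ball (0 : Bdry d) 1)).toReal < z 0 / 100 := by linarith
    have h4 : z 0 / 100 ≤ (z 0 / 100) ^ d :=
      le_self_pow₀ (le_of_lt ((le_max_left _ _).trans_lt h3)) (by omega)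
    linarith [le_max_right (1 : ℝ) (volume O / volume (ball (0 : Bdry d) 1)).toReal]
  obtain ⟨u, huA, hdisj, hcov⟩ := Vitali.exists_disjoint_subfamily_covering_enlargement
    (fun z : Space d => ball (tang z) (z 0 / 200)) A (fun z => z 0) 2 (by norm_num)
    (fun z hz => (hA hz).le) R hR
    (fun z hz => ⟨tang z, mem_ball_self (div_pos (hA hz) (by norm_num))⟩)
  have hucount : u.Countable := hdisj.countable_of_nonempty_interior fun z hz => by
    rw [isOpen_ball.interior_eq]
    exact ⟨tang z, mem_ball_self (div_pos (hA (huA hz)) (by norm_num))⟩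
  -- The selected b satisfies z₀ ≤ 2 b₀, and the balls of radii z₀/200 and b₀/200 meet, so z is at
  -- distance at most 2 b₀ + 3 b₀/200 from the foot of b. The ratio of 3 b₀ to b₀/200 is the
  -- constant 600.
  have hsub : A ⊆ ⋃ b ∈ u, halfSpace d ∩ ball (pt 0 (tang b)) (3 * b 0) := by
    intro z hz
    obtain ⟨b, hb, ⟨w, hw1, hw2⟩, hle⟩ := hcov z hz
    refine mem_iUnion₂.2 ⟨b, hb, hA hz, ?_⟩
    have hz0 : 0 < z 0 := hA hz
    have hb0 : 0 < b 0 := hA (huA hb)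
    rw [mem_ball] at hw1 hw2 ⊢
    have h1 := dist_pt_le 0 (tang b) z
    rw [sub_zero, abs_of_pos hz0] at h1
    have h2 := dist_triangle_left (tang z) (tang b) w
    linarith
  calc ν A ≤ ν (⋃ b ∈ u, halfSpace d ∩ ball (pt 0 (tang b)) (3 * b 0)) := measure_mono hsub
    _ ≤ ∑' b : u, ν (halfSpace d ∩ ball (pt 0 (tang (b : Space d))) (3 * (b : Space d) 0)) :=
        measure_biUnion_le ν hucount _
    _ ≤ ∑' b : u, ENNReal.ofReal (600 ^ d) * N *
          volume (ball (tang (b : Space d)) ((b : Space d) 0 / 200)) := by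
        refine ENNReal.tsum_le_tsum fun b => ?_
        have hb0 : 0 < (b : Space d) 0 := hA (huA b.2)
        refine (hN _ _ (by positivity)).trans (le_of_eq ?_)
        rw [show 3 * (b : Space d) 0 = 600 * ((b : Space d) 0 / 200) by ring,
          volume_ball_mul _ _ (by norm_num)]
        ring
    _ = ENNReal.ofReal (600 ^ d) * N * volume (⋃ b ∈ u, ball (tang b) (b 0 / 200)) := by
        rw [ENNReal.tsum_mul_left, measure_biUnion hucount hdisj fun _ _ => measurableSet_ball]
    _ ≤ ENNReal.ofReal (600 ^ d) * N * volume O := by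
        gcongr
        refine iUnion₂_subset fun b hb => (ball_subset_ball ?_).trans (hO b (huA hb))
        have hb0 : 0 < b 0 := hA (huA hb)
        linarith

lemma lintegral_eq_lintegral_superlevel {α : Type*} [MeasurableSpace α] {μ : Measure α} [SFinite μ]
    {a : α → ℝ≥0∞} (ha : Measurable a) :
    ∫⁻ z, a z ∂μ = ∫⁻ t in Ioi (0 : ℝ), μ {z | ENNReal.ofReal t < a z} := by
  have h1 : ∀ z, a z = ∫⁻ t in Ioi (0 : ℝ), {t : ℝ | ENNReal.ofReal t < a z}.indicator 1 t := by
    intro z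
    have hm : MeasurableSet {t : ℝ | ENNReal.ofReal t < a z} :=
      measurableSet_lt ENNReal.measurable_ofReal measurable_const
    rw [lintegral_indicator_one hm, Measure.restrict_apply hm]
    rcases eq_or_ne (a z) ⊤ with hz | hz
    · simp [hz]
    · have : {t : ℝ | ENNReal.ofReal t < a z} ∩ Ioi 0 = Ioo 0 (a z).toReal := by
        ext t
        simp only [mem_inter_iff, mem_ofPred_eq, mem_Ioi, mem_Ioo, and_comm (a := 0 < t)]
        refine and_congr_left fun ht => ?_
        rw [ENNReal.ofReal_lt_iff_lt_toReal ht.le hz]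
      rw [this, Real.volume_Ioo, sub_zero, ENNReal.ofReal_toReal hz]
  have hM : MeasurableSet {q : α × ℝ | ENNReal.ofReal q.2 < a q.1} :=
    measurableSet_lt (ENNReal.measurable_ofReal.comp measurable_snd) (ha.comp measurable_fst)
  calc ∫⁻ z, a z ∂μ
      = ∫⁻ z, (∫⁻ t in Ioi (0 : ℝ), {t : ℝ | ENNReal.ofReal t < a z}.indicator 1 t) ∂μ :=
        lintegral_congr h1
    _ = ∫⁻ t in Ioi (0 : ℝ), ∫⁻ z, {t : ℝ | ENNReal.ofReal t < a z}.indicator 1 t ∂μ :=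
        lintegral_lintegral_swap
          (Measurable.aemeasurable ((measurable_const (a := (1 : ℝ≥0∞))).indicator hM))
    _ = _ := by
        refine lintegral_congr fun t => ?_
        have hm : MeasurableSet {z | ENNReal.ofReal t < a z} :=
          measurableSet_lt measurable_const ha
        rw [← lintegral_indicator_one hm]
        rfl

/-- The Carleson embedding: the integral of a function is controlled by the integral of any majorant
of its values at the points whose shadow contains the given boundary point. -/
lemma carleson_embedding (hd : 1 ≤ d) {ν : Measure (Space d)} [SFinite ν] {N : ℝ≥0∞}
    (hN : ∀ (q : Bdry d) (r : ℝ), 0 < r →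
      ν (halfSpace d ∩ ball (pt 0 q) r) ≤ N * volume (ball q r))
    {a : Space d → ℝ≥0∞} (ha : Measurable a) (ha0 : ∀ z, z ∉ halfSpace d → a z = 0)
    {M : Bdry d → ℝ≥0∞} (hM : ∀ z ∈ halfSpace d, ∀ y ∈ ball (tang z) (z 0 / 100), a z ≤ M y) :
    ∫⁻ z, a z ∂ν ≤ ENNReal.ofReal (600 ^ d) * N * ∫⁻ y, M y := by
  -- M need not be measurable. The least majorant built from the shadows is a supremum of indicators
  -- of open balls, hence lower semicontinuous, and it lies below M.
  set M' : Bdry d → ℝ≥0∞ := fun y =>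
    ⨆ z : Space d, (ball (tang z) (z 0 / 100)).indicator (fun _ => a z) y with hM'
  have hM'm : Measurable M' :=
    (lowerSemicontinuous_iSup fun z => isOpen_ball.lowerSemicontinuous_indicator zero_le).measurable
  have hM'le : ∀ y, M' y ≤ M y := fun y => iSup_le fun z => by
    by_cases hy : y ∈ ball (tang z) (z 0 / 100)
    · rw [indicator_of_mem hy]
      by_cases hz : z ∈ halfSpace d
      · exact hM z hz y hy
      · rw [ha0 z hz]; exact zero_le
    · rw [indicator_of_notMem hy]; exact zero_le
  refine le_trans ?_ (mul_le_mul_right (lintegral_mono hM'le) _)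
  rw [lintegral_eq_lintegral_superlevel ha, lintegral_eq_lintegral_superlevel hM'm,
    ← lintegral_const_mul]
  · refine lintegral_mono fun t => carleson_weak hd hN (fun z hz => ?_) fun z hz y hy => ?_
    · by_contra h
      rw [mem_ofPred_eq, ha0 z h] at hz
      exact not_lt_zero hz
    · have hz' : ENNReal.ofReal t < a z := hz
      refine lt_of_lt_of_le hz' ?_
      refine le_trans ?_ (le_iSup _ z)
      rw [indicator_of_mem hy]
  -- Measurability in t of the distribution function comes from its monotonicity.
  · have hanti : Antitone fun t : ℝ => volume {y | ENNReal.ofReal t < M' y} := fun s t hst =>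
      measure_mono fun y (hy : _ < _) => lt_of_le_of_lt (ENNReal.ofReal_le_ofReal hst) hy
    exact hanti.measurable

/-- Each x is spread over the ball of radius x₀/100 about the vertically moved point (σ x₀, x').
Fubini rewrites the integral as one of κ(z) against an average of v near z, to which
`carleson_embedding` applies. The final averages are centred at (z₀, y), directly above y, and thus
see cones of any aperture. The factor σ is free: σ < 1 respects a truncation in height, σ > 1 lifts
points above a graph. -/
lemma carleson_averaging (hd : 1 ≤ d) {σ : ℝ} (hσ : 9 / 10 ≤ σ) (hσ' : σ ≤ 5 / 4)
    {E : Set (Space d)} (hE : MeasurableSet E) (hEs : E ⊆ halfSpace d) {v : Space d → ℝ≥0∞}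
    (hv : Measurable v) {K κ : Space d → ℝ≥0∞} (hκ : Measurable κ)
    (hK : ∀ x ∈ E, ∀ z ∈ ball (pt (σ * x 0) (tang x)) (x 0 / 100), K x ≤ κ z) {N : ℝ≥0∞}
    (hN : ∀ (q : Bdry d) (r : ℝ), 0 < r →
      ((volume.restrict (halfSpace d)).withDensity κ) (halfSpace d ∩ ball (pt 0 q) r) ≤
        N * volume (ball q r))
    {M : Bdry d → ℝ≥0∞}
    (hM : ∀ x ∈ E, ∀ z ∈ ball (pt (σ * x 0) (tang x)) (x 0 / 100),
      ∀ y ∈ ball (tang z) (z 0 / 100), (⨍⁻ w in ball (pt (z 0) y) (z 0 / 2), v w ∂volume) ≤ M y) :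
    ∫⁻ x in E, v x * K x ≤
      ENNReal.ofReal (126 ^ (d + 1)) * (ENNReal.ofReal (600 ^ d) * N * ∫⁻ y, M y) := by
  set W := volume (ball (0 : Space d) 1) with hW
  have hW0 : W ≠ 0 := (measure_ball_pos volume _ one_pos).ne'
  have hW1 : W ≠ ⊤ := measure_ball_lt_top.ne
  have hvol : ∀ (w : Space d) (s : ℝ), 0 < s →
      volume (ball w s) = ENNReal.ofReal (s ^ (d + 1)) * W := fun w s hs => by
    rw [Measure.addHaar_ball_of_pos _ _ hs, finrank_euclideanSpace_fin]
  set Γ : Set (Space d × Space d) :=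
    {q | q.1 ∈ E ∧ dist q.2 (pt (σ * q.1 0) (tang q.1)) < q.1 0 / 100} with hΓ
  have hcoord : ∀ {x z : Space d}, (x, z) ∈ Γ → 0 < x 0 ∧ |z 0 - σ * x 0| < x 0 / 100 ∧
      dist (tang z) (tang x) < x 0 / 100 := fun {x z} hxz => by
    refine ⟨hEs hxz.1, lt_of_le_of_lt ?_ hxz.2, lt_of_le_of_lt ?_ hxz.2⟩
    · simpa using abs_coord_sub_le z (pt (σ * x 0) (tang x)) 0
    · simpa using dist_tang_le z (pt (σ * x 0) (tang x))
  have hpos : ∀ {x z : Space d}, (x, z) ∈ Γ → 0 < z 0 ∧ z 0 ≤ 126 * (x 0 / 100) ∧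
      89 / 100 * x 0 ≤ z 0 ∧ |x 0 - z 0| ≤ 26 / 100 * x 0 := fun {x z} hxz => by
    obtain ⟨h0, h1, -⟩ := hcoord hxz
    rw [abs_lt] at h1
    have h2 : 9 / 10 * x 0 ≤ σ * x 0 := by gcongr
    have h3 : σ * x 0 ≤ 5 / 4 * x 0 := by gcongr
    exact ⟨by linarith, by linarith, by linarith, abs_le.2 ⟨by linarith, by linarith⟩⟩
  have hΓm : MeasurableSet Γ := by
    have h1 : Measurable fun q : Space d × Space d => pt (σ * q.1 0) (tang q.1) :=
      (continuous_pt.comp (((continuous_const.mul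
        ((continuous_coord 0).comp continuous_fst))).prodMk
          (continuous_tang.comp continuous_fst))).measurable
    have h2 : Measurable fun q : Space d × Space d => q.1 0 / 100 :=
      (((continuous_coord 0).comp continuous_fst).div_const _).measurable
    exact (measurable_fst hE).inter (measurableSet_lt (measurable_snd.dist h1) h2)
  have hmz : Measurable fun z : Space d => (ENNReal.ofReal (z 0 ^ (d + 1)) * W)⁻¹ :=
    ((ENNReal.measurable_ofReal.comp ((continuous_coord 0).pow _).measurable).mul_const W).inv
  set a : Space d → ℝ≥0∞ := fun z => (ENNReal.ofReal (z 0 ^ (d + 1)) * W)⁻¹ *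
    ∫⁻ x, Γ.indicator (fun q => v q.1) (x, z) with ha
  have hind : Measurable (Γ.indicator fun q : Space d × Space d => v q.1) :=
    (hv.comp measurable_fst).indicator hΓm
  have ham : Measurable a := hmz.mul hind.lintegral_prod_left'
  have hlow : ∀ x ∈ E, v x * K x ≤ ∫⁻ z, ENNReal.ofReal (126 ^ (d + 1)) *
      (κ z * ((ENNReal.ofReal (z 0 ^ (d + 1)) * W)⁻¹ *
        Γ.indicator (fun q => v q.1) (x, z))) := by
    intro x hx
    have hx0 : 0 < x 0 := hEs hx
    set D := ball (pt (σ * x 0) (tang x)) (x 0 / 100) with hD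
    have hDv : volume D = ENNReal.ofReal ((x 0 / 100) ^ (d + 1)) * W := hvol _ _ (by positivity)
    have hD0 : volume D ≠ 0 := (measure_ball_pos volume _ (by positivity)).ne'
    have hD1 : volume D ≠ ⊤ := measure_ball_lt_top.ne
    calc v x * K x = ∫⁻ _ in D, (volume D)⁻¹ * (v x * K x) := by
          rw [setLIntegral_const, mul_comm ((volume D)⁻¹), mul_assoc,
            ENNReal.inv_mul_cancel hD0 hD1, mul_one]
      _ ≤ ∫⁻ z in D, ENNReal.ofReal (126 ^ (d + 1)) *
          (κ z * ((ENNReal.ofReal (z 0 ^ (d + 1)) * W)⁻¹ *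
            Γ.indicator (fun q => v q.1) (x, z))) := by
          refine setLIntegral_mono' measurableSet_ball fun z hz => ?_
          have hxz : (x, z) ∈ Γ := ⟨hx, hz⟩
          obtain ⟨hz0, hz1, -⟩ := hpos hxz
          rw [indicator_of_mem hxz]
          -- The height z₀ is at most (5/4 + 1/100) x₀, that is, 126 times the radius x₀/100 of D.
          have h1 : (volume D)⁻¹ ≤ ENNReal.ofReal (126 ^ (d + 1)) *
              (ENNReal.ofReal (z 0 ^ (d + 1)) * W)⁻¹ := by
            rw [hDv]
            have h2 : ENNReal.ofReal (z 0 ^ (d + 1)) ≤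
                ENNReal.ofReal (126 ^ (d + 1)) * ENNReal.ofReal ((x 0 / 100) ^ (d + 1)) := by
              rw [← ENNReal.ofReal_mul (by positivity), ← mul_pow]
              gcongr
            have h3 : ENNReal.ofReal (126 ^ (d + 1)) ≠ 0 := by simp
            have h4 : ENNReal.ofReal (126 ^ (d + 1)) ≠ ⊤ := ENNReal.ofReal_ne_top
            calc _ = ENNReal.ofReal (126 ^ (d + 1)) * (ENNReal.ofReal (126 ^ (d + 1)) *
                  (ENNReal.ofReal ((x 0 / 100) ^ (d + 1)) * W))⁻¹ := by
                  rw [ENNReal.mul_inv (Or.inl h3) (Or.inl h4), ← mul_assoc,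
                    ENNReal.mul_inv_cancel h3 h4, one_mul]
              _ ≤ _ := by
                  refine mul_le_mul_right (ENNReal.inv_le_inv.2 ?_) _
                  rw [← mul_assoc]
                  exact mul_le_mul_left h2 W
          calc (volume D)⁻¹ * (v x * K x) ≤ (ENNReal.ofReal (126 ^ (d + 1)) *
              (ENNReal.ofReal (z 0 ^ (d + 1)) * W)⁻¹) * (v x * κ z) := by
                gcongr
                exact hK x hx z hz
            _ = _ := by ring
      _ ≤ _ := setLIntegral_le_lintegral _ _
  calc ∫⁻ x in E, v x * K x
      ≤ ∫⁻ x in E, ∫⁻ z, ENNReal.ofReal (126 ^ (d + 1)) *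
        (κ z * ((ENNReal.ofReal (z 0 ^ (d + 1)) * W)⁻¹ *
          Γ.indicator (fun q => v q.1) (x, z))) := setLIntegral_mono' hE hlow
    _ ≤ ∫⁻ x, ∫⁻ z, ENNReal.ofReal (126 ^ (d + 1)) *
        (κ z * ((ENNReal.ofReal (z 0 ^ (d + 1)) * W)⁻¹ *
          Γ.indicator (fun q => v q.1) (x, z))) := setLIntegral_le_lintegral _ _
    _ = ∫⁻ z, ∫⁻ x, ENNReal.ofReal (126 ^ (d + 1)) *
        (κ z * ((ENNReal.ofReal (z 0 ^ (d + 1)) * W)⁻¹ *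
          Γ.indicator (fun q => v q.1) (x, z))) :=
        lintegral_lintegral_swap (Measurable.aemeasurable
          (((hκ.comp measurable_snd).mul ((hmz.comp measurable_snd).mul hind)).const_mul _))
    _ = ∫⁻ z, ENNReal.ofReal (126 ^ (d + 1)) * (κ z * a z) := by
        refine lintegral_congr fun z => ?_
        have hm : Measurable fun x => Γ.indicator (fun q => v q.1) (x, z) :=
          hind.comp measurable_prodMk_right
        rw [lintegral_const_mul _ ((hm.const_mul _).const_mul _),
          lintegral_const_mul _ (hm.const_mul _), lintegral_const_mul _ hm]
    _ = ENNReal.ofReal (126 ^ (d + 1)) * ∫⁻ z, κ z * a z :=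
        lintegral_const_mul _ (hκ.mul ham)
    _ = ENNReal.ofReal (126 ^ (d + 1)) *
        ∫⁻ z, a z ∂((volume.restrict (halfSpace d)).withDensity κ) := by
        rw [lintegral_withDensity_eq_lintegral_mul _ hκ ham,
          ← lintegral_indicator measurableSet_halfSpace]
        congr 1
        refine lintegral_congr fun z => ?_
        by_cases hz : z ∈ halfSpace d
        · rw [indicator_of_mem hz]; rfl
        · have h0 : ∀ x, Γ.indicator (fun q => v q.1) (x, z) = 0 := fun x =>
            indicator_of_notMem (fun hxz => hz (hpos hxz).1) _
          rw [indicator_of_notMem hz, ha]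
          simp [h0]
    _ ≤ _ := by
        refine mul_le_mul_right (carleson_embedding hd hN ham (fun z hz => ?_)
          fun z hz y hy => ?_) _
        · have h0 : ∀ x, Γ.indicator (fun q => v q.1) (x, z) = 0 := fun x =>
            indicator_of_notMem (fun hxz => hz (hpos hxz).1) _
          simp [ha, h0]
        · have hz0 : 0 < z 0 := hz
          by_cases hex : ∃ x, (x, z) ∈ Γ
          · obtain ⟨x, hxz⟩ := hex
            refine le_trans ?_ (hM x hxz.1 z hxz.2 y hy)
            rw [setLAverage_eq, div_eq_mul_inv, mul_comm, ha]
            refine mul_le_mul' ?_ ?_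
            · rw [ENNReal.inv_le_inv, hvol _ _ (by positivity)]
              gcongr
              linarith
            · rw [← lintegral_indicator measurableSet_ball]
              -- Every x' spread onto z is within 0.26 x'₀ + 0.01 x'₀ + 0.01 z₀ of (z₀, y). This is
              -- less than z₀/2, as z₀ ≥ 0.89 x'₀.
              refine lintegral_mono fun x' => ?_
              by_cases hx' : (x', z) ∈ Γ
              · rw [indicator_of_mem hx', indicator_of_mem]
                obtain ⟨h0, -, h2⟩ := hcoord hx'
                obtain ⟨-, -, h3, h4⟩ := hpos hx'
                have h5 := dist_pt_le (z 0) y x'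
                have h6 := dist_triangle4 (tang x') (tang z) (tang z) y
                rw [dist_self, add_zero] at h6
                rw [mem_ball] at hy ⊢
                rw [dist_comm] at hy h2
                linarith
              · rw [indicator_of_notMem hx']; exact zero_le
          · have h0 : ∀ x, Γ.indicator (fun q => v q.1) (x, z) = 0 := fun x =>
              indicator_of_notMem (fun hxz => hex ⟨x, hxz⟩) _
            simp [ha, h0]

end CarlesonEmbedding

/-! ### Absolute continuity and integration by parts on vertical lines. -/

section SliceCalculus

-- An increment of φ ∘ g is at most K times the sum of the increments of the real and imaginary
-- parts of g.
open AbsolutelyContinuousOnInterval in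
lemma absolutelyContinuous_comp_of_lipschitzOn {φ : ℂ → ℝ} {g : ℝ → ℂ} {a b : ℝ} {K : ℝ≥0}
    (hφ : LipschitzOnWith K φ (g '' uIcc a b))
    (hre : AbsolutelyContinuousOnInterval (fun t => (g t).re) a b)
    (him : AbsolutelyContinuousOnInterval (fun t => (g t).im) a b) :
    AbsolutelyContinuousOnInterval (fun t => φ (g t)) a b := by
  have h1 := (Tendsto.add hre him).const_mul (K : ℝ)
  rw [add_zero, mul_zero] at h1
  refine squeeze_zero' (Eventually.of_forall fun E => Finset.sum_nonneg fun _ _ => dist_nonneg) ?_ h1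
  have h2 : ∀ᶠ E in totalLengthFilter ⊓ 𝓟 (disjWithin a b), E ∈ disjWithin a b :=
    mem_inf_of_right (mem_principal_self _)
  filter_upwards [h2] with E hE
  rw [← Finset.sum_add_distrib, Finset.mul_sum]
  refine Finset.sum_le_sum fun i hi => ?_
  obtain ⟨hi1, hi2⟩ := hE.1 i hi
  refine (hφ.dist_le_mul _ (mem_image_of_mem g hi1) _ (mem_image_of_mem g hi2)).trans ?_
  gcongr
  rw [dist_eq_norm, Real.dist_eq, Real.dist_eq, ← Complex.sub_re, ← Complex.sub_im]
  exact Complex.norm_le_abs_re_add_abs_im _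

variable {d : ℕ} {p : ℝ} {h : ℝ} {A : Space d → Matrix (Fin (d + 1)) (Fin (d + 1)) ℂ}
    {B : Space d → EuclideanSpace ℂ (Fin (d + 1))} {f : Bdry d → ℂ} {u : Space d → ℂ}
    {G : Space d → EuclideanSpace ℂ (Fin (d + 1))}

/-- Integration by parts on almost every vertical line. -/
lemma IsEnergySolution.slice_integral (hs : IsEnergySolution h A B f u G) (hh : 0 < h)
    (P : Profile p) : ∀ᵐ y : Bdry d, ∀ a b : ℝ, 0 ≤ a → a ≤ b → ∀ χ : ℝ → ℝ,
      AbsolutelyContinuousOnInterval χ a b →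
      ∫ t in a..b, χ t * (p * (G (pt t y) 0 * P.Th (u (pt t y))).re) =
        χ b * P.V (u (pt b y)) - χ a * P.V (u (pt a y)) -
          ∫ t in a..b, deriv χ t * P.V (u (pt t y)) := by
  filter_upwards [hs.slice hh] with y ⟨hG, hy⟩ a b ha hab χ hχ
  set g : ℝ → ℂ := fun t => f y + ∫ s in (0 : ℝ)..t, G (pt s y) 0 with hg
  have hgi := intervalIntegrable_of_memLp hG le_rfl (ha.trans hab)
  have hac : ∀ L : ℂ →L[ℝ] ℝ, AbsolutelyContinuousOnInterval (fun t => L (g t)) a b := by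
    intro L
    have h1 : IntervalIntegrable (fun s => L (G (pt s y) 0)) volume 0 b :=
      ⟨L.integrable_comp hgi.1, L.integrable_comp hgi.2⟩
    have h2 := (h1.absolutelyContinuousOnInterval_intervalIntegral (c := 0) (by simp)).mono
      (c := a) (d := b) (by
        rw [uIcc_of_le hab, uIcc_of_le (ha.trans hab)]
        exact Icc_subset_Icc_left ha)
    have h3 : LipschitzOnWith 0 (fun _ : ℝ => L (f y)) (uIcc a b) :=
      (LipschitzWith.const _).lipschitzOnWith
    have h4 := h3.absolutelyContinuousOnInterval.add h2
    have h5 : ∀ t ∈ uIcc a b, L (g t) = L (f y) + ∫ s in (0 : ℝ)..t, L (G (pt s y) 0) := by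
      intro t ht
      rw [uIcc_of_le hab] at ht
      have h6 := intervalIntegrable_of_memLp hG le_rfl (ha.trans ht.1)
      rw [hg, map_add, L.intervalIntegral_comp_comm h6]
    rw [absolutelyContinuousOnInterval_iff] at h4 ⊢
    intro ε hε
    obtain ⟨δ, hδ, h7⟩ := h4 ε hε
    refine ⟨δ, hδ, fun E hE hlt => lt_of_eq_of_lt ?_ (h7 E hE hlt)⟩
    refine Finset.sum_congr rfl fun i hi => ?_
    rw [h5 _ (hE.1 i hi).1, h5 _ (hE.1 i hi).2]
    rfl
  have hre := hac Complex.reCLM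
  have him := hac Complex.imCLM
  have hgc : ContinuousOn g (uIcc a b) := by
    have : g = fun t => ((g t).re : ℂ) + (g t).im * Complex.I := funext fun t =>
      (Complex.re_add_im (g t)).symm
    rw [this]
    exact (Complex.continuous_ofReal.comp_continuousOn hre.continuousOn).add
      ((Complex.continuous_ofReal.comp_continuousOn him.continuousOn).mul continuousOn_const)
  obtain ⟨K, hK⟩ := (P.contDiff_V.locallyLipschitz.locallyLipschitzOn (s := g '' uIcc a b)
    ).exists_lipschitzOnWith_of_compact (isCompact_uIcc.image_of_continuousOn hgc)
  have hW := absolutelyContinuous_comp_of_lipschitzOn hK hre him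
  -- Chain rule at the points where the primitive of the transversal derivative is differentiable,
  -- which are almost all by Lebesgue's theorem.
  have hder : ∀ᵐ t : ℝ, t ∈ uIoc a b →
      deriv (fun t => P.V (g t)) t = p * (G (pt t y) 0 * P.Th (u (pt t y))).re := by
    filter_upwards [hgi.ae_hasDerivAt_integral] with t ht hmem
    rw [uIoc_of_le hab] at hmem
    have h1 : t ∈ uIcc 0 b := by
      rw [uIcc_of_le (ha.trans hab)]
      exact ⟨(ha.trans_lt hmem.1).le, hmem.2⟩
    have h2 : HasDerivAt g (G (pt t y) 0) t := (ht h1 0 (by simp)).const_add _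
    have h3 := (P.hasFDerivAt_V (g t)).comp_hasDerivAt t h2
    have h4 : HasDerivAt (fun t => P.V (g t)) _ t := h3
    rw [h4.deriv, P.fderiv_V_apply, hy t (ha.trans hmem.1.le)]
  have e1 := hχ.integral_mul_deriv_eq_deriv_mul hW
  have e2 : ∫ t in a..b, χ t * deriv (fun t => P.V (g t)) t =
      ∫ t in a..b, χ t * (p * (G (pt t y) 0 * P.Th (u (pt t y))).re) := by
    refine intervalIntegral.integral_congr_ae ?_
    filter_upwards [hder] with t ht hmem
    rw [ht hmem]
  have e3 : ∫ t in a..b, deriv χ t * P.V (g t) = ∫ t in a..b, deriv χ t * P.V (u (pt t y)) := by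
    refine intervalIntegral.integral_congr fun t ht => ?_
    rw [uIcc_of_le hab] at ht
    simp only [hg, hy t (ha.trans ht.1)]
  rw [e2, e3] at e1
  rw [e1, hy a ha, hy b (ha.trans hab)]

lemma integral_halfSpace {F : Space d → ℝ} (hF : IntegrableOn F (halfSpace d)) :
    ∫ x in halfSpace d, F x = ∫ y : Bdry d, ∫ t in Ioi (0 : ℝ), F (pt t y) := by
  rw [← integral_indicator measurableSet_halfSpace,
    integral_space ((integrable_indicator_iff measurableSet_halfSpace).2 hF)]
  refine integral_congr_ae (Eventually.of_forall fun y => ?_)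
  simp only
  rw [← integral_indicator measurableSet_Ioi]
  refine integral_congr_ae (Eventually.of_forall fun t => ?_)
  by_cases ht : 0 < t <;> simp [indicator, halfSpace, ht]

lemma integrable_integral_halfSpace {F : Space d → ℝ} (hF : IntegrableOn F (halfSpace d)) :
    Integrable fun y : Bdry d => ∫ t in Ioi (0 : ℝ), F (pt t y) := by
  have h1 := (integrable_indicator_iff measurableSet_halfSpace).2 hF
  have h2 := (integrable_comp_pt h1).integral_prod_right
  refine h2.congr (Eventually.of_forall fun y => ?_)
  simp only
  rw [← integral_indicator measurableSet_Ioi]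
  refine integral_congr_ae (Eventually.of_forall fun t => ?_)
  by_cases ht : 0 < t <;> simp [indicator, halfSpace, ht]

lemma integrable_V_of_memLp {α : Type*} [MeasurableSpace α] {μ : Measure α} (hp : 0 ≤ p)
    (P : Profile p) {g : α → ℂ} (hg : MemLp g 2 μ) : Integrable (fun x => P.V (g x)) μ := by
  refine (hg.norm.integrable_sq.const_mul (p / 2 * P.K)).mono'
    (P.continuous_V.comp_aestronglyMeasurable hg.aestronglyMeasurable)
    (Eventually.of_forall fun x => ?_)
  rw [Real.norm_of_nonneg (P.V_nonneg hp _)]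
  exact P.V_le_sq hp _

/-- The derivative of the parabolic profile `t (1 - t / r)` on `[0, r]`, extended by zero. -/
def capDeriv (r t : ℝ) : ℝ := if t < r then 1 - 2 * t / r else 0

lemma measurable_capDeriv (r : ℝ) : Measurable (capDeriv r) :=
  Measurable.ite measurableSet_Iio (by fun_prop) measurable_const

/-- The factor 1 - 2t/r is 1 at t = 0 and -1 at t = r, so both boundary terms come out with a minus
sign. Its constant slope -2/r produces the bulk term. -/
lemma IsEnergySolution.integral_capDeriv (hs : IsEnergySolution h A B f u G) (hh : 0 < h)
    (hp : 0 ≤ p) (P : Profile p) {r : ℝ} (hr : 0 < r)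
    (hI : IntegrableOn (fun x => p * (G x 0 * P.Th (u x)).re * capDeriv r (x 0)) (halfSpace d)) :
    ∫ x in halfSpace d, p * (G x 0 * P.Th (u x)).re * capDeriv r (x 0) =
      2 / r * (∫ x in {x : Space d | 0 < x 0 ∧ x 0 ≤ r}, P.V (u x)) -
        (∫ y, P.V (u (pt 0 y))) - ∫ y, P.V (u (pt r y)) := by
  set E : Set (Space d) := {x | 0 < x 0 ∧ x 0 ≤ r} with hE
  have hEm : MeasurableSet E := (measurableSet_halfSpace).inter
    (isClosed_le (continuous_coord 0) continuous_const).measurableSet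
  have hEs : E ⊆ halfSpace d := fun x hx => hx.1
  have hV : IntegrableOn (fun x => P.V (u x)) (halfSpace d) :=
    integrable_V_of_memLp hp P (hs.memLp_u hh)
  have hVE : IntegrableOn (E.indicator fun x => P.V (u x)) (halfSpace d) :=
    hV.indicator hEm
  have hV0 := integrable_V_of_memLp hp P (hs.memLp_level hh le_rfl)
  have hVr := integrable_V_of_memLp hp P (hs.memLp_level hh hr.le)
  have hin : ∀ y : Bdry d, ∫ t in Ioi (0 : ℝ), E.indicator (fun x => P.V (u x)) (pt t y) =
      ∫ t in (0 : ℝ)..r, P.V (u (pt t y)) := fun y => by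
    rw [intervalIntegral.integral_of_le hr.le, ← integral_indicator measurableSet_Ioi,
      ← integral_indicator measurableSet_Ioc]
    refine integral_congr_ae (Eventually.of_forall fun t => ?_)
    by_cases h1 : 0 < t <;> by_cases h2 : t ≤ r <;> simp [indicator, hE, h1, h2]
  have e1 : ∫ x in E, P.V (u x) = ∫ y, ∫ t in (0 : ℝ)..r, P.V (u (pt t y)) := by
    rw [← integral_indicator hEm]
    have : ∫ x, E.indicator (fun x => P.V (u x)) x =
        ∫ x in halfSpace d, E.indicator (fun x => P.V (u x)) x :=
      (setIntegral_eq_integral_of_forall_compl_eq_zero fun x hx =>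
        indicator_of_notMem (fun h => hx (hEs h)) _).symm
    rw [this, integral_halfSpace hVE]
    exact integral_congr_ae (Eventually.of_forall hin)
  have hJ : Integrable fun y : Bdry d => ∫ t in (0 : ℝ)..r, P.V (u (pt t y)) :=
    (integrable_integral_halfSpace hVE).congr (Eventually.of_forall hin)
  have hJ2 := (hJ.const_mul (2 / r)).sub hV0
  rw [integral_halfSpace hI, e1, ← integral_const_mul, ← integral_sub (hJ.const_mul _) hV0,
    ← integral_sub (by exact hJ2) hVr]
  refine integral_congr_ae ?_
  filter_upwards [hs.slice_integral hh P] with y hy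
  have hd : ∀ t, HasDerivAt (fun t : ℝ => 1 - 2 * t / r) (-(2 / r)) t := fun t => by
    have := (((hasDerivAt_id t).const_mul 2).div_const r).const_sub 1
    simpa using this
  have hχ : AbsolutelyContinuousOnInterval (fun t : ℝ => 1 - 2 * t / r) 0 r :=
    ContDiffOn.absolutelyContinuousOnInterval (by fun_prop)
  have h1 := hy 0 r le_rfl hr.le _ hχ
  have h2 : deriv (fun t : ℝ => 1 - 2 * t / r) = fun _ => -(2 / r) := funext fun t => (hd t).deriv
  rw [h2, intervalIntegral.integral_const_mul] at h1
  have h3 : ∫ t in Ioi (0 : ℝ), p * (G (pt t y) 0 * P.Th (u (pt t y))).re *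
      capDeriv r ((pt t y : Space d) 0) =
      ∫ t in (0 : ℝ)..r, (1 - 2 * t / r) * (p * (G (pt t y) 0 * P.Th (u (pt t y))).re) := by
    rw [intervalIntegral.integral_of_le hr.le, integral_Ioc_eq_integral_Ioo,
      ← integral_indicator measurableSet_Ioi, ← integral_indicator measurableSet_Ioo]
    refine integral_congr_ae (Eventually.of_forall fun t => ?_)
    by_cases h1 : 0 < t <;> by_cases h2 : t < r <;> simp [indicator, capDeriv, h1, h2, mul_comm]
  rw [h3, h1]
  have h4 : (2 : ℝ) * r / r = 2 := by field_simp
  simp only [h4, mul_zero, zero_div]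
  ring

end SliceCalculus

/-! ### Carleson bounds for the coefficient measures. -/

section CarlesonDensity

variable {d : ℕ}

/-- No regularity of F is needed: for fixed y the set of x with y in B(x, x₀/2) is open, so the
function is a supremum of lower semicontinuous ones. -/
lemma measurable_supDensity (F : Space d → ℝ≥0∞) :
    Measurable fun x : Space d => ⨆ y ∈ ball x (x 0 / 2), F y := by
  have h1 : (fun x : Space d => ⨆ y ∈ ball x (x 0 / 2), F y) = fun x => ⨆ y,
      {x : Space d | dist y x < x 0 / 2}.indicator (fun _ => F y) x := by
    funext x
    refine iSup_congr fun y => ?_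
    by_cases hy : dist y x < x 0 / 2
    · rw [indicator_of_mem (by exact hy)]
      simp [mem_ball, hy]
    · rw [indicator_of_notMem (by exact hy)]
      simp [mem_ball, hy]
  rw [h1]
  refine (lowerSemicontinuous_iSup fun y =>
    IsOpen.lowerSemicontinuous_indicator ?_ zero_le).measurable
  exact isOpen_lt (by fun_prop) ((continuous_coord 0).div_const _)

/-- The constant of the Carleson estimates for averages. -/
def carlesonConst (d : ℕ) : ℝ := 126 ^ (d + 1) * 600 ^ d

lemma carlesonConst_pos : 0 < carlesonConst d := by unfold carlesonConst; positivity

lemma carleson_averaging' (hd : 1 ≤ d) {σ : ℝ} (hσ : 9 / 10 ≤ σ) (hσ' : σ ≤ 5 / 4)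
    {E : Set (Space d)} (hE : MeasurableSet E) (hEs : E ⊆ halfSpace d) {v : Space d → ℝ≥0∞}
    (hv : Measurable v) {K κ : Space d → ℝ≥0∞} (hκ : Measurable κ)
    (hK : ∀ x ∈ E, ∀ z ∈ ball (pt (σ * x 0) (tang x)) (x 0 / 100), K x ≤ κ z) {N : ℝ≥0∞}
    (hN : ∀ (q : Bdry d) (r : ℝ), 0 < r →
      ((volume.restrict (halfSpace d)).withDensity κ) (halfSpace d ∩ ball (pt 0 q) r) ≤
        N * volume (ball q r))
    {M : Bdry d → ℝ≥0∞}
    (hM : ∀ x ∈ E, ∀ z ∈ ball (pt (σ * x 0) (tang x)) (x 0 / 100),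
      ∀ y ∈ ball (tang z) (z 0 / 100), (⨍⁻ w in ball (pt (z 0) y) (z 0 / 2), v w ∂volume) ≤ M y) :
    ∫⁻ x in E, v x * K x ≤ ENNReal.ofReal (carlesonConst d) * N * ∫⁻ y, M y := by
  refine (carleson_averaging hd hσ hσ' hE hEs hv hκ hK hN hM).trans (le_of_eq ?_)
  rw [carlesonConst, ENNReal.ofReal_mul (by positivity)]
  ring

/-- Coordinates of a point near the vertical translate of `x`. -/
lemma coord_of_mem_ball {σ : ℝ} (hσ : 9 / 10 ≤ σ) (hσ' : σ ≤ 5 / 4) {x z : Space d}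
    (hx : 0 < x 0) (hz : z ∈ ball (pt (σ * x 0) (tang x)) (x 0 / 100)) :
    |z 0 - σ * x 0| < x 0 / 100 ∧ dist (tang z) (tang x) < x 0 / 100 ∧
      89 / 100 * x 0 ≤ z 0 ∧ z 0 ≤ 126 / 100 * x 0 := by
  have h1 : |z 0 - σ * x 0| < x 0 / 100 := lt_of_le_of_lt
    (by simpa using abs_coord_sub_le z (pt (σ * x 0) (tang x)) 0) (mem_ball.1 hz)
  have h2 : dist (tang z) (tang x) < x 0 / 100 := lt_of_le_of_lt
    (by simpa using dist_tang_le z (pt (σ * x 0) (tang x))) (mem_ball.1 hz)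
  have h3 : 9 / 10 * x 0 ≤ σ * x 0 := by gcongr
  have h4 : σ * x 0 ≤ 5 / 4 * x 0 := by gcongr
  obtain ⟨h5, h6⟩ := abs_lt.1 h1
  exact ⟨h1, h2, by linarith, by linarith⟩

/-- This is where the supremum in the Carleson density is used: x lies in B(z, z₀/2) for every z
onto which it is spread, so F x is below the supremum at z. The factor 2 comes from x₀ ≤ 2 z₀. -/
lemma carleson_supMeasure (hd : 1 ≤ d) {σ : ℝ} (hσ : 9 / 10 ≤ σ) (hσ' : σ ≤ 5 / 4)
    {E : Set (Space d)} (hE : MeasurableSet E) (hEs : E ⊆ halfSpace d) {v : Space d → ℝ≥0∞}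
    (hv : Measurable v) (F : Space d → ℝ≥0∞) {M : Bdry d → ℝ≥0∞}
    (hM : ∀ x ∈ E, ∀ z ∈ ball (pt (σ * x 0) (tang x)) (x 0 / 100),
      ∀ y ∈ ball (tang z) (z 0 / 100), (⨍⁻ w in ball (pt (z 0) y) (z 0 / 2), v w ∂volume) ≤ M y) :
    ∫⁻ x in E, v x * (F x * ENNReal.ofReal (x 0)) ≤
      ENNReal.ofReal (carlesonConst d) * (2 * carlesonNorm (supMeasure F)) * ∫⁻ y, M y := by
  have hm : Measurable fun x : Space d =>
      (⨆ y ∈ ball x (x 0 / 2), F y) * ENNReal.ofReal (x 0) :=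
    (measurable_supDensity F).mul (ENNReal.measurable_ofReal.comp (continuous_coord 0).measurable)
  refine carleson_averaging' hd hσ hσ' hE hEs hv
    (κ := (2 : ℝ≥0∞) • fun x => (⨆ y ∈ ball x (x 0 / 2), F y) * ENNReal.ofReal (x 0))
    (hm.const_smul _) (fun x hx z hz => ?_) (fun q r hr => ?_) hM
  · have hx0 : 0 < x 0 := hEs hx
    obtain ⟨h1, h2, h3, h4⟩ := coord_of_mem_ball hσ hσ' hx0 hz
    have h5 : x ∈ ball z (z 0 / 2) := by
      rw [mem_ball]
      refine (dist_le_coord_add_tang x z).trans_lt ?_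
      rw [dist_comm (tang x)]
      have h6 : |x 0 - z 0| ≤ 26 / 100 * x 0 := by
        obtain ⟨h5, h6⟩ := abs_lt.1 h1
        have h7 : 9 / 10 * x 0 ≤ σ * x 0 := by gcongr
        have h8 : σ * x 0 ≤ 5 / 4 * x 0 := by gcongr
        exact abs_le.2 ⟨by linarith, by linarith⟩
      linarith
    calc F x * ENNReal.ofReal (x 0)
        ≤ (⨆ y ∈ ball z (z 0 / 2), F y) * (2 * ENNReal.ofReal (z 0)) := by
          gcongr
          · exact le_iSup₂_of_le x h5 le_rfl
          · calc ENNReal.ofReal (x 0) ≤ ENNReal.ofReal (2 * z 0) :=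
                  ENNReal.ofReal_le_ofReal (by linarith)
              _ = _ := by rw [ENNReal.ofReal_mul (by norm_num), ENNReal.ofReal_ofNat]
      _ = _ := by rw [Pi.smul_apply, smul_eq_mul]; ring
  · rw [withDensity_smul _ hm, Measure.smul_apply, smul_eq_mul, mul_assoc]
    gcongr
    exact le_carlesonNorm (supMeasure F) q hr

/-- The density of `muRow`. -/
def rowDensityENN (A : Space d → Matrix (Fin (d + 1)) (Fin (d + 1)) ℂ)
    (B : Space d → EuclideanSpace ℂ (Fin (d + 1))) (y : Space d) : ℝ≥0∞ :=
  (∑ j, ‖pd 0 (fun z => A z 0 j) y‖ₑ ^ 2) + ‖∑ j, pd j (fun z => A z 0 j) y‖ₑ ^ 2 + ‖B y‖ₑ ^ 2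

lemma enorm_sq_eq {E : Type*} [SeminormedAddCommGroup E] (x : E) :
    ‖x‖ₑ ^ 2 = ENNReal.ofReal (‖x‖ ^ 2) := by
  rw [← ofReal_norm, ENNReal.ofReal_pow (norm_nonneg _)]

variable {A : Space d → Matrix (Fin (d + 1)) (Fin (d + 1)) ℂ}
    {B : Space d → EuclideanSpace ℂ (Fin (d + 1))}

lemma ofReal_rowDensity (x : Space d) :
    ENNReal.ofReal (rowDensity A B x) = rowDensityENN A B x := by
  unfold rowDensity rowDensityENN
  rw [ENNReal.ofReal_add (by positivity) (by positivity),
    ENNReal.ofReal_add (by positivity) (by positivity),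
    ENNReal.ofReal_sum_of_nonneg fun _ _ => by positivity]
  simp only [enorm_sq_eq]

lemma muRow_eq : muRow A B = supMeasure (rowDensityENN A B) := rfl

lemma carlesonNorm_le {μ : Measure (Space d)} {N : ℝ≥0∞} (hN : ∀ (q : Bdry d) (r : ℝ), 0 < r →
    μ (halfSpace d ∩ ball (pt 0 q) r) ≤ N * volume (ball q r)) : carlesonNorm μ ≤ N :=
  sInf_le hN

lemma carlesonNorm_supMeasure_le {F F' : Space d → ℝ≥0∞} {c : ℝ≥0∞}
    (h : ∀ x, F x ≤ c * F' x) :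
    carlesonNorm (supMeasure F) ≤ c * carlesonNorm (supMeasure F') := by
  have hm : Measurable fun x : Space d =>
      (⨆ y ∈ ball x (x 0 / 2), F' y) * ENNReal.ofReal (x 0) :=
    (measurable_supDensity F').mul (ENNReal.measurable_ofReal.comp (continuous_coord 0).measurable)
  have h1 : supMeasure F ≤ c • supMeasure F' := by
    unfold supMeasure
    rw [← withDensity_smul _ hm]
    refine withDensity_mono (Eventually.of_forall fun x => ?_)
    simp only [Pi.smul_apply, smul_eq_mul]
    rw [← mul_assoc]
    gcongr
    refine iSup₂_le fun y hy => (h y).trans ?_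
    gcongr
    exact le_iSup₂_of_le y hy le_rfl
  refine carlesonNorm_le fun q r hr => (h1 _).trans ?_
  rw [Measure.smul_apply, smul_eq_mul, mul_assoc]
  gcongr
  exact le_carlesonNorm _ q hr

/-- Cauchy-Schwarz on the d + 1 terms of the row divergence costs d + 1, and the transversal
derivatives of the row add one more. -/
lemma carlesonNorm_muRow_le : carlesonNorm (muRow A B) ≤ (d + 2 : ℕ) * carlesonNorm (muFull A B) := by
  refine carlesonNorm_supMeasure_le fun x => ?_
  have hle : (∑ j, ‖pd 0 (fun z => A z 0 j) x‖ ^ 2) + ‖∑ j, pd j (fun z => A z 0 j) x‖ ^ 2 +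
      ‖B x‖ ^ 2 ≤ (d + 2 : ℕ) * ((∑ i, ∑ j, ∑ k, ‖pd k (fun z => A z i j) x‖ ^ 2) + ‖B x‖ ^ 2) := by
    set T := ∑ i, ∑ j, ∑ k, ‖pd k (fun z => A z i j) x‖ ^ 2 with hT
    have h0 : ∑ j, ∑ k, ‖pd k (fun z => A z 0 j) x‖ ^ 2 ≤ T :=
      Finset.single_le_sum (f := fun i => ∑ j, ∑ k, ‖pd k (fun z => A z i j) x‖ ^ 2)
        (fun i _ => Finset.sum_nonneg fun j _ => Finset.sum_nonneg fun k _ => by positivity)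
        (Finset.mem_univ 0)
    have hk : ∀ κ : Fin (d + 1) → Fin (d + 1),
        ∑ j, ‖pd (κ j) (fun z => A z 0 j) x‖ ^ 2 ≤ T := fun κ => by
      refine le_trans (Finset.sum_le_sum fun j _ => ?_) h0
      exact Finset.single_le_sum (f := fun k => ‖pd k (fun z => A z 0 j) x‖ ^ 2)
        (fun k _ => by positivity) (Finset.mem_univ (κ j))
    have h1 := hk fun _ => 0
    have h2 : ‖∑ j, pd j (fun z => A z 0 j) x‖ ^ 2 ≤ (d + 1) * T := by
      calc _ ≤ (∑ j, ‖pd j (fun z => A z 0 j) x‖) ^ 2 := by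
            gcongr; exact norm_sum_le _ _
        _ ≤ (Finset.univ : Finset (Fin (d + 1))).card * ∑ j, ‖pd j (fun z => A z 0 j) x‖ ^ 2 :=
            sq_sum_le_card_mul_sum_sq
        _ ≤ _ := by
            simp only [Finset.card_univ, Fintype.card_fin, Nat.cast_add, Nat.cast_one]
            gcongr
            exact hk id
    have h3 : (0 : ℝ) ≤ d * ‖B x‖ ^ 2 := by positivity
    have h4 : 0 ≤ ‖B x‖ ^ 2 := by positivity
    push_cast
    nlinarith
  have h1 := ENNReal.ofReal_le_ofReal hle
  rw [ENNReal.ofReal_mul (by positivity), ENNReal.ofReal_natCast] at h1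
  refine le_trans (le_of_eq ?_) (h1.trans (le_of_eq ?_))
  · exact (ofReal_rowDensity (A := A) (B := B) x).symm
  · congr 1
    rw [ENNReal.ofReal_add (by positivity) (by positivity),
      ENNReal.ofReal_sum_of_nonneg fun _ _ => by positivity]
    simp only [enorm_sq_eq]
    congr 1
    refine Finset.sum_congr rfl fun i _ => ?_
    rw [ENNReal.ofReal_sum_of_nonneg fun _ _ => by positivity]
    refine Finset.sum_congr rfl fun j _ => ?_
    rw [ENNReal.ofReal_sum_of_nonneg fun _ _ => by positivity]

end CarlesonDensity

/-! ### Averages of |u|^p below the nontangential maximal function. -/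

section MaximalFunction

variable {d : ℕ} {p h : ℝ} {A : Space d → Matrix (Fin (d + 1)) (Fin (d + 1)) ℂ}
    {B : Space d → EuclideanSpace ℂ (Fin (d + 1))} {f : Bdry d → ℂ} {u : Space d → ℂ}
    {G : Space d → EuclideanSpace ℂ (Fin (d + 1))}

/-- The `p`-th power of the modulus, cut off outside the strip. -/
def powDensity (p h : ℝ) (u : Space d → ℂ) (x : Space d) : ℝ≥0∞ :=
  ‖(strip d h).indicator u x‖ₑ ^ p

lemma IsEnergySolution.measurable_powDensity (hs : IsEnergySolution h A B f u G) :
    Measurable (powDensity p h u) := by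
  have h1 : Measurable ((strip d h).indicator u) := by
    classical
    rw [← piecewise_eq_indicator]
    exact hs.continuousOn.measurable_piecewise continuousOn_const (isOpen_strip h).measurableSet
  exact h1.enorm.pow_const p

lemma IsEnergySolution.powDensity_eq (hs : IsEnergySolution h A B f u G) {x : Space d}
    (hx : x ∈ halfSpace d) : powDensity p h u x = ‖u x‖ₑ ^ p := by
  unfold powDensity
  by_cases hx' : x ∈ strip d h
  · rw [indicator_of_mem hx']
  · rw [indicator_of_notMem hx', hs.eq_zero x (not_lt.1 fun h => hx' ⟨hx, h⟩)]

lemma IsEnergySolution.lpAverage_rpow (hs : IsEnergySolution h A B f u G) (hp : 0 < p)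
    {w : Space d} (hw : w ∈ halfSpace d) :
    lpAverage p u w ^ p = ⨍⁻ z in ball w (w 0 / 2), powDensity p h u z ∂volume := by
  unfold lpAverage
  rw [← ENNReal.rpow_mul, one_div_mul_cancel hp.ne', ENNReal.rpow_one]
  rw [setLAverage_eq, setLAverage_eq]
  congr 1
  refine setLIntegral_congr_fun measurableSet_ball fun z hz => (hs.powDensity_eq ?_).symm
  have h1 := (abs_coord_sub_le z w 0).trans_lt (mem_ball.1 hz)
  have hw0 : 0 < w 0 := hw
  have h2 := (abs_lt.1 h1).1
  show 0 < z 0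
  linarith

/-- A point vertically above the vertex has zero tangential displacement, so it lies in the cone for
every a > 0. -/
lemma IsEnergySolution.average_le_ntMaxTrunc (hs : IsEnergySolution h A B f u G) (hp : 0 < p)
    {a : ℝ} (ha : 0 < a) {g : Bdry d → ℝ} {r t : ℝ} {y : Bdry d} (ht : 0 < t) (hg : g y < t)
    (hr : t - g y ≤ r) :
    (⨍⁻ z in ball (pt t y) (t / 2), powDensity p h u z ∂volume) ≤ ntMaxTrunc p a g r u y ^ p := by
  have h1 : (pt t y : Space d) ∈ halfSpace d := by simpa [halfSpace] using ht
  have h2 := hs.lpAverage_rpow hp h1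
  rw [pt_zero] at h2
  rw [← h2]
  refine ENNReal.rpow_le_rpow (le_iSup₂_of_le (pt t y) ?_ le_rfl) hp.le
  refine ⟨⟨by simpa [above] using hg, ?_⟩, by simpa using hr⟩
  rw [tang_pt, sub_self, norm_zero, pt_zero]
  exact mul_pos ha (abs_pos.2 (by linarith))

lemma measurableSet_slab (r : ℝ) : MeasurableSet {x : Space d | 0 < x 0 ∧ x 0 ≤ r} :=
  measurableSet_halfSpace.inter (isClosed_le (continuous_coord 0) continuous_const).measurableSet

/-- With σ = 9/10 the averaging centres have height at most 0.91 x₀ ≤ r, so the maximal function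
truncated at r itself is enough. -/
lemma IsEnergySolution.carleson_slab (hs : IsEnergySolution h A B f u G) (hd : 1 ≤ d) (hp : 0 < p)
    {a : ℝ} (ha : 0 < a) (r : ℝ) :
    ∫⁻ x in {x : Space d | 0 < x 0 ∧ x 0 ≤ r},
      ‖u x‖ₑ ^ p * (ENNReal.ofReal (rowDensity A B x) * ENNReal.ofReal (x 0)) ≤
    ENNReal.ofReal (carlesonConst d) * (2 * carlesonNorm (muRow A B)) *
      ∫⁻ y, ntMaxTrunc p a (fun _ => 0) r u y ^ p := by
  refine le_trans (le_of_eq ?_) (carleson_supMeasure hd (σ := 9 / 10) le_rfl (by norm_num)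
    (measurableSet_slab r) (fun x hx => hx.1) (hs.measurable_powDensity (p := p))
    (rowDensityENN A B) fun x hx z hz y _ => ?_)
  · refine setLIntegral_congr_fun (measurableSet_slab r) fun x hx => ?_
    simp only [ofReal_rowDensity]
    rw [hs.powDensity_eq hx.1]
  · have hx0 : 0 < x 0 := hx.1
    have hxr : x 0 ≤ r := hx.2
    obtain ⟨h1, -, h3, -⟩ := coord_of_mem_ball le_rfl (by norm_num) hx0 hz
    have h4 := (abs_lt.1 h1).2
    exact hs.average_le_ntMaxTrunc hp ha (by linarith) (by linarith) (by linarith)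

end MaximalFunction

/-! ### Cutoffs for slabs. -/

section Cutoffs

variable {d : ℕ}

/-- Differentiability is not required: where it fails, `fderiv` is 0 by convention and the bound is
trivial. -/
lemma abs_rd_le_of_line {F : Space d → ℝ} {x : Space d} {k : Fin (d + 1)} {L : ℝ} (hL : 0 ≤ L)
    (h : ∀ᶠ t in 𝓝 (0 : ℝ), |F (x + t • EuclideanSpace.single k 1) - F x| ≤ L * |t|) :
    |rd k F x| ≤ L := by
  by_cases hF : DifferentiableAt ℝ F x
  · have h1 : HasDerivAt (fun t : ℝ => x + t • (EuclideanSpace.single k 1 : Space d))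
        (EuclideanSpace.single k 1) 0 := by
      simpa using ((hasDerivAt_id (0 : ℝ)).smul_const
        (EuclideanSpace.single k 1 : Space d)).const_add x
    have h2 : HasFDerivAt F (fderiv ℝ F x)
        (x + (0 : ℝ) • (EuclideanSpace.single k 1 : Space d)) := by
      simpa using hF.hasFDerivAt
    have h3 := h2.comp_hasDerivAt (0 : ℝ) h1
    have h4 := h3.le_of_lip' (C := L) hL (by simpa using h)
    exact h4
  · rw [rd, fderiv_zero_of_not_differentiableAt hF]
    simpa using hL

lemma rd_eq_of_line {F : Space d → ℝ} {x : Space d} {k : Fin (d + 1)} {c : ℝ}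
    (hF : DifferentiableAt ℝ F x)
    (h : HasDerivAt (fun t : ℝ => F (x + t • EuclideanSpace.single k 1)) c 0) : rd k F x = c := by
  have h1 : HasDerivAt (fun t : ℝ => x + t • (EuclideanSpace.single k 1 : Space d))
      (EuclideanSpace.single k 1) 0 := by
    simpa using ((hasDerivAt_id (0 : ℝ)).smul_const
      (EuclideanSpace.single k 1 : Space d)).const_add x
  have h2 : HasFDerivAt F (fderiv ℝ F x)
      (x + (0 : ℝ) • (EuclideanSpace.single k 1 : Space d)) := by
    simpa using hF.hasFDerivAt
  exact (h2.comp_hasDerivAt (0 : ℝ) h1).unique h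

lemma coord_add_single_succ (x : Space d) (t : ℝ) (i : Fin d) :
    (x + t • EuclideanSpace.single i.succ (1 : ℝ) : Space d) 0 = x 0 := by
  simp

lemma tang_add_single_succ (x : Space d) (t : ℝ) (i : Fin d) :
    tang (x + t • EuclideanSpace.single i.succ (1 : ℝ) : Space d) =
      tang x + t • EuclideanSpace.single i (1 : ℝ) := by
  ext j
  simp [tang]

lemma lipschitz_coord : LipschitzWith 1 fun x : Space d => x 0 :=
  LipschitzWith.of_dist_le_mul fun x y => by
    simpa [Real.dist_eq] using abs_coord_sub_le x y 0

lemma lipschitz_tang : LipschitzWith 1 (tang : Space d → Bdry d) :=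
  LipschitzWith.of_dist_le_mul fun x y => by simpa using dist_tang_le x y

lemma lipschitz_mul_of_bounded {α : Type*} [PseudoMetricSpace α] {F H : α → ℝ} {K L : ℝ≥0}
    (hF : LipschitzWith K F) (hH : LipschitzWith L H) {M N : ℝ≥0} (hM : ∀ x, |F x| ≤ M)
    (hN : ∀ x, |H x| ≤ N) : LipschitzWith (M * L + N * K) fun x => F x * H x := by
  refine LipschitzWith.of_dist_le_mul fun x y => ?_
  have h1 := hF.dist_le_mul x y
  have h2 := hH.dist_le_mul x y
  rw [Real.dist_eq] at h1 h2 ⊢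
  have h3 : F x * H x - F y * H y = F x * (H x - H y) + H y * (F x - F y) := by ring
  rw [h3]
  refine (abs_add_le _ _).trans ?_
  rw [abs_mul, abs_mul]
  calc |F x| * |H x - H y| + |H y| * |F x - F y|
      ≤ M * (L * dist x y) + N * (K * dist x y) := by
        gcongr
        exacts [hM x, hN y]
    _ = _ := by push_cast; ring

/-- The parabolic profile `t (1 - t / r)` on `[0, r]`, extended by zero. -/
def cap (r t : ℝ) : ℝ := max 0 (min t r) * (1 - max 0 (min t r) / r)

lemma cap_of_mem {r t : ℝ} (h0 : 0 ≤ t) (h1 : t ≤ r) : cap r t = t * (1 - t / r) := by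
  rw [cap, min_eq_left h1, max_eq_right h0]

lemma cap_of_nonpos {r t : ℝ} (h0 : t ≤ 0) : cap r t = 0 := by
  rw [cap, max_eq_left ((min_le_left _ _).trans h0), zero_mul]

lemma cap_of_ge {r t : ℝ} (hr : 0 < r) (h1 : r ≤ t) : cap r t = 0 := by
  rw [cap, min_eq_right h1, max_eq_right hr.le, div_self hr.ne', sub_self, mul_zero]

lemma cap_nonneg {r : ℝ} (hr : 0 < r) (t : ℝ) : 0 ≤ cap r t := by
  refine mul_nonneg (le_max_left _ _) (sub_nonneg.2 ((div_le_one hr).2 ?_))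
  exact max_le hr.le (min_le_right _ _)

lemma cap_le {r : ℝ} (hr : 0 < r) (t : ℝ) : cap r t ≤ max 0 (min t r) := by
  refine mul_le_of_le_one_right (le_max_left _ _) (sub_le_self _ ?_)
  exact div_nonneg (le_max_left _ _) hr.le

lemma cap_le_right {r : ℝ} (hr : 0 < r) (t : ℝ) : cap r t ≤ r :=
  (cap_le hr t).trans (max_le hr.le (min_le_right _ _))

/-- The source of the constant λ/2 and of the height r/2 in the slab estimate. -/
lemma half_le_cap {r t : ℝ} (hr : 0 < r) (h0 : 0 ≤ t) (h1 : t ≤ r / 2) : t / 2 ≤ cap r t := by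
  rw [cap_of_mem h0 (by linarith)]
  have h2 : t / r ≤ 1 / 2 := by rw [div_le_iff₀ hr]; linarith
  nlinarith

lemma lipschitz_cap {r : ℝ} (hr : 0 < r) : LipschitzWith 1 (cap r) := by
  have h1 : LipschitzWith 1 fun t : ℝ => max 0 (min t r) :=
    (LipschitzWith.id.min_const r).const_max 0
  refine LipschitzWith.of_dist_le_mul fun s t => ?_
  refine le_trans ?_ (h1.dist_le_mul s t)
  rw [Real.dist_eq, Real.dist_eq]
  simp only [cap]
  have hb : ∀ s, 0 ≤ max 0 (min s r) ∧ max 0 (min s r) ≤ r := fun s =>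
    ⟨le_max_left _ _, max_le hr.le (min_le_right _ _)⟩
  obtain ⟨ha0, ha1⟩ := hb s
  obtain ⟨hb0, hb1⟩ := hb t
  set a := max 0 (min s r)
  set b := max 0 (min t r)
  have h2 : a * (1 - a / r) - b * (1 - b / r) = (a - b) * (1 - (a + b) / r) := by ring
  rw [h2, abs_mul]
  refine mul_le_of_le_one_right (abs_nonneg _) (abs_le.2 ⟨?_, ?_⟩)
  · have : (a + b) / r ≤ 2 := by rw [div_le_iff₀ hr]; linarith
    linarith
  · have : 0 ≤ (a + b) / r := by positivity
    linarith

lemma hasDerivAt_cap {r t : ℝ} (hr : 0 < r) (h0 : 0 < t) (h1 : t ≠ r) :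
    HasDerivAt (cap r) (capDeriv r t) t := by
  rcases lt_or_gt_of_ne h1 with h | h
  · have h2 : HasDerivAt (fun t : ℝ => t * (1 - t / r)) (1 - 2 * t / r) t := by
      have := (hasDerivAt_id t).mul (((hasDerivAt_id t).div_const r).const_sub 1)
      refine this.congr_deriv ?_
      simp only [id]; ring
    rw [capDeriv, if_pos h]
    refine h2.congr_of_eventuallyEq ?_
    filter_upwards [Ioo_mem_nhds h0 h] with s hs using cap_of_mem hs.1.le hs.2.le
  · rw [capDeriv, if_neg (by linarith)]
    refine (hasDerivAt_const t (0 : ℝ)).congr_of_eventuallyEq ?_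
    filter_upwards [lt_mem_nhds h] with s hs using cap_of_ge hr (le_of_lt hs)

lemma abs_capDeriv_le {r t : ℝ} (hr : 0 < r) (h0 : 0 ≤ t) : |capDeriv r t| ≤ 1 := by
  unfold capDeriv
  split_ifs with h
  · have h1 : 0 ≤ 2 * t / r := by positivity
    have h2 : 2 * t / r ≤ 2 := by rw [div_le_iff₀ hr]; linarith
    exact abs_le.2 ⟨by linarith, by linarith⟩
  · simp

/-- A Lipschitz cutoff equal to one on the ball of radius `R`. -/
def radial (R : ℝ) (y : Bdry d) : ℝ := max 0 (min 1 (2 - ‖y‖ / R))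

lemma radial_nonneg (R : ℝ) (y : Bdry d) : 0 ≤ radial R y := le_max_left _ _

lemma radial_le_one (R : ℝ) (y : Bdry d) : radial R y ≤ 1 := max_le zero_le_one (min_le_left _ _)

lemma radial_eq_zero {R : ℝ} (hR : 0 < R) {y : Bdry d} (hy : 2 * R ≤ ‖y‖) : radial R y = 0 := by
  have h1 : 2 ≤ ‖y‖ / R := by rwa [le_div_iff₀ hR]
  exact max_eq_left ((min_le_right _ _).trans (by linarith))

lemma radial_eq_one {R : ℝ} (hR : 0 < R) {y : Bdry d} (hy : ‖y‖ ≤ R) : radial R y = 1 := by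
  have h1 : ‖y‖ / R ≤ 1 := by rwa [div_le_one hR]
  rw [radial, min_eq_left (by linarith), max_eq_right zero_le_one]

lemma abs_radial_sub_le {R : ℝ} (hR : 0 < R) (y z : Bdry d) :
    |radial R y - radial R z| ≤ 1 / R * ‖y - z‖ := by
  refine (abs_max_sub_max_le_max _ _ _ _).trans (max_le (by simp; positivity) ?_)
  refine (abs_min_sub_min_le_max _ _ _ _).trans (max_le (by simp; positivity) ?_)
  have h1 : 2 - ‖y‖ / R - (2 - ‖z‖ / R) = (1 / R) * (‖z‖ - ‖y‖) := by ring
  rw [h1, abs_mul, abs_of_pos (by positivity : 0 < 1 / R), abs_sub_comm]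
  gcongr
  exact abs_norm_sub_norm_le y z

lemma lipschitz_radial {R : ℝ} (hR : 0 < R) :
    LipschitzWith (Real.toNNReal (1 / R)) (radial R : Bdry d → ℝ) :=
  LipschitzWith.of_dist_le_mul fun y z => by
    rw [Real.coe_toNNReal _ (by positivity), Real.dist_eq, dist_eq_norm]
    exact abs_radial_sub_le hR y z

/-- The cutoff of the slab of height `r`, localised to the cylinder of radius `2 R`. -/
def slabCutoff (r R : ℝ) (x : Space d) : ℝ := cap r (x 0) * radial R (tang x)

lemma exists_lipschitz_slabCutoff {r R : ℝ} (hr : 0 < r) (hR : 0 < R) :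
    ∃ K, LipschitzWith K (slabCutoff r R : Space d → ℝ) := by
  refine ⟨_, lipschitz_mul_of_bounded ((lipschitz_cap hr).comp lipschitz_coord)
    ((lipschitz_radial hR).comp lipschitz_tang) (M := Real.toNNReal r) (N := 1)
    (fun x => ?_) fun x => ?_⟩
  · rw [Function.comp, abs_of_nonneg (cap_nonneg hr _), Real.coe_toNNReal _ hr.le]
    exact cap_le_right hr _
  · rw [Function.comp, abs_of_nonneg (radial_nonneg _ _)]
    exact radial_le_one _ _

lemma slabCutoff_nonneg {r : ℝ} (hr : 0 < r) (R : ℝ) (x : Space d) : 0 ≤ slabCutoff r R x :=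
  mul_nonneg (cap_nonneg hr _) (radial_nonneg _ _)

lemma slabCutoff_le {r : ℝ} (hr : 0 < r) (R : ℝ) (x : Space d) : slabCutoff r R x ≤ cap r (x 0) :=
  mul_le_of_le_one_right (cap_nonneg hr _) (radial_le_one _ _)

lemma hasCompactSupport_slabCutoff {r R : ℝ} (hr : 0 < r) (hR : 0 < R) :
    HasCompactSupport (slabCutoff r R : Space d → ℝ) := by
  refine HasCompactSupport.intro (isCompact_closedBall (0 : Space d) (r + 2 * R)) fun x hx => ?_
  rw [mem_closedBall_zero_iff, not_le] at hx
  have h1 := norm_pt_le (x 0) (tang x)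
  rw [pt_tang] at h1
  rcases le_or_gt (2 * R) ‖tang x‖ with h2 | h2
  · rw [slabCutoff, radial_eq_zero hR h2, mul_zero]
  · have h3 : r < |x 0| := by linarith
    rcases le_or_gt (x 0) 0 with h4 | h4
    · rw [slabCutoff, cap_of_nonpos h4, zero_mul]
    · rw [abs_of_pos h4] at h3
      rw [slabCutoff, cap_of_ge hr h3.le, zero_mul]

lemma norm_tgrad_slabCutoff_le {r R : ℝ} (hr : 0 < r) (hR : 0 < R) (x : Space d) :
    ‖tgrad (slabCutoff r R) x‖ ≤ d * (r / R) := by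
  have h1 : ∀ i : Fin d, |rd i.succ (slabCutoff r R) x| ≤ r / R := fun i => by
    refine abs_rd_le_of_line (by positivity) (Eventually.of_forall fun t => ?_)
    rw [slabCutoff, slabCutoff, coord_add_single_succ, tang_add_single_succ, ← mul_sub, abs_mul,
      abs_of_nonneg (cap_nonneg hr _)]
    calc _ ≤ r * (1 / R * ‖tang x + t • EuclideanSpace.single i (1 : ℝ) - tang x‖) := by
          gcongr
          exacts [cap_le_right hr _, abs_radial_sub_le hR _ _]
      _ = r / R * |t| := by
          rw [add_sub_cancel_left, norm_smul, PiLp.norm_single, norm_one, Real.norm_eq_abs]; ring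
  refine (norm_tgrad_le _ x).trans ((Finset.sum_le_sum fun i _ => h1 i).trans ?_)
  simp

/-- Two null sets are discarded: the points of non-differentiability and the hyperplane x₀ = r,
where the profile has a corner. -/
lemma ae_rd_slabCutoff {r R : ℝ} (hr : 0 < r) (hR : 0 < R) :
    ∀ᵐ x ∂(volume.restrict (halfSpace d)),
      rd 0 (slabCutoff r R) x = capDeriv r (x 0) * radial R (tang x) := by
  obtain ⟨K, hK⟩ := exists_lipschitz_slabCutoff (d := d) hr hR
  have h1 : ∀ᵐ x : Space d, x 0 ≠ r := by
    have h2 : volume {x : Space d | x 0 = r} = 0 := by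
      have hm : MeasurableSet {x : Space d | x 0 = r} :=
        (continuous_coord 0).measurable (measurableSet_singleton r)
      rw [← lintegral_indicator_one hm, lintegral_space (Measurable.aemeasurable
        (measurable_one.indicator hm))]
      have : ∀ y : Bdry d, ∫⁻ t : ℝ, {x : Space d | x 0 = r}.indicator 1 (pt t y) = 0 := by
        intro y
        have h3 : ∀ t : ℝ, {x : Space d | x 0 = r}.indicator (1 : Space d → ℝ≥0∞) (pt t y) =
            ({r} : Set ℝ).indicator 1 t := fun t => by
          by_cases ht : t = r <;> simp [indicator, ht]
        simp_rw [h3]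
        rw [lintegral_indicator_one (measurableSet_singleton r)]
        simp
      simp [this]
    rw [ae_iff]
    simpa using h2
  filter_upwards [ae_restrict_of_ae (hK.ae_differentiableAt (μ := volume)),
    ae_restrict_of_ae h1, ae_restrict_mem measurableSet_halfSpace] with x hx hxr hx0
  refine rd_eq_of_line hx ?_
  have h2 : ∀ t : ℝ, slabCutoff r R (x + t • EuclideanSpace.single 0 1) =
      cap r (x 0 + t) * radial R (tang x) := fun t => by
    have h3 := tang_add_smul x t
    rw [e0] at h3
    rw [slabCutoff, h3]
    simp
  simp_rw [h2]
  have h4 : HasDerivAt (cap r) (capDeriv r (x 0)) (x 0 + 0) := by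
    simpa using hasDerivAt_cap hr hx0 hxr
  exact (HasDerivAt.comp_const_add (x 0) 0 h4).mul_const _

end Cutoffs

/-! ### The energy inequality on a slab of infinite width. -/

section SlabEstimate

variable {d : ℕ} {p h : ℝ} {A : Space d → Matrix (Fin (d + 1)) (Fin (d + 1)) ℂ}
    {B : Space d → EuclideanSpace ℂ (Fin (d + 1))} {f : Bdry d → ℂ} {u : Space d → ℂ}
    {G : Space d → EuclideanSpace ℂ (Fin (d + 1))}

lemma ofReal_om_le (hp : 0 < p) (P : Profile p) (z : ℂ) :
    ENNReal.ofReal (P.om z * ‖z‖ ^ 2) ≤ ‖z‖ₑ ^ p := by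
  refine (ENNReal.ofReal_le_ofReal (P.om_mul_sq_le hp z)).trans (le_of_eq ?_)
  rw [← ENNReal.ofReal_rpow_of_nonneg (norm_nonneg z) hp.le, ofReal_norm]

lemma ofReal_V_le (hp : 0 < p) (P : Profile p) (z : ℂ) :
    ENNReal.ofReal (P.V z) ≤ ‖z‖ₑ ^ p := by
  refine (ENNReal.ofReal_le_ofReal (P.V_le_rpow hp z)).trans (le_of_eq ?_)
  rw [← ENNReal.ofReal_rpow_of_nonneg (norm_nonneg z) hp.le, ofReal_norm]

/-- The lateral cutoff radius tends to infinity. Its tangential gradient is at most d r / R, and the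
flux |∇u| |Th(u)| is integrable over the half-space as a product of L² functions, so the term with
`Lam` disappears in the limit. -/
lemma IsEnergySolution.slab_inequality {lam Lam θ : ℝ}
    (hs : IsEnergySolution h A B f u G) (hh : 0 < h)
    (hA : ∀ i j, ContDiffOn ℝ ∞ (fun x => A x i j) (halfSpace d))
    (hB : ContDiffOn ℝ ∞ B (halfSpace d)) (hell : IsPElliptic p lam Lam A)
    (hrow : ∀ x ∈ halfSpace d, A x 0 0 = 1 ∧ ∀ j, (A x 0 j).im = 0)
    (hp : 1 < p) (hlam : 0 ≤ lam) (hθ : 0 < θ) (P : Profile p) {r : ℝ} (hr : 0 < r)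
    {R : ℝ} (hR0 : 0 ≤ R)
    (hR : ∫⁻ x in {x : Space d | 0 < x 0 ∧ x 0 ≤ r},
      ‖u x‖ₑ ^ p * (ENNReal.ofReal (rowDensity A B x) * ENNReal.ofReal (x 0)) ≤
        ENNReal.ofReal R) :
    (lam * min 2 p - 3 * θ) * (∫ x in halfSpace d, P.om (u x) * ‖G x‖ ^ 2 * cap r (x 0)) +
      (∫ x in halfSpace d, (G x 0 * P.Th (u x)).re * capDeriv r (x 0)) ≤ R / (4 * θ) := by
  have hRn : ∀ n : ℕ, (0 : ℝ) < (n : ℝ) + 1 := fun n => by positivity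
  have hcm : Measurable fun x : Space d => cap r (x 0) :=
    ((lipschitz_cap hr).continuous.comp (continuous_coord 0)).measurable
  have hcb : ∀ x : Space d, |cap r (x 0)| ≤ r := fun x => by
    rw [abs_of_nonneg (cap_nonneg hr _)]; exact cap_le_right hr _
  set ζ : ℕ → Space d → ℝ := fun n => slabCutoff r ((n : ℝ) + 1) with hζ
  have key : ∀ n, (lam * min 2 p - 3 * θ) *
      (∫ x in halfSpace d, P.om (u x) * ‖G x‖ ^ 2 * ζ n x) +
      (∫ x in halfSpace d, (G x 0 * P.Th (u x)).re * rd 0 (ζ n) x) ≤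
    R / (4 * θ) +
      2 * Lam * ∫ x in halfSpace d, ‖tgrad (ζ n) x‖ * (‖G x‖ * ‖P.Th (u x)‖) := by
    intro n
    obtain ⟨K, hK⟩ := exists_lipschitz_slabCutoff (d := d) hr (hRn n)
    refine hs.energy_inequality hh hA hB hell hrow hp hlam hθ P hK
      (slabCutoff_nonneg hr _) (hasCompactSupport_slabCutoff hr (hRn n))
      (fun x hx => by rw [slabCutoff, cap_of_nonpos hx, zero_mul]) hR0 (le_trans ?_ hR)
    rw [← lintegral_indicator measurableSet_halfSpace, ← lintegral_indicator (measurableSet_slab r)]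
    refine lintegral_mono fun x => ?_
    by_cases hx : x ∈ halfSpace d
    · rw [indicator_of_mem hx]
      have hx0 : 0 < x 0 := hx
      rcases le_or_gt (x 0) r with hxr | hxr
      · rw [indicator_of_mem (by exact ⟨hx0, hxr⟩), ENNReal.ofReal_mul (mul_nonneg
          (rowDensity_nonneg x) (mul_nonneg (P.om_nonneg _) (by positivity))),
          ENNReal.ofReal_mul (rowDensity_nonneg x)]
        calc _ ≤ ENNReal.ofReal (rowDensity A B x) * ‖u x‖ₑ ^ p * ENNReal.ofReal (x 0) := by
              gcongr
              · exact ofReal_om_le (by linarith) P _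
              · refine (slabCutoff_le hr _ x).trans ((cap_le hr _).trans ?_)
                exact max_le hx0.le (min_le_left _ _)
          _ = _ := by ring
      · have : slabCutoff r ((n : ℝ) + 1) x = 0 := by
          rw [slabCutoff, cap_of_ge hr hxr.le, zero_mul]
        rw [this, mul_zero, ENNReal.ofReal_zero]
        exact zero_le
    · rw [indicator_of_notMem hx]; exact zero_le
  have hrad : ∀ y : Bdry d, Tendsto (fun n : ℕ => radial ((n : ℝ) + 1) y) atTop (𝓝 1) := fun y => by
    obtain ⟨N, hN⟩ := exists_nat_gt ‖y‖
    refine tendsto_const_nhds.congr' ?_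
    filter_upwards [eventually_ge_atTop N] with n hn
    have : (N : ℝ) ≤ n := by exact_mod_cast hn
    exact (radial_eq_one (hRn n) (by linarith)).symm
  have l1 : Tendsto (fun n => ∫ x in halfSpace d, P.om (u x) * ‖G x‖ ^ 2 * ζ n x) atTop
      (𝓝 (∫ x in halfSpace d, P.om (u x) * ‖G x‖ ^ 2 * cap r (x 0))) := by
    refine tendsto_integral_of_dominated_convergence _ (fun n => ?_)
      (hs.integrable_energy hh P hcm hcb)
      (fun n => Eventually.of_forall fun x => ?_) (Eventually.of_forall fun x => ?_)
    · obtain ⟨K, hK⟩ := exists_lipschitz_slabCutoff (d := d) hr (hRn n)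
      refine (hs.integrable_energy hh P hK.continuous.measurable (M := r) fun x => ?_).1
      rw [abs_of_nonneg (slabCutoff_nonneg hr _ x)]
      exact (slabCutoff_le hr _ x).trans (cap_le_right hr _)
    · have := P.om_nonneg (u x)
      rw [Real.norm_of_nonneg (mul_nonneg (by positivity) (slabCutoff_nonneg hr _ x))]
      exact mul_le_mul_of_nonneg_left (slabCutoff_le hr _ x) (by positivity)
    · refine Tendsto.const_mul _ ?_
      have := (hrad (tang x)).const_mul (cap r (x 0))
      rwa [mul_one] at this
  have hcd : ∀ x ∈ halfSpace d, |capDeriv r (x 0)| ≤ 1 := fun x hx =>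
    abs_capDeriv_le hr (le_of_lt hx)
  have l2 : Tendsto (fun n => ∫ x in halfSpace d, (G x 0 * P.Th (u x)).re * rd 0 (ζ n) x) atTop
      (𝓝 (∫ x in halfSpace d, (G x 0 * P.Th (u x)).re * capDeriv r (x 0))) := by
    have hb := (hs.integrable_transversal hh P 0 (c := fun _ => 1) measurable_const (M := 1)
      (by simp)).norm
    refine tendsto_integral_of_dominated_convergence _ (fun n => ?_) hb
      (fun n => ?_) ?_
    · obtain ⟨K, hK⟩ := exists_lipschitz_slabCutoff (d := d) hr (hRn n)
      exact (hs.integrable_transversal hh P 0 (measurable_rd 0 _) (abs_rd_le hK 0)).1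
    · filter_upwards [ae_rd_slabCutoff (d := d) hr (hRn n),
        ae_restrict_mem measurableSet_halfSpace] with x hx hx0
      rw [hx, mul_one, norm_mul]
      refine mul_le_of_le_one_right (norm_nonneg _) ?_
      rw [Real.norm_eq_abs, abs_mul, abs_of_nonneg (radial_nonneg _ _)]
      exact mul_le_one₀ (hcd x hx0) (radial_nonneg _ _) (radial_le_one _ _)
    · have h1 : ∀ᵐ x ∂(volume.restrict (halfSpace d)), ∀ n : ℕ,
          rd 0 (ζ n) x = capDeriv r (x 0) * radial ((n : ℝ) + 1) (tang x) :=
        ae_all_iff.2 fun n => ae_rd_slabCutoff hr (hRn n)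
      filter_upwards [h1] with x hx
      simp only [hx]
      refine Tendsto.const_mul _ ?_
      have := (hrad (tang x)).const_mul (capDeriv r (x 0))
      rwa [mul_one] at this
  have l3 : Tendsto (fun n => ∫ x in halfSpace d, ‖tgrad (ζ n) x‖ * (‖G x‖ * ‖P.Th (u x)‖)) atTop
      (𝓝 0) := by
    have hfl := hs.integrable_flux hh P (c := fun _ => 1) measurable_const (M := 1) (by simp)
    simp only [one_mul] at hfl
    have h1 : ∀ n, ∫ x in halfSpace d, ‖tgrad (ζ n) x‖ * (‖G x‖ * ‖P.Th (u x)‖) ≤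
        d * (r * (1 / ((n : ℝ) + 1))) * ∫ x in halfSpace d, ‖G x‖ * ‖P.Th (u x)‖ := fun n => by
      obtain ⟨K, hK⟩ := exists_lipschitz_slabCutoff (d := d) hr (hRn n)
      rw [← integral_const_mul]
      refine integral_mono_ae (hs.integrable_flux hh P (measurable_tgrad _).norm (fun x => by
        rw [abs_of_nonneg (norm_nonneg _)]
        exact norm_tgrad_le_of_lipschitz hK x)) (hfl.const_mul _) (Eventually.of_forall fun x => ?_)
      have := norm_tgrad_slabCutoff_le (d := d) hr (hRn n) x
      rw [div_eq_mul_one_div] at this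
      exact mul_le_mul_of_nonneg_right this (by positivity)
    have h2 : Tendsto (fun n : ℕ => d * (r * (1 / ((n : ℝ) + 1))) *
        ∫ x in halfSpace d, ‖G x‖ * ‖P.Th (u x)‖) atTop (𝓝 0) := by
      have := ((tendsto_one_div_add_atTop_nhds_zero_nat.const_mul r).const_mul (d : ℝ)).mul_const
        (∫ x in halfSpace d, ‖G x‖ * ‖P.Th (u x)‖)
      simpa using this
    exact squeeze_zero (fun n => integral_nonneg fun x => by positivity) h1 h2
  have := le_of_tendsto_of_tendsto' ((l1.const_mul _).add l2)
    (tendsto_const_nhds.add (l3.const_mul _)) key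
  simpa using this

end SlabEstimate

/-! ### Removal of the bounded weights. -/

section Fatou

variable {d : ℕ} {p h : ℝ} {A : Space d → Matrix (Fin (d + 1)) (Fin (d + 1)) ℂ}
    {B : Space d → EuclideanSpace ℂ (Fin (d + 1))} {f : Bdry d → ℂ} {u : Space d → ℂ}
    {G : Space d → EuclideanSpace ℂ (Fin (d + 1))}

/-- Bounds that are uniform over all bounded profiles pass to the weight `|z|^(p-2)`. -/
lemma IsEnergySolution.lintegral_energyDensity_le (hs : IsEnergySolution h A B f u G) (hh : 0 < h)
    (hp : 1 < p) {c₁ c₂ : Space d → ℝ} (hc₁ : Measurable c₁) (hc₂ : Measurable c₂) {Z : ℝ≥0∞}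
    (hZ : ∀ P : Profile p, ∫⁻ x in halfSpace d,
      (ENNReal.ofReal (P.om (u x) * ‖G x‖ ^ 2) * ENNReal.ofReal (c₁ x) +
        ENNReal.ofReal (P.V (u x)) * ENNReal.ofReal (c₂ x)) ≤ Z) :
    ∫⁻ x in halfSpace d, (energyDensity p u G x * ENNReal.ofReal (c₁ x) +
      ‖u x‖ₑ ^ p * ENNReal.ofReal (c₂ x)) ≤ Z := by
  obtain ⟨P, hP1, hP2⟩ := Profile.exists_approx hp
  have hum := (hs.memLp_u hh).aestronglyMeasurable
  have hGm := hs.gradient_L2.aestronglyMeasurable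
  have hlim : ∀ x, Tendsto (fun n =>
      ENNReal.ofReal ((P n).om (u x) * ‖G x‖ ^ 2) * ENNReal.ofReal (c₁ x) +
        ENNReal.ofReal ((P n).V (u x)) * ENNReal.ofReal (c₂ x)) atTop
      (𝓝 (energyDensity p u G x * ENNReal.ofReal (c₁ x) +
      ‖u x‖ₑ ^ p * ENNReal.ofReal (c₂ x))) := by
    intro x
    refine Tendsto.add (ENNReal.Tendsto.mul_const ?_ (Or.inr ENNReal.ofReal_ne_top))
      (ENNReal.Tendsto.mul_const ?_ (Or.inr ENNReal.ofReal_ne_top))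
    · have h1 : ∀ n, ENNReal.ofReal ((P n).om (u x) * ‖G x‖ ^ 2) =
          ‖G x‖ₑ ^ 2 * ENNReal.ofReal ((P n).om (u x)) := fun n => by
        rw [ENNReal.ofReal_mul ((P n).om_nonneg _), ENNReal.ofReal_pow (norm_nonneg _), ofReal_norm,
          mul_comm]
      simp_rw [h1]
      -- The factor |∇u|² is finite, so the limit passes through the product even where the weight
      -- tends to ∞; where the gradient vanishes the product is 0 throughout, in agreement with 0 ·
      -- ∞ = 0.
      exact ENNReal.Tendsto.const_mul (hP1 _) (Or.inr (ENNReal.pow_ne_top enorm_ne_top))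
    · have h2 := ENNReal.tendsto_ofReal (hP2 (u x))
      rwa [← ENNReal.ofReal_rpow_of_nonneg (norm_nonneg _) (by linarith : (0:ℝ) ≤ p),
        ofReal_norm] at h2
  have hmeas : ∀ n, AEMeasurable (fun x =>
      ENNReal.ofReal ((P n).om (u x) * ‖G x‖ ^ 2) * ENNReal.ofReal (c₁ x) +
        ENNReal.ofReal ((P n).V (u x)) * ENNReal.ofReal (c₂ x))
      (volume.restrict (halfSpace d)) := fun n => by
    have h1 := ((P n).continuous_om.comp_aestronglyMeasurable hum).aemeasurable
    have h2 := ((P n).continuous_V.comp_aestronglyMeasurable hum).aemeasurable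
    have h3 := hGm.norm.aemeasurable
    exact (((h1.mul (h3.pow_const 2)).ennreal_ofReal).mul hc₁.aemeasurable.ennreal_ofReal).add
      (h2.ennreal_ofReal.mul hc₂.aemeasurable.ennreal_ofReal)
  calc _ = ∫⁻ x in halfSpace d, liminf (fun n =>
        ENNReal.ofReal ((P n).om (u x) * ‖G x‖ ^ 2) * ENNReal.ofReal (c₁ x) +
        ENNReal.ofReal ((P n).V (u x)) * ENNReal.ofReal (c₂ x)) atTop :=
        lintegral_congr fun x => (hlim x).liminf_eq.symm
    _ ≤ _ := lintegral_liminf_le' hmeas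
    _ ≤ Z := liminf_le_of_le (by isBoundedDefault) fun b hb => by
        obtain ⟨n, hn⟩ := hb.exists
        exact hn.trans (hZ (P n))

end Fatou

/-! ### The estimates at every height and their global limit. -/

section SlabConclusions

variable {d : ℕ} {p h : ℝ} {A : Space d → Matrix (Fin (d + 1)) (Fin (d + 1)) ℂ}
    {B : Space d → EuclideanSpace ℂ (Fin (d + 1))} {f : Bdry d → ℂ} {u : Space d → ℂ}
    {G : Space d → EuclideanSpace ℂ (Fin (d + 1))}

/-- The constant in the estimates on slabs. -/
def slabConst (d : ℕ) (p lam : ℝ) : ℝ :=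
  p / (4 * ((min 2 p - 1) * lam / 3)) * carlesonConst d * 2

lemma IsEnergySolution.slab_estimate {lam Lam a : ℝ} (hd : 1 ≤ d)
    (hs : IsEnergySolution h A B f u G) (hh : 0 < h)
    (hA : ∀ i j, ContDiffOn ℝ ∞ (fun x => A x i j) (halfSpace d))
    (hB : ContDiffOn ℝ ∞ B (halfSpace d)) (hell : IsPElliptic p lam Lam A)
    (hrow : ∀ x ∈ halfSpace d, A x 0 0 = 1 ∧ ∀ j, (A x 0 j).im = 0)
    (hp : 1 < p) (hlam : 0 < lam) (ha : 0 < a) {r : ℝ} (hr : 0 < r) :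
    ENNReal.ofReal (p * (lam / 2)) * (∫⁻ x in {x : Space d | 0 < x 0 ∧ x 0 ≤ r / 2},
        energyDensity p u G x * ENNReal.ofReal (x 0)) +
      ENNReal.ofReal (2 / r) * (∫⁻ x in {x : Space d | 0 < x 0 ∧ x 0 ≤ r}, ‖u x‖ₑ ^ p) ≤
    (∫⁻ y, ‖f y‖ₑ ^ p) + (∫⁻ y, ‖u (pt r y)‖ₑ ^ p) +
      ENNReal.ofReal (slabConst d p lam) * carlesonNorm (muRow A B) *
        (∫⁻ y, ntMaxTrunc p a (fun _ => 0) r u y ^ p) := by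
  -- Chosen so that the three Young terms use up exactly the surplus λ min(2, p) - λ, which is
  -- positive because p > 1.
  set θ : ℝ := (min 2 p - 1) * lam / 3 with hθdef
  have hmin : 1 < min 2 p := lt_min (by norm_num) hp
  have hθ : 0 < θ := by
    have : 0 < min 2 p - 1 := by linarith
    positivity
  set S : ℝ≥0∞ := ENNReal.ofReal (carlesonConst d) * (2 * carlesonNorm (muRow A B)) *
      ∫⁻ y, ntMaxTrunc p a (fun _ => 0) r u y ^ p with hS
  have hcon : ENNReal.ofReal (slabConst d p lam) * carlesonNorm (muRow A B) *
        (∫⁻ y, ntMaxTrunc p a (fun _ => 0) r u y ^ p) = ENNReal.ofReal (p / (4 * θ)) * S := by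
    have hc := (carlesonConst_pos (d := d)).le
    rw [slabConst, ← hθdef, ENNReal.ofReal_mul (by positivity), ENNReal.ofReal_mul (by positivity),
      hS, ENNReal.ofReal_ofNat]
    ring
  rw [hcon]
  have hpθ : 0 < p / (4 * θ) := by positivity
  by_cases hStop : S = ⊤
  · rw [hStop, ENNReal.mul_top (by simpa using hpθ)]
    simp
  set R := S.toReal with hR
  have hRS : ENNReal.ofReal R = S := ENNReal.ofReal_toReal hStop
  -- The two integrals on the left are carried through Fatou together, encoded as weights on the
  -- half-space.
  set c₁ : Space d → ℝ := {x : Space d | 0 < x 0 ∧ x 0 ≤ r / 2}.indicator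
    fun x => p * (lam / 2) * x 0 with hc1
  set c₂ : Space d → ℝ := {x : Space d | 0 < x 0 ∧ x 0 ≤ r}.indicator fun _ => 2 / r with hc2
  have hc1m : Measurable c₁ :=
    ((continuous_coord 0).measurable.const_mul _).indicator (measurableSet_slab _)
  have hc2m : Measurable c₂ := measurable_const.indicator (measurableSet_slab _)
  have hsub : ∀ r : ℝ, {x : Space d | 0 < x 0 ∧ x 0 ≤ r} ∩ halfSpace d =
      {x : Space d | 0 < x 0 ∧ x 0 ≤ r} := fun r => inter_eq_left.2 fun x hx => hx.1
  have h0 : ∀ x, 0 ≤ c₁ x := fun x => indicator_nonneg (fun x hx => by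
    have := hx.1; positivity) x
  have h0' : ∀ x, 0 ≤ c₂ x := fun x => indicator_nonneg (fun x hx => by positivity) x
  have hkey : ∀ P : Profile p, ∫⁻ x in halfSpace d,
      (ENNReal.ofReal (P.om (u x) * ‖G x‖ ^ 2) * ENNReal.ofReal (c₁ x) +
        ENNReal.ofReal (P.V (u x)) * ENNReal.ofReal (c₂ x)) ≤
      (∫⁻ y, ‖f y‖ₑ ^ p) + (∫⁻ y, ‖u (pt r y)‖ₑ ^ p) + ENNReal.ofReal (p / (4 * θ)) * S := by
    intro P
    have hI : IntegrableOn (fun x => p * (G x 0 * P.Th (u x)).re * capDeriv r (x 0))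
        (halfSpace d) := by
      -- `capDeriv` is unbounded for negative heights, so it is clipped to [-1, 1]; nothing changes
      -- in the half-space.
      have h1 := hs.integrable_transversal hh P 0 (c := fun x => max (-1) (min 1 (capDeriv r (x 0))))
        (M := 1) (measurable_const.max (measurable_const.min
          ((measurable_capDeriv r).comp (continuous_coord 0).measurable)))
        (fun x => abs_le.2 ⟨le_max_left _ _, max_le (by norm_num) (min_le_left _ _)⟩)
      refine (h1.const_mul p).congr ?_
      filter_upwards [ae_restrict_mem measurableSet_halfSpace] with x hx
      have h2 := abs_le.1 (abs_capDeriv_le hr (le_of_lt hx) : |capDeriv r (x 0)| ≤ 1)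
      rw [min_eq_right h2.2, max_eq_right h2.1]; ring
    have hslab := hs.slab_inequality hh hA hB hell hrow hp hlam.le hθ P hr
      (ENNReal.toReal_nonneg : 0 ≤ R) (by rw [hRS]; exact hs.carleson_slab hd (by linarith) ha r)
    have hcd := hs.integral_capDeriv hh (by linarith) P hr hI
    have hcd' : ∫ x in halfSpace d, p * (G x 0 * P.Th (u x)).re * capDeriv r (x 0) =
        p * ∫ x in halfSpace d, (G x 0 * P.Th (u x)).re * capDeriv r (x 0) := by
      rw [← integral_const_mul]; simp_rw [mul_assoc]
    have hV0 := integrable_V_of_memLp (by linarith) P (hs.memLp_level hh le_rfl)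
    have hVr := integrable_V_of_memLp (by linarith) P (hs.memLp_level hh hr.le)
    have hVu := integrable_V_of_memLp (by linarith) P (hs.memLp_u hh)
    have hcap : Measurable fun x : Space d => cap r (x 0) :=
      ((lipschitz_cap hr).continuous.comp (continuous_coord 0)).measurable
    have hcb : ∀ x : Space d, |cap r (x 0)| ≤ r := fun x => by
      rw [abs_of_nonneg (cap_nonneg hr _)]; exact cap_le_right hr _
    have hI0 := hs.integrable_energy hh P hcap hcb
    have hI1 := hs.integrable_energy hh P hc1m (M := p * (lam / 2) * (r / 2)) fun x => by
      rw [abs_of_nonneg (h0 x)]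
      by_cases hx : x ∈ {x : Space d | 0 < x 0 ∧ x 0 ≤ r / 2}
      · rw [hc1, indicator_of_mem hx]
        have := hx.2
        gcongr
      · rw [hc1, indicator_of_notMem hx]; positivity
    have hI2 : IntegrableOn (fun x => P.V (u x) * c₂ x) (halfSpace d) :=
      Integrable.mul_bdd (c := 2 / r) hVu hc2m.aestronglyMeasurable (Eventually.of_forall fun x => by
        rw [Real.norm_of_nonneg (h0' x)]
        exact indicator_le_self' (fun _ _ => by positivity) x)
    have e2 : ∫ x in halfSpace d, P.V (u x) * c₂ x =
        2 / r * ∫ x in {x : Space d | 0 < x 0 ∧ x 0 ≤ r}, P.V (u x) := by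
      have h1 : (fun x => P.V (u x) * c₂ x) = {x : Space d | 0 < x 0 ∧ x 0 ≤ r}.indicator
          fun x => 2 / r * P.V (u x) := by
        ext x
        by_cases hx : x ∈ {x : Space d | 0 < x 0 ∧ x 0 ≤ r}
        · rw [hc2, indicator_of_mem hx, indicator_of_mem hx, mul_comm]
        · rw [hc2, indicator_of_notMem hx, indicator_of_notMem hx, mul_zero]
      rw [h1, setIntegral_indicator (measurableSet_slab r), inter_comm, hsub, integral_const_mul]
    have e1 : ∫ x in halfSpace d, P.om (u x) * ‖G x‖ ^ 2 * c₁ x ≤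
        p * (lam * ∫ x in halfSpace d, P.om (u x) * ‖G x‖ ^ 2 * cap r (x 0)) := by
      rw [← integral_const_mul, ← integral_const_mul]
      refine setIntegral_mono_on hI1 ((hI0.const_mul _).const_mul _) measurableSet_halfSpace
        fun x hx => ?_
      have h1 := P.om_nonneg (u x)
      have h2 := cap_nonneg hr (x 0)
      by_cases hx' : x ∈ {x : Space d | 0 < x 0 ∧ x 0 ≤ r / 2}
      · rw [hc1, indicator_of_mem hx']
        have h3 := half_le_cap hr hx'.1.le hx'.2
        calc P.om (u x) * ‖G x‖ ^ 2 * (p * (lam / 2) * x 0)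
            = P.om (u x) * ‖G x‖ ^ 2 * (p * lam * (x 0 / 2)) := by ring
          _ ≤ P.om (u x) * ‖G x‖ ^ 2 * (p * lam * cap r (x 0)) := by gcongr
          _ = _ := by ring
      · rw [hc1, indicator_of_notMem hx', mul_zero]; positivity
    have hθ3 : lam * min 2 p - 3 * θ = lam := by rw [hθdef]; ring
    rw [hθ3] at hslab
    have hreal : (∫ x in halfSpace d, P.om (u x) * ‖G x‖ ^ 2 * c₁ x) +
        (∫ x in halfSpace d, P.V (u x) * c₂ x) ≤
        (∫ y, P.V (u (pt 0 y))) + (∫ y, P.V (u (pt r y))) + p / (4 * θ) * R := by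
      have h5 := mul_le_mul_of_nonneg_left hslab (by linarith : (0:ℝ) ≤ p)
      rw [mul_add, ← hcd', hcd] at h5
      rw [e2]
      have h6 : p * (R / (4 * θ)) = p / (4 * θ) * R := by ring
      linarith
    have hVle : ∀ g : Bdry d → ℂ, Integrable (fun y => P.V (g y)) volume →
        ENNReal.ofReal (∫ y, P.V (g y)) ≤ ∫⁻ y, ‖g y‖ₑ ^ p := fun g hg => by
      rw [ofReal_integral_eq_lintegral_ofReal hg
        (Eventually.of_forall fun y => P.V_nonneg (by linarith) _)]
      exact lintegral_mono fun y => ofReal_V_le (by linarith) P _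
    calc _ = ENNReal.ofReal ((∫ x in halfSpace d, P.om (u x) * ‖G x‖ ^ 2 * c₁ x) +
        (∫ x in halfSpace d, P.V (u x) * c₂ x)) := by
          have hI12 : IntegrableOn (fun x => P.om (u x) * ‖G x‖ ^ 2 * c₁ x + P.V (u x) * c₂ x)
              (halfSpace d) := hI1.add hI2
          rw [← integral_add hI1 hI2, ofReal_integral_eq_lintegral_ofReal hI12
            (Eventually.of_forall fun x => add_nonneg (mul_nonneg (mul_nonneg (P.om_nonneg _)
              (by positivity)) (h0 x)) (mul_nonneg (P.V_nonneg (by linarith) _) (h0' x)))]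
          refine lintegral_congr fun x => ?_
          have h1 := P.om_nonneg (u x)
          have h2 := P.V_nonneg (by linarith) (u x)
          rw [ENNReal.ofReal_add (mul_nonneg (by positivity) (h0 x)) (mul_nonneg h2 (h0' x)),
            ENNReal.ofReal_mul (p := P.om (u x) * ‖G x‖ ^ 2) (by positivity), ENNReal.ofReal_mul h2]
      _ ≤ _ := ENNReal.ofReal_le_ofReal hreal
      _ ≤ _ := by
          refine ENNReal.ofReal_add_le.trans (add_le_add (ENNReal.ofReal_add_le.trans
            (add_le_add ((hVle _ hV0).trans (le_of_eq ?_)) (hVle _ hVr))) ?_)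
          · refine lintegral_congr_ae ?_
            filter_upwards [hs.eq_datum] with y hy
            rw [hy]
          · rw [ENNReal.ofReal_mul hpθ.le, hRS]
  have hfin := hs.lintegral_energyDensity_le hh hp hc1m hc2m hkey
  refine le_trans (le_of_eq ?_) hfin
  have hum := (hs.memLp_u hh).aestronglyMeasurable
  have hm2 : AEMeasurable (fun x => ‖u x‖ₑ ^ p * ENNReal.ofReal (c₂ x))
      (volume.restrict (halfSpace d)) :=
    (hum.enorm.pow_const p).mul hc2m.aemeasurable.ennreal_ofReal
  rw [lintegral_add_right' _ hm2]
  congr 1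
  · have h1 : ∀ x, energyDensity p u G x * ENNReal.ofReal (c₁ x) =
        {x : Space d | 0 < x 0 ∧ x 0 ≤ r / 2}.indicator (fun x => ENNReal.ofReal (p * (lam / 2)) *
          (energyDensity p u G x * ENNReal.ofReal (x 0))) x := fun x => by
      by_cases hx : x ∈ {x : Space d | 0 < x 0 ∧ x 0 ≤ r / 2}
      · rw [hc1, indicator_of_mem hx, indicator_of_mem hx, ENNReal.ofReal_mul (by positivity)]
        ring
      · rw [hc1, indicator_of_notMem hx, indicator_of_notMem hx, ENNReal.ofReal_zero, mul_zero]
    simp_rw [h1]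
    rw [setLIntegral_indicator (measurableSet_slab _), hsub,
      lintegral_const_mul' _ _ ENNReal.ofReal_ne_top]
  · have h1 : ∀ x, ‖u x‖ₑ ^ p * ENNReal.ofReal (c₂ x) =
        {x : Space d | 0 < x 0 ∧ x 0 ≤ r}.indicator (fun x => ENNReal.ofReal (2 / r) *
          ‖u x‖ₑ ^ p) x := fun x => by
      by_cases hx : x ∈ {x : Space d | 0 < x 0 ∧ x 0 ≤ r}
      · rw [hc2, indicator_of_mem hx, indicator_of_mem hx, mul_comm]
      · rw [hc2, indicator_of_notMem hx, indicator_of_notMem hx, ENNReal.ofReal_zero, mul_zero]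
    simp_rw [h1]
    rw [setLIntegral_indicator (measurableSet_slab _), hsub,
      lintegral_const_mul' _ _ ENNReal.ofReal_ne_top]

/-- For r ≥ h the term on the level x₀ = r vanishes. The half-space is exhausted by slabs, and
monotone convergence concludes. -/
lemma IsEnergySolution.global_estimate {lam Lam a : ℝ} (hd : 1 ≤ d)
    (hs : IsEnergySolution h A B f u G) (hh : 0 < h)
    (hA : ∀ i j, ContDiffOn ℝ ∞ (fun x => A x i j) (halfSpace d))
    (hB : ContDiffOn ℝ ∞ B (halfSpace d)) (hell : IsPElliptic p lam Lam A)
    (hrow : ∀ x ∈ halfSpace d, A x 0 0 = 1 ∧ ∀ j, (A x 0 j).im = 0)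
    (hp : 1 < p) (hlam : 0 < lam) (ha : 0 < a) :
    ENNReal.ofReal (p * (lam / 2)) * (∫⁻ x in halfSpace d,
        energyDensity p u G x * ENNReal.ofReal (x 0)) ≤
    (∫⁻ y, ‖f y‖ₑ ^ p) + ENNReal.ofReal (slabConst d p lam) * carlesonNorm (muRow A B) *
        (∫⁻ y, ntMax p a (fun _ => 0) u y ^ p) := by
  have hun : halfSpace d = ⋃ n : ℕ, {x : Space d | 0 < x 0 ∧ x 0 ≤ n} := by
    ext x
    simp only [mem_iUnion]
    refine ⟨fun hx => ?_, fun ⟨n, hn⟩ => hn.1⟩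
    obtain ⟨n, hn⟩ := exists_nat_ge (x 0)
    exact ⟨n, hx, hn⟩
  have hdir : Directed (· ⊆ ·) fun n : ℕ => {x : Space d | 0 < x 0 ∧ x 0 ≤ n} :=
    (monotone_nat_of_le_succ fun n x hx => ⟨hx.1, hx.2.trans (by push_cast; linarith)⟩).directed_le
  rw [hun, setLIntegral_iUnion_of_directed _ hdir, ENNReal.mul_iSup]
  refine iSup_le fun n => ?_
  obtain ⟨N, hN⟩ := exists_nat_ge h
  set r : ℝ := 2 * ((n : ℝ) + N + 1) with hr
  have hr0 : 0 < r := by positivity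
  have hn0 : (0 : ℝ) ≤ n := by positivity
  have hN0 : (0 : ℝ) ≤ N := by positivity
  have h1 := hs.slab_estimate hd hh hA hB hell hrow hp hlam ha hr0
  have h2 : ∫⁻ y : Bdry d, ‖u (pt r y)‖ₑ ^ p = 0 := by
    have : ∀ y : Bdry d, u (pt r y) = 0 := fun y => hs.eq_zero _ (by
      rw [pt_zero]; linarith)
    simp [this, show 0 < p by linarith]
  rw [h2, add_zero] at h1
  refine le_trans ?_ ((le_self_add.trans h1).trans ?_)
  · gcongr
    linarith
  · gcongr with y
    exact biSup_mono fun x hx => hx.1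

end SlabConclusions

/-! ### The quadratic cutoff between two Lipschitz graphs. -/

section LayerCutoff

variable {d : ℕ} {g H : Bdry d → ℝ}

/-- The function `max 0 (min x₀ (min (10 x₀ - 9 g) (11 H - 10 x₀)))`, which equals `x₀` between the
graphs of `g` and `H`. -/
def tent (g H : Bdry d → ℝ) (x : Space d) : ℝ :=
  max 0 (min (x 0) (min (10 * x 0 - 9 * g (tang x)) (11 * H (tang x) - 10 * x 0)))

/-- The quotient of `tent` by the height; a cutoff with values in `[0, 1]`. -/
def ratio (g H : Bdry d → ℝ) (x : Space d) : ℝ := tent g H x / x 0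

/-- The cutoff `tent² / x₀`, which equals `x₀` between the graphs of `g` and `H`. -/
def layerCutoff (g H : Bdry d → ℝ) (x : Space d) : ℝ := ratio g H x * tent g H x

/-- The region that contains the support of the cutoffs. -/
def region (g H : Bdry d → ℝ) : Set (Space d) :=
  {x | 0 < x 0 ∧ 9 / 10 * g (tang x) ≤ x 0 ∧ x 0 ≤ 11 / 10 * H (tang x)}

/-- The part of the region where the cutoffs vary. -/
def layer (g H : Bdry d → ℝ) : Set (Space d) :=
  region g H ∩ {x | x 0 ≤ g (tang x) ∨ H (tang x) ≤ x 0}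

lemma tent_nonneg (x : Space d) : 0 ≤ tent g H x := le_max_left _ _

lemma tent_of_nonpos {x : Space d} (hx : x 0 ≤ 0) : tent g H x = 0 :=
  max_eq_left ((min_le_left _ _).trans hx)

lemma tent_le {x : Space d} (hx : 0 ≤ x 0) : tent g H x ≤ x 0 := max_le hx (min_le_left _ _)

lemma ratio_mul (x : Space d) : ratio g H x * x 0 = tent g H x := by
  rcases eq_or_ne (x 0) 0 with h | h
  · rw [h, mul_zero, tent_of_nonpos h.le]
  · rw [ratio, div_mul_cancel₀ _ h]

lemma ratio_of_nonpos {x : Space d} (hx : x 0 ≤ 0) : ratio g H x = 0 := by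
  rw [ratio, tent_of_nonpos hx, zero_div]

lemma ratio_nonneg (x : Space d) : 0 ≤ ratio g H x := by
  rcases le_or_gt (x 0) 0 with h | h
  · rw [ratio_of_nonpos h]
  · exact div_nonneg (tent_nonneg x) h.le

lemma ratio_le_one (x : Space d) : ratio g H x ≤ 1 := by
  rcases le_or_gt (x 0) 0 with h | h
  · rw [ratio_of_nonpos h]; exact zero_le_one
  · exact (div_le_one h).2 (tent_le h.le)

lemma layerCutoff_nonneg (x : Space d) : 0 ≤ layerCutoff g H x :=
  mul_nonneg (ratio_nonneg x) (tent_nonneg x)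

lemma layerCutoff_eq (x : Space d) : layerCutoff g H x = ratio g H x ^ 2 * x 0 := by
  rw [layerCutoff, ← ratio_mul x]; ring

lemma layerCutoff_le {x : Space d} (hx : 0 ≤ x 0) : layerCutoff g H x ≤ x 0 :=
  (mul_le_of_le_one_left (tent_nonneg x) (ratio_le_one x)).trans (tent_le hx)

lemma tent_eq_zero_of_notMem {x : Space d} (hx : x ∉ region g H) : tent g H x = 0 := by
  by_contra h
  have h1 : 0 < tent g H x := lt_of_le_of_ne (tent_nonneg x) (Ne.symm h)
  simp only [tent, lt_max_iff, lt_self_iff_false, false_or, lt_min_iff] at h1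
  exact hx ⟨h1.1, by linarith [h1.2.1], by linarith [h1.2.2]⟩

lemma ratio_eq_zero_of_notMem {x : Space d} (hx : x ∉ region g H) : ratio g H x = 0 := by
  rw [ratio, tent_eq_zero_of_notMem hx, zero_div]

lemma layerCutoff_eq_zero_of_notMem {x : Space d} (hx : x ∉ region g H) :
    layerCutoff g H x = 0 := by
  rw [layerCutoff, tent_eq_zero_of_notMem hx, mul_zero]

lemma tent_eq {x : Space d} (h0 : 0 ≤ x 0) (h1 : g (tang x) ≤ x 0) (h2 : x 0 ≤ H (tang x)) :
    tent g H x = x 0 := by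
  rw [tent, min_eq_left (le_min (by linarith) (by linarith)), max_eq_right h0]

lemma ratio_eq_one {x : Space d} (h0 : 0 < x 0) (h1 : g (tang x) ≤ x 0) (h2 : x 0 ≤ H (tang x)) :
    ratio g H x = 1 := by
  rw [ratio, tent_eq h0.le h1 h2, div_self h0.ne']

lemma layerCutoff_of_ratio_eq_one {x : Space d} (h : ratio g H x = 1) :
    layerCutoff g H x = x 0 := by
  rw [layerCutoff_eq, h]; ring

/-- The steepest branch is 11 H - 10 x₀, with constant 11 + 10. -/
lemma lipschitz_tent (hg : LipschitzWith 1 g) (hH : LipschitzWith 1 H) :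
    LipschitzWith 21 (tent g H) := by
  have h0 := lipschitz_coord (d := d)
  have hmul : ∀ {F : Space d → ℝ} (c : ℝ≥0), LipschitzWith 1 F →
      LipschitzWith c fun x => (c : ℝ) * F x := fun c hF =>
    LipschitzWith.of_dist_le_mul fun x y => by
      have := hF.dist_le_mul x y
      rw [Real.dist_eq] at this ⊢
      rw [← mul_sub, abs_mul, abs_of_nonneg c.coe_nonneg]
      simpa using mul_le_mul_of_nonneg_left this c.coe_nonneg
  have hg' : LipschitzWith 1 fun x : Space d => g (tang x) := by
    simpa [Function.comp_def] using hg.comp lipschitz_tang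
  have hH' : LipschitzWith 1 fun x : Space d => H (tang x) := by
    simpa [Function.comp_def] using hH.comp lipschitz_tang
  have h1 := (hmul 10 h0).sub (hmul 9 hg')
  have h2 := (hmul 11 hH').sub (hmul 10 h0)
  have h3 := (h0.min (h1.min h2)).const_max 0
  refine (h3.weaken ?_)
  refine max_le (by norm_num) (max_le (by norm_num) (by norm_num))

lemma measurable_tent (hg : LipschitzWith 1 g) (hH : LipschitzWith 1 H) :
    Measurable (tent g H) := (lipschitz_tent hg hH).continuous.measurable

lemma measurable_ratio (hg : LipschitzWith 1 g) (hH : LipschitzWith 1 H) :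
    Measurable (ratio g H) := (measurable_tent hg hH).div (continuous_coord 0).measurable

lemma measurableSet_region (hg : LipschitzWith 1 g) (hH : LipschitzWith 1 H) :
    MeasurableSet (region g H) := by
  have h1 := (continuous_coord (d := d) 0).measurable
  have h2 := (hg.continuous.comp (lipschitz_tang (d := d)).continuous).measurable
  have h3 := (hH.continuous.comp (lipschitz_tang (d := d)).continuous).measurable
  exact measurableSet_halfSpace.inter ((measurableSet_le (h2.const_mul _) h1).inter
    (measurableSet_le h1 (h3.const_mul _)))

lemma measurableSet_layer (hg : LipschitzWith 1 g) (hH : LipschitzWith 1 H) :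
    MeasurableSet (layer g H) := by
  have h1 := (continuous_coord (d := d) 0).measurable
  have h2 := (hg.continuous.comp (lipschitz_tang (d := d)).continuous).measurable
  have h3 := (hH.continuous.comp (lipschitz_tang (d := d)).continuous).measurable
  exact (measurableSet_region hg hH).inter ((measurableSet_le h1 h2).union (measurableSet_le h3 h1))

/-- A difference formula for tent²/x₀ without division by x₀. It therefore holds across the
boundary, and each term keeps a factor `ratio`. -/
lemma abs_layerCutoff_sub_le (x y : Space d) : |layerCutoff g H x - layerCutoff g H y| ≤
    (ratio g H x + ratio g H y) * |tent g H x - tent g H y| +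
      ratio g H x * ratio g H y * |x 0 - y 0| := by
  have h1 : layerCutoff g H x - layerCutoff g H y =
      ratio g H x * (tent g H x - tent g H y) + ratio g H y * (tent g H x - tent g H y) -
        ratio g H x * ratio g H y * (x 0 - y 0) := by
    rw [layerCutoff, layerCutoff]
    linear_combination (ratio g H y) * ratio_mul (g := g) (H := H) x -
      (ratio g H x) * ratio_mul (g := g) (H := H) y
  have hx := ratio_nonneg (g := g) (H := H) x
  have hy := ratio_nonneg (g := g) (H := H) y
  rw [h1]
  refine (abs_sub _ _).trans (add_le_add ((abs_add_le _ _).trans (le_of_eq ?_)) (le_of_eq ?_))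
  · rw [abs_mul, abs_mul, abs_of_nonneg hx, abs_of_nonneg hy]; ring
  · rw [abs_mul, abs_of_nonneg (mul_nonneg hx hy)]

lemma abs_ratio_sub_le {x y : Space d} (hy : 0 < y 0) :
    |ratio g H x - ratio g H y| ≤ (|tent g H x - tent g H y| + |x 0 - y 0|) / y 0 := by
  have h1 : (ratio g H x - ratio g H y) * y 0 =
      (tent g H x - tent g H y) - ratio g H x * (x 0 - y 0) := by
    linear_combination ratio_mul (g := g) (H := H) x - ratio_mul (g := g) (H := H) y
  have hx := ratio_nonneg (g := g) (H := H) x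
  rw [le_div_iff₀ hy, ← abs_of_pos hy, ← abs_mul, h1, abs_of_pos hy]
  refine (abs_sub _ _).trans (add_le_add le_rfl ?_)
  rw [abs_mul, abs_of_nonneg hx]
  exact mul_le_of_le_one_left (abs_nonneg _) (ratio_le_one x)

lemma abs_tent_sub_le (hg : LipschitzWith 1 g) (hH : LipschitzWith 1 H) (x y : Space d) :
    |tent g H x - tent g H y| ≤ 21 * dist x y := by
  simpa [Real.dist_eq] using (lipschitz_tent hg hH).dist_le_mul x y

lemma lipschitz_layerCutoff (hg : LipschitzWith 1 g) (hH : LipschitzWith 1 H) :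
    LipschitzWith 43 (layerCutoff g H) := by
  refine LipschitzWith.of_dist_le_mul fun x y => ?_
  rw [Real.dist_eq]
  refine (abs_layerCutoff_sub_le x y).trans ?_
  have h1 := abs_tent_sub_le hg hH x y
  have h2 := abs_coord_sub_le x y 0
  have hx := ratio_nonneg (g := g) (H := H) x
  have hy := ratio_nonneg (g := g) (H := H) y
  have hx1 := ratio_le_one (g := g) (H := H) x
  have hy1 := ratio_le_one (g := g) (H := H) y
  have h3 : (ratio g H x + ratio g H y) * |tent g H x - tent g H y| ≤ 2 * (21 * dist x y) :=
    mul_le_mul (by linarith) h1 (abs_nonneg _) (by norm_num)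
  have h4 : ratio g H x * ratio g H y * |x 0 - y 0| ≤ 1 * dist x y :=
    mul_le_mul (mul_le_one₀ hx1 hy hy1) h2 (abs_nonneg _) zero_le_one
  push_cast
  linarith

lemma continuousAt_ratio (hg : LipschitzWith 1 g) (hH : LipschitzWith 1 H) {x : Space d}
    (hx : 0 < x 0) : ContinuousAt (ratio g H) x :=
  (lipschitz_tent hg hH).continuous.continuousAt.div (continuous_coord 0).continuousAt hx.ne'

/-- Off the layer the cutoff is locally constant. -/
lemma eventually_ratio_eq (hg : Continuous g) (hH : Continuous H) {x : Space d} (hx : 0 < x 0)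
    (hl : x ∉ layer g H) : ∀ᶠ y in 𝓝 x, ratio g H y = ratio g H x := by
  have h0 := continuous_coord (d := d) 0
  have hg' := hg.comp (lipschitz_tang (d := d)).continuous
  have hH' := hH.comp (lipschitz_tang (d := d)).continuous
  by_cases h : x ∈ region g H
  · have h1 : g (tang x) < x 0 ∧ x 0 < H (tang x) := by
      by_contra h2
      rw [not_and_or, not_lt, not_lt] at h2
      exact hl ⟨h, h2⟩
    rw [ratio_eq_one hx h1.1.le h1.2.le]
    filter_upwards [h0.continuousAt.eventually (lt_mem_nhds hx),
      (h0.sub hg').continuousAt.eventually (lt_mem_nhds (sub_pos.2 h1.1)),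
      (hH'.sub h0).continuousAt.eventually (lt_mem_nhds (sub_pos.2 h1.2))] with y hy1 hy2 hy3
    exact ratio_eq_one hy1 (sub_pos.1 hy2).le (sub_pos.1 hy3).le
  · rw [ratio_eq_zero_of_notMem h]
    have h1 : x 0 < 9 / 10 * g (tang x) ∨ 11 / 10 * H (tang x) < x 0 := by
      by_contra h2
      rw [not_or, not_lt, not_lt] at h2
      exact h ⟨hx, h2⟩
    rcases h1 with h1 | h1
    · filter_upwards [((hg'.const_mul (9 / 10)).sub h0).continuousAt.eventually
        (lt_mem_nhds (sub_pos.2 h1))] with y hy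
      exact ratio_eq_zero_of_notMem fun hy' => absurd hy'.2.1 (not_le.2 (sub_pos.1 hy))
    · filter_upwards [(h0.sub (hH'.const_mul (11 / 10))).continuousAt.eventually
        (lt_mem_nhds (sub_pos.2 h1))] with y hy
      exact ratio_eq_zero_of_notMem fun hy' => absurd hy'.2.2 (not_le.2 (sub_pos.1 hy))

/-- The gain from squaring the tent: the gradient is bounded by `ratio`, whose square times x₀ is
the cutoff itself. Hence flux terms can be absorbed by the energy weighted with the same cutoff. -/
lemma abs_rd_layerCutoff_le (hg : LipschitzWith 1 g) (hH : LipschitzWith 1 H) {x : Space d}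
    (hx : 0 < x 0) (k : Fin (d + 1)) : |rd k (layerCutoff g H) x| ≤ 65 * ratio g H x := by
  rcases (ratio_nonneg (g := g) (H := H) x).eq_or_lt with h0 | h0
  · rw [rd_eq_zero_of_min layerCutoff_nonneg (by rw [layerCutoff, ← h0, zero_mul]), ← h0]
    simp
  refine abs_rd_le_of_line (by positivity) ?_
  have hc : Tendsto (fun t : ℝ => x + t • (EuclideanSpace.single k 1 : Space d)) (𝓝 0) (𝓝 x) := by
    have : Continuous fun t : ℝ => x + t • (EuclideanSpace.single k 1 : Space d) := by fun_prop
    simpa using this.tendsto 0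
  have h1 := ((continuousAt_ratio hg hH hx).tendsto.comp hc).eventually
    (gt_mem_nhds (by linarith : ratio g H x < 2 * ratio g H x))
  filter_upwards [h1] with t ht
  set y := x + t • (EuclideanSpace.single k 1 : Space d) with hy
  have ht' : ratio g H y < 2 * ratio g H x := ht
  have hd : dist y x = |t| := by
    rw [hy, dist_eq_norm, add_sub_cancel_left, norm_smul, PiLp.norm_single]; simp
  have h2 := abs_tent_sub_le hg hH y x
  have h3 := abs_coord_sub_le y x 0
  rw [hd] at h2 h3
  have hy0 := ratio_nonneg (g := g) (H := H) y
  refine (abs_layerCutoff_sub_le y x).trans ?_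
  -- Near x the ratio is less than twice its value at x, so the slope is at most 3 · 21 + 1 times
  -- that value, below 65.
  have h4 : (ratio g H y + ratio g H x) * |tent g H y - tent g H x| ≤
      (3 * ratio g H x) * (21 * |t|) :=
    mul_le_mul (by linarith) h2 (abs_nonneg _) (by positivity)
  have h5 : ratio g H y * ratio g H x * |y 0 - x 0| ≤ (1 * ratio g H x) * |t| :=
    mul_le_mul (mul_le_mul_of_nonneg_right (ratio_le_one y) h0.le) h3 (abs_nonneg _) (by positivity)
  have h6 : 0 ≤ ratio g H x * |t| := by positivity
  nlinarith

lemma rd_layerCutoff_of_notMem_layer (hg : Continuous g) (hH : Continuous H) {x : Space d}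
    (hx : 0 < x 0) (hl : x ∉ layer g H) (k : Fin (d + 1)) :
    rd k (layerCutoff g H) x = if k = 0 then ratio g H x ^ 2 else 0 := by
  have h1 := eventually_ratio_eq hg hH hx hl
  have h2 : layerCutoff g H =ᶠ[𝓝 x] fun y => ratio g H x ^ 2 * y 0 := by
    filter_upwards [h1] with y hy
    rw [layerCutoff_eq, hy]
  have h3 : HasFDerivAt (fun y : Space d => y 0)
      (EuclideanSpace.proj 0 : Space d →L[ℝ] ℝ) x :=
    (EuclideanSpace.proj (𝕜 := ℝ) (0 : Fin (d + 1))).hasFDerivAt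
  rw [rd, h2.fderiv_eq, (h3.const_mul _).fderiv]
  by_cases hk : k = 0
  · simp [hk]
  · simp [hk, Ne.symm hk]

lemma abs_rd_zero_layerCutoff_sub_le (hg : LipschitzWith 1 g) (hH : LipschitzWith 1 H)
    {x : Space d} (hx : 0 < x 0) : |rd 0 (layerCutoff g H) x - ratio g H x ^ 2| ≤
      (layer g H).indicator (fun x => 66 * ratio g H x) x := by
  by_cases hl : x ∈ layer g H
  · rw [indicator_of_mem hl]
    have h0 := ratio_nonneg (g := g) (H := H) x
    have h1 := ratio_le_one (g := g) (H := H) x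
    refine (abs_sub _ _).trans ?_
    rw [abs_of_nonneg (by positivity : 0 ≤ ratio g H x ^ 2)]
    nlinarith [abs_rd_layerCutoff_le hg hH hx 0]
  · rw [indicator_of_notMem hl, rd_layerCutoff_of_notMem_layer hg.continuous hH.continuous hx hl]
    simp

lemma norm_tgrad_layerCutoff_le (hg : LipschitzWith 1 g) (hH : LipschitzWith 1 H)
    {x : Space d} (hx : 0 < x 0) : ‖tgrad (layerCutoff g H) x‖ ≤
      (layer g H).indicator (fun x => 65 * d * ratio g H x) x := by
  refine (norm_tgrad_le _ x).trans ?_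
  by_cases hl : x ∈ layer g H
  · rw [indicator_of_mem hl]
    refine (Finset.sum_le_sum fun i _ => abs_rd_layerCutoff_le hg hH hx i.succ).trans (le_of_eq ?_)
    simp; ring
  · rw [indicator_of_notMem hl]
    refine le_of_eq (Finset.sum_eq_zero fun i _ => ?_)
    rw [rd_layerCutoff_of_notMem_layer hg.continuous hH.continuous hx hl, if_neg (Fin.succ_ne_zero i)]
    simp

/-- The profile of the cutoff on the vertical line through `y`, frozen below the height `t₀`. -/
lemma lipschitz_ratio_line (hg : LipschitzWith 1 g) (hH : LipschitzWith 1 H) (y : Bdry d) {t₀ : ℝ}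
    (ht₀ : 0 < t₀) :
    LipschitzWith (Real.toNNReal (44 / t₀)) fun t : ℝ => ratio g H (pt (max t t₀) y) ^ 2 := by
  refine LipschitzWith.of_dist_le_mul fun s t => ?_
  rw [Real.coe_toNNReal _ (by positivity), Real.dist_eq, Real.dist_eq]
  have hs : t₀ ≤ max s t₀ := le_max_right _ _
  have ht : t₀ ≤ max t t₀ := le_max_right _ _
  have h0 : (0 : ℝ) < (pt (max t t₀) y : Space d) 0 := by rw [pt_zero]; linarith
  have h1 := abs_ratio_sub_le (g := g) (H := H) (x := pt (max s t₀) y) h0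
  have h2 := abs_tent_sub_le hg hH (pt (max s t₀) y) (pt (max t t₀) y)
  have h3 : dist (pt (max s t₀) y : Space d) (pt (max t t₀) y) ≤ |max s t₀ - max t t₀| := by
    simpa using dist_le_coord_add_tang (pt (max s t₀) y : Space d) (pt (max t t₀) y)
  rw [pt_zero, pt_zero] at h1
  have h4 : |max s t₀ - max t t₀| ≤ |s - t| := abs_max_sub_max_le_abs _ _ _
  have ha := ratio_nonneg (g := g) (H := H) (pt (max s t₀) y)
  have hb := ratio_nonneg (g := g) (H := H) (pt (max t t₀) y)
  have ha' := ratio_le_one (g := g) (H := H) (pt (max s t₀) y)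
  have hb' := ratio_le_one (g := g) (H := H) (pt (max t t₀) y)
  rw [sq_sub_sq, abs_mul, abs_of_nonneg (add_nonneg ha hb)]
  have h5 : (|tent g H (pt (max s t₀) y) - tent g H (pt (max t t₀) y)| + |max s t₀ - max t t₀|) /
      max t t₀ ≤ 22 * |s - t| / t₀ := by
    gcongr
    linarith
  calc _ ≤ 2 * (22 * |s - t| / t₀) :=
        mul_le_mul (by linarith) (h1.trans h5) (abs_nonneg _) (by norm_num)
    _ = _ := by ring

lemma abs_deriv_ratio_line_le (hg : LipschitzWith 1 g) (hH : LipschitzWith 1 H) (y : Bdry d)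
    {t : ℝ} (ht : 0 < t) : |deriv (fun s : ℝ => ratio g H (pt s y) ^ 2) t| ≤
      (layer g H).indicator (fun x => 88 / x 0) (pt t y) := by
  have hpt : Continuous fun s : ℝ => (pt s y : Space d) :=
    continuous_pt.comp (Continuous.prodMk continuous_id continuous_const)
  by_cases hl : pt t y ∈ layer g H
  · rw [indicator_of_mem hl, pt_zero]
    -- Freezing the profile below t/2 does not affect it near t, and gives the constant 44/(t/2) =
    -- 88/t.
    have h1 : (fun s : ℝ => ratio g H (pt s y) ^ 2) =ᶠ[𝓝 t]
        fun s => ratio g H (pt (max s (t / 2)) y) ^ 2 := by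
      filter_upwards [lt_mem_nhds (by linarith : t / 2 < t)] with s hs
      rw [max_eq_left hs.le]
    rw [h1.deriv_eq]
    have h2 := norm_deriv_le_of_lipschitz (x₀ := t) (lipschitz_ratio_line hg hH y (half_pos ht))
    rw [Real.coe_toNNReal _ (by positivity), Real.norm_eq_abs] at h2
    refine h2.trans (le_of_eq ?_)
    field_simp
    norm_num
  · rw [indicator_of_notMem hl]
    have h0 : 0 < (pt t y : Space d) 0 := by rwa [pt_zero]
    have h1 := (hpt.tendsto t).eventually
      (eventually_ratio_eq hg.continuous hH.continuous h0 hl)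
    have h2 : (fun s : ℝ => ratio g H (pt s y) ^ 2) =ᶠ[𝓝 t]
        fun _ => ratio g H (pt t y) ^ 2 := by
      filter_upwards [h1] with s hs
      rw [hs]
    rw [h2.deriv_eq]; simp

/-- Near the boundary the cutoff is constant on vertical lines. -/
lemma exists_ratio_line_eq (hg0 : ∀ y, 0 ≤ g y) (y : Bdry d) : ∃ t₀ : ℝ, 0 < t₀ ∧
    ∀ t, 0 < t → t ≤ t₀ → ratio g H (pt t y) = {y | g y = 0 ∧ 0 < H y}.indicator 1 y := by
  rcases (hg0 y).eq_or_lt with h | h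
  · rcases le_or_gt (H y) 0 with hH | hH
    · refine ⟨1, one_pos, fun t ht _ => ?_⟩
      rw [indicator_of_notMem (by simp [hH]), ratio_eq_zero_of_notMem]
      intro hx
      have := hx.2.2
      rw [pt_zero, tang_pt] at this
      linarith
    · refine ⟨H y, hH, fun t ht ht' => ?_⟩
      rw [indicator_of_mem (by exact ⟨h.symm, hH⟩), ratio_eq_one (by rwa [pt_zero])
        (by rw [pt_zero, tang_pt, ← h]; exact ht.le) (by rwa [pt_zero, tang_pt])]
      rfl
  · refine ⟨g y / 2, by linarith, fun t ht ht' => ?_⟩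
    rw [indicator_of_notMem (by simp [h.ne']), ratio_eq_zero_of_notMem]
    intro hx
    have := hx.2.1
    rw [pt_zero, tang_pt] at this
    linarith

end LayerCutoff

/-! ### The energy inequality with the graph cutoff. -/

section LayerInequality

variable {d : ℕ} {p h : ℝ} {A : Space d → Matrix (Fin (d + 1)) (Fin (d + 1)) ℂ}
    {B : Space d → EuclideanSpace ℂ (Fin (d + 1))} {f : Bdry d → ℂ} {u : Space d → ℂ}
    {G : Space d → EuclideanSpace ℂ (Fin (d + 1))} {g H : Bdry d → ℝ}

lemma integrable_slice_halfSpace {F : Space d → ℝ} (hF : IntegrableOn F (halfSpace d)) :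
    ∀ᵐ y : Bdry d, IntegrableOn (fun t => F (pt t y)) (Ioi 0) := by
  have h1 := (integrable_indicator_iff measurableSet_halfSpace).2 hF
  filter_upwards [(integrable_comp_pt h1).prod_left_ae] with y hy
  rw [← integrable_indicator_iff measurableSet_Ioi]
  refine hy.congr (Eventually.of_forall fun t => ?_)
  by_cases ht : 0 < t <;> simp [indicator, halfSpace, ht]

/-- The boundary term of the transversal integration by parts against the squared cutoff. -/
lemma IsEnergySolution.neg_integral_ratio_le (hs : IsEnergySolution h A B f u G) (hh : 0 < h)
    (hp : 0 ≤ p) (P : Profile p) (hg : LipschitzWith 1 g) (hH : LipschitzWith 1 H)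
    (hg0 : ∀ y, 0 ≤ g y) {T : ℝ} (hT : 0 < T) (hHT : ∀ y, 11 / 10 * H y < T)
    (hJ : IntegrableOn ((layer g H).indicator fun x => P.V (u x) / x 0) (halfSpace d)) :
    -(p * ∫ x in halfSpace d, (G x 0 * P.Th (u x)).re * ratio g H x ^ 2) ≤
      (∫ y, {y | g y = 0 ∧ 0 < H y}.indicator (fun y => P.V (u (pt 0 y))) y) +
        88 * ∫ x in halfSpace d, (layer g H).indicator (fun x => P.V (u x) / x 0) x := by
  set S : Set (Bdry d) := {y | g y = 0 ∧ 0 < H y} with hS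
  have hSm : MeasurableSet S := (hg.continuous.measurable (measurableSet_singleton 0)).inter
    (measurableSet_lt measurable_const hH.continuous.measurable)
  have hF : IntegrableOn (fun x => p * ((G x 0 * P.Th (u x)).re * ratio g H x ^ 2))
      (halfSpace d) := (hs.integrable_transversal hh P 0 ((measurable_ratio hg hH).pow_const 2)
        (M := 1) (fun x => by
          rw [abs_of_nonneg (by positivity)]
          exact pow_le_one₀ (ratio_nonneg x) (ratio_le_one x))).const_mul p
  have hV0 := (integrable_V_of_memLp hp P (hs.memLp_level hh le_rfl)).indicator hSm
  rw [← integral_const_mul, integral_halfSpace hF, integral_halfSpace hJ, ← integral_neg,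
    ← integral_const_mul,
    ← integral_add hV0 ((integrable_integral_halfSpace hJ).const_mul 88)]
  refine integral_mono_ae (integrable_integral_halfSpace hF).neg
    (hV0.add ((integrable_integral_halfSpace hJ).const_mul 88)) ?_
  filter_upwards [hs.slice_integral hh P, integrable_slice_halfSpace hJ] with y hy hJy
  obtain ⟨t₀, ht₀, hconst⟩ := exists_ratio_line_eq (H := H) hg0 y
  -- Since the profile is constant on (0, t₀], freezing it there changes nothing for t > 0 and makes
  -- it Lipschitz up to t = 0. Its value at 0 is 1 exactly when g y = 0 < H y, so a boundary term
  -- appears only where the graph touches the boundary.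
  set χ : ℝ → ℝ := fun t => ratio g H (pt (max t t₀) y) ^ 2 with hχ
  have hχeq : ∀ t, 0 < t → χ t = ratio g H (pt t y) ^ 2 := fun t ht => by
    rcases le_total t₀ t with h1 | h1
    · simp only [hχ, max_eq_left h1]
    · simp only [hχ, max_eq_right h1]
      rw [hconst t ht h1, hconst t₀ ht₀ le_rfl]
  have hχ0 : χ 0 * P.V (u (pt 0 y)) = S.indicator (fun y => P.V (u (pt 0 y))) y := by
    simp only [hχ, max_eq_right ht₀.le]
    rw [hconst t₀ ht₀ le_rfl, ← hS]
    by_cases hyS : y ∈ S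
    · rw [indicator_of_mem hyS, indicator_of_mem hyS, Pi.one_apply, one_pow, one_mul]
    · rw [indicator_of_notMem hyS, indicator_of_notMem hyS]; ring
  have hzero : ∀ t, T ≤ t → ratio g H (pt t y) = 0 := fun t ht =>
    ratio_eq_zero_of_notMem fun hx => by
      have := hx.2.2
      rw [pt_zero, tang_pt] at this
      linarith [hHT y]
  have hχT : χ T = 0 := by rw [hχeq T hT, hzero T le_rfl]; norm_num
  have hac : AbsolutelyContinuousOnInterval χ 0 T :=
    (lipschitz_ratio_line hg hH y ht₀).lipschitzOnWith.absolutelyContinuousOnInterval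
  have h1 := hy 0 T le_rfl hT.le χ hac
  rw [hχT, zero_mul, zero_sub, hχ0] at h1
  have h2 : ∫ t in Ioi (0 : ℝ), p * ((G (pt t y) 0 * P.Th (u (pt t y))).re *
      ratio g H (pt t y) ^ 2) = ∫ t in (0 : ℝ)..T, χ t * (p * (G (pt t y) 0 * P.Th (u (pt t y))).re) := by
    rw [intervalIntegral.integral_of_le hT.le,
      setIntegral_eq_of_subset_of_forall_sdiff_eq_zero measurableSet_Ioi
        (Ioc_subset_Ioi_self : Ioc 0 T ⊆ Ioi (0 : ℝ)) fun t ht => ?_]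
    · refine setIntegral_congr_fun measurableSet_Ioc fun t ht => ?_
      simp only
      rw [hχeq t ht.1]; ring
    · have : T < t := by
        by_contra h3
        exact ht.2 ⟨ht.1, not_lt.1 h3⟩
      rw [hzero t this.le]; ring
  have hJ0 : ∀ t ∈ Ioi (0 : ℝ), 0 ≤ (layer g H).indicator (fun x => P.V (u x) / x 0) (pt t y) :=
    fun t ht => indicator_nonneg (fun x hx => div_nonneg (P.V_nonneg hp _) hx.1.1.le) _
  have hJT : IntervalIntegrable (fun t => 88 * (layer g H).indicator (fun x => P.V (u x) / x 0)
      (pt t y)) volume 0 T :=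
    (intervalIntegrable_iff_integrableOn_Ioc_of_le hT.le).2
      ((hJy.mono_set Ioc_subset_Ioi_self).const_mul 88)
  have h3 : ‖∫ t in (0 : ℝ)..T, deriv χ t * P.V (u (pt t y))‖ ≤
      ∫ t in (0 : ℝ)..T, 88 * (layer g H).indicator (fun x => P.V (u x) / x 0) (pt t y) := by
    refine intervalIntegral.norm_integral_le_of_norm_le hT.le
      (Eventually.of_forall fun t ht => ?_) hJT
    have h4 : χ =ᶠ[𝓝 t] fun s => ratio g H (pt s y) ^ 2 := by
      filter_upwards [lt_mem_nhds ht.1] with s hs'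
      exact hχeq s hs'
    have h5 := abs_deriv_ratio_line_le hg hH y ht.1
    have h6 := P.V_nonneg hp (u (pt t y))
    rw [h4.deriv_eq, norm_mul, Real.norm_eq_abs, Real.norm_of_nonneg h6]
    refine (mul_le_mul_of_nonneg_right h5 h6).trans (le_of_eq ?_)
    by_cases hl : pt t y ∈ layer g H
    · rw [indicator_of_mem hl, indicator_of_mem hl]; ring
    · rw [indicator_of_notMem hl, indicator_of_notMem hl]; ring
  have h7 : ∫ t in (0 : ℝ)..T, 88 * (layer g H).indicator (fun x => P.V (u x) / x 0) (pt t y) ≤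
      88 * ∫ t in Ioi (0 : ℝ), (layer g H).indicator (fun x => P.V (u x) / x 0) (pt t y) := by
    rw [intervalIntegral.integral_const_mul, intervalIntegral.integral_of_le hT.le]
    refine mul_le_mul_of_nonneg_left (setIntegral_mono_set hJy
      ((ae_restrict_mem measurableSet_Ioi).mono hJ0)
      (Ioc_subset_Ioi_self : Ioc 0 T ⊆ Ioi (0 : ℝ)).eventuallyLE) (by norm_num)
  rw [h2, h1]
  rw [Real.norm_eq_abs] at h3
  linarith [le_abs_self (∫ t in (0 : ℝ)..T, deriv χ t * P.V (u (pt t y)))]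

/-- Applied both to w(|z|²)|z|², which arises from Young's inequality, and to `V`, which arises from
integration by parts. Both are dominated by |z|^p. -/
lemma IsEnergySolution.integrable_layer (hs : IsEnergySolution h A B f u G) (hh : 0 < h)
    (hg : LipschitzWith 1 g) (hH : LipschitzWith 1 H) {φ : ℂ → ℝ} (hφ : Continuous φ)
    (hφ0 : ∀ z, 0 ≤ φ z) (hφp : ∀ z, ENNReal.ofReal (φ z) ≤ ‖z‖ₑ ^ p) {R : ℝ} (hR0 : 0 ≤ R)
    (hR : ∫⁻ x in layer g H, ‖u x‖ₑ ^ p * ENNReal.ofReal (1 / x 0) ≤ ENNReal.ofReal R) :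
    IntegrableOn ((layer g H).indicator fun x => φ (u x) / x 0) (halfSpace d) ∧
      ∫ x in halfSpace d, (layer g H).indicator (fun x => φ (u x) / x 0) x ≤ R := by
  have hm := measurableSet_layer (d := d) hg hH
  have hnn : ∀ x, 0 ≤ (layer g H).indicator (fun x => φ (u x) / x 0) x :=
    indicator_nonneg fun x hx => div_nonneg (hφ0 _) hx.1.1.le
  have hmeas : AEStronglyMeasurable ((layer g H).indicator fun x => φ (u x) / x 0)
      (volume.restrict (halfSpace d)) := by
    have h1 := (hφ.comp_aestronglyMeasurable (hs.memLp_u hh).aestronglyMeasurable).aemeasurable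
    have h2 := h1.div (continuous_coord (d := d) 0).measurable.aemeasurable
    exact (h2.indicator hm).aestronglyMeasurable
  have hle : ∫⁻ x in halfSpace d,
      ENNReal.ofReal ((layer g H).indicator (fun x => φ (u x) / x 0) x) ≤ ENNReal.ofReal R := by
    refine le_trans ?_ hR
    rw [← lintegral_indicator hm]
    refine (setLIntegral_le_lintegral _ _).trans (lintegral_mono fun x => ?_)
    by_cases hx : x ∈ layer g H
    · rw [indicator_of_mem hx, indicator_of_mem hx, div_eq_mul_one_div,
        ENNReal.ofReal_mul (hφ0 _)]
      gcongr
      exact hφp _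
    · rw [indicator_of_notMem hx, indicator_of_notMem hx, ENNReal.ofReal_zero]
  have hint : IntegrableOn ((layer g H).indicator fun x => φ (u x) / x 0) (halfSpace d) := by
    refine ⟨hmeas, ?_⟩
    rw [hasFiniteIntegral_iff_ofReal (Eventually.of_forall hnn)]
    exact hle.trans_lt ENNReal.ofReal_lt_top
  refine ⟨hint, (ENNReal.ofReal_le_ofReal_iff hR0).1 ?_⟩
  rwa [ofReal_integral_eq_lintegral_ofReal hint (Eventually.of_forall hnn)]

lemma hasCompactSupport_layerCutoff {q : Bdry d} {T : ℝ}
    (hHq : ∀ y, 0 < H y → dist y q ≤ T ∧ H y ≤ T) :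
    HasCompactSupport (layerCutoff g H) := by
  refine HasCompactSupport.intro (isCompact_closedBall (pt 0 q) (3 * T)) fun x hx => ?_
  refine layerCutoff_eq_zero_of_notMem fun hxr => hx ?_
  obtain ⟨h0, -, h2⟩ := hxr
  obtain ⟨h3, h4⟩ := hHq (tang x) (by linarith)
  rw [mem_closedBall]
  refine (dist_le_coord_add_tang _ _).trans ?_
  rw [pt_zero, tang_pt, sub_zero, abs_of_pos h0]
  linarith

/-- Off the layer the cutoff is a constant multiple of x₀, so all deviations of ∇ζ from ratio² e₀
live on the layer and are at most a multiple of `ratio`. One further Young inequality splits this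
flux into the weighted energy, whence 4θ instead of 3θ, and |u|^p / x₀ on the layer. The remaining
term in ratio² is integrated along vertical lines. -/
lemma IsEnergySolution.layer_inequality {lam Lam θ : ℝ}
    (hs : IsEnergySolution h A B f u G) (hh : 0 < h)
    (hA : ∀ i j, ContDiffOn ℝ ∞ (fun x => A x i j) (halfSpace d))
    (hB : ContDiffOn ℝ ∞ B (halfSpace d)) (hell : IsPElliptic p lam Lam A)
    (hrow : ∀ x ∈ halfSpace d, A x 0 0 = 1 ∧ ∀ j, (A x 0 j).im = 0)
    (hp : 1 < p) (hlam : 0 ≤ lam) (hθ : 0 < θ) (P : Profile p) (hg : LipschitzWith 1 g)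
    (hH : LipschitzWith 1 H) (hg0 : ∀ y, 0 ≤ g y) {q : Bdry d} {T : ℝ} (hT : 0 < T)
    (hHq : ∀ y, 0 < H y → dist y q ≤ T ∧ H y ≤ T) {R R' : ℝ} (hR0 : 0 ≤ R) (hR0' : 0 ≤ R')
    (hR : ∫⁻ x in halfSpace d, ENNReal.ofReal (rowDensity A B x * (P.om (u x) * ‖u x‖ ^ 2) *
      layerCutoff g H x) ≤ ENNReal.ofReal R)
    (hR' : ∫⁻ x in layer g H, ‖u x‖ₑ ^ p * ENNReal.ofReal (1 / x 0) ≤ ENNReal.ofReal R') :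
    p * (lam * min 2 p - 4 * θ) *
        (∫ x in halfSpace d, P.om (u x) * ‖G x‖ ^ 2 * layerCutoff g H x) ≤
      p / (4 * θ) * R + (p * (66 + 130 * d * |Lam|) ^ 2 / (4 * θ) + 88) * R' +
        ∫ y, {y | g y = 0 ∧ 0 < H y}.indicator (fun y => P.V (u (pt 0 y))) y := by
  set ζ := layerCutoff g H with hζ
  -- 66 = 65 + 1 bounds the deviation of ∂₀ζ from ratio², and 130 d |Λ| is 2|Λ| times the bound 65 d
  -- for the tangential gradient.
  set κ : ℝ := 66 + 130 * d * |Lam| with hκ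
  have hζL := lipschitz_layerCutoff hg hH
  have hcs := hasCompactSupport_layerCutoff (g := g) hHq
  obtain ⟨M, hM⟩ := hcs.exists_bound_of_continuous hζL.continuous
  have hr0 := ratio_nonneg (d := d) (g := g) (H := H)
  have hr1 := ratio_le_one (d := d) (g := g) (H := H)
  have hrm := measurable_ratio hg hH
  have hlm := measurableSet_layer hg hH
  have hen := hs.energy_inequality hh hA hB hell hrow hp hlam hθ P hζL layerCutoff_nonneg hcs
    (fun x hx => by rw [layerCutoff, tent_of_nonpos hx, mul_zero]) hR0 hR
  have hI := hs.integrable_energy hh P hζL.continuous.measurable hM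
  have hI1 := hs.integrable_transversal hh P 0 (measurable_rd 0 ζ) (abs_rd_le hζL 0)
  have hI2 := hs.integrable_transversal hh P 0 (hrm.pow_const 2) (M := 1) fun x => by
    rw [abs_of_nonneg (by positivity)]
    exact pow_le_one₀ (hr0 x) (hr1 x)
  have hI3 := hs.integrable_flux hh P (measurable_tgrad ζ).norm
    (fun x => by rw [abs_of_nonneg (norm_nonneg _)]; exact norm_tgrad_le_of_lipschitz hζL x)
  have hc0 : ∀ x, 0 ≤ (layer g H).indicator (ratio g H) x := indicator_nonneg fun x _ => hr0 x
  have hI4 := hs.integrable_flux hh P (hrm.indicator hlm) (M := 1) fun x => by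
    rw [abs_of_nonneg (hc0 x)]
    exact indicator_le_self' (fun _ _ => hr0 x) x |>.trans (hr1 x)
  set Fl := ∫ x in halfSpace d, (layer g H).indicator (ratio g H) x * (‖G x‖ * ‖P.Th (u x)‖)
    with hFl
  obtain ⟨hJ1, hJ2⟩ := hs.integrable_layer hh hg hH (φ := fun z => P.om z * ‖z‖ ^ 2)
    (P.continuous_om.mul (by fun_prop))
    (fun z => mul_nonneg (P.om_nonneg z) (by positivity)) (ofReal_om_le (by linarith) P) hR0' hR'
  obtain ⟨hJ3, hJ4⟩ := hs.integrable_layer hh hg hH P.continuous_V (P.V_nonneg (by linarith))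
    (ofReal_V_le (by linarith) P) hR0' hR'
  have hbd := hs.neg_integral_ratio_le hh (by linarith) P hg hH hg0 (T := 2 * T) (by linarith)
    (fun y => by
      rcases le_or_gt (H y) 0 with h1 | h1
      · linarith
      · linarith [(hHq y h1).2]) hJ3
  have e1 : (∫ x in halfSpace d, (G x 0 * P.Th (u x)).re * ratio g H x ^ 2) - 66 * Fl ≤
      ∫ x in halfSpace d, (G x 0 * P.Th (u x)).re * rd 0 ζ x := by
    rw [hFl, ← integral_const_mul, ← integral_sub hI2 (hI4.const_mul 66)]
    refine setIntegral_mono_on (hI2.sub (hI4.const_mul 66)) hI1 measurableSet_halfSpace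
      fun x hx => ?_
    have h1 := abs_rd_zero_layerCutoff_sub_le hg hH hx
    have h2 : |(G x 0 * P.Th (u x)).re| ≤ ‖G x‖ * ‖P.Th (u x)‖ := by
      refine (Complex.abs_re_le_norm _).trans ?_
      rw [norm_mul]
      exact mul_le_mul_of_nonneg_right (PiLp.norm_apply_le _ _) (norm_nonneg _)
    have h3 : (layer g H).indicator (fun x => 66 * ratio g H x) x =
        66 * (layer g H).indicator (ratio g H) x := by
      by_cases hl : x ∈ layer g H <;> simp [hl]
    rw [h3] at h1
    have h4 : |(G x 0 * P.Th (u x)).re * (rd 0 ζ x - ratio g H x ^ 2)| ≤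
        (‖G x‖ * ‖P.Th (u x)‖) * (66 * (layer g H).indicator (ratio g H) x) := by
      rw [abs_mul]
      exact mul_le_mul h2 h1 (abs_nonneg _) (by positivity)
    have h5 := neg_abs_le ((G x 0 * P.Th (u x)).re * (rd 0 ζ x - ratio g H x ^ 2))
    nlinarith
  have e2 : 2 * Lam * (∫ x in halfSpace d, ‖tgrad ζ x‖ * (‖G x‖ * ‖P.Th (u x)‖)) ≤
      130 * d * |Lam| * Fl := by
    have h1 : ∫ x in halfSpace d, ‖tgrad ζ x‖ * (‖G x‖ * ‖P.Th (u x)‖) ≤ 65 * d * Fl := by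
      rw [hFl, ← integral_const_mul]
      refine setIntegral_mono_on hI3 (hI4.const_mul _) measurableSet_halfSpace fun x hx => ?_
      have h1 := norm_tgrad_layerCutoff_le hg hH hx
      have h3 : (layer g H).indicator (fun x => 65 * d * ratio g H x) x =
          65 * d * (layer g H).indicator (ratio g H) x := by
        by_cases hl : x ∈ layer g H <;> simp [hl]
      rw [h3] at h1
      have h4 : 0 ≤ ‖G x‖ * ‖P.Th (u x)‖ := by positivity
      refine (mul_le_mul_of_nonneg_right h1 h4).trans (le_of_eq ?_)
      ring
    have h2 : 0 ≤ ∫ x in halfSpace d, ‖tgrad ζ x‖ * (‖G x‖ * ‖P.Th (u x)‖) :=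
      integral_nonneg fun x => by positivity
    calc _ ≤ 2 * |Lam| * (∫ x in halfSpace d, ‖tgrad ζ x‖ * (‖G x‖ * ‖P.Th (u x)‖)) :=
          mul_le_mul_of_nonneg_right (by linarith [le_abs_self Lam]) h2
      _ ≤ 2 * |Lam| * (65 * d * Fl) := mul_le_mul_of_nonneg_left h1 (by positivity)
      _ = _ := by ring
  have e3 : κ * Fl ≤ θ * (∫ x in halfSpace d, P.om (u x) * ‖G x‖ ^ 2 * ζ x) +
      κ ^ 2 / (4 * θ) * R' := by
    refine le_trans ?_ (add_le_add le_rfl (mul_le_mul_of_nonneg_left hJ2 (by positivity)))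
    rw [hFl, ← integral_const_mul, ← integral_const_mul, ← integral_const_mul,
      ← integral_add (hI.const_mul θ) (hJ1.const_mul _)]
    refine setIntegral_mono_on (hI4.const_mul _) ((hI.const_mul θ).add (hJ1.const_mul _))
      measurableSet_halfSpace fun x hx => ?_
    have hx0 : 0 < x 0 := hx
    have hom := P.om_nonneg (u x)
    by_cases hl : x ∈ layer g H
    · rw [indicator_of_mem hl, indicator_of_mem hl, layerCutoff_eq, P.norm_Th]
      have h1 := young_om (X := κ / x 0) (a := ratio g H x * ‖G x‖) (z := ‖u x‖) hom hx0.le hθ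
      have h2 : x 0 * (κ / x 0 * (ratio g H x * ‖G x‖ * (P.om (u x) * ‖u x‖))) =
          κ * (ratio g H x * (‖G x‖ * (P.om (u x) * ‖u x‖))) := by
        field_simp
      have h3 : (κ / x 0) ^ 2 * (P.om (u x) * ‖u x‖ ^ 2) * x 0 / (4 * θ) =
          κ ^ 2 / (4 * θ) * (P.om (u x) * ‖u x‖ ^ 2 / x 0) := by
        field_simp
      rw [h2, h3] at h1
      refine h1.trans (le_of_eq ?_)
      ring
    · rw [indicator_of_notMem hl, indicator_of_notMem hl, zero_mul, mul_zero, mul_zero, add_zero]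
      have := layerCutoff_nonneg (g := g) (H := H) x
      positivity
  have e4 : (lam * min 2 p - 4 * θ) * (∫ x in halfSpace d, P.om (u x) * ‖G x‖ ^ 2 * ζ x) ≤
      R / (4 * θ) + κ ^ 2 / (4 * θ) * R' -
        ∫ x in halfSpace d, (G x 0 * P.Th (u x)).re * ratio g H x ^ 2 := by
    have : κ * Fl = 66 * Fl + 130 * d * |Lam| * Fl := by rw [hκ]; ring
    linarith
  have e5 := mul_le_mul_of_nonneg_left e4 (by linarith : (0 : ℝ) ≤ p)
  have e6 : p * (R / (4 * θ) + κ ^ 2 / (4 * θ) * R' -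
        ∫ x in halfSpace d, (G x 0 * P.Th (u x)).re * ratio g H x ^ 2) =
      p / (4 * θ) * R + p * κ ^ 2 / (4 * θ) * R' -
        p * ∫ x in halfSpace d, (G x 0 * P.Th (u x)).re * ratio g H x ^ 2 := by ring
  rw [e6] at e5
  linarith

end LayerInequality

/-! ### The layers carry a Carleson measure of absolute size. -/

section LayerCarleson

variable {d : ℕ} {g H : Bdry d → ℝ}

lemma lintegral_inv_dyadic_le (c : ℝ) :
    ∫⁻ t in Ioi (0 : ℝ), (Icc c (2 * c)).indicator (fun t => ENNReal.ofReal (2 / t)) t ≤ 2 := by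
  rcases le_or_gt c 0 with hc | hc
  · refine le_trans (le_of_eq ?_) zero_le
    rw [setLIntegral_congr_fun (g := fun _ => 0) measurableSet_Ioi fun t ht => ?_, lintegral_zero]
    refine indicator_of_notMem (fun h => ?_) _
    have h1 : (0 : ℝ) < t := ht
    linarith [h.2]
  · refine (setLIntegral_le_lintegral _ _).trans ?_
    rw [lintegral_indicator measurableSet_Icc]
    calc _ ≤ ∫⁻ _ in Icc c (2 * c), ENNReal.ofReal (2 / c) :=
          setLIntegral_mono measurable_const fun t ht =>
            ENNReal.ofReal_le_ofReal (by have := ht.1; gcongr)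
      _ = 2 := by
          rw [setLIntegral_const, Real.volume_Icc, ← ENNReal.ofReal_mul (by positivity)]
          have : 2 / c * (2 * c - c) = 2 := by field_simp; norm_num
          rw [this, ENNReal.ofReal_ofNat]

/-- A weight of scale-invariant size living near two graphs. -/
def graphWeight (g H : Bdry d → ℝ) (z : Space d) : ℝ≥0∞ :=
  (Icc (g (tang z)) (2 * g (tang z))).indicator (fun t => ENNReal.ofReal (2 / t)) (z 0) +
    (Icc (H (tang z)) (2 * H (tang z))).indicator (fun t => ENNReal.ofReal (2 / t)) (z 0)

lemma measurable_graphWeight (hg : Continuous g) (hH : Continuous H) :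
    Measurable (graphWeight g H) := by
  have h0 := (continuous_coord (d := d) 0).measurable
  have hw : Measurable fun z : Space d => ENNReal.ofReal (2 / z 0) :=
    (measurable_const.div h0).ennreal_ofReal
  have key : ∀ {k : Bdry d → ℝ}, Continuous k → Measurable fun z : Space d =>
      (Icc (k (tang z)) (2 * k (tang z))).indicator (fun t => ENNReal.ofReal (2 / t)) (z 0) := by
    intro k hk
    have h1 := (hk.comp (lipschitz_tang (d := d)).continuous).measurable
    have h2 : MeasurableSet {z : Space d | k (tang z) ≤ z 0 ∧ z 0 ≤ 2 * k (tang z)} :=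
      (measurableSet_le h1 h0).inter (measurableSet_le h0 (h1.const_mul 2))
    exact hw.indicator h2
  exact (key hg).add (key hH)

/-- On every vertical line each graph contributes mass at most 2, so the constant 4 does not depend
on the graphs. -/
lemma graphWeight_carleson (hg : Continuous g) (hH : Continuous H) (q : Bdry d) (r : ℝ) :
    ((volume.restrict (halfSpace d)).withDensity (graphWeight g H))
      (halfSpace d ∩ ball (pt 0 q) r) ≤ 4 * volume (ball q r) := by
  have hm := measurable_graphWeight hg hH
  have hsm : MeasurableSet {z : Space d | tang z ∈ ball q r} :=
    (lipschitz_tang (d := d)).continuous.measurable measurableSet_ball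
  refine (measure_mono (t := {z : Space d | tang z ∈ ball q r}) fun z hz => ?_).trans ?_
  · refine (show dist (tang z) q ≤ dist z (pt 0 q) from ?_).trans_lt hz.2
    simpa using dist_tang_le z (pt 0 q)
  rw [withDensity_apply _ hsm, ← lintegral_indicator hsm,
    lintegral_halfSpace (hm.indicator hsm).aemeasurable, ← lintegral_indicator_const
      measurableSet_ball]
  refine lintegral_mono fun y => ?_
  by_cases hy : y ∈ ball q r
  · rw [indicator_of_mem hy]
    have h1 : ∀ t : ℝ, {z : Space d | tang z ∈ ball q r}.indicator (graphWeight g H) (pt t y) =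
        (Icc (g y) (2 * g y)).indicator (fun t => ENNReal.ofReal (2 / t)) t +
        (Icc (H y) (2 * H y)).indicator (fun t => ENNReal.ofReal (2 / t)) t := fun t => by
      rw [indicator_of_mem (by simpa using hy), graphWeight, pt_zero, tang_pt]
    simp_rw [h1]
    have h2 : ∀ c : ℝ, Measurable ((Icc c (2 * c)).indicator fun t => ENNReal.ofReal (2 / t)) :=
      fun c => ((measurable_const.div measurable_id).ennreal_ofReal).indicator measurableSet_Icc
    rw [lintegral_add_left (h2 _)]
    refine (add_le_add (lintegral_inv_dyadic_le _) (lintegral_inv_dyadic_le _)).trans ?_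
    norm_num
  · rw [indicator_of_notMem hy]
    refine le_of_eq ((lintegral_congr fun t => ?_).trans lintegral_zero)
    exact indicator_of_notMem (by simpa using hy) _

/-- On the layer x₀ is within about ten percent of g or of H. Raising the height by the factor 5/4
brings it into [g, 2g] or [H, 2H], with room for the variation of the graphs over a distance x₀/100.
-/
lemma inv_le_graphWeight (hg : LipschitzWith 1 g) (hH : LipschitzWith 1 H) {x z : Space d}
    (hx : x ∈ layer g H) (hz : z ∈ ball (pt (5 / 4 * x 0) (tang x)) (x 0 / 100)) :
    ENNReal.ofReal (1 / x 0) ≤ graphWeight g H z := by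
  have hx0 : 0 < x 0 := hx.1.1
  obtain ⟨h1, h2, h3, h4⟩ := coord_of_mem_ball (by norm_num) le_rfl hx0 hz
  have h5 := (abs_lt.1 h1).1
  have hz0 : 0 < z 0 := by linarith
  have h6 : ENNReal.ofReal (1 / x 0) ≤ ENNReal.ofReal (2 / z 0) := by
    refine ENNReal.ofReal_le_ofReal ?_
    rw [div_le_div_iff₀ hx0 hz0]
    linarith
  have hgz := hg.dist_le_mul (tang z) (tang x)
  have hHz := hH.dist_le_mul (tang z) (tang x)
  rw [Real.dist_eq, NNReal.coe_one, one_mul] at hgz hHz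
  have hgz := abs_le.1 (hgz.trans h2.le)
  have hHz := abs_le.1 (hHz.trans h2.le)
  rcases hx.2 with h | h
  · have hm : z 0 ∈ Icc (g (tang z)) (2 * g (tang z)) := by
      have := hx.1.2.1
      constructor <;> linarith [hgz.1, hgz.2]
    exact h6.trans (le_trans (le_of_eq (indicator_of_mem hm fun t => ENNReal.ofReal (2 / t)).symm) le_self_add)
  · have hm : z 0 ∈ Icc (H (tang z)) (2 * H (tang z)) := by
      have := hx.1.2.2
      constructor <;> linarith [hHz.1, hHz.2]
    exact h6.trans (le_trans (le_of_eq (indicator_of_mem hm fun t => ENNReal.ofReal (2 / t)).symm) le_add_self)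

lemma lintegral_layer_le (hd : 1 ≤ d) (hg : LipschitzWith 1 g) (hH : LipschitzWith 1 H)
    {v : Space d → ℝ≥0∞} (hv : Measurable v) {M : Bdry d → ℝ≥0∞}
    (hM : ∀ x ∈ region g H, ∀ z ∈ ball (pt (5 / 4 * x 0) (tang x)) (x 0 / 100),
      ∀ y ∈ ball (tang z) (z 0 / 100), (⨍⁻ w in ball (pt (z 0) y) (z 0 / 2), v w ∂volume) ≤ M y) :
    ∫⁻ x in layer g H, v x * ENNReal.ofReal (1 / x 0) ≤
      ENNReal.ofReal (carlesonConst d) * 4 * ∫⁻ y, M y :=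
  carleson_averaging' hd (by norm_num) le_rfl (measurableSet_layer hg hH) (fun x hx => hx.1.1) hv
    (measurable_graphWeight hg.continuous hH.continuous)
    (fun _ hx _ hz => inv_le_graphWeight hg hH hx hz)
    (fun q r _ => graphWeight_carleson hg.continuous hH.continuous q r)
    fun x hx => hM x hx.1

end LayerCarleson

/-! ### The local estimate above a Lipschitz graph. -/

section LocalEstimate

variable {d : ℕ} {p h : ℝ} {A : Space d → Matrix (Fin (d + 1)) (Fin (d + 1)) ℂ}
    {B : Space d → EuclideanSpace ℂ (Fin (d + 1))} {f : Bdry d → ℂ} {u : Space d → ℂ}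
    {G : Space d → EuclideanSpace ℂ (Fin (d + 1))} {g : Bdry d → ℝ}

/-- The roof over a surface ball. -/
def roof (q : Bdry d) (ρ : ℝ) (y : Bdry d) : ℝ := 2 * ρ - dist y q

lemma lipschitz_roof (q : Bdry d) (ρ : ℝ) : LipschitzWith 1 (roof q ρ) :=
  LipschitzWith.of_dist_le_mul fun x y => by
    rw [Real.dist_eq, roof, roof, NNReal.coe_one, one_mul]
    have := abs_dist_sub_le x y q
    rwa [sub_sub_sub_cancel_left, abs_sub_comm]

/-- With σ = 5/4 the height z₀ is at least 1.24 x₀, while g y ≤ (10/9 + 0.0226) x₀, so the centre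
lies above the graph. The tangential displacement is at most (0.01 + 0.0126) x₀, which keeps y under
the roof and hence in the doubled ball. Finally z₀ ≤ 1.26 · 1.1 · 2ρ is below the truncation height
4ρ. -/
lemma IsEnergySolution.average_le_of_mem_region (hs : IsEnergySolution h A B f u G) (hp : 0 < p)
    {a : ℝ} (ha : 0 < a) (hg : LipschitzWith 1 g) (hg0 : ∀ y, 0 ≤ g y) {q : Bdry d} {ρ : ℝ}
    {x z : Space d} (hx : x ∈ region g (roof q ρ))
    (hz : z ∈ ball (pt (5 / 4 * x 0) (tang x)) (x 0 / 100)) {y : Bdry d}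
    (hy : y ∈ ball (tang z) (z 0 / 100)) :
    (⨍⁻ w in ball (pt (z 0) y) (z 0 / 2), powDensity p h u w ∂volume) ≤
      (ball q (2 * ρ)).indicator (fun y => ntMaxTrunc p a g (2 * (2 * ρ)) u y ^ p) y := by
  obtain ⟨hx0, hx1, hx2⟩ := hx
  obtain ⟨h1, h2, h3, h4⟩ := coord_of_mem_ball (by norm_num) le_rfl hx0 hz
  have h5 := (abs_lt.1 h1).1
  have h6 : dist y (tang x) ≤ 226 / 10000 * x 0 := by
    have := dist_triangle y (tang z) (tang x)
    have := mem_ball.1 hy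
    linarith
  rw [roof] at hx2
  have h7 : dist (tang x) q < 2 * ρ := by linarith
  have h8 : 0 ≤ dist (tang x) q := dist_nonneg
  have hyq : y ∈ ball q (2 * ρ) := by
    rw [mem_ball]
    have := dist_triangle y (tang x) q
    linarith
  have hgy := hg.dist_le_mul y (tang x)
  rw [Real.dist_eq, NNReal.coe_one, one_mul] at hgy
  have hgy := (abs_le.1 (hgy.trans h6)).2
  rw [indicator_of_mem hyq]
  have := hg0 y
  exact hs.average_le_ntMaxTrunc hp ha (by linarith) (by linarith) (by linarith)

/-- The constant in the local estimate above a Lipschitz graph. -/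
def graphConst (d : ℕ) (p lam Lam : ℝ) : ℝ :=
  1 / (p * lam) * (p / ((min 2 p - 1) * lam) * (carlesonConst d * (2 * (d + 2))) +
    (p * (66 + 130 * d * |Lam|) ^ 2 / ((min 2 p - 1) * lam) + 88) * (carlesonConst d * 4) + 1)

/-- The cutoff with H the conical roof equals x₀, which is at least δ_g, on the region of
integration. Both error integrals in `layer_inequality` are Carleson terms controlled by the
truncated maximal function on the doubled ball. -/
lemma IsEnergySolution.graph_estimate {lam Lam a : ℝ} (hd : 1 ≤ d)
    (hs : IsEnergySolution h A B f u G) (hh : 0 < h)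
    (hA : ∀ i j, ContDiffOn ℝ ∞ (fun x => A x i j) (halfSpace d))
    (hB : ContDiffOn ℝ ∞ B (halfSpace d)) (hell : IsPElliptic p lam Lam A)
    (hrow : ∀ x ∈ halfSpace d, A x 0 0 = 1 ∧ ∀ j, (A x 0 j).im = 0)
    (hp : 1 < p) (hlam : 0 < lam) (ha : 0 < a) (hg : LipschitzWith 1 g) (hg0 : ∀ y, 0 ≤ g y)
    (q : Bdry d) {ρ : ℝ} (hρ : 0 < ρ) :
    (∫⁻ x in above g ∩ (halfSpace d ∩ ball (pt 0 q) ρ),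
      energyDensity p u G x * ENNReal.ofReal (x 0 - g (tang x))) ≤
    ENNReal.ofReal (graphConst d p lam Lam) * ∫⁻ y in ball q (2 * ρ),
      (‖u (pt (g y) y)‖ₑ ^ p +
        (1 + carlesonNorm (muFull A B)) * ntMaxTrunc p a g (2 * (2 * ρ)) u y ^ p) := by
  set H := roof q ρ with hHdef
  have hH : LipschitzWith 1 H := lipschitz_roof q ρ
  set ζ := layerCutoff g H with hζ
  have hζm : Measurable ζ := (lipschitz_layerCutoff hg hH).continuous.measurable
  -- Four Young terms are absorbed here, so that exactly λ remains in front of the energy.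
  set θ : ℝ := (min 2 p - 1) * lam / 4 with hθdef
  have hmin : 0 < min 2 p - 1 := sub_pos.2 (lt_min (by norm_num) hp)
  have hθ : 0 < θ := by positivity
  set κ : ℝ := 66 + 130 * d * |Lam| with hκ
  set W : ℝ≥0∞ := ∫⁻ y in ball q (2 * ρ), ntMaxTrunc p a g (2 * (2 * ρ)) u y ^ p with hW
  set U : ℝ≥0∞ := ∫⁻ y in ball q (2 * ρ), ‖u (pt (g y) y)‖ₑ ^ p with hU
  have hWi : ∫⁻ y, (ball q (2 * ρ)).indicator
      (fun y => ntMaxTrunc p a g (2 * (2 * ρ)) u y ^ p) y = W :=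
    lintegral_indicator measurableSet_ball _
  have hM : ∀ x ∈ region g H, ∀ z ∈ ball (pt (5 / 4 * x 0) (tang x)) (x 0 / 100),
      ∀ y ∈ ball (tang z) (z 0 / 100),
        (⨍⁻ w in ball (pt (z 0) y) (z 0 / 2), powDensity p h u w ∂volume) ≤
        (ball q (2 * ρ)).indicator (fun y => ntMaxTrunc p a g (2 * (2 * ρ)) u y ^ p) y :=
    fun x hx z hz y hy => hs.average_le_of_mem_region (by linarith) ha hg hg0 hx hz hy
  set S₁ : ℝ≥0∞ := ENNReal.ofReal (carlesonConst d) * (2 * carlesonNorm (muRow A B)) * W with hS1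
  set S₂ : ℝ≥0∞ := ENNReal.ofReal (carlesonConst d) * 4 * W with hS2
  have hrowS : ∀ P : Profile p, ∫⁻ x in halfSpace d, ENNReal.ofReal (rowDensity A B x *
      (P.om (u x) * ‖u x‖ ^ 2) * ζ x) ≤ S₁ := fun P => by
    have h1 := carleson_supMeasure hd (by norm_num) le_rfl (measurableSet_region hg hH)
      (fun x hx => hx.1) (hs.measurable_powDensity (p := p)) (rowDensityENN A B) hM
    rw [hWi, ← muRow_eq] at h1
    refine le_trans ?_ h1
    rw [← lintegral_indicator measurableSet_halfSpace,
      ← lintegral_indicator (measurableSet_region hg hH)]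
    refine lintegral_mono fun x => ?_
    by_cases hx : x ∈ region g H
    · have hx0 : x ∈ halfSpace d := hx.1
      rw [indicator_of_mem hx0, indicator_of_mem hx, hs.powDensity_eq hx0, ← ofReal_rowDensity,
        ENNReal.ofReal_mul (mul_nonneg (rowDensity_nonneg x)
          (mul_nonneg (P.om_nonneg _) (by positivity))), ENNReal.ofReal_mul (rowDensity_nonneg x)]
      calc _ ≤ ENNReal.ofReal (rowDensity A B x) * ‖u x‖ₑ ^ p * ENNReal.ofReal (x 0) := by
            gcongr
            · exact ofReal_om_le (by linarith) P _
            · exact layerCutoff_le hx.1.le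
        _ = _ := by ring
    · rw [indicator_of_notMem hx]
      by_cases hx0 : x ∈ halfSpace d
      · rw [indicator_of_mem hx0, hζ, layerCutoff_eq_zero_of_notMem hx, mul_zero,
          ENNReal.ofReal_zero]
      · rw [indicator_of_notMem hx0]
  have hlayS : ∫⁻ x in layer g H, ‖u x‖ₑ ^ p * ENNReal.ofReal (1 / x 0) ≤ S₂ := by
    have h1 := lintegral_layer_le hd hg hH (hs.measurable_powDensity (p := p)) hM
    rw [hWi] at h1
    refine le_trans (le_of_eq (setLIntegral_congr_fun (measurableSet_layer hg hH)
      fun x hx => ?_)) h1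
    simp only
    rw [hs.powDensity_eq hx.1.1]
  set Z : ℝ≥0∞ := ENNReal.ofReal (1 / (p * lam)) * (ENNReal.ofReal (p / (4 * θ)) * S₁ +
    ENNReal.ofReal (p * κ ^ 2 / (4 * θ) + 88) * S₂ + U) with hZ
  have hκ0 : 0 ≤ p * κ ^ 2 / (4 * θ) := by positivity
  have hpl : 0 < p * lam := by positivity
  have hZle : ∀ P : Profile p, ∫⁻ x in halfSpace d,
      (ENNReal.ofReal (P.om (u x) * ‖G x‖ ^ 2) * ENNReal.ofReal (ζ x) +
        ENNReal.ofReal (P.V (u x)) * ENNReal.ofReal ((fun _ => 0 : Space d → ℝ) x)) ≤ Z := by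
    intro P
    have hc1 : ENNReal.ofReal (1 / (p * lam)) ≠ 0 := by simpa using by positivity
    by_cases hS1t : S₁ = ⊤
    · rw [hZ, hS1t, ENNReal.mul_top (a := ENNReal.ofReal (p / (4 * θ))) (by simpa using by positivity),
        top_add, top_add, ENNReal.mul_top hc1]
      exact le_top
    by_cases hS2t : S₂ = ⊤
    · rw [hZ, hS2t, ENNReal.mul_top (a := ENNReal.ofReal (p * κ ^ 2 / (4 * θ) + 88))
        (by simpa using by positivity), add_top, top_add, ENNReal.mul_top hc1]
      exact le_top
    have hR1 : ENNReal.ofReal S₁.toReal = S₁ := ENNReal.ofReal_toReal hS1t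
    have hR2 : ENNReal.ofReal S₂.toReal = S₂ := ENNReal.ofReal_toReal hS2t
    have hHq : ∀ y, 0 < H y → dist y q ≤ 2 * ρ ∧ H y ≤ 2 * ρ := fun y hy => by
      have h1 : 0 < 2 * ρ - dist y q := hy
      have h2 : H y = 2 * ρ - dist y q := rfl
      have h3 : 0 ≤ dist y q := dist_nonneg
      exact ⟨by linarith, by linarith⟩
    have key := hs.layer_inequality hh hA hB hell hrow hp hlam.le hθ P hg hH hg0
      (T := 2 * ρ) (by linarith) hHq ENNReal.toReal_nonneg ENNReal.toReal_nonneg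
      ((hrowS P).trans hR1.ge) (hlayS.trans hR2.ge)
    rw [← hκ, ← hζ, show lam * min 2 p - 4 * θ = lam by rw [hθdef]; ring] at key
    set I := ∫ x in halfSpace d, P.om (u x) * ‖G x‖ ^ 2 * ζ x with hI
    obtain ⟨M, hMb⟩ := (hasCompactSupport_layerCutoff (g := g) hHq).exists_bound_of_continuous
      (lipschitz_layerCutoff hg hH).continuous
    have hIi := hs.integrable_energy hh P hζm hMb
    have hSm : MeasurableSet {y | g y = 0 ∧ 0 < H y} :=
      (hg.continuous.measurable (measurableSet_singleton 0)).inter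
        (measurableSet_lt measurable_const hH.continuous.measurable)
    have hVi := (integrable_V_of_memLp (by linarith) P (hs.memLp_level hh le_rfl)).indicator hSm
    -- The boundary term involves only points with g y = 0, where the trace u(0, y) is the value of
    -- u on the graph.
    have hb : ENNReal.ofReal
        (∫ y, {y | g y = 0 ∧ 0 < H y}.indicator (fun y => P.V (u (pt 0 y))) y) ≤ U := by
      rw [ofReal_integral_eq_lintegral_ofReal hVi (Eventually.of_forall fun y =>
        indicator_nonneg (fun y _ => P.V_nonneg (by linarith) _) y), hU,
        ← lintegral_indicator measurableSet_ball]
      refine lintegral_mono fun y => ?_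
      by_cases hy : y ∈ {y | g y = 0 ∧ 0 < H y}
      · have h1 : 0 < 2 * ρ - dist y q := hy.2
        rw [indicator_of_mem hy, indicator_of_mem (by rw [mem_ball]; linarith), hy.1]
        exact ofReal_V_le (by linarith) P _
      · rw [indicator_of_notMem hy, ENNReal.ofReal_zero]; exact zero_le
    have hI' : I ≤ 1 / (p * lam) * (p / (4 * θ) * S₁.toReal +
        (p * κ ^ 2 / (4 * θ) + 88) * S₂.toReal +
        ∫ y, {y | g y = 0 ∧ 0 < H y}.indicator (fun y => P.V (u (pt 0 y))) y) := by
      rw [one_div, inv_mul_eq_div, le_div_iff₀ hpl]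
      linarith
    calc _ = ENNReal.ofReal I := by
          rw [hI, ofReal_integral_eq_lintegral_ofReal hIi (Eventually.of_forall fun x =>
            mul_nonneg (mul_nonneg (P.om_nonneg _) (by positivity)) (layerCutoff_nonneg x))]
          refine lintegral_congr fun x => ?_
          have := P.om_nonneg (u x)
          rw [ENNReal.ofReal_zero, mul_zero, add_zero,
            ENNReal.ofReal_mul (p := P.om (u x) * ‖G x‖ ^ 2) (by positivity)]
      _ ≤ _ := ENNReal.ofReal_le_ofReal hI'
      _ ≤ Z := by
          rw [ENNReal.ofReal_mul (by positivity), hZ]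
          gcongr
          refine ENNReal.ofReal_add_le.trans (add_le_add (ENNReal.ofReal_add_le.trans
            (add_le_add ?_ ?_)) hb)
          · rw [ENNReal.ofReal_mul (by positivity), hR1]
          · rw [ENNReal.ofReal_mul (by positivity), hR2]
  have hfin := hs.lintegral_energyDensity_le hh hp hζm measurable_const hZle
  have hTm : MeasurableSet (above g ∩ (halfSpace d ∩ ball (pt 0 q) ρ)) :=
    (measurableSet_lt (hg.continuous.comp (lipschitz_tang (d := d)).continuous).measurable
      (continuous_coord 0).measurable).inter (measurableSet_halfSpace.inter measurableSet_ball)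
  have hleft : (∫⁻ x in above g ∩ (halfSpace d ∩ ball (pt 0 q) ρ),
      energyDensity p u G x * ENNReal.ofReal (x 0 - g (tang x))) ≤ Z := by
    refine le_trans ?_ hfin
    refine le_trans ?_ (lintegral_mono_set (fun x hx => hx.2.1 :
      above g ∩ (halfSpace d ∩ ball (pt 0 q) ρ) ⊆ halfSpace d))
    refine setLIntegral_mono' hTm fun x hx => ?_
    have hx0 : 0 < x 0 := hx.2.1
    have hxg : g (tang x) < x 0 := hx.1
    -- In T(Δ) both the height and the tangential distance to q are below ρ, so the point lies under
    -- the roof of height 2ρ - |y - q|.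
    have h1 : x 0 ≤ H (tang x) := by
      have h2 := abs_coord_sub_le x (pt 0 q) 0
      have h3 := dist_tang_le x (pt 0 q)
      have h4 := mem_ball.1 hx.2.2
      rw [pt_zero, sub_zero, abs_of_pos hx0] at h2
      rw [tang_pt] at h3
      have h5 : H (tang x) = 2 * ρ - dist (tang x) q := rfl
      linarith
    have h2 : ζ x = x 0 := layerCutoff_of_ratio_eq_one (ratio_eq_one hx0 hxg.le h1)
    rw [h2, ENNReal.ofReal_zero, mul_zero, add_zero]
    gcongr
    linarith [hg0 (tang x)]
  refine hleft.trans ?_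
  have hN := carlesonNorm_muRow_le (A := A) (B := B)
  set N := carlesonNorm (muFull A B) with hNdef
  have hcc := carlesonConst_pos (d := d)
  have hsum : U + (1 + N) * W ≤ ∫⁻ y in ball q (2 * ρ), (‖u (pt (g y) y)‖ₑ ^ p +
      (1 + N) * ntMaxTrunc p a g (2 * (2 * ρ)) u y ^ p) :=
    (add_le_add le_rfl (lintegral_const_mul_le _ _)).trans (le_lintegral_add _ _)
  refine le_trans ?_ (mul_le_mul_right hsum _)
  have h4θ : 4 * θ = (min 2 p - 1) * lam := by rw [hθdef]; ring
  rw [graphConst, ← hκ, ← h4θ, ENNReal.ofReal_mul (by positivity), hZ, mul_assoc]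
  refine mul_le_mul_right ?_ _
  set Y := U + (1 + N) * W with hY
  have hS1le : S₁ ≤ ENNReal.ofReal (carlesonConst d * (2 * (d + 2))) * Y := by
    have h1 : ENNReal.ofReal (carlesonConst d * (2 * (d + 2))) =
        ENNReal.ofReal (carlesonConst d) * (2 * ((d + 2 : ℕ) : ℝ≥0∞)) := by
      rw [ENNReal.ofReal_mul hcc.le, ENNReal.ofReal_mul (by norm_num), ENNReal.ofReal_ofNat,
        ← ENNReal.ofReal_natCast]
      push_cast
      rfl
    have h2 : N * W ≤ Y := (mul_le_mul_left le_add_self W).trans le_add_self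
    calc S₁ ≤ ENNReal.ofReal (carlesonConst d) * (2 * (((d + 2 : ℕ) : ℝ≥0∞) * N)) * W := by
          rw [hS1]; gcongr
      _ = ENNReal.ofReal (carlesonConst d) * (2 * ((d + 2 : ℕ) : ℝ≥0∞)) * (N * W) := by ring
      _ ≤ _ := by rw [h1]; gcongr
  have hS2le : S₂ ≤ ENNReal.ofReal (carlesonConst d * 4) * Y := by
    have h2 : W ≤ Y := by
      calc W = 1 * W := (one_mul W).symm
        _ ≤ (1 + N) * W := mul_le_mul_left le_self_add W
        _ ≤ Y := le_add_self
    rw [ENNReal.ofReal_mul hcc.le, ENNReal.ofReal_ofNat, hS2]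
    gcongr
  have hUle : U ≤ 1 * Y := by rw [one_mul]; exact le_self_add
  have hsplit : ∀ {α β γ δ : ℝ}, 0 ≤ α → 0 ≤ β → 0 ≤ γ → 0 ≤ δ →
      ENNReal.ofReal (α * β + γ * δ + 1) = ENNReal.ofReal α * ENNReal.ofReal β +
        ENNReal.ofReal γ * ENNReal.ofReal δ + 1 := fun hα hβ hγ hδ => by
    rw [ENNReal.ofReal_add (by positivity) zero_le_one, ENNReal.ofReal_add (by positivity)
      (by positivity), ENNReal.ofReal_mul hα, ENNReal.ofReal_mul hγ, ENNReal.ofReal_one]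
  rw [hsplit (by positivity) (by positivity) (by positivity) (by positivity), add_mul, add_mul,
    mul_assoc, mul_assoc]
  gcongr

end LocalEstimate

end StripPDE

end

theorem lemmaS3 (d : ℕ) (hd : 1 ≤ d) (p lam Lam : ℝ) (hp : 1 < p) (hlam : 0 < lam) :
    ∃ (C : ℝ≥0) (L₀ : ℝ≥0), 0 < L₀ ∧
      ∀ (a h : ℝ), 0 < a → 0 < h →
      ∀ (A : StripPDE.Space d → Matrix (Fin (d + 1)) (Fin (d + 1)) ℂ)
        (B : StripPDE.Space d → EuclideanSpace ℂ (Fin (d + 1))),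
        (∀ i j, ContDiffOn ℝ ∞ (fun x => A x i j) (StripPDE.halfSpace d)) →
        ContDiffOn ℝ ∞ B (StripPDE.halfSpace d) →
        StripPDE.IsPElliptic p lam Lam A →
        (∀ x ∈ StripPDE.halfSpace d, A x 0 0 = 1 ∧ ∀ j, (A x 0 j).im = 0) →
        StripPDE.carlesonNorm (StripPDE.muRow A B) < ⊤ →
      ∀ (f : StripPDE.Bdry d → ℂ) (u : StripPDE.Space d → ℂ)
        (G : StripPDE.Space d → EuclideanSpace ℂ (Fin (d + 1))),
        MemLp f (ENNReal.ofReal p) volume →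
        StripPDE.HomBesovHalf f →
        StripPDE.IsEnergySolution h A B f u G →
        -- the estimate at every height
        (∀ r : ℝ, 0 < r →
          ENNReal.ofReal (p * (lam / 2)) *
              (∫⁻ x in {x : StripPDE.Space d | 0 < x 0 ∧ x 0 ≤ r / 2},
                StripPDE.energyDensity p u G x * ENNReal.ofReal (x 0)) +
            ENNReal.ofReal (2 / r) *
              (∫⁻ x in {x : StripPDE.Space d | 0 < x 0 ∧ x 0 ≤ r}, ‖u x‖ₑ ^ p) ≤
          (∫⁻ y, ‖f y‖ₑ ^ p) + (∫⁻ y, ‖u (StripPDE.pt r y)‖ₑ ^ p) +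
            C * StripPDE.carlesonNorm (StripPDE.muRow A B) *
              (∫⁻ y, StripPDE.ntMaxTrunc p a (fun _ => 0) r u y ^ p)) ∧
        -- the global estimate
        (ENNReal.ofReal (p * (lam / 2)) *
            (∫⁻ x in StripPDE.halfSpace d,
              StripPDE.energyDensity p u G x * ENNReal.ofReal (x 0)) ≤
          (∫⁻ y, ‖f y‖ₑ ^ p) +
            C * StripPDE.carlesonNorm (StripPDE.muRow A B) *
              (∫⁻ y, StripPDE.ntMax p a (fun _ => 0) u y ^ p)) ∧
        -- the local estimate above a Lipschitz graph, for the surface ball of centre `q` and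
        -- radius `ρ`, whose diameter is `2 * ρ`
        (∀ (g : StripPDE.Bdry d → ℝ) (L : ℝ≥0), (∀ y, 0 ≤ g y) → LipschitzWith L g →
          L ≤ L₀ → a * L < 1 →
          ∀ (q : StripPDE.Bdry d) (ρ : ℝ), 0 < ρ → (∀ y ∈ ball q ρ, g y ≤ (2 * ρ) / 2) →
          (∫⁻ x in StripPDE.above g ∩ (StripPDE.halfSpace d ∩ ball (StripPDE.pt 0 q) ρ),
            StripPDE.energyDensity p u G x * ENNReal.ofReal (x 0 - g (StripPDE.tang x))) ≤
          C * ∫⁻ y in ball q (2 * ρ),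
            (‖u (StripPDE.pt (g y) y)‖ₑ ^ p +
              (1 + StripPDE.carlesonNorm (StripPDE.muFull A B)) *
                StripPDE.ntMaxTrunc p a g (2 * (2 * ρ)) u y ^ p)) := by
  -- L₀ = 1 is the Lipschitz constant for which the margins 9/10, 11/10 and 5/4 of the graph cutoff
  -- were arranged.
  refine ⟨max (StripPDE.slabConst d p lam).toNNReal (StripPDE.graphConst d p lam Lam).toNNReal, 1,
    one_pos, fun a h ha hh A B hA hB hell hrow _ f u G _ _ hs => ⟨fun r hr => ?_, ?_, ?_⟩⟩
  · refine (hs.slab_estimate hd hh hA hB hell hrow hp hlam ha hr).trans ?_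
    gcongr
    exact ENNReal.coe_le_coe.2 (le_max_left _ _)
  · refine (hs.global_estimate hd hh hA hB hell hrow hp hlam ha).trans ?_
    gcongr
    exact ENNReal.coe_le_coe.2 (le_max_left _ _)
  · intro g L hg0 hg hL _ q ρ hρ _
    refine (hs.graph_estimate hd hh hA hB hell hrow hp hlam ha (hg.weaken hL) hg0 q hρ).trans ?_
    gcongr
    exact ENNReal.coe_le_coe.2 (le_max_right _ _)
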